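/- Let $n\geqslant 2$ and $\sigma\geqslant 1$ be integers, $\kappa\in\{-1,+1\}$, $s<\frac n2-\frac1\sigma$, and let $a_0\in C_0^\infty(\mathbb R_+;\mathbb C)$ have support in $\{1\leqslant r\leqslant 2\}$. For $\lambda\in\,]0,1]$ put $\varepsilon=\lambda^{\frac{n\sigma}2-1-s\sigma}\in\,]0,1]$. Consider, on the hyperbolic space $\mathbb H^n$ with $r$ the distance to the origin, the radial solution $u$ of $$i\partial_t u+\Delta_{\mathbb H^n}u=\kappa|u|^{2\sigma}u,\qquad u(0,r)=\lambda^{-\frac n2+s}a_0\!\left(\frac r\lambda\right),$$ and set $\psi^\varepsilon(t,r)=\lambda^{\frac n2-s}\,u\big(\lambda^{\frac{n\sigma}2+1-s\sigma}t,\lambda r\big)$, so that $$i\varepsilon\partial_t\psi^\varepsilon+\varepsilon^2\Delta_\lambda\psi^\varepsilon=\kappa|\psi^\varepsilon|^{2\sigma}\psi^\varepsilon,\qquad \psi^\varepsilon(0,r)=a_0(r),$$ where $\Delta_\lambda=\partial_r^2+(n-1)\lambda\coth(\lambda r)\partial_r$ is the radial Laplacian of the hyperbolic space $\mathbb H^n_\lambda$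 of curvature $-\lambda^2$. Let $\varphi^\varepsilon(t,r)=a_0(r)\,e^{-i\kappa\frac t\varepsilon|a_0(r)|^{2\sigma}}$, the solution of $i\varepsilon\partial_t\varphi^\varepsilon=\kappa|\varphi^\varepsilon|^{2\sigma}\varphi^\varepsilon$, $\varphi^\varepsilon(0,r)=a_0(r)$. Here solutions $u$ on an interval $[0,T]$ are strong radial solutions that are bounded on $[0,T]\times\mathbb H^n$ and belong to $C([0,T];H^2(\mathbb H^n))\cap C^1([0,T];L^2(\mathbb H^n))$, and, for real $k\geqslant0$, $H^k=H^k(\mathbb H^n_\lambda)$ is the Sobolev space (the domain of $(1-\Delta_{\mathbb H^n_\lambda})^{k/2}$ with a norm equivalent to its graph norm, with constants depending only on $k$). Fix a real $k>n/2$. Then there are constants $c_0,c_1,\theta,C>0$, independent of $\varepsilon\in\,]0,1]$, such that for every $\varepsilon\in\,]0,1]$ a solution $\psi^\varepsilon$ exists on $[0,c_0\varepsilon|\ln\varepsilon|^\theta]$, and every such solution satisfies $$\|\psi^\varepsilon-\varphi^\varepsilon\|_{L^\infty([0,c_0\varepsilon|\ln\varepsilon|^\theta];H^k)}\leqslant C\,\varepsilon\,|\ln\varepsilon|^{c_1}.$$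 -/

import Mathlib

open Set Filter MeasureTheory
open scoped Topology ENNReal ContDiff

noncomputable section

/-! ### Radial functions on the hyperbolic space of curvature `-lam ^ 2`

In geodesic polar coordinates this space carries the metric
`dr ^ 2 + (sinh (lam * r) / lam) ^ 2 dω ^ 2`; for `lam = 1` it is the usual hyperbolic space.
A radial function is a function of the distance `r > 0` to the origin, so it is represented by
a function `ℝ → ℂ` of which only the restriction to `(0, ∞)` matters. -/

/-- The Riemannian volume of the `n`-dimensional hyperbolic space of curvature `-lam ^ 2`, read
on radial functions: `(sinh (lam * r) / lam) ^ (n - 1) dr` on `(0, ∞)`. The area of the unit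
sphere, a constant factor depending only on `n`, is left out. -/
def radialMeasure (n : ℕ) (lam : ℝ) : Measure ℝ :=
  (volume.restrict (Ioi (0 : ℝ))).withDensity
    (fun r => ENNReal.ofReal ((Real.sinh (lam * r) / lam) ^ (n - 1)))

/-- The divergence of the radial vector field `χ(r) ∂_r`, namely
`χ'(r) + (n - 1) lam coth(lam r) χ(r)`. -/
def radialDiv (n : ℕ) (lam : ℝ) (χ : ℝ → ℝ) (r : ℝ) : ℝ :=
  deriv χ r + ((n : ℝ) - 1) * lam * (Real.cosh (lam * r) / Real.sinh (lam * r)) * χ r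

/-- `g ∂_r` is the gradient of the radial function `f` in the weak sense. The test objects are
the smooth compactly supported radial vector fields `χ(r) ∂_r`, that is, `χ` is odd. -/
def IsWeakRadialGrad (n : ℕ) (lam : ℝ) (f g : ℝ → ℂ) : Prop :=
  ∀ χ : ℝ → ℝ, ContDiff ℝ ∞ χ → HasCompactSupport χ → (∀ r, χ (-r) = -χ r) →
    ∫ r, (radialDiv n lam χ r : ℂ) * f r ∂(radialMeasure n lam) =
      -∫ r, (χ r : ℂ) * g r ∂(radialMeasure n lam)

/-- The radial function `h` is the divergence of the radial vector field `g ∂_r` in the weak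
sense. The test objects are the smooth compactly supported radial functions, that is, the even
functions `φ` of `r`. -/
def IsWeakRadialDiv (n : ℕ) (lam : ℝ) (g h : ℝ → ℂ) : Prop :=
  ∀ φ : ℝ → ℝ, ContDiff ℝ ∞ φ → HasCompactSupport φ → (∀ r, φ (-r) = φ r) →
    ∫ r, ((deriv φ r : ℝ) : ℂ) * g r ∂(radialMeasure n lam) =
      -∫ r, (φ r : ℂ) * h r ∂(radialMeasure n lam)

/-- `F 0, F 1, F 2, F 3, …, F m` are the weak derivatives `f, ∇f, Δf, ∇Δf, …` up to order `m`
of the radial function `f`, all of them in `L²`. Here `Δ = div ∇` is the Laplace-Beltrami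
operator, which is `∂_r ^ 2 + (n - 1) lam coth(lam r) ∂_r` on radial functions. -/
structure IsSobolevChain (n : ℕ) (lam : ℝ) (m : ℕ) (f : ℝ → ℂ) (F : ℕ → ℝ → ℂ) : Prop where
  zero : F 0 =ᵐ[radialMeasure n lam] f
  memLp : ∀ j ≤ m, MemLp (F j) 2 (radialMeasure n lam)
  grad : ∀ j < m, Even j → IsWeakRadialGrad n lam (F j) (F (j + 1))
  div : ∀ j < m, Odd j → IsWeakRadialDiv n lam (F j) (F (j + 1))

/-- The square of the `H^m` norm, for an integer `m`, of a radial function: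
`‖f‖² + ‖∇f‖² + ‖Δf‖² + ‖∇Δf‖² + …`, up to order `m`, that is, the sum over `j ≤ m` of
`⟨(-Δ)^j f, f⟩`. It is `∞` if `f` is not in `H^m`. (The chain is unique up to null sets.) -/
def sobolevNormSq (n : ℕ) (lam : ℝ) (m : ℕ) (f : ℝ → ℂ) : ℝ≥0∞ :=
  ⨅ (F : ℕ → ℝ → ℂ) (_ : IsSobolevChain n lam m f F),
    ∑ j ∈ Finset.range (m + 1), eLpNorm (F j) 2 (radialMeasure n lam) ^ 2

/-- The quadratic `K`-functional of the pair `(H^m, H^(m+1))`, squared. -/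
def kFunctionalSq (n : ℕ) (lam : ℝ) (m : ℕ) (f : ℝ → ℂ) (τ : ℝ) : ℝ≥0∞ :=
  ⨅ h : ℝ → ℂ, sobolevNormSq n lam m (fun r => f r - h r) +
    ENNReal.ofReal (τ ^ 2) * sobolevNormSq n lam (m + 1) h

/-- The `H^k` norm, for a real `k ≥ 0`, of a radial function on the hyperbolic space of curvature
`-lam ^ 2`; it is `∞` if the function is not in `H^k`. For `k = m + θ` with `m` an integer and
`0 < θ < 1`, the space `H^k` is the Hilbert interpolation space between `H^m` and `H^(m+1)`,
that is, the domain of `(1 - Δ)^(k/2)`. -/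
def sobolevNorm (n : ℕ) (lam : ℝ) (k : ℝ) (f : ℝ → ℂ) : ℝ≥0∞ :=
  if Int.fract k = 0 then sobolevNormSq n lam ⌊k⌋₊ f ^ (1 / 2 : ℝ)
  else
    (ENNReal.ofReal (2 * Real.sin (Real.pi * Int.fract k) / Real.pi) *
      ∫⁻ τ in Ioi (0 : ℝ), ENNReal.ofReal (τ ^ (-2 * Int.fract k - 1)) *
        kFunctionalSq n lam ⌊k⌋₊ f τ) ^ (1 / 2 : ℝ)

/-- `u` is a bounded strong radial solution, on the time interval `[0, T]`, of
`i ∂_t u + Δ u = κ |u| ^ (2 σ) u`, `u(0) = u₀`, on the `n`-dimensional hyperbolic space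
(of curvature `-1`): `u` is bounded on `[0, T]`, it is in `C([0, T]; H²)`, it is differentiable
from `[0, T]` to `L²`, and the equation holds in `L²` at every time. -/
structure IsRadialNLSSolution (n σ : ℕ) (κ : ℝ) (u₀ : ℝ → ℂ) (T : ℝ)
    (u : ℝ → Lp ℂ 2 (radialMeasure n 1)) : Prop where
  init : u 0 =ᵐ[radialMeasure n 1] u₀
  bounded : ∃ M : ℝ, ∀ t ∈ Icc 0 T, ∀ᵐ r ∂(radialMeasure n 1), ‖u t r‖ ≤ M
  cont : ∀ t ∈ Icc 0 T,
    Tendsto (fun t' => sobolevNormSq n 1 2 (fun r => u t' r - u t r)) (𝓝[Icc 0 T] t) (𝓝 0)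
  eqn : ∀ t ∈ Icc 0 T, ∃ (V : Lp ℂ 2 (radialMeasure n 1)) (F : ℕ → ℝ → ℂ),
    HasDerivWithinAt u V (Icc 0 T) t ∧
    IsSobolevChain n 1 2 (u t) F ∧
    ∀ᵐ r ∂(radialMeasure n 1),
      Complex.I * V r + F 2 r = (κ : ℂ) * (‖u t r‖ : ℂ) ^ (2 * σ) * u t r

/-- The concentrated initial datum `lam ^ (-n/2 + s) a₀(r / lam)`. -/
def concentratedDatum (n : ℕ) (s lam : ℝ) (a₀ : ℝ → ℂ) (r : ℝ) : ℂ :=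
  ((lam ^ (-((n : ℝ) / 2) + s) : ℝ) : ℂ) * a₀ (r / lam)

/-- The factor between the time of `ψ` and the time of `u`: `lam ^ (n σ / 2 + 1 - s σ)`. -/
def timeScale (n σ : ℕ) (s lam : ℝ) : ℝ :=
  lam ^ ((n : ℝ) * σ / 2 + 1 - s * σ)

/-- The rescaled solution
`ψ(t, r) = lam ^ (n/2 - s) u(lam ^ (n σ / 2 + 1 - s σ) t, lam r)`. -/
def rescaledSolution (n σ : ℕ) (s lam : ℝ) (u : ℝ → Lp ℂ 2 (radialMeasure n 1))
    (t r : ℝ) : ℂ :=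
  ((lam ^ ((n : ℝ) / 2 - s) : ℝ) : ℂ) * u (timeScale n σ s lam * t) (lam * r)

/-- The solution `φ(t, r) = a₀(r) exp(-i κ (t / ε) |a₀(r)| ^ (2 σ))` of the ordinary
differential equation `i ε ∂_t φ = κ |φ| ^ (2 σ) φ`, `φ(0, r) = a₀(r)`. -/
def odeSolution (σ : ℕ) (κ ε : ℝ) (a₀ : ℝ → ℂ) (t r : ℝ) : ℂ :=
  a₀ r * Complex.exp (-Complex.I * κ * (t / ε) * (‖a₀ r‖ : ℂ) ^ (2 * σ))

end

open Set Filter MeasureTheory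
open scoped Topology ENNReal ContDiff

noncomputable section

/-! In the time τ = t/ε the equation is i∂_τψ + ε²Δψ = κ|ψ|^{2σ}ψ, and φ solves it without the
Laplacian. Put ψ = φ + w and N(z) = |z|^{2σ}z. Then w(0) = 0 and i∂_τw + ε²Δw = κ(N(φ+w) − N(φ)) −
ε²Δφ. The space derivatives of φ grow polynomially in τ, so for τ ≤ T the function φ has size A =
B(1+T)^N in a high Sobolev space, N has a Lipschitz constant K of order (A+1)^{2σ} in the unit ball
around φ, and exp(iτε²Δ) is unitary there. Gronwall's inequality gives ‖w(τ)‖ ≤ const · ε²Aτe^{Kτ}.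
With T = c₀|ln ε|^θ and c₀, θ small, A e^{KT} is at most of order 1/ε, so the error is O(εT). The
existence of w is `exists_correction`, its use is `exists_semiclassical_tower`, and the choice of T
is `exists_time_constants`.

All estimates have to be uniform in the curvature. They rest on the derivative D = hq⁻¹∂_r, taken
with respect to cosh(lam r)/lam². It maps radial functions in dimension n to radial functions in
dimension n + 2, and DΔ_n = (Δ_{n+2} + n lam²)D. A Sobolev function is therefore described by its
tower G, DG, D²G, …, the j-th entry being square integrable in dimension n + 2j (`IsTower`). On
towers the Laplacian has the explicit form `lapTower` and is symmetric level by level. Hardy's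
inequality (`IsD.hardy`) bounds it as an operator losing two derivatives, `isD_of_div` recovers the
second derivative from the Laplacian, `IsTower.exists_norm_le` is the Sobolev embedding and
`IsTower.exists_mulTower` the algebra property.

Towers modulo null sets form a Hilbert space `towerSpace`. The Riesz representation theorem on H¹
and elliptic regularity (`exists_tower_of_resolvent`) make 1 − Δ bijective between two such spaces,
and J = (1 − Δ)⁻¹ is bounded, self-adjoint and injective. The Schrödinger group is built from J by
the continuous functional calculus, through the continuous function x exp(it(1 − 1/x)). Conjugation
by the group turns the problem for w into an ordinary differential equation with a locally Lipschitz
right-hand side (`exists_mild_solution`).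

Finally the norms of the theorem are bounded by tower norms (`exists_sobolevNorm_le`), scaling gives
a strong solution in curvature −1 (`isRadialNLSSolution_scale`), and an L² energy argument
(`IsRadialNLSSolution.eq`) shows that every bounded strong solution is this one. -/

/-- The radius function `sinh (lam r) / lam` of the geodesic spheres. -/
def hq (lam r : ℝ) : ℝ := Real.sinh (lam * r) / lam

/-- The derivative `cosh (lam r)` of `hq`. -/
def hc (lam r : ℝ) : ℝ := Real.cosh (lam * r)

/-! ### Elementary bounds on the radius function, uniform for lam ≤ 1. -/

section Radius

variable {lam r : ℝ}

lemma hasDerivAt_hq (hl : 0 < lam) (r : ℝ) : HasDerivAt (hq lam) (hc lam r) r := by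
  have h : HasDerivAt (fun r => Real.sinh (lam * r)) (Real.cosh (lam * r) * (lam * 1)) r :=
    ((hasDerivAt_id r).const_mul lam).sinh
  have := h.div_const lam
  convert! this using 1
  unfold hc
  field_simp

lemma hasDerivAt_hc (hl : 0 < lam) (r : ℝ) : HasDerivAt (hc lam) (lam ^ 2 * hq lam r) r := by
  have h : HasDerivAt (fun r => Real.cosh (lam * r)) (Real.sinh (lam * r) * (lam * 1)) r :=
    ((hasDerivAt_id r).const_mul lam).cosh
  convert! h using 1
  unfold hq
  field_simp

lemma contDiff_hq : ContDiff ℝ ∞ (hq lam) := by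
  unfold hq
  exact (Real.contDiff_sinh.comp (contDiff_const.mul contDiff_id)).div_const _

lemma contDiff_hc : ContDiff ℝ ∞ (hc lam) := by
  unfold hc
  exact Real.contDiff_cosh.comp (contDiff_const.mul contDiff_id)

lemma continuous_hq : Continuous (hq lam) := contDiff_hq.continuous

lemma continuous_hc : Continuous (hc lam) := contDiff_hc.continuous

lemma hq_zero : hq lam 0 = 0 := by simp [hq]

lemma hq_pos (hl : 0 < lam) (hr : 0 < r) : 0 < hq lam r :=
  div_pos (Real.sinh_pos_iff.2 (mul_pos hl hr)) hl

lemma hq_ne_zero (hl : 0 < lam) (hr : 0 < r) : hq lam r ≠ 0 := (hq_pos hl hr).ne'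

lemma hq_cast_ne_zero (hl : 0 < lam) (hr : 0 < r) : (hq lam r : ℂ) ≠ 0 :=
  Complex.ofReal_ne_zero.2 (hq_ne_zero hl hr)

lemma hc_pos (r : ℝ) : 0 < hc lam r := Real.cosh_pos _

lemma one_le_hc (r : ℝ) : 1 ≤ hc lam r := Real.one_le_cosh _

lemma hc_sq (hl : 0 < lam) (r : ℝ) : hc lam r ^ 2 = 1 + lam ^ 2 * hq lam r ^ 2 := by
  unfold hc hq
  rw [Real.cosh_sq]
  field_simp
  ring

/-- Since hc² = 1 + lam² hq² ≤ (1 + hq)² for lam ≤ 1. A factor hc thus costs at most one power of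
hq, with a constant independent of the curvature. -/
lemma hc_le (hl : 0 < lam) (hl1 : lam ≤ 1) (hr : 0 < r) : hc lam r ≤ 1 + hq lam r := by
  have h1 := hc_sq hl r
  have h2 := hq_pos hl hr
  have h3 : lam ^ 2 ≤ 1 := pow_le_one₀ hl.le hl1
  have h4 : lam ^ 2 * hq lam r ^ 2 ≤ 1 * hq lam r ^ 2 := by gcongr
  have := hc_pos (lam := lam) r
  nlinarith

lemma le_hq (hl : 0 < lam) (hr : 0 ≤ r) : r ≤ hq lam r := by
  unfold hq
  rw [le_div_iff₀ hl, mul_comm]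
  exact Real.self_le_sinh_iff.2 (by positivity)

/-- The mean value theorem with hq' = hc ≤ cosh 1 ≤ 2. With `le_hq` it makes hq comparable to r near
the origin, uniformly in lam. -/
lemma hq_le_two_mul (hl : 0 < lam) (hl1 : lam ≤ 1) (hr : 0 ≤ r) (hr1 : r ≤ 1) :
    hq lam r ≤ 2 * r := by
  have h1 : ∀ x ∈ Icc (0 : ℝ) 1, hc lam x ≤ 2 := by
    intro x hx
    unfold hc
    have h2 : Real.cosh (lam * x) ≤ Real.cosh 1 := by
      rw [Real.cosh_le_cosh, abs_of_nonneg (mul_nonneg hl.le hx.1), abs_one]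
      exact mul_le_one₀ hl1 hx.1 hx.2
    have h3 : Real.cosh 1 ≤ 2 := by
      rw [Real.cosh_eq]
      have := Real.exp_one_lt_d9
      have h4 : Real.exp (-1) ≤ 1 := by
        rw [Real.exp_le_one_iff]; norm_num
      linarith
    linarith
  have h2 := Convex.image_sub_le_mul_sub_of_deriv_le (convex_Icc (0 : ℝ) 1)
    (f := hq lam) continuous_hq.continuousOn
    (fun x _ => (hasDerivAt_hq hl x).differentiableAt.differentiableWithinAt) (C := 2)
    (fun x hx => by
      rw [(hasDerivAt_hq hl x).deriv]
      exact h1 x (interior_subset hx)) 0 (by simp) r ⟨hr, hr1⟩ hr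
  simpa [hq_zero] using h2

end Radius

/-! ### The weighted measure on the half-line and its L² space. -/

section RadialMeasure

variable {n : ℕ} {lam : ℝ}

lemma measurable_radial_density (n : ℕ) (lam : ℝ) :
    Measurable (fun r => ENNReal.ofReal (hq lam r ^ (n - 1))) :=
  (ENNReal.continuous_ofReal.comp (continuous_hq.pow _)).measurable

lemma radialMeasure_eq (n : ℕ) (lam : ℝ) : radialMeasure n lam =
    (volume.restrict (Ioi (0 : ℝ))).withDensity (fun r => ENNReal.ofReal (hq lam r ^ (n - 1))) :=
  rfl

lemma ae_radial_iff (hl : 0 < lam) {p : ℝ → Prop} :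
    (∀ᵐ r ∂(radialMeasure n lam), p r) ↔ ∀ᵐ r ∂(volume.restrict (Ioi (0 : ℝ))), p r := by
  rw [radialMeasure_eq, ae_withDensity_iff (measurable_radial_density n lam),
    ae_restrict_iff' measurableSet_Ioi, ae_restrict_iff' measurableSet_Ioi]
  refine eventually_congr (Eventually.of_forall fun r => ?_)
  refine forall_congr' fun hr => ?_
  have : ENNReal.ofReal (hq lam r ^ (n - 1)) ≠ 0 := by
    rw [Ne, ENNReal.ofReal_eq_zero, not_le]
    exact pow_pos (hq_pos hl hr) _
  simp [this]

lemma ae_radial_iff' (hl : 0 < lam) {p : ℝ → Prop} :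
    (∀ᵐ r ∂(radialMeasure n lam), p r) ↔ ∀ᵐ r, 0 < r → p r := by
  rw [ae_radial_iff hl, ae_restrict_iff' measurableSet_Ioi]
  rfl

lemma ae_radial_of_forall (hl : 0 < lam) {p : ℝ → Prop} (h : ∀ r, 0 < r → p r) :
    ∀ᵐ r ∂(radialMeasure n lam), p r :=
  (ae_radial_iff' hl).2 (Eventually.of_forall h)

lemma ae_radial_eq (hl : 0 < lam) :
    ae (radialMeasure n lam) = ae (volume.restrict (Ioi (0 : ℝ))) := by
  ext s
  exact ae_radial_iff hl (p := fun r => r ∈ s)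

lemma aestronglyMeasurable_radial_iff (hl : 0 < lam) {E : Type*} [TopologicalSpace E]
    {f : ℝ → E} :
    AEStronglyMeasurable f (radialMeasure n lam) ↔
      AEStronglyMeasurable f (volume.restrict (Ioi (0 : ℝ))) :=
  ⟨fun h => h.mono_ac (Measure.ae_le_iff_absolutelyContinuous.1 (ae_radial_eq hl).ge),
    fun h => h.mono_ac (Measure.ae_le_iff_absolutelyContinuous.1 (ae_radial_eq hl).le)⟩

lemma integral_radial (hl : 0 < lam) {E : Type*} [NormedAddCommGroup E] [NormedSpace ℝ E]
    (f : ℝ → E) :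
    ∫ r, f r ∂(radialMeasure n lam) = ∫ r in Ioi (0 : ℝ), hq lam r ^ (n - 1) • f r := by
  rw [radialMeasure_eq, integral_withDensity_eq_integral_toReal_smul
    (measurable_radial_density n lam) (by simp)]
  refine setIntegral_congr_fun measurableSet_Ioi fun r hr => ?_
  rw [ENNReal.toReal_ofReal (pow_nonneg (hq_pos hl hr).le _)]

lemma integrable_radial_iff (hl : 0 < lam) {E : Type*} [NormedAddCommGroup E] [NormedSpace ℝ E]
    {f : ℝ → E} :
    Integrable f (radialMeasure n lam) ↔
      IntegrableOn (fun r => hq lam r ^ (n - 1) • f r) (Ioi 0) := by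
  rw [radialMeasure_eq, integrable_withDensity_iff_integrable_smul'
    (measurable_radial_density n lam) (by simp)]
  refine integrableOn_congr_fun (fun r hr => ?_) measurableSet_Ioi
  rw [ENNReal.toReal_ofReal (pow_nonneg (hq_pos hl hr).le _)]

lemma memLp_radial_iff (hl : 0 < lam) {f : ℝ → ℂ} :
    MemLp f 2 (radialMeasure n lam) ↔
      AEStronglyMeasurable f (volume.restrict (Ioi (0 : ℝ))) ∧
        IntegrableOn (fun r => hq lam r ^ (n - 1) * ‖f r‖ ^ 2) (Ioi 0) := by
  constructor
  · intro h
    have h1 := (memLp_two_iff_integrable_sq_norm h.1).1 h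
    exact ⟨(aestronglyMeasurable_radial_iff hl).1 h.1, (integrable_radial_iff hl).1 h1⟩
  · rintro ⟨h1, h2⟩
    exact (memLp_two_iff_integrable_sq_norm ((aestronglyMeasurable_radial_iff hl).2 h1)).2
      ((integrable_radial_iff hl).2 h2)

/-- The square of the `L²` norm. -/
def radialSq (n : ℕ) (lam : ℝ) (f : ℝ → ℂ) : ℝ := ∫ r, ‖f r‖ ^ 2 ∂(radialMeasure n lam)

lemma radialSq_nonneg (f : ℝ → ℂ) : 0 ≤ radialSq n lam f :=
  integral_nonneg fun _ => by positivity

lemma radialSq_eq (hl : 0 < lam) (f : ℝ → ℂ) :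
    radialSq n lam f = ∫ r in Ioi (0 : ℝ), hq lam r ^ (n - 1) * ‖f r‖ ^ 2 :=
  integral_radial hl _

lemma radialSq_congr {f g : ℝ → ℂ} (h : f =ᵐ[radialMeasure n lam] g) :
    radialSq n lam f = radialSq n lam g := by
  refine integral_congr_ae ?_
  filter_upwards [h] with r hr
  rw [hr]

lemma eLpNorm_sq_eq {f : ℝ → ℂ} (h : MemLp f 2 (radialMeasure n lam)) :
    eLpNorm f 2 (radialMeasure n lam) ^ 2 = ENNReal.ofReal (radialSq n lam f) := by
  have h1 := h.eLpNorm_eq_integral_rpow_norm (by norm_num) (by norm_num)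
  rw [h1, ← ENNReal.ofReal_pow (by positivity)]
  congr 1
  have h2 : 0 ≤ radialSq n lam f := radialSq_nonneg f
  have h3 : ∫ a, ‖f a‖ ^ (2 : ℝ≥0∞).toReal ∂(radialMeasure n lam) = radialSq n lam f := by
    simp [radialSq]
  rw [h3]
  rw [← Real.rpow_natCast, ← Real.rpow_mul h2]
  norm_num

lemma norm_toLp_sq {f : ℝ → ℂ} (h : MemLp f 2 (radialMeasure n lam)) :
    ‖h.toLp f‖ ^ 2 = radialSq n lam f := by
  rw [Lp.norm_toLp, ← ENNReal.toReal_pow, eLpNorm_sq_eq h, ENNReal.toReal_ofReal]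
  exact radialSq_nonneg f

/-- Raising the dimension by 2j multiplies the density by hq^(2j), which is the square of the factor
moved onto the function. -/
lemma memLp_shift_iff (hn : 1 ≤ n) (hl : 0 < lam) (j : ℕ) {f : ℝ → ℂ} :
    MemLp f 2 (radialMeasure (n + 2 * j) lam) ↔
      MemLp (fun r => (hq lam r : ℂ) ^ j * f r) 2 (radialMeasure n lam) := by
  rw [memLp_radial_iff hl, memLp_radial_iff hl]
  refine and_congr ⟨fun h => ?_, fun h => ?_⟩ (integrableOn_congr_fun (fun r hr => ?_)
    measurableSet_Ioi)
  · exact ((Complex.continuous_ofReal.comp continuous_hq).pow j).aestronglyMeasurable.mul h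
  · have h1 : AEStronglyMeasurable (fun r => ((hq lam r : ℂ) ^ j)⁻¹)
        (volume.restrict (Ioi (0 : ℝ))) :=
      (((Complex.continuous_ofReal.comp continuous_hq).pow j).measurable.inv).aestronglyMeasurable
    refine (h1.mul h).congr ?_
    filter_upwards [ae_restrict_mem measurableSet_Ioi] with r hr
    have := hq_cast_ne_zero hl hr
    simp only [Pi.mul_apply]
    field_simp
  · have := hq_pos hl hr
    simp only [norm_mul, norm_pow, Complex.norm_real, Real.norm_eq_abs, abs_of_pos this]
    have h2 : n + 2 * j - 1 = n - 1 + 2 * j := by omega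
    rw [h2, pow_add, pow_mul]
    ring

lemma radialSq_shift (hn : 1 ≤ n) (hl : 0 < lam) (j : ℕ) (f : ℝ → ℂ) :
    radialSq (n + 2 * j) lam f = radialSq n lam (fun r => (hq lam r : ℂ) ^ j * f r) := by
  rw [radialSq_eq hl, radialSq_eq hl]
  refine setIntegral_congr_fun measurableSet_Ioi fun r hr => ?_
  have := hq_pos hl hr
  simp only [norm_mul, norm_pow, Complex.norm_real, Real.norm_eq_abs, abs_of_pos this]
  have h2 : n + 2 * j - 1 = n - 1 + 2 * j := by omega
  rw [h2, pow_add, pow_mul]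
  ring

lemma radialSq_mono {f g : ℝ → ℂ} (hg : MemLp g 2 (radialMeasure n lam))
    (h : ∀ᵐ r ∂(radialMeasure n lam), ‖f r‖ ≤ ‖g r‖) : radialSq n lam f ≤ radialSq n lam g := by
  refine integral_mono_of_nonneg (Eventually.of_forall fun _ => by positivity)
    ((memLp_two_iff_integrable_sq_norm hg.1).1 hg) ?_
  filter_upwards [h] with r hr
  gcongr

lemma radialSq_add_le {f g : ℝ → ℂ} (hf : MemLp f 2 (radialMeasure n lam))
    (hg : MemLp g 2 (radialMeasure n lam)) :
    radialSq n lam (fun r => f r + g r) ≤ 2 * radialSq n lam f + 2 * radialSq n lam g := by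
  unfold radialSq
  rw [← integral_const_mul, ← integral_const_mul, ← integral_add]
  · refine integral_mono_of_nonneg (Eventually.of_forall fun _ => by positivity) ?_
      (Eventually.of_forall fun r => ?_)
    · exact (((memLp_two_iff_integrable_sq_norm hf.1).1 hf).const_mul 2).add
        (((memLp_two_iff_integrable_sq_norm hg.1).1 hg).const_mul 2)
    · have h1 := norm_add_le (f r) (g r)
      have h2 : ‖f r + g r‖ ^ 2 ≤ (‖f r‖ + ‖g r‖) ^ 2 := by gcongr
      simp only
      nlinarith [sq_nonneg (‖f r‖ - ‖g r‖)]
  · exact ((memLp_two_iff_integrable_sq_norm hf.1).1 hf).const_mul 2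
  · exact ((memLp_two_iff_integrable_sq_norm hg.1).1 hg).const_mul 2

lemma radialSq_const_mul (a : ℂ) (f : ℝ → ℂ) :
    radialSq n lam (fun r => a * f r) = ‖a‖ ^ 2 * radialSq n lam f := by
  unfold radialSq
  rw [← integral_const_mul]
  congr 1
  ext r
  rw [norm_mul, mul_pow]

/-- A function in `L²` with the radial weight is integrable on compact intervals of `(0, ∞)`. -/
lemma MeasureTheory.MemLp.intervalIntegrable_of_pos (hl : 0 < lam) {f : ℝ → ℂ}
    (hf : MemLp f 2 (radialMeasure n lam)) {x y : ℝ} (hx : 0 < x) (hy : 0 < y) :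
    IntervalIntegrable f volume x y := by
  obtain ⟨h1, h2⟩ := (memLp_radial_iff hl).1 hf
  have hsub : Set.uIcc x y ⊆ Ioi 0 := fun z hz => lt_of_lt_of_le (lt_min hx hy) hz.1
  rw [intervalIntegrable_iff']
  have h3 : IntegrableOn (fun r => hq lam r ^ (n - 1) * ‖f r‖ ^ 2) (uIcc x y) := h2.mono_set hsub
  have h4 : IntegrableOn (fun r => (hq lam r ^ (n - 1))⁻¹ * (hq lam r ^ (n - 1) * ‖f r‖ ^ 2))
      (uIcc x y) := by
    refine h3.continuousOn_mul ?_ isCompact_uIcc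
    refine ((continuous_hq.pow _).continuousOn).inv₀ fun z hz => ?_
    exact pow_ne_zero _ (hq_ne_zero hl (hsub hz))
  have h5 : IntegrableOn (fun r => ‖f r‖ ^ 2) (uIcc x y) := by
    refine h4.congr_fun (fun z hz => ?_) measurableSet_uIcc
    have := hq_ne_zero hl (hsub hz)
    field_simp
  have h6 : MemLp f 2 (volume.restrict (uIcc x y)) :=
    (memLp_two_iff_integrable_sq_norm (h1.mono_measure (Measure.restrict_mono hsub le_rfl))).2 h5
  have : IsFiniteMeasure (volume.restrict (uIcc x y)) :=
    ⟨by simp⟩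
  exact h6.integrable (by norm_num)

end RadialMeasure

/-! ### Calculus of locally absolutely continuous functions on the open half-line. -/

/-- `f` is a primitive of `g` on `(0, ∞)`. -/
def IsPrim (f g : ℝ → ℂ) : Prop :=
  ∀ x y, 0 < x → 0 < y → IntervalIntegrable g volume x y ∧ ∫ t in x..y, g t = f y - f x

lemma uIcc_subset_Ioi_zero {x y : ℝ} (hx : 0 < x) (hy : 0 < y) : uIcc x y ⊆ Ioi 0 :=
  fun _ hz => lt_of_lt_of_le (lt_min hx hy) hz.1

lemma AbsolutelyContinuousOnInterval.ofReal {f : ℝ → ℝ} {x y : ℝ}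
    (hf : AbsolutelyContinuousOnInterval f x y) (a : ℂ) :
    AbsolutelyContinuousOnInterval (fun t => (f t : ℂ) * a) x y := by
  have hc : AbsolutelyContinuousOnInterval (fun _ : ℝ => a) x y :=
    (LipschitzWith.const a).lipschitzOnWith.absolutelyContinuousOnInterval
  convert! hf.smul hc using 1

namespace IsPrim

variable {f g f' g' : ℝ → ℂ}

lemma intervalIntegrable (h : IsPrim f f') {x y : ℝ} (hx : 0 < x) (hy : 0 < y) :
    IntervalIntegrable f' volume x y := (h x y hx hy).1

lemma integral_eq (h : IsPrim f f') {x y : ℝ} (hx : 0 < x) (hy : 0 < y) :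
    ∫ t in x..y, f' t = f y - f x := (h x y hx hy).2

lemma of_integral {C : ℂ} (hg : ∀ x y, 0 < x → 0 < y → IntervalIntegrable g volume x y)
    (hf : ∀ x, 0 < x → f x = C + ∫ t in (1 : ℝ)..x, g t) : IsPrim f g := by
  intro x y hx hy
  refine ⟨hg x y hx hy, ?_⟩
  rw [hf x hx, hf y hy, ← intervalIntegral.integral_add_adjacent_intervals
    (hg 1 x one_pos hx) (hg x y hx hy)]
  ring

lemma of_hasDerivAt (h : ∀ x, 0 < x → HasDerivAt f (f' x) x) (hc : ContinuousOn f' (Ioi 0)) :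
    IsPrim f f' := by
  intro x y hx hy
  have h1 : IntervalIntegrable f' volume x y :=
    (hc.mono (uIcc_subset_Ioi_zero hx hy)).intervalIntegrable
  exact ⟨h1, intervalIntegral.integral_eq_sub_of_hasDerivAt
    (fun t ht => h t (uIcc_subset_Ioi_zero hx hy ht)) h1⟩

lemma congr (h : IsPrim f f') (hf : ∀ x, 0 < x → f x = g x)
    (hg : ∀ᵐ x, 0 < x → f' x = g' x) : IsPrim g g' := by
  intro x y hx hy
  have h1 : ∀ᵐ t, t ∈ uIoc x y → f' t = g' t := by
    filter_upwards [hg] with t ht hxy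
    exact ht (uIcc_subset_Ioi_zero hx hy (uIoc_subset_uIcc hxy))
  refine ⟨(h.intervalIntegrable hx hy).congr_ae ?_, ?_⟩
  · exact (ae_restrict_iff' measurableSet_uIoc).2 h1
  · rw [← intervalIntegral.integral_congr_ae h1, h.integral_eq hx hy, hf x hx, hf y hy]

lemma add (hf : IsPrim f f') (hg : IsPrim g g') :
    IsPrim (fun x => f x + g x) (fun x => f' x + g' x) := by
  intro x y hx hy
  refine ⟨(hf.intervalIntegrable hx hy).add (hg.intervalIntegrable hx hy), ?_⟩
  rw [intervalIntegral.integral_add (hf.intervalIntegrable hx hy)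
    (hg.intervalIntegrable hx hy), hf.integral_eq hx hy, hg.integral_eq hx hy]
  ring

lemma const_mul (a : ℂ) (hf : IsPrim f f') : IsPrim (fun x => a * f x) (fun x => a * f' x) := by
  intro x y hx hy
  refine ⟨(hf.intervalIntegrable hx hy).const_mul a, ?_⟩
  rw [intervalIntegral.integral_const_mul, hf.integral_eq hx hy]
  ring

lemma sub (hf : IsPrim f f') (hg : IsPrim g g') :
    IsPrim (fun x => f x - g x) (fun x => f' x - g' x) := by
  have := hf.add (hg.const_mul (-1))
  simpa [sub_eq_add_neg] using this

lemma zero : IsPrim (fun _ => 0) (fun _ => 0) := by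
  intro x y _ _
  simp

lemma sum {ι : Type*} (s : Finset ι) {F F' : ι → ℝ → ℂ} (h : ∀ i ∈ s, IsPrim (F i) (F' i)) :
    IsPrim (fun x => ∑ i ∈ s, F i x) (fun x => ∑ i ∈ s, F' i x) := by
  classical
  induction s using Finset.induction_on with
  | empty => simpa using zero
  | insert i s hi ih =>
    simp only [Finset.sum_insert hi]
    exact (h i (Finset.mem_insert_self i s)).add
      (ih fun k hk => h k (Finset.mem_insert_of_mem hk))

lemma star (hf : IsPrim f f') :
    IsPrim (fun x => (starRingEnd ℂ) (f x)) (fun x => (starRingEnd ℂ) (f' x)) := by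
  intro x y hx hy
  have h1 := hf.intervalIntegrable hx hy
  refine ⟨?_, ?_⟩
  · rw [intervalIntegrable_iff] at h1 ⊢
    exact (Complex.conjCLE.toContinuousLinearMap.integrable_comp h1)
  · rw [← map_sub, ← hf.integral_eq hx hy]
    exact Complex.conjCLE.toContinuousLinearMap.intervalIntegral_comp_comm h1

/-- On the interval f is a constant plus the integrals of the real and imaginary parts of f', each
absolutely continuous. -/
lemma absolutelyContinuous (hf : IsPrim f f') {x y : ℝ} (hx : 0 < x) (hy : 0 < y) :
    AbsolutelyContinuousOnInterval f x y := by
  have h1 := hf.intervalIntegrable hx hy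
  have hr : IntervalIntegrable (fun t => (f' t).re) volume x y := by
    rw [intervalIntegrable_iff] at h1 ⊢
    exact h1.re
  have hi : IntervalIntegrable (fun t => (f' t).im) volume x y := by
    rw [intervalIntegrable_iff] at h1 ⊢
    exact h1.im
  have h2 := ((hr.absolutelyContinuousOnInterval_intervalIntegral (c := x) (by simp)).ofReal 1).add
    ((hi.absolutelyContinuousOnInterval_intervalIntegral (c := x) (by simp)).ofReal Complex.I)
  have h3 : AbsolutelyContinuousOnInterval (fun _ : ℝ => f x) x y :=
    (LipschitzWith.const _).lipschitzOnWith.absolutelyContinuousOnInterval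
  have h4 := h3.add h2
  have h5 : EqOn f ((fun _ : ℝ => f x) + ((fun t => ((∫ s in x..t, (f' s).re : ℝ) : ℂ) * 1) +
      fun t => ((∫ s in x..t, (f' s).im : ℝ) : ℂ) * Complex.I)) (uIcc x y) := by
    intro t ht
    have ht0 : 0 < t := uIcc_subset_Ioi_zero hx hy ht
    have h6 := hf.integral_eq hx ht0
    have h7 := hf.intervalIntegrable hx ht0
    have hre : ∫ s in x..t, (f' s).re = (f t - f x).re := by
      rw [← h6]
      exact Complex.reCLM.intervalIntegral_comp_comm h7
    have him : ∫ s in x..t, (f' s).im = (f t - f x).im := by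
      rw [← h6]
      exact Complex.imCLM.intervalIntegral_comp_comm h7
    simp only [Pi.add_apply, hre, him, mul_one]
    rw [Complex.re_add_im]
    ring
  rw [absolutelyContinuousOnInterval_iff] at h4 ⊢
  intro ε hε
  obtain ⟨δ, hδ, h8⟩ := h4 ε hε
  refine ⟨δ, hδ, fun E hE hEδ => ?_⟩
  refine lt_of_le_of_lt (Finset.sum_le_sum fun i hi => ?_) (h8 E hE hEδ)
  rw [h5 (hE.1 i hi).1, h5 (hE.1 i hi).2]

lemma continuousOn (hf : IsPrim f f') : ContinuousOn f (Ioi 0) := by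
  intro x hx
  have hx' : (0 : ℝ) < x := hx
  have h1 := (hf.absolutelyContinuous (x := x / 2) (y := x + 1) (by positivity)
    (by positivity)).continuousOn
  have h2 : uIcc (x / 2) (x + 1) ∈ 𝓝 x := by
    rw [uIcc_of_le (by linarith)]
    exact Icc_mem_nhds (by linarith) (by linarith)
  exact (h1.continuousAt h2).continuousWithinAt

/-- Lebesgue's differentiation theorem on the countably many intervals (1/(k+2), k+2), which exhaust
the half-line. -/
lemma ae_hasDerivAt (hf : IsPrim f f') : ∀ᵐ t, 0 < t → HasDerivAt f (f' t) t := by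
  have h1 : ∀ k : ℕ, ∀ᵐ t, t ∈ Ioo (1 / ((k : ℝ) + 2)) (k + 2) → HasDerivAt f (f' t) t := by
    intro k
    have hk1 : (0 : ℝ) < 1 / (k + 2) := by positivity
    have hk2 : (0 : ℝ) < (k : ℝ) + 2 := by positivity
    have hk3 : 1 / ((k : ℝ) + 2) ≤ k + 2 := by
      rw [div_le_iff₀ hk2]
      nlinarith [(Nat.cast_nonneg k : (0 : ℝ) ≤ k)]
    filter_upwards [(hf.intervalIntegrable hk1 hk2).ae_hasDerivAt_integral] with t ht hm
    have hm' : t ∈ uIcc (1 / ((k : ℝ) + 2)) (k + 2) := by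
      rw [uIcc_of_le hk3]
      exact ⟨hm.1.le, hm.2.le⟩
    have h2 := (ht hm' (1 / ((k : ℝ) + 2)) (by simp)).const_add (f (1 / ((k : ℝ) + 2)))
    refine h2.congr_of_eventuallyEq ?_
    filter_upwards [Ioo_mem_nhds hm.1 hm.2] with s hs
    rw [hf.integral_eq hk1 (hk1.trans hs.1)]
    ring
  rw [← ae_all_iff] at h1
  filter_upwards [h1] with t ht ht0
  obtain ⟨k, hk⟩ := exists_nat_gt (max (1 / t) t)
  refine ht k ⟨?_, ?_⟩
  · rw [div_lt_iff₀ (by positivity)]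
    have := (le_max_left (1 / t) t).trans_lt hk
    rw [div_lt_iff₀ ht0] at this
    nlinarith
  · have := (le_max_right (1 / t) t).trans_lt hk
    linarith

lemma ae_unique (hf : IsPrim f f') (hg : IsPrim f g') : ∀ᵐ t, 0 < t → f' t = g' t := by
  filter_upwards [hf.ae_hasDerivAt, hg.ae_hasDerivAt] with t h1 h2 ht
  exact (h1 ht).unique (h2 ht)

/-- The product minus the integral of the expected derivative is absolutely continuous with
derivative zero almost everywhere, hence constant. -/
lemma mul (hf : IsPrim f f') (hg : IsPrim g g') :
    IsPrim (fun x => f x * g x) (fun x => f' x * g x + f x * g' x) := by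
  intro x y hx hy
  have hsub := uIcc_subset_Ioi_zero hx hy
  have hi : IntervalIntegrable (fun t => f' t * g t + f t * g' t) volume x y :=
    ((hf.intervalIntegrable hx hy).mul_continuousOn (hg.continuousOn.mono hsub)).add
      ((hg.intervalIntegrable hx hy).continuousOn_mul (hf.continuousOn.mono hsub))
  refine ⟨hi, ?_⟩
  have hB : IsPrim (fun t => ∫ s in x..t, (f' s * g s + f s * g' s))
      (fun t => f' t * g t + f t * g' t) := by
    have hi' : ∀ u v, 0 < u → 0 < v →
        IntervalIntegrable (fun t => f' t * g t + f t * g' t) volume u v := fun u v hu hv =>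
      ((hf.intervalIntegrable hu hv).mul_continuousOn
        (hg.continuousOn.mono (uIcc_subset_Ioi_zero hu hv))).add
      ((hg.intervalIntegrable hu hv).continuousOn_mul
        (hf.continuousOn.mono (uIcc_subset_Ioi_zero hu hv)))
    refine of_integral (C := ∫ s in x..1, (f' s * g s + f s * g' s)) hi' fun u hu => ?_
    rw [intervalIntegral.integral_add_adjacent_intervals (hi' x 1 hx one_pos) (hi' 1 u one_pos hu)]
  have h1 := ((hf.absolutelyContinuous hx hy).smul (hg.absolutelyContinuous hx hy)).sub
    (hB.absolutelyContinuous hx hy)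
  obtain ⟨C, hC⟩ := h1.const_of_ae_hasDerivAt_zero (by
    filter_upwards [hf.ae_hasDerivAt, hg.ae_hasDerivAt, hB.ae_hasDerivAt] with t h2 h3 h4 ht
    have ht0 := hsub ht
    have h5 := ((h2 ht0).mul (h3 ht0)).sub (h4 ht0)
    convert! h5 using 1
    ring)
  have h6 := hC x (by simp)
  have h7 := hC y (by simp)
  simp only [Pi.sub_apply, Pi.mul_apply, smul_eq_mul, intervalIntegral.integral_same,
    sub_zero] at h6 h7
  simp only [h6, ← h7]
  ring

lemma of_ofReal {u v : ℝ → ℝ} (h : ∀ x, 0 < x → HasDerivAt u (v x) x)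
    (hc : ContinuousOn v (Ioi 0)) : IsPrim (fun x => (u x : ℂ)) (fun x => (v x : ℂ)) :=
  of_hasDerivAt (fun x hx => (h x hx).ofReal_comp)
    (Complex.continuous_ofReal.comp_continuousOn hc)

lemma hc {lam : ℝ} (hl : 0 < lam) :
    IsPrim (fun r => (hc lam r : ℂ)) (fun r => (lam : ℂ) ^ 2 * (_root_.hq lam r : ℂ)) := by
  have := of_ofReal (u := _root_.hc lam) (fun x _ => hasDerivAt_hc hl x)
    (continuous_const.mul continuous_hq).continuousOn
  simpa using this

lemma hq_pow {lam : ℝ} (hl : 0 < lam) (k : ℕ) :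
    IsPrim (fun r => (_root_.hq lam r : ℂ) ^ k)
      (fun r => k * (_root_.hq lam r : ℂ) ^ (k - 1) * (_root_.hc lam r : ℂ)) := by
  have := of_ofReal (u := fun r => _root_.hq lam r ^ k)
    (fun x _ => (hasDerivAt_hq hl x).pow k)
    (by
      have h1 := continuous_hq (lam := lam)
      have h2 := continuous_hc (lam := lam)
      fun_prop)
  simpa using this

/-- If two primitives agree almost everywhere then they agree on `(0, ∞)`. -/
lemma eq_of_ae (hf : IsPrim f f') (hg : IsPrim g g') (h : ∀ᵐ t, 0 < t → f t = g t) :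
    ∀ t, 0 < t → f t = g t := by
  have h1 : f =ᵐ[volume.restrict (Ioi 0)] g := (ae_restrict_iff' measurableSet_Ioi).2 h
  have := MeasureTheory.Measure.eqOn_open_of_ae_eq h1 isOpen_Ioi hf.continuousOn hg.continuousOn
  exact fun t ht => this ht

end IsPrim

/-! ### Boundary values of primitives at the origin and at infinity. -/

namespace IsPrim

variable {B b : ℝ → ℂ}

lemma tendsto_zero (h : IsPrim B b) (hb : IntegrableOn b (Ioc 0 1)) :
    Tendsto B (𝓝[>] 0) (𝓝 (B 1 - ∫ t in (0 : ℝ)..1, b t)) := by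
  have hi : IntervalIntegrable b volume 0 1 :=
    (intervalIntegrable_iff_integrableOn_Ioc_of_le zero_le_one).2 hb
  have h1 : ContinuousOn (fun x => ∫ t in (1 : ℝ)..x, b t) (uIcc 0 1) :=
    intervalIntegral.continuousOn_primitive_interval' hi (by simp)
  have h2 : Tendsto (fun x => ∫ t in (1 : ℝ)..x, b t) (𝓝[>] 0) (𝓝 (∫ t in (1 : ℝ)..0, b t)) := by
    refine (h1 0 (by simp)).mono_left ?_
    rw [uIcc_of_le zero_le_one, ← nhdsWithin_Ioc_eq_nhdsGT zero_lt_one]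
    exact nhdsWithin_mono _ Ioc_subset_Icc_self
  have h3 := h2.const_add (B 1)
  rw [intervalIntegral.integral_symm, ← sub_eq_add_neg] at h3
  refine h3.congr' ?_
  filter_upwards [self_mem_nhdsWithin] with x hx
  rw [h.integral_eq one_pos hx]
  ring

lemma tendsto_top (h : IsPrim B b) (hb : IntegrableOn b (Ioi 1)) :
    Tendsto B atTop (𝓝 (B 1 + ∫ t in Ioi (1 : ℝ), b t)) := by
  have h1 := (intervalIntegral_tendsto_integral_Ioi 1 hb tendsto_id).const_add (B 1)
  refine h1.congr' ?_
  filter_upwards [Ioi_mem_atTop 0] with x hx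
  rw [id, h.integral_eq one_pos hx]
  ring

lemma integral_Ioi (h : IsPrim B b) (hb : IntegrableOn b (Ioi 0)) {l m : ℂ}
    (hl : Tendsto B (𝓝[>] 0) (𝓝 l)) (hm : Tendsto B atTop (𝓝 m)) :
    ∫ t in Ioi (0 : ℝ), b t = m - l := by
  have h1 := h.tendsto_zero (hb.mono_set Ioc_subset_Ioi_self)
  have h2 := h.tendsto_top (hb.mono_set (Ioi_subset_Ioi zero_le_one))
  rw [tendsto_nhds_unique hl h1, tendsto_nhds_unique hm h2,
    ← Ioc_union_Ioi_eq_Ioi (zero_le_one' ℝ), setIntegral_union (Ioc_disjoint_Ioi le_rfl)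
    measurableSet_Ioi (hb.mono_set Ioc_subset_Ioi_self)
    (hb.mono_set (Ioi_subset_Ioi zero_le_one)), intervalIntegral.integral_of_le zero_le_one]
  ring

/-- A primitive `B` with `B / r` integrable near `0` tends to `0` at `0`. -/
lemma tendsto_zero_zero {lam : ℝ} (hl : 0 < lam) (hl1 : lam ≤ 1) (h : IsPrim B b)
    (hb : IntegrableOn b (Ioc 0 1))
    (hB : IntegrableOn (fun r => (_root_.hq lam r)⁻¹ * ‖B r‖) (Ioc 0 1)) :
    Tendsto B (𝓝[>] 0) (𝓝 0) := by
  have h1 := h.tendsto_zero hb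
  set l := B 1 - ∫ t in (0 : ℝ)..1, b t
  by_cases hl0 : l = 0
  · rwa [hl0] at h1
  exfalso
  have hpos : 0 < ‖l‖ := norm_pos_iff.2 hl0
  -- If the limit were nonzero, hq⁻¹‖B‖ would dominate a multiple of 1/r near 0, because hq ≤ 2r
  -- there, and 1/r is not integrable.
  have h2 : ∀ᶠ r in 𝓝[>] (0 : ℝ), ‖l‖ / 2 < ‖B r‖ :=
    (tendsto_order.1 h1.norm).1 _ (by linarith)
  obtain ⟨δ, hδ, h3⟩ := mem_nhdsGT_iff_exists_Ioc_subset.1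
    (inter_mem h2 (Ioc_mem_nhdsGT (zero_lt_one' ℝ)))
  have h4 : IntegrableOn (fun r => 4 / ‖l‖ * ((_root_.hq lam r)⁻¹ * ‖B r‖)) (Ioc 0 δ) :=
    (hB.mono_set fun r hr => (h3 hr).2).const_mul _
  have h5 : IntegrableOn (fun r : ℝ => r⁻¹) (Ioc 0 δ) := by
    refine Integrable.mono' h4 measurable_inv.aestronglyMeasurable ?_
    refine (ae_restrict_iff' measurableSet_Ioc).2 (Eventually.of_forall fun r hr => ?_)
    obtain ⟨h6, h7⟩ := h3 hr
    have h8 := hq_le_two_mul hl hl1 h7.1.le h7.2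
    have h9 := hq_pos hl h7.1
    have h10 : (2 * r)⁻¹ ≤ (_root_.hq lam r)⁻¹ := inv_anti₀ h9 h8
    have hr0 := h7.1
    rw [Real.norm_eq_abs, abs_of_pos (inv_pos.2 hr0)]
    have h6' : ‖l‖ / 2 < ‖B r‖ := h6
    calc r⁻¹ = 4 / ‖l‖ * ((2 * r)⁻¹ * (‖l‖ / 2)) := by field_simp; norm_num
      _ ≤ _ := by gcongr
  have h6 := (intervalIntegrable_iff_integrableOn_Ioc_of_le hδ.le).2 h5
  rw [intervalIntegrable_inv_iff] at h6
  rcases h6 with h6 | h6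
  · exact hδ.ne h6
  · simp at h6

/-- The boundary terms of a primitive vanish under integrability conditions. -/
lemma integral_Ioi_eq_zero {lam : ℝ} (hl : 0 < lam) (hl1 : lam ≤ 1) (h : IsPrim B b)
    (hb : IntegrableOn b (Ioi 0))
    (hB0 : IntegrableOn (fun r => (_root_.hq lam r)⁻¹ * ‖B r‖) (Ioc 0 1))
    (hB : IntegrableOn B (Ioi 1)) : ∫ t in Ioi (0 : ℝ), b t = 0 := by
  have h1 := h.tendsto_zero_zero hl hl1 (hb.mono_set Ioc_subset_Ioi_self) hB0
  have h2 := h.tendsto_top (hb.mono_set (Ioi_subset_Ioi zero_le_one))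
  -- The left side is the limit of B at infinity, and an integrable function on a half-line of
  -- infinite measure can only have the limit 0.
  have h3 : B 1 + ∫ t in Ioi (1 : ℝ), b t = 0 := by
    refine IntegrableAtFilter.eq_zero_of_tendsto (μ := volume) (l := atTop)
      ⟨Ioi 1, Ioi_mem_atTop 1, hB⟩ (fun s hs => ?_) h2
    obtain ⟨a, ha⟩ := mem_atTop_sets.1 hs
    exact top_unique ((Real.volume_Ici (a := a)).symm.le.trans (measure_mono ha))
  rw [h3] at h2
  simpa using h.integral_Ioi hb h1 h2

end IsPrim

/-! ### Test functions on the half-line and weak derivatives in one variable. -/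

lemma MeasureTheory.MemLp.integrableOn_weight {n : ℕ} {lam : ℝ} (hl : 0 < lam) {f : ℝ → ℂ}
    (hf : MemLp f 2 (radialMeasure n lam)) (R : ℝ) :
    IntegrableOn (fun r => (hq lam r : ℂ) ^ (n - 1) * f r) (Ioc 0 R) := by
  obtain ⟨h1, h2⟩ := (memLp_radial_iff hl).1 hf
  have h3 : IntegrableOn (fun r => hq lam r ^ (n - 1)) (Ioc 0 R) :=
    ((continuous_hq.pow _).integrableOn_Icc).mono_set Ioc_subset_Icc_self
  refine Integrable.mono' (h3.add (h2.mono_set Ioc_subset_Ioi_self)) ?_ ?_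
  · exact (((Complex.continuous_ofReal.comp continuous_hq).pow _).aestronglyMeasurable.mul
      (h1.mono_measure (Measure.restrict_mono Ioc_subset_Ioi_self le_rfl)))
  · refine (ae_restrict_iff' measurableSet_Ioc).2 (Eventually.of_forall fun r hr => ?_)
    have h4 := hq_pos hl hr.1
    simp only [norm_mul, norm_pow, Complex.norm_real, Real.norm_eq_abs, abs_of_pos h4,
      Pi.add_apply]
    have h5 : ‖f r‖ ≤ 1 + ‖f r‖ ^ 2 := by nlinarith [sq_nonneg (‖f r‖ - 1)]
    have h6 : 0 ≤ hq lam r ^ (n - 1) := by positivity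
    nlinarith

/-- The support of a test function on `(0, ∞)` is contained in a compact interval. -/
lemma exists_tsupport_subset_Icc {ζ : ℝ → ℝ} (hc : HasCompactSupport ζ)
    (hs : tsupport ζ ⊆ Ioi 0) : ∃ a b, 0 < a ∧ a < b ∧ tsupport ζ ⊆ Icc a b := by
  rcases (tsupport ζ).eq_empty_or_nonempty with h | h
  · exact ⟨1, 2, one_pos, one_lt_two, by simp [h]⟩
  · have hc' : IsCompact (tsupport ζ) := hc
    obtain ⟨a, ha, ha'⟩ := hc'.exists_isLeast h
    obtain ⟨b, hb, hb'⟩ := hc'.exists_isGreatest h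
    have : (0 : ℝ) < a := hs ha
    exact ⟨a / 2, b + 1, by positivity, by linarith [ha' hb], fun x hx =>
      ⟨by linarith [ha' hx], by linarith [hb' hx]⟩⟩

lemma eq_zero_of_tsupport_subset {ζ : ℝ → ℝ} {a b : ℝ} (h : tsupport ζ ⊆ Icc a b) {x : ℝ}
    (hx : x ∉ Icc a b) : ζ x = 0 :=
  image_eq_zero_of_notMem_tsupport fun h' => hx (h h')

lemma contDiff_primitive {ζ : ℝ → ℝ} (hζ : ContDiff ℝ ∞ ζ) (a : ℝ) :
    ContDiff ℝ ∞ (fun x => ∫ t in a..x, ζ t) ∧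
      ∀ x, HasDerivAt (fun x => ∫ t in a..x, ζ t) (ζ x) x := by
  have hd : ∀ x, HasDerivAt (fun x => ∫ t in a..x, ζ t) (ζ x) x := fun x =>
    intervalIntegral.integral_hasDerivAt_right (hζ.continuous.intervalIntegrable _ _)
      hζ.continuous.stronglyMeasurable.stronglyMeasurableAtFilter hζ.continuous.continuousAt
  refine ⟨?_, hd⟩
  rw [contDiff_infty_iff_deriv]
  refine ⟨fun x => (hd x).differentiableAt, ?_⟩
  rwa [funext fun x => (hd x).deriv]

lemma integrableOn_Ioi_of_eq_zero {f : ℝ → ℂ} {b : ℝ} (h : IntegrableOn f (Ioc 0 b))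
    (h0 : ∀ x, b < x → f x = 0) : IntegrableOn f (Ioi 0) := by
  rcases le_or_gt 0 b with hb | hb
  · rw [← Ioc_union_Ioi_eq_Ioi hb]
    refine h.union ?_
    exact (integrableOn_zero).congr_fun (fun x hx => (h0 x hx).symm) measurableSet_Ioi
  · exact (integrableOn_zero).congr_fun (fun x hx => (h0 x (hb.trans hx)).symm) measurableSet_Ioi

lemma IsPrim.ofReal_of_contDiff {η : ℝ → ℝ} (h : ContDiff ℝ ∞ η) :
    IsPrim (fun x => (η x : ℂ)) (fun x => ((deriv η x : ℝ) : ℂ)) :=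
  IsPrim.of_ofReal (fun x _ => (h.differentiable (by simp) x).hasDerivAt)
    (h.continuous_deriv (by simp)).continuousOn

/-- Integration by parts against a test function on `(0, ∞)`. -/
lemma IsPrim.integral_test {f g : ℝ → ℂ} (h : IsPrim f g) {η : ℝ → ℝ} (hη : ContDiff ℝ ∞ η)
    {a b : ℝ} (ha : 0 < a) (hab : a < b) (hs : tsupport η ⊆ Icc a b) :
    ∫ x in Ioi (0 : ℝ), ((deriv η x : ℝ) : ℂ) * f x = -∫ x in Ioi (0 : ℝ), (η x : ℂ) * g x := by
  have hb : 0 < b := ha.trans hab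
  have h1 := (IsPrim.ofReal_of_contDiff hη).mul h
  have hη0 : ∀ x, x ∉ Icc a b → η x = 0 := fun x hx => eq_zero_of_tsupport_subset hs hx
  have hdη0 : ∀ x, x ∉ Icc a b → deriv η x = 0 := fun x hx =>
    eq_zero_of_tsupport_subset (tsupport_deriv_subset.trans hs) hx
  have hi : ∀ F : ℝ → ℂ, IntervalIntegrable F volume a b → (∀ x, x ∉ Icc a b → F x = 0) →
      IntegrableOn F (Ioi 0) := by
    intro F hF h0
    have h2 : IntegrableOn F (Icc a b) := by
      rw [integrableOn_Icc_iff_integrableOn_Ioc]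
      exact (intervalIntegrable_iff_integrableOn_Ioc_of_le hab.le).1 hF
    exact ((integrableOn_iff_integrable_of_support_subset fun x hx => by
      by_contra hxs; exact hx (h0 x hxs)).1 h2).integrableOn
  have hi1 : IntegrableOn (fun x => ((deriv η x : ℝ) : ℂ) * f x) (Ioi 0) := by
    refine hi _ ?_ fun x hx => by simp [hdη0 x hx]
    refine ContinuousOn.intervalIntegrable (ContinuousOn.mul ?_ ?_)
    · exact (Complex.continuous_ofReal.comp (hη.continuous_deriv (by simp))).continuousOn
    · exact h.continuousOn.mono (uIcc_subset_Ioi_zero ha hb)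
  have hi2 : IntegrableOn (fun x => (η x : ℂ) * g x) (Ioi 0) := by
    refine hi _ ?_ fun x hx => by simp [hη0 x hx]
    exact (h.intervalIntegrable ha hb).continuousOn_mul
      (Complex.continuous_ofReal.comp hη.continuous).continuousOn
  have h2 := h1.integral_Ioi (l := 0) (m := 0) (hi1.add hi2) ?_ ?_
  · rw [integral_add hi1 hi2, sub_zero] at h2
    exact eq_neg_of_add_eq_zero_left h2
  · refine tendsto_const_nhds.congr' ?_
    filter_upwards [Ioo_mem_nhdsGT ha] with x hx
    simp [hη0 x fun h => absurd h.1 (not_le.2 hx.2)]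
  · refine tendsto_const_nhds.congr' ?_
    filter_upwards [Ioi_mem_atTop b] with x hx
    simp [hη0 x fun h => absurd h.2 (not_le.2 hx)]

/-- The fundamental lemma of du Bois-Reymond on `(0, ∞)`. -/
lemma exists_isPrim_of_weak {f g : ℝ → ℂ}
    (hf : ∀ x y, 0 < x → 0 < y → IntervalIntegrable f volume x y)
    (hg : ∀ x y, 0 < x → 0 < y → IntervalIntegrable g volume x y)
    (h : ∀ η : ℝ → ℝ, ContDiff ℝ ∞ η → HasCompactSupport η → tsupport η ⊆ Ioi 0 →
      ∫ x in Ioi (0 : ℝ), ((deriv η x : ℝ) : ℂ) * f x =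
        -∫ x in Ioi (0 : ℝ), (η x : ℂ) * g x) :
    ∃ F : ℝ → ℂ, (∀ᵐ x, 0 < x → f x = F x) ∧ IsPrim F g := by
  set G : ℝ → ℂ := fun x => ∫ t in (1 : ℝ)..x, g t
  have hG : IsPrim G g := IsPrim.of_integral (C := 0) hg fun x _ => by simp [G]
  have hG' : ∀ x y, 0 < x → 0 < y → IntervalIntegrable G volume x y := fun x y hx hy =>
    (hG.continuousOn.mono (uIcc_subset_Ioi_zero hx hy)).intervalIntegrable
  set k : ℝ → ℂ := fun x => f x - G x
  have hk : ∀ x y, 0 < x → 0 < y → IntervalIntegrable k volume x y := fun x y hx hy =>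
    (hf x y hx hy).sub (hG' x y hx hy)
  have htest : ∀ (ζ : ℝ → ℝ) (F : ℝ → ℂ) (a b : ℝ), Continuous ζ → 0 < a → a < b →
      tsupport ζ ⊆ Icc a b → IntervalIntegrable F volume a b →
      Integrable (fun x => (ζ x : ℂ) * F x) := by
    intro ζ F a b hζ ha hab hs hF
    have h2 : IntegrableOn (fun x => (ζ x : ℂ) * F x) (Icc a b) := by
      rw [integrableOn_Icc_iff_integrableOn_Ioc]
      exact (intervalIntegrable_iff_integrableOn_Ioc_of_le hab.le).1
        (hF.continuousOn_mul (Complex.continuous_ofReal.comp hζ).continuousOn)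
    exact (integrableOn_iff_integrable_of_support_subset fun x hx => by
      by_contra hxs
      exact hx (by simp [eq_zero_of_tsupport_subset hs hxs])).1 h2
  have hIoi : ∀ (ζ : ℝ → ℝ) (F : ℝ → ℂ), tsupport ζ ⊆ Ioi 0 →
      ∫ x in Ioi (0 : ℝ), (ζ x : ℂ) * F x = ∫ x, (ζ x : ℂ) * F x := by
    intro ζ F hs
    refine setIntegral_eq_integral_of_forall_compl_eq_zero fun x hx => ?_
    simp [image_eq_zero_of_notMem_tsupport fun h' => hx (hs h')]
  -- The difference k = f − G has weak derivative zero; what remains is to show that it is constant.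
  have h0 : ∀ η : ℝ → ℝ, ContDiff ℝ ∞ η → HasCompactSupport η → tsupport η ⊆ Ioi 0 →
      ∫ x, ((deriv η x : ℝ) : ℂ) * k x = 0 := by
    intro η hη hc hs
    obtain ⟨a, b, ha, hab, hs'⟩ := exists_tsupport_subset_Icc hc hs
    have h1 := h η hη hc hs
    have h2 := hG.integral_test hη ha hab hs'
    have hs1 := (tsupport_deriv_subset (f := η))
    rw [hIoi _ _ (hs1.trans hs)] at h1 h2
    have hd := hη.continuous_deriv (by simp)
    simp only [k, mul_sub]
    rw [integral_sub (htest _ _ a b hd ha hab (hs1.trans hs') (hf a b ha (ha.trans hab)))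
      (htest _ _ a b hd ha hab (hs1.trans hs') (hG' a b ha (ha.trans hab))), h1, h2, sub_self]
  -- a bump function of integral one
  let ρ₀ : ContDiffBump (2 : ℝ) := ⟨1 / 2, 1, by norm_num, by norm_num⟩
  set ρ : ℝ → ℝ := ρ₀.normed volume
  have hρ : ContDiff ℝ ∞ ρ := ρ₀.contDiff_normed
  have hρs : tsupport ρ ⊆ Icc 1 3 := by
    rw [show tsupport ρ = Metric.closedBall 2 1 from ρ₀.tsupport_normed_eq, Real.closedBall_eq_Icc]
    norm_num
  have hρ1 : ∫ x, ρ x = 1 := ρ₀.integral_normed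
  set C : ℂ := ∫ x, (ρ x : ℂ) * k x
  have key : ∀ᵐ x, x ∈ Ioi (0 : ℝ) → k x - C = 0 := by
    refine isOpen_Ioi.ae_eq_zero_of_integral_contDiff_smul_eq_zero ?_ ?_
    · have hloc : LocallyIntegrableOn k (Ioi 0) := by
        intro x hx
        have hx' : (0 : ℝ) < x := hx
        refine ⟨Ioc (x / 2) (x + 1), mem_nhdsWithin_of_mem_nhds
          (Ioc_mem_nhds (by linarith) (by linarith)), ?_⟩
        exact (intervalIntegrable_iff_integrableOn_Ioc_of_le (by linarith)).1
          (hk _ _ (by linarith) (by linarith))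
      exact hloc.sub (continuous_const.locallyIntegrable.locallyIntegrableOn _)
    · intro ζ hζ hζc hζs
      obtain ⟨a', b', ha', hab', hs'⟩ := exists_tsupport_subset_Icc hζc hζs
      set a := min a' 1
      set b := max b' 3
      have ha : 0 < a := lt_min ha' one_pos
      have hab : a < b := (min_le_left _ _).trans_lt (hab'.trans_le (le_max_left _ _))
      have hζab : tsupport ζ ⊆ Icc a b :=
        hs'.trans (Icc_subset_Icc (min_le_left _ _) (le_max_left _ _))
      have hρab : tsupport ρ ⊆ Icc a b :=
        hρs.trans (Icc_subset_Icc (min_le_right _ _) (le_max_right _ _))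
      set I := ∫ x, ζ x
      -- Subtracting a multiple of the normalized bump makes the mean vanish, so the primitive of ξ
      -- is again compactly supported and may be used as a test function.
      set ξ : ℝ → ℝ := fun x => ζ x - I * ρ x
      have hξ : ContDiff ℝ ∞ ξ := hζ.sub (contDiff_const.mul hρ)
      have hξ0 : ∀ x, x ∉ Icc a b → ξ x = 0 := fun x hx => by
        simp [ξ, eq_zero_of_tsupport_subset hζab hx, eq_zero_of_tsupport_subset hρab hx]
      have hζi : Integrable ζ := hζ.continuous.integrable_of_hasCompactSupport hζc
      have hρi : Integrable ρ := hρ.continuous.integrable_of_hasCompactSupport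
        (HasCompactSupport.of_support_subset_isCompact isCompact_Icc
          ((subset_tsupport _).trans hρs))
      have hξi : ∫ x, ξ x = 0 := by
        simp only [ξ]
        rw [integral_sub hζi (hρi.const_mul I), integral_const_mul, hρ1, mul_one, sub_self]
      obtain ⟨hη1, hη2⟩ := contDiff_primitive hξ (a / 2)
      set η : ℝ → ℝ := fun x => ∫ t in (a / 2)..x, ξ t
      have hηs : tsupport η ⊆ Icc a b := by
        refine closure_minimal (fun x hx => ?_) isClosed_Icc
        by_contra hxs
        apply hx
        rcases lt_or_ge x a with hxa | hxa
        · refine intervalIntegral.integral_zero_ae (Eventually.of_forall fun t ht => hξ0 t ?_)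
          exact fun h' => absurd h'.1 (not_le.2 (lt_of_le_of_lt ht.2 (max_lt (by linarith) hxa)))
        · have hxb : b < x := not_le.1 fun h' => hxs ⟨hxa, h'⟩
          simp only [η]
          rw [intervalIntegral.integral_eq_integral_of_support_subset, hξi]
          intro t ht
          have ht' : t ∈ Icc a b := by
            by_contra h'
            exact ht (hξ0 t h')
          exact ⟨by linarith [ht'.1], by linarith [ht'.2]⟩
      have h3 := h0 η hη1 (HasCompactSupport.of_support_subset_isCompact isCompact_Icc
          ((subset_tsupport _).trans hηs)) (hηs.trans fun x hx => lt_of_lt_of_le ha hx.1)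
      simp only [(hη2 _).deriv] at h3
      have hk1 := htest ζ k a b hζ.continuous ha hab hζab (hk a b ha (ha.trans hab))
      have hk2 := htest ρ k a b hρ.continuous ha hab hρab (hk a b ha (ha.trans hab))
      have h4 : ∫ x, (ζ x : ℂ) * k x = I * C := by
        have h5 : (fun x => ((ξ x : ℝ) : ℂ) * k x) =
            fun x => (ζ x : ℂ) * k x - (I : ℂ) * ((ρ x : ℂ) * k x) := by
          ext x; simp only [ξ]; push_cast; ring
        rw [h5, integral_sub hk1 (hk2.const_mul _), integral_const_mul] at h3
        exact sub_eq_zero.1 h3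
      have hk3 : Integrable (fun x => (ζ x : ℂ) * C) := hζi.ofReal.mul_const C
      simp only [smul_sub, Complex.real_smul]
      rw [integral_sub hk1 hk3, h4, integral_mul_const, integral_complex_ofReal,
        sub_self]
  refine ⟨fun x => C + G x, ?_, ?_⟩
  · filter_upwards [key] with x hx hx0
    have := hx hx0
    simp only [k] at this
    linear_combination this
  · intro x y hx hy
    refine ⟨hg x y hx hy, ?_⟩
    rw [hG.integral_eq hx hy]
    ring

/-! ### Weak gradients and divergences versus pointwise primitives. -/

section Weak

variable {n : ℕ} {lam : ℝ}

lemma MeasureTheory.MemLp.integrableOn_mul (hl : 0 < lam) {f g : ℝ → ℂ}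
    (hf : MemLp f 2 (radialMeasure n lam)) (hg : MemLp g 2 (radialMeasure n lam)) :
    IntegrableOn (fun r => (hq lam r : ℂ) ^ (n - 1) * (f r * g r)) (Ioi 0) := by
  have h := (integrable_radial_iff hl).1 (hf.integrable_mul hg)
  refine h.congr_fun (fun r _ => ?_) measurableSet_Ioi
  simp [Complex.real_smul]

lemma MeasureTheory.MemLp.integrableOn_test (hl : 0 < lam) {f φ : ℝ → ℂ}
    (hf : MemLp f 2 (radialMeasure n lam)) {C b : ℝ}
    (hφ : AEStronglyMeasurable φ (volume.restrict (Ioi 0)))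
    (hC : ∀ r, 0 < r → r ≤ b → ‖φ r‖ ≤ C) (h0 : ∀ r, b < r → φ r = 0) :
    IntegrableOn (fun r => (hq lam r : ℂ) ^ (n - 1) * (φ r * f r)) (Ioi 0) := by
  refine integrableOn_Ioi_of_eq_zero (b := b) ?_ fun x hx => by simp [h0 x hx]
  have h1 := hf.integrableOn_weight hl b
  have h2 := h1.bdd_mul (c := C)
    (hφ.mono_measure (Measure.restrict_mono (fun x (hx : x ∈ Ioc 0 b) => hx.1) le_rfl))
    ((ae_restrict_iff' measurableSet_Ioc).2 (Eventually.of_forall fun r hr => hC r hr.1 hr.2))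
  refine h2.congr (Eventually.of_forall fun r => ?_)
  simp only
  ring

/-- Oddness forces χ(0) = 0, and χ is Lipschitz with r ≤ hq. This tames the coth singularity of the
divergence and the boundary term at the origin. -/
lemma exists_abs_le_hq (hl : 0 < lam) {χ : ℝ → ℝ} (hχ : ContDiff ℝ ∞ χ)
    (hsp : HasCompactSupport χ) (hodd : ∀ r, χ (-r) = -χ r) :
    ∃ C, 0 ≤ C ∧ ∀ r, 0 < r → |χ r| ≤ C * hq lam r := by
  obtain ⟨C, hC⟩ := hχ.lipschitzWith_of_hasCompactSupport hsp (by simp)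
  refine ⟨C, C.2, fun r hr => ?_⟩
  have h0 : χ 0 = 0 := by
    have := hodd 0
    rw [neg_zero] at this
    linarith
  have h1 := hC.dist_le_mul r 0
  rw [Real.dist_eq, Real.dist_eq, h0, sub_zero, sub_zero, abs_of_pos hr] at h1
  exact h1.trans (mul_le_mul_of_nonneg_left (le_hq hl hr.le) C.2)

lemma exists_bound_of_test {φ : ℝ → ℝ} (hsp : HasCompactSupport φ) :
    ∃ b, 1 ≤ b ∧ ∀ x, b < x → x ∉ tsupport φ := by
  obtain ⟨b, hb⟩ := (show IsCompact (tsupport φ) from hsp).isBounded.subset_closedBall 0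
  refine ⟨max b 1, le_max_right _ _, fun x hx hxs => ?_⟩
  have := hb hxs
  rw [Real.closedBall_eq_Icc] at this
  have := this.2
  have := (le_max_left b 1).trans_lt hx
  linarith

/-- The right side is the derivative of hq^(n-1) χ: against the density the divergence becomes an
exact derivative. -/
lemma hq_pow_mul_radialDiv (hn : 2 ≤ n) (hl : 0 < lam) (χ : ℝ → ℝ) {r : ℝ} (hr : 0 < r) :
    hq lam r ^ (n - 1) * radialDiv n lam χ r =
      hq lam r ^ (n - 1) * deriv χ r +
        ((n - 1 : ℕ) : ℝ) * hq lam r ^ (n - 1 - 1) * hc lam r * χ r := by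
  obtain ⟨m, rfl⟩ : ∃ m, n = m + 2 := ⟨n - 2, by omega⟩
  have h1 := hq_ne_zero hl hr
  have h2 : Real.sinh (lam * r) = lam * hq lam r := by
    unfold hq
    field_simp
  unfold radialDiv
  rw [h2]
  simp only [Nat.add_succ_sub_one, Nat.add_sub_cancel]
  unfold hc
  push_cast
  field_simp
  ring

/-- The function hq^(n-1) χ f has integral-free boundary terms: it vanishes for large r, and at the
origin `tendsto_zero_zero` applies because χ/hq is bounded. -/
lemma isWeakRadialGrad_of_isPrim (hn : 2 ≤ n) (hl : 0 < lam) (hl1 : lam ≤ 1) {f g : ℝ → ℂ}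
    (h : IsPrim f g) (hf : MemLp f 2 (radialMeasure n lam))
    (hg : MemLp g 2 (radialMeasure n lam)) : IsWeakRadialGrad n lam f g := by
  intro χ hχ hsp hodd
  obtain ⟨C, hC0, hC⟩ := exists_abs_le_hq hl hχ hsp hodd
  obtain ⟨b, hb1, hb⟩ := exists_bound_of_test hsp
  obtain ⟨K, hK⟩ := (hχ.continuous_deriv (by simp)).bounded_above_of_compact_support hsp.deriv
  have hχ0 : ∀ r, b < r → χ r = 0 := fun r hr => image_eq_zero_of_notMem_tsupport (hb r hr)
  have hdχ0 : ∀ r, b < r → deriv χ r = 0 := fun r hr =>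
    image_eq_zero_of_notMem_tsupport fun h' => hb r hr (tsupport_deriv_subset h')
  obtain ⟨K', hK'⟩ := isCompact_Icc.exists_bound_of_continuousOn
    (continuous_hc (lam := lam)).continuousOn (s := Icc 0 b)
  have hdm : Measurable (radialDiv n lam χ) := by
    unfold radialDiv
    have h1 := (hχ.continuous_deriv (by simp)).measurable
    have h2 := hχ.continuous.measurable
    have h3 := Real.continuous_cosh.measurable
    have h4 := Real.continuous_sinh.measurable
    fun_prop
  have hi1 : IntegrableOn (fun r => (hq lam r : ℂ) ^ (n - 1) * ((radialDiv n lam χ r : ℂ) * f r))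
      (Ioi 0) := by
    refine hf.integrableOn_test hl (C := K + (n - 1) * K' * C) (b := b)
      (Complex.measurable_ofReal.comp hdm).aestronglyMeasurable (fun r hr hrb => ?_) fun r hr => ?_
    · rw [Complex.norm_real, Real.norm_eq_abs]
      unfold radialDiv
      have h2 : Real.sinh (lam * r) = lam * hq lam r := by
        unfold hq
        field_simp
      have h3 := hq_pos hl hr
      have h4 : (1 : ℝ) ≤ n := by exact_mod_cast (by omega : 1 ≤ n)
      refine (abs_add_le _ _).trans (add_le_add (hK r) ?_)
      rw [h2, show ((n : ℝ) - 1) * lam * (Real.cosh (lam * r) / (lam * hq lam r)) * χ r =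
        ((n : ℝ) - 1) * Real.cosh (lam * r) * (χ r / hq lam r) by field_simp,
        abs_mul, abs_mul, abs_of_nonneg (sub_nonneg.2 h4), abs_div, abs_of_pos h3]
      have h5 := hK' r ⟨hr.le, hrb⟩
      rw [Real.norm_eq_abs] at h5
      have h6 : |χ r| / hq lam r ≤ C := (div_le_iff₀ h3).2 (hC r hr)
      have h7 : 0 ≤ (n : ℝ) - 1 := sub_nonneg.2 h4
      have h8 : 0 ≤ K' := (abs_nonneg _).trans h5
      unfold hc at h5
      gcongr
    · unfold radialDiv
      simp [hχ0 r hr, hdχ0 r hr]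
  have hi2 : IntegrableOn (fun r => (hq lam r : ℂ) ^ (n - 1) * ((χ r : ℂ) * g r)) (Ioi 0) := by
    obtain ⟨K₂, hK₂⟩ := hχ.continuous.bounded_above_of_compact_support hsp
    refine hg.integrableOn_test hl (C := K₂) (b := b)
      (Complex.continuous_ofReal.comp hχ.continuous).aestronglyMeasurable (fun r _ _ => ?_)
      fun r hr => by simp [hχ0 r hr]
    rw [Complex.norm_real]
    exact hK₂ r
  have hprim := ((IsPrim.hq_pow hl (n - 1)).mul (IsPrim.ofReal_of_contDiff hχ)).mul h
  have hprim' : IsPrim (fun r => (hq lam r : ℂ) ^ (n - 1) * (χ r : ℂ) * f r)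
      (fun r => (hq lam r : ℂ) ^ (n - 1) * ((radialDiv n lam χ r : ℂ) * f r) +
        (hq lam r : ℂ) ^ (n - 1) * ((χ r : ℂ) * g r)) := by
    refine hprim.congr (fun _ _ => rfl) (Eventually.of_forall fun r hr => ?_)
    have h1 := hq_pow_mul_radialDiv hn hl χ hr
    have h2 : (hq lam r : ℂ) ^ (n - 1) * (radialDiv n lam χ r : ℂ) =
        (hq lam r : ℂ) ^ (n - 1) * ((deriv χ r : ℝ) : ℂ) +
        ((n - 1 : ℕ) : ℂ) * (hq lam r : ℂ) ^ (n - 1 - 1) * (hc lam r : ℂ) * (χ r : ℂ) := by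
      exact_mod_cast h1
    linear_combination (-f r) * h2
  have hB : IntegrableOn (fun r => (hq lam r : ℂ) ^ (n - 1) * ((χ r : ℂ) * f r)) (Ioi 0) := by
    obtain ⟨K₂, hK₂⟩ := hχ.continuous.bounded_above_of_compact_support hsp
    refine hf.integrableOn_test hl (C := K₂) (b := b)
      (Complex.continuous_ofReal.comp hχ.continuous).aestronglyMeasurable (fun r _ _ => ?_)
      fun r hr => by simp [hχ0 r hr]
    rw [Complex.norm_real]
    exact hK₂ r
  have hB0 : IntegrableOn (fun r => (hq lam r : ℂ) ^ (n - 1) *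
      (((χ r / hq lam r : ℝ) : ℂ) * f r)) (Ioi 0) := by
    refine hf.integrableOn_test hl (C := C) (b := b)
      (Complex.measurable_ofReal.comp
        (hχ.continuous.measurable.div continuous_hq.measurable)).aestronglyMeasurable
      (fun r hr _ => ?_) fun r hr => by simp [hχ0 r hr]
    rw [Complex.norm_real, Real.norm_eq_abs, abs_div, abs_of_pos (hq_pos hl hr)]
    exact (div_le_iff₀ (hq_pos hl hr)).2 (hC r hr)
  have key := hprim'.integral_Ioi_eq_zero hl hl1 (hi1.add hi2) ?_ ?_
  · rw [integral_add hi1 hi2] at key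
    rw [integral_radial hl, integral_radial hl]
    simp only [Complex.real_smul, Complex.ofReal_pow]
    exact eq_neg_of_add_eq_zero_left key
  · refine (hB0.mono_set Ioc_subset_Ioi_self).norm.congr
      ((ae_restrict_iff' measurableSet_Ioc).2 (Eventually.of_forall fun r hr => ?_))
    have := hq_pos hl hr.1
    simp only [norm_mul, norm_pow, Complex.norm_real, Real.norm_eq_abs, abs_div, abs_of_pos this]
    field_simp
  · refine (hB.mono_set (Ioi_subset_Ioi zero_le_one)).congr_fun (fun r _ => ?_) measurableSet_Ioi
    simp only
    ring

/-- Integrate the derivative of φ hq^n g. The field is hq g, but square integrability of g itself is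
needed as well: the boundary term at the origin, divided by hq, is hq^(n-1) φ g. -/
lemma isWeakRadialDiv_of_isPrim (hn : 2 ≤ n) (hl : 0 < lam) (hl1 : lam ≤ 1) {g h : ℝ → ℂ}
    (hp : IsPrim (fun r => (hq lam r : ℂ) ^ n * g r) (fun r => (hq lam r : ℂ) ^ (n - 1) * h r))
    (hg : MemLp g 2 (radialMeasure n lam))
    (hg' : MemLp (fun r => (hq lam r : ℂ) * g r) 2 (radialMeasure n lam))
    (hh : MemLp h 2 (radialMeasure n lam)) :
    IsWeakRadialDiv n lam (fun r => (hq lam r : ℂ) * g r) h := by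
  intro φ hφ hsp _
  obtain ⟨b, hb1, hb⟩ := exists_bound_of_test hsp
  obtain ⟨K, hK⟩ := (hφ.continuous_deriv (by simp)).bounded_above_of_compact_support hsp.deriv
  obtain ⟨K₂, hK₂⟩ := hφ.continuous.bounded_above_of_compact_support hsp
  have hφ0 : ∀ r, b < r → φ r = 0 := fun r hr => image_eq_zero_of_notMem_tsupport (hb r hr)
  have hdφ0 : ∀ r, b < r → deriv φ r = 0 := fun r hr =>
    image_eq_zero_of_notMem_tsupport fun h' => hb r hr (tsupport_deriv_subset h')
  have hφi : ∀ F : ℝ → ℂ, MemLp F 2 (radialMeasure n lam) →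
      IntegrableOn (fun r => (hq lam r : ℂ) ^ (n - 1) * ((φ r : ℂ) * F r)) (Ioi 0) := by
    intro F hF
    refine hF.integrableOn_test hl (C := K₂) (b := b)
      (Complex.continuous_ofReal.comp hφ.continuous).aestronglyMeasurable (fun r _ _ => ?_)
      fun r hr => by simp [hφ0 r hr]
    rw [Complex.norm_real]
    exact hK₂ r
  have hi1 : IntegrableOn (fun r => (hq lam r : ℂ) ^ (n - 1) *
      (((deriv φ r : ℝ) : ℂ) * ((hq lam r : ℂ) * g r))) (Ioi 0) := by
    refine hg'.integrableOn_test hl (C := K) (b := b)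
      (Complex.continuous_ofReal.comp (hφ.continuous_deriv (by simp))).aestronglyMeasurable
      (fun r _ _ => ?_) fun r hr => by simp [hdφ0 r hr]
    rw [Complex.norm_real]
    exact hK r
  have hi2 := hφi h hh
  have hpow : ∀ r : ℝ, (hq lam r : ℂ) ^ n = (hq lam r : ℂ) ^ (n - 1) * (hq lam r : ℂ) := by
    intro r
    rw [← pow_succ, Nat.sub_add_cancel (by omega)]
  have hprim : IsPrim (fun r => (φ r : ℂ) * ((hq lam r : ℂ) ^ n * g r))
      (fun r => (hq lam r : ℂ) ^ (n - 1) * (((deriv φ r : ℝ) : ℂ) * ((hq lam r : ℂ) * g r)) +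
        (hq lam r : ℂ) ^ (n - 1) * ((φ r : ℂ) * h r)) := by
    refine ((IsPrim.ofReal_of_contDiff hφ).mul hp).congr (fun _ _ => rfl)
      (Eventually.of_forall fun r _ => ?_)
    rw [hpow]
    ring
  have key := hprim.integral_Ioi_eq_zero hl hl1 (hi1.add hi2) ?_ ?_
  · rw [integral_add hi1 hi2] at key
    rw [integral_radial hl, integral_radial hl]
    simp only [Complex.real_smul, Complex.ofReal_pow]
    exact eq_neg_of_add_eq_zero_left key
  · refine ((hφi g hg).mono_set Ioc_subset_Ioi_self).norm.congr
      ((ae_restrict_iff' measurableSet_Ioc).2 (Eventually.of_forall fun r hr => ?_))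
    have := hq_pos hl hr.1
    simp only [hpow, norm_mul, norm_pow, Complex.norm_real, Real.norm_eq_abs, abs_of_pos this]
    field_simp
  · refine ((hφi _ hg').mono_set (Ioi_subset_Ioi zero_le_one)).congr_fun (fun r _ => ?_)
      measurableSet_Ioi
    simp only
    rw [hpow]
    ring

/-- A test function η supported away from 0 yields the odd field χ extending η/hq^(n-1). Its
weighted divergence is η', so the weak gradient becomes a weak derivative in one variable and
`exists_isPrim_of_weak` applies. -/
lemma IsWeakRadialGrad.exists_isPrim (hn : 2 ≤ n) (hl : 0 < lam) {f g : ℝ → ℂ}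
    (hf : MemLp f 2 (radialMeasure n lam)) (hg : MemLp g 2 (radialMeasure n lam))
    (h : IsWeakRadialGrad n lam f g) :
    ∃ F : ℝ → ℂ, f =ᵐ[radialMeasure n lam] F ∧ IsPrim F g := by
  suffices hw : ∀ η : ℝ → ℝ, ContDiff ℝ ∞ η → HasCompactSupport η → tsupport η ⊆ Ioi 0 →
      ∫ x in Ioi (0 : ℝ), ((deriv η x : ℝ) : ℂ) * f x =
        -∫ x in Ioi (0 : ℝ), (η x : ℂ) * g x by
    obtain ⟨F, hF1, hF2⟩ := exists_isPrim_of_weak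
      (fun x y hx hy => hf.intervalIntegrable_of_pos hl hx hy)
      (fun x y hx hy => hg.intervalIntegrable_of_pos hl hx hy) hw
    exact ⟨F, (ae_radial_iff' hl).2 hF1, hF2⟩
  intro η hη hsp hs
  obtain ⟨a, b, ha, hab, hs'⟩ := exists_tsupport_subset_Icc hsp hs
  have hη0 : ∀ x, x ∉ Icc a b → η x = 0 := fun x hx => eq_zero_of_tsupport_subset hs' hx
  set ξ : ℝ → ℝ := fun r => η r / hq lam r ^ (n - 1)
  have hξ : ContDiff ℝ ∞ ξ := by
    rw [contDiff_iff_contDiffAt]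
    intro x
    rcases lt_or_ge x a with hx | hx
    · have : ξ =ᶠ[𝓝 x] fun _ => 0 := by
        filter_upwards [Iio_mem_nhds hx] with y hy
        simp [ξ, hη0 y fun h' => absurd h'.1 (not_le.2 hy)]
      exact contDiffAt_const.congr_of_eventuallyEq this
    · exact hη.contDiffAt.div (contDiff_hq.contDiffAt.pow _)
        (pow_ne_zero _ (hq_ne_zero hl (ha.trans_le hx)))
  have hξ0 : ∀ x, x ∉ Icc a b → ξ x = 0 := fun x hx => by simp [ξ, hη0 x hx]
  set χ : ℝ → ℝ := fun r => ξ r - ξ (-r)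
  have hχ : ContDiff ℝ ∞ χ := hξ.sub (hξ.comp contDiff_neg)
  have hχpos : ∀ r, 0 < r → χ r = ξ r := fun r hr => by
    simp only [χ]
    rw [hξ0 (-r) fun h' => absurd h'.1 (by linarith), sub_zero]
  have hdχ : ∀ r, 0 < r → deriv χ r = deriv ξ r := by
    intro r hr
    refine Filter.EventuallyEq.deriv_eq ?_
    filter_upwards [Ioi_mem_nhds hr] with s hs using hχpos s hs
  have h1 := h χ hχ ?_ fun r => by simp [χ]
  · rw [integral_radial hl, integral_radial hl] at h1
    convert! h1 using 1
    · refine setIntegral_congr_fun measurableSet_Ioi fun r hr => ?_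
      have hr' : (0 : ℝ) < r := hr
      have h2 := hq_pow_mul_radialDiv hn hl χ hr'
      have h3 : HasDerivAt (fun s => hq lam s ^ (n - 1) * ξ s) _ r :=
        ((hasDerivAt_hq hl r).pow (n - 1)).mul (hξ.differentiable (by simp) r).hasDerivAt
      have h4 : HasDerivAt η (deriv η r) r := (hη.differentiable (by simp) r).hasDerivAt
      have h5 : (fun s => hq lam s ^ (n - 1) * ξ s) =ᶠ[𝓝 r] η := by
        filter_upwards [Ioi_mem_nhds hr'] with s hs
        have := hq_ne_zero hl hs
        simp only [ξ]
        field_simp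
      have h6 := (h3.congr_of_eventuallyEq h5.symm).unique h4
      have h7 : hq lam r ^ (n - 1) * radialDiv n lam χ r = deriv η r := by
        rw [h2, ← h6, hdχ r hr', hχpos r hr', Pi.pow_apply]
        ring
      simp only [Complex.real_smul]
      rw [← h7]
      push_cast
      ring
    · congr 1
      refine setIntegral_congr_fun measurableSet_Ioi fun r hr => ?_
      have hr' : (0 : ℝ) < r := hr
      have := hq_cast_ne_zero hl hr'
      simp only [Complex.real_smul, hχpos r hr', ξ]
      push_cast
      field_simp
  · refine HasCompactSupport.of_support_subset_isCompact (isCompact_Icc (a := -b) (b := b))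
      fun x hx => ?_
    by_contra hxs
    apply hx
    simp only [χ]
    rw [hξ0 x fun h' => hxs ⟨by linarith [h'.1], h'.2⟩,
      hξ0 (-x) fun h' => hxs ⟨by linarith [h'.2], by linarith [h'.1]⟩, sub_zero]

lemma isPrim_primitive_weight (hl : 0 < lam) {h : ℝ → ℂ}
    (hh : MemLp h 2 (radialMeasure n lam)) :
    IsPrim (fun x => ∫ t in (0 : ℝ)..x, (hq lam t : ℂ) ^ (n - 1) * h t)
      (fun t => (hq lam t : ℂ) ^ (n - 1) * h t) ∧
    Tendsto (fun x => ∫ t in (0 : ℝ)..x, (hq lam t : ℂ) ^ (n - 1) * h t) (𝓝[>] 0) (𝓝 0) := by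
  have hi : ∀ x, 0 ≤ x → IntervalIntegrable (fun t => (hq lam t : ℂ) ^ (n - 1) * h t)
      volume 0 x := fun x hx =>
    (intervalIntegrable_iff_integrableOn_Ioc_of_le hx).2 (hh.integrableOn_weight hl x)
  have hp : IsPrim (fun x => ∫ t in (0 : ℝ)..x, (hq lam t : ℂ) ^ (n - 1) * h t)
      (fun t => (hq lam t : ℂ) ^ (n - 1) * h t) := by
    intro x y hx hy
    have h1 := hi x hx.le
    have h2 := hi y hy.le
    refine ⟨h1.symm.trans h2, ?_⟩
    rw [intervalIntegral.integral_interval_sub_left h2 h1]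
  refine ⟨hp, ?_⟩
  have h1 := hp.tendsto_zero (hh.integrableOn_weight hl 1)
  simpa using h1

/-- Test functions with support away from 0 would determine the flux hq^(n-1) g only up to a
constant. Even test functions need not vanish at the origin, and this selects the primitive that
starts from 0, excluding a point source. -/
lemma IsWeakRadialDiv.ae_eq (hl : 0 < lam) {g h : ℝ → ℂ}
    (hg : MemLp g 2 (radialMeasure n lam)) (hh : MemLp h 2 (radialMeasure n lam))
    (hw : IsWeakRadialDiv n lam g h) :
    ∀ᵐ x, 0 < x → (hq lam x : ℂ) ^ (n - 1) * g x =
      ∫ t in (0 : ℝ)..x, (hq lam t : ℂ) ^ (n - 1) * h t := by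
  obtain ⟨hQ, hQ0⟩ := isPrim_primitive_weight hl hh
  set Q : ℝ → ℂ := fun x => ∫ t in (0 : ℝ)..x, (hq lam t : ℂ) ^ (n - 1) * h t
  have key : ∀ᵐ x, x ∈ Ioi (0 : ℝ) → (hq lam x : ℂ) ^ (n - 1) * g x - Q x = 0 := by
    have hgi : ∀ x y, 0 < x → 0 < y →
        IntervalIntegrable (fun x => (hq lam x : ℂ) ^ (n - 1) * g x) volume x y :=
      fun x y hx hy => (hg.intervalIntegrable_of_pos hl hx hy).continuousOn_mul
        ((Complex.continuous_ofReal.comp continuous_hq).pow _).continuousOn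
    have hQi : ∀ x y, 0 < x → 0 < y → IntervalIntegrable Q volume x y := fun x y hx hy =>
      (hQ.continuousOn.mono (uIcc_subset_Ioi_zero hx hy)).intervalIntegrable
    refine isOpen_Ioi.ae_eq_zero_of_integral_contDiff_smul_eq_zero ?_ ?_
    · intro x hx
      have hx' : (0 : ℝ) < x := hx
      refine ⟨Ioc (x / 2) (x + 1), mem_nhdsWithin_of_mem_nhds
        (Ioc_mem_nhds (by linarith) (by linarith)), ?_⟩
      exact (intervalIntegrable_iff_integrableOn_Ioc_of_le (by linarith)).1
        ((hgi _ _ (by linarith) (by linarith)).sub (hQi _ _ (by linarith) (by linarith)))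
    · intro ζ hζ hζc hζs
      obtain ⟨a, b, ha, hab, hs'⟩ := exists_tsupport_subset_Icc hζc hζs
      have hb : 0 < b := ha.trans hab
      have hζ0 : ∀ x, x ∉ Icc a b → ζ x = 0 := fun x hx => eq_zero_of_tsupport_subset hs' hx
      -- Starting the primitive beyond the support of ζ makes it vanish for large r; near the origin
      -- it is constant, in general not zero.
      obtain ⟨hΦ1, hΦ2⟩ := contDiff_primitive hζ (b + 1)
      set Φ : ℝ → ℝ := fun x => ∫ t in (b + 1)..x, ζ t
      have hΦb : ∀ x, b < x → Φ x = 0 := fun x hx =>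
        intervalIntegral.integral_zero_ae (Eventually.of_forall fun t ht =>
          hζ0 t fun h' => absurd h'.2 (not_le.2 (lt_of_le_of_lt' ht.1.le (by
            exact lt_min (by linarith) hx))))
      have hΦa : ∀ x, x ≤ 0 → Φ x = Φ 0 := by
        intro x hx
        have h1 : Φ x = Φ 0 + ∫ t in (0 : ℝ)..x, ζ t := by
          simp only [Φ]
          rw [intervalIntegral.integral_add_adjacent_intervals
            (hζ.continuous.intervalIntegrable _ _) (hζ.continuous.intervalIntegrable _ _)]
        rw [h1, intervalIntegral.integral_zero_ae (Eventually.of_forall fun t ht =>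
          hζ0 t fun h' => absurd h'.1 (not_le.2 (lt_of_le_of_lt ht.2 (by
            rw [max_eq_left hx]; exact ha)))), add_zero]
      -- As Φ is constant on the negative half-line, this is a smooth even function that agrees with
      -- Φ for x ≥ 0.
      set φ : ℝ → ℝ := fun x => Φ x + Φ (-x) - Φ 0
      have hφ : ContDiff ℝ ∞ φ := (hΦ1.add (hΦ1.comp contDiff_neg)).sub contDiff_const
      have hφpos : ∀ x, 0 ≤ x → φ x = Φ x := fun x hx => by
        simp only [φ]
        rw [hΦa (-x) (by linarith)]
        ring
      have hφeven : ∀ x, φ (-x) = φ x := fun x => by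
        simp only [φ, neg_neg]
        ring
      have hφc : HasCompactSupport φ := by
        refine HasCompactSupport.of_support_subset_isCompact (isCompact_Icc (a := -b) (b := b))
          fun x hx => ?_
        by_contra hxs
        apply hx
        rcases le_or_gt 0 x with h0 | h0
        · rw [hφpos x h0]
          exact hΦb x (not_le.1 fun h' => hxs ⟨by linarith, h'⟩)
        · rw [← hφeven, hφpos _ (by linarith)]
          exact hΦb _ (not_le.1 fun h' => hxs ⟨by linarith, by linarith⟩)
      have hdφ : ∀ x, 0 < x → deriv φ x = ζ x := by
        intro x hx
        refine HasDerivAt.deriv ?_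
        refine (hΦ2 x).congr_of_eventuallyEq ?_
        filter_upwards [Ioi_mem_nhds hx] with s hs using hφpos s (le_of_lt hs)
      have h1 := hw φ hφ hφc hφeven
      rw [integral_radial hl, integral_radial hl] at h1
      simp only [Complex.real_smul, Complex.ofReal_pow] at h1
      have h2 : ∫ x in Ioi (0 : ℝ), (ζ x : ℂ) * ((hq lam x : ℂ) ^ (n - 1) * g x) =
          -∫ x in Ioi (0 : ℝ), (hq lam x : ℂ) ^ (n - 1) * ((Φ x : ℂ) * h x) := by
        convert! h1 using 1
        · refine setIntegral_congr_fun measurableSet_Ioi fun x hx => ?_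
          simp only [hdφ x hx]
          ring
        · congr 1
          refine setIntegral_congr_fun measurableSet_Ioi fun x hx => ?_
          simp only [hφpos x (le_of_lt hx)]
      have hI : ∀ F : ℝ → ℂ, IntervalIntegrable F volume a b →
          Integrable (fun x => (ζ x : ℂ) * F x) := by
        intro F hF
        have h2 : IntegrableOn (fun x => (ζ x : ℂ) * F x) (Icc a b) := by
          rw [integrableOn_Icc_iff_integrableOn_Ioc]
          exact (intervalIntegrable_iff_integrableOn_Ioc_of_le hab.le).1
            (hF.continuousOn_mul (Complex.continuous_ofReal.comp hζ.continuous).continuousOn)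
        exact (integrableOn_iff_integrable_of_support_subset fun x hx => by
          by_contra hxs
          exact hx (by simp [hζ0 x hxs])).1 h2
      have hi1 := hI _ (hgi a b ha hb)
      have hi2 := hI _ (hQi a b ha hb)
      obtain ⟨K, hK⟩ := isCompact_Icc.exists_bound_of_continuousOn hΦ1.continuous.continuousOn
        (s := Icc 0 b)
      have hi3 : IntegrableOn (fun x => (hq lam x : ℂ) ^ (n - 1) * ((Φ x : ℂ) * h x)) (Ioi 0) :=
        hh.integrableOn_test hl (C := K) (b := b)
          (Complex.continuous_ofReal.comp hΦ1.continuous).aestronglyMeasurable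
          (fun r hr hrb => by rw [Complex.norm_real]; exact hK r ⟨hr.le, hrb⟩)
          fun r hr => by simp [hΦb r hr]
      have h3 : IsPrim (fun x => (Φ x : ℂ) * Q x)
          (fun x => (ζ x : ℂ) * Q x + (hq lam x : ℂ) ^ (n - 1) * ((Φ x : ℂ) * h x)) := by
        refine ((IsPrim.ofReal_of_contDiff hΦ1).mul hQ).congr (fun _ _ => rfl)
          (Eventually.of_forall fun x _ => ?_)
        simp only [(hΦ2 x).deriv]
        ring
      have h4 := h3.integral_Ioi (hi2.integrableOn.add hi3) (l := 0) (m := 0) ?_ ?_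
      · rw [integral_add hi2.integrableOn hi3, sub_zero] at h4
        have hz : ∀ F : ℝ → ℂ, ∫ x in Ioi (0 : ℝ), (ζ x : ℂ) * F x = ∫ x, (ζ x : ℂ) * F x := by
          intro F
          refine setIntegral_eq_integral_of_forall_compl_eq_zero fun x hx => ?_
          rw [hζ0 x fun h' => hx (ha.trans_le h'.1)]
          simp
        rw [hz] at h2 h4
        simp only [smul_sub, Complex.real_smul]
        rw [integral_sub hi1 hi2, h2]
        linear_combination -h4
      · have h5 : Tendsto (fun x => (Φ x : ℂ)) (𝓝[>] 0) (𝓝 (Φ 0)) :=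
          ((Complex.continuous_ofReal.comp hΦ1.continuous).tendsto 0).mono_left nhdsWithin_le_nhds
        simpa using h5.mul hQ0
      · refine tendsto_const_nhds.congr' ?_
        filter_upwards [Ioi_mem_atTop b] with x hx
        simp [hΦb x hx]
  filter_upwards [key] with x hx hx0
  exact sub_eq_zero.1 (hx hx0)

end Weak

/-! ### Truncated integrals and Hardy's inequality. -/

section Integral

variable {n : ℕ} {lam : ℝ}

/-- Monotone convergence along the intervals (1/(k+1), k+1]. It allows one to integrate by parts on
compact intervals before anything is known to be integrable. -/
lemma integrableOn_Ioi_of_integral_Ioc_le {F : ℝ → ℝ} {I : ℝ}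
    (hF : ∀ a b, 0 < a → a ≤ b → IntegrableOn F (Ioc a b)) (h0 : ∀ r, 0 < r → 0 ≤ F r)
    (hI : ∀ a b, 0 < a → a ≤ 1 → 1 ≤ b → ∫ r in Ioc a b, F r ≤ I) :
    IntegrableOn F (Ioi 0) ∧ ∫ r in Ioi (0 : ℝ), F r ≤ I := by
  set φ : ℕ → Set ℝ := fun k => Ioc (1 / ((k : ℝ) + 1)) (k + 1)
  have hφpos : ∀ k : ℕ, (0 : ℝ) < 1 / ((k : ℝ) + 1) := fun k => by positivity
  have hφ1 : ∀ k : ℕ, 1 / ((k : ℝ) + 1) ≤ 1 := fun k => by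
    rw [div_le_one (by positivity)]
    linarith [(Nat.cast_nonneg k : (0 : ℝ) ≤ k)]
  have hφ2 : ∀ k : ℕ, (1 : ℝ) ≤ k + 1 := fun k => by
    linarith [(Nat.cast_nonneg k : (0 : ℝ) ≤ k)]
  have hsub : ∀ k, φ k ⊆ Ioi 0 := fun k x hx => (hφpos k).trans hx.1
  have hcov : AECover (volume.restrict (Ioi (0 : ℝ))) atTop φ := by
    refine ⟨(ae_restrict_iff' measurableSet_Ioi).2 (Eventually.of_forall fun x hx => ?_),
      fun k => measurableSet_Ioc⟩
    have h1 : ∀ᶠ k : ℕ in atTop, 1 / ((k : ℝ) + 1) < x :=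
      (tendsto_order.1 tendsto_one_div_add_atTop_nhds_zero_nat).2 x hx
    have h2 : ∀ᶠ k : ℕ in atTop, x ≤ (k : ℝ) :=
      tendsto_natCast_atTop_atTop.eventually_ge_atTop x
    filter_upwards [h1, h2] with k hk1 hk2
    exact ⟨hk1, by linarith⟩
  have hres : ∀ k, (volume.restrict (Ioi (0 : ℝ))).restrict (φ k) = volume.restrict (φ k) :=
    fun k => Measure.restrict_restrict_of_subset (hsub k)
  have hi : Integrable F (volume.restrict (Ioi (0 : ℝ))) := by
    refine hcov.integrable_of_integral_bounded_of_nonneg_ae I (fun k => ?_)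
      ((ae_restrict_iff' measurableSet_Ioi).2 (Eventually.of_forall h0))
      (Eventually.of_forall fun k => ?_)
    · rw [IntegrableOn, hres]
      exact hF _ _ (hφpos k) ((hφ1 k).trans (hφ2 k))
    · rw [hres]
      exact hI _ _ (hφpos k) (hφ1 k) (hφ2 k)
  refine ⟨hi, le_of_tendsto' (hcov.integral_tendsto_of_countably_generated hi) fun k => ?_⟩
  rw [hres]
  exact hI _ _ (hφpos k) (hφ1 k) (hφ2 k)

/-- Write B(r) = B(s) − ∫_r^s b and average over s in [r, r + 1]. -/
lemma IsPrim.norm_le_of_one_le {B b : ℝ → ℂ} (h : IsPrim B b) (hB : IntegrableOn B (Ioi 1))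
    (hb : IntegrableOn b (Ioi 1)) {r : ℝ} (hr : 1 ≤ r) :
    ‖B r‖ ≤ (∫ s in Ioi (1 : ℝ), ‖B s‖) + ∫ s in Ioi (1 : ℝ), ‖b s‖ := by
  have hr0 : 0 < r := one_pos.trans_le hr
  have h1 : ∀ s ∈ Icc r (r + 1), ‖B r‖ ≤ ‖B s‖ + ∫ s in Ioi (1 : ℝ), ‖b s‖ := by
    intro s hs
    have h2 := h.integral_eq hr0 (hr0.trans_le hs.1)
    have h3 : ‖∫ t in r..s, b t‖ ≤ ∫ t in Ioi (1 : ℝ), ‖b t‖ := by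
      rw [intervalIntegral.integral_of_le hs.1]
      refine (norm_integral_le_integral_norm _).trans ?_
      exact setIntegral_mono_set hb.norm (Eventually.of_forall fun _ => norm_nonneg _)
        (LE.le.eventuallyLE fun t ht => lt_of_le_of_lt hr ht.1)
    have h4 : B r = B s - ∫ t in r..s, b t := by rw [h2]; ring
    rw [h4]
    exact (norm_sub_le _ _).trans (by gcongr)
  have hBi : IntervalIntegrable (fun s => ‖B s‖) volume r (r + 1) :=
    ((h.continuousOn.mono (uIcc_subset_Ioi_zero hr0 (by linarith))).norm).intervalIntegrable
  have h5 : ∫ s in r..(r + 1), ‖B r‖ ≤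
      ∫ s in r..(r + 1), (‖B s‖ + ∫ s in Ioi (1 : ℝ), ‖b s‖) :=
    intervalIntegral.integral_mono_on (by linarith) (by simp)
      (hBi.add (by simp)) h1
  rw [intervalIntegral.integral_add hBi (by simp)] at h5
  simp only [intervalIntegral.integral_const, add_sub_cancel_left, one_smul] at h5
  refine h5.trans (add_le_add ?_ le_rfl)
  rw [intervalIntegral.integral_of_le (by linarith)]
  exact setIntegral_mono_set hB.norm (Eventually.of_forall fun _ => norm_nonneg _)
    (LE.le.eventuallyLE fun t ht => lt_of_le_of_lt hr ht.1)

lemma IsPrim.aestronglyMeasurable {B b : ℝ → ℂ} (h : IsPrim B b) :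
    AEStronglyMeasurable b (volume.restrict (Ioi 0)) := by
  have : LocallyIntegrableOn b (Ioi 0) := by
    intro x hx
    have hx' : (0 : ℝ) < x := hx
    refine ⟨Ioc (x / 2) (x + 1), mem_nhdsWithin_of_mem_nhds
      (Ioc_mem_nhds (by linarith) (by linarith)), ?_⟩
    exact (intervalIntegrable_iff_integrableOn_Ioc_of_le (by linarith)).1
      (h.intervalIntegrable (by linarith) (by linarith))
  exact this.aestronglyMeasurable

/-- `g` is the derivative of `f` with respect to `cosh (lam r) / lam ^ 2`. -/
def IsD (lam : ℝ) (f g : ℝ → ℂ) : Prop := IsPrim f (fun r => (hq lam r : ℂ) * g r)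

lemma ofReal_re_mul_conj (z w : ℂ) :
    w * (starRingEnd ℂ) z + z * (starRingEnd ℂ) w = ((2 * (w * (starRingEnd ℂ) z).re : ℝ) : ℂ) := by
  have h : z * (starRingEnd ℂ) w = (starRingEnd ℂ) (w * (starRingEnd ℂ) z) := by
    rw [map_mul, Complex.conj_conj, mul_comm]
  rw [h, Complex.add_conj]

lemma abs_re_mul_conj_le (z w : ℂ) : |(w * (starRingEnd ℂ) z).re| ≤ ‖w‖ * ‖z‖ := by
  refine (Complex.abs_re_le_norm _).trans ?_
  rw [norm_mul, RCLike.norm_conj]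

lemma IsD.normSq {f g : ℝ → ℂ} (h : IsD lam f g) :
    IsPrim (fun r => ((‖f r‖ ^ 2 : ℝ) : ℂ))
      (fun r => ((2 * hq lam r * (g r * (starRingEnd ℂ) (f r)).re : ℝ) : ℂ)) := by
  refine (IsPrim.mul h (IsPrim.star h)).congr (fun r _ => ?_)
    (Eventually.of_forall fun r _ => ?_)
  · rw [Complex.mul_conj, Complex.normSq_eq_norm_sq]
  · have := ofReal_re_mul_conj (f r) (g r)
    simp only [map_mul, Complex.conj_ofReal]
    push_cast at this ⊢
    linear_combination (hq lam r : ℂ) * this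

lemma radialSq_hq_mul (hl : 0 < lam) (j : ℕ) (f : ℝ → ℂ) :
    radialSq n lam (fun r => (hq lam r : ℂ) ^ j * f r) =
      ∫ r in Ioi (0 : ℝ), hq lam r ^ (n - 1) * (hq lam r ^ (2 * j) * ‖f r‖ ^ 2) := by
  rw [radialSq_eq hl]
  refine setIntegral_congr_fun measurableSet_Ioi fun r hr => ?_
  have := hq_pos hl hr
  simp only [norm_mul, norm_pow, Complex.norm_real, Real.norm_eq_abs, abs_of_pos this]
  ring

lemma integrableOn_hq_mul (hl : 0 < lam) (j : ℕ) {f : ℝ → ℂ}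
    (hf : MemLp (fun r => (hq lam r : ℂ) ^ j * f r) 2 (radialMeasure n lam)) :
    IntegrableOn (fun r => hq lam r ^ (n - 1) * (hq lam r ^ (2 * j) * ‖f r‖ ^ 2)) (Ioi 0) := by
  refine ((memLp_radial_iff hl).1 hf).2.congr_fun (fun r hr => ?_) measurableSet_Ioi
  have := hq_pos hl hr
  simp only [norm_mul, norm_pow, Complex.norm_real, Real.norm_eq_abs, abs_of_pos this]
  ring

lemma IsPrim.re {u v : ℝ → ℝ} (h : IsPrim (fun r => (u r : ℂ)) (fun r => (v r : ℂ))) {a b : ℝ}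
    (ha : 0 < a) (hb : 0 < b) :
    IntervalIntegrable v volume a b ∧ ∫ r in a..b, v r = u b - u a := by
  have h1 := h.intervalIntegrable ha hb
  have h2 := h.integral_eq ha hb
  refine ⟨?_, ?_⟩
  · rw [intervalIntegrable_iff] at h1 ⊢
    exact h1.re
  · rw [intervalIntegral.integral_ofReal] at h2
    exact_mod_cast h2

/-- Hardy's inequality. -/
lemma IsD.hardy (hn : 2 ≤ n) (hl : 0 < lam) (hl1 : lam ≤ 1) {g g1 : ℝ → ℂ} (h : IsD lam g g1)
    (hg : MemLp (fun r => (hq lam r : ℂ) ^ 1 * g r) 2 (radialMeasure n lam))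
    (hg1 : MemLp (fun r => (hq lam r : ℂ) ^ 2 * g1 r) 2 (radialMeasure n lam)) :
    MemLp g 2 (radialMeasure n lam) ∧ radialSq n lam g ≤ (2 * n + 3) *
      (radialSq n lam (fun r => (hq lam r : ℂ) ^ 1 * g r) +
        radialSq n lam (fun r => (hq lam r : ℂ) ^ 2 * g1 r)) := by
  set S0 := radialSq n lam (fun r => (hq lam r : ℂ) ^ 1 * g r)
  set S1 := radialSq n lam (fun r => (hq lam r : ℂ) ^ 2 * g1 r)
  have hS0 : 0 ≤ S0 := radialSq_nonneg _
  have hS1 : 0 ≤ S1 := radialSq_nonneg _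
  have e0 : S0 = _ := radialSq_hq_mul hl 1 g
  have e1 : S1 = _ := radialSq_hq_mul hl 2 g1
  have i0 := integrableOn_hq_mul hl 1 hg
  have i1 := integrableOn_hq_mul hl 2 hg1
  -- Here u' = v. As n ≥ 2 and hc ≥ 1, the first term of v is at least 2 hq^(n-1)|g|²; one half of
  -- it absorbs the cross term at the cost of hq^(n+3)|g1|², the other half is the quantity to be
  -- bounded. The value u(a) at the lower end has the good sign, so only u(b) has to be estimated.
  set u : ℝ → ℝ := fun r => hq lam r ^ n * ‖g r‖ ^ 2
  set v : ℝ → ℝ := fun r => hq lam r ^ (n - 1) * (n * hc lam r * ‖g r‖ ^ 2 +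
    2 * hq lam r ^ 2 * (g1 r * (starRingEnd ℂ) (g r)).re)
  have hpow : ∀ r : ℝ, hq lam r ^ n = hq lam r ^ (n - 1) * hq lam r := fun r => by
    rw [← pow_succ, Nat.sub_add_cancel (by omega)]
  have hB : IsPrim (fun r => (u r : ℂ)) (fun r => (v r : ℂ)) := by
    refine ((IsPrim.hq_pow hl n).mul h.normSq).congr (fun r _ => by simp [u])
      (Eventually.of_forall fun r _ => ?_)
    simp only [v]
    have := hpow r
    have h2 : (hq lam r : ℂ) ^ n = (hq lam r : ℂ) ^ (n - 1) * (hq lam r : ℂ) := by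
      exact_mod_cast this
    rw [h2]
    push_cast
    ring
  have hab : ∀ r, 2 * hq lam r ^ 2 * |(g1 r * (starRingEnd ℂ) (g r)).re| ≤
      2 * hq lam r ^ 2 * (‖g1 r‖ * ‖g r‖) := fun r => by
    have := abs_re_mul_conj_le (g r) (g1 r)
    gcongr
  -- the boundary term at infinity
  have hbound : ∀ r, 1 ≤ r → u r ≤ (2 * n + 2) * (S0 + S1) := by
    have hu : ∀ r, 1 ≤ r → u r ≤ hq lam r ^ (n - 1) * (hq lam r ^ (2 * 1) * ‖g r‖ ^ 2) := by
      intro r hr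
      have hq1 : 1 ≤ hq lam r := hr.trans (le_hq hl (by linarith))
      simp only [u, hpow]
      rw [mul_assoc]
      have : hq lam r ≤ hq lam r ^ (2 * 1) := by
        rw [mul_one]
        nlinarith
      have := hq_pos hl (show 0 < r by linarith)
      gcongr
    have hv : ∀ r, 1 ≤ r → |v r| ≤
        (2 * n + 1) * (hq lam r ^ (n - 1) * (hq lam r ^ (2 * 1) * ‖g r‖ ^ 2)) +
          hq lam r ^ (n - 1) * (hq lam r ^ (2 * 2) * ‖g1 r‖ ^ 2) := by
      intro r hr
      have hr0 : 0 < r := by linarith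
      have hq1 : 1 ≤ hq lam r := hr.trans (le_hq hl hr0.le)
      have hqp : 0 < hq lam r ^ (n - 1) := pow_pos (hq_pos hl hr0) _
      have hcq := hc_le hl hl1 hr0
      have hcp := hc_pos (lam := lam) r
      simp only [v, abs_mul, abs_of_pos hqp]
      have h3 : |n * hc lam r * ‖g r‖ ^ 2 + 2 * hq lam r ^ 2 * (g1 r * (starRingEnd ℂ) (g r)).re| ≤
          (2 * n + 1) * (hq lam r ^ 2 * ‖g r‖ ^ 2) + hq lam r ^ 4 * ‖g1 r‖ ^ 2 := by
        refine (abs_add_le _ _).trans ?_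
        rw [abs_of_nonneg (by positivity), abs_mul, abs_of_nonneg (by positivity : (0:ℝ) ≤
          2 * hq lam r ^ 2)]
        have h4 := hab r
        have h5 : 2 * hq lam r ^ 2 * (‖g1 r‖ * ‖g r‖) ≤
            hq lam r ^ 2 * ‖g r‖ ^ 2 + hq lam r ^ 4 * ‖g1 r‖ ^ 2 := by
          have h6 : hq lam r ^ 2 * ‖g1 r‖ ^ 2 ≤ hq lam r ^ 4 * ‖g1 r‖ ^ 2 := by
            gcongr
            · norm_num
          nlinarith [mul_nonneg (sq_nonneg (hq lam r)) (sq_nonneg (‖g1 r‖ - ‖g r‖))]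
        have h7 : hc lam r ≤ 2 * hq lam r ^ 2 := by nlinarith
        have h8 : n * hc lam r * ‖g r‖ ^ 2 ≤ n * (2 * hq lam r ^ 2) * ‖g r‖ ^ 2 := by gcongr
        nlinarith
      calc _ ≤ hq lam r ^ (n - 1) * ((2 * n + 1) * (hq lam r ^ 2 * ‖g r‖ ^ 2) +
            hq lam r ^ 4 * ‖g1 r‖ ^ 2) := by gcongr
        _ = _ := by ring
    have i0' := i0.mono_set (Ioi_subset_Ioi (zero_le_one' ℝ))
    have i1' := i1.mono_set (Ioi_subset_Ioi (zero_le_one' ℝ))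
    have hupos : ∀ r, 1 ≤ r → 0 ≤ u r := fun r hr => by
      have := hq_pos hl (show 0 < r by linarith)
      positivity
    have hBi : IntegrableOn (fun r => (u r : ℂ)) (Ioi 1) := by
      refine Integrable.mono' i0' ((hB.continuousOn.mono
        (Ioi_subset_Ioi zero_le_one)).aestronglyMeasurable measurableSet_Ioi)
        ((ae_restrict_iff' measurableSet_Ioi).2 (Eventually.of_forall fun r hr => ?_))
      rw [Complex.norm_real, Real.norm_eq_abs, abs_of_nonneg (hupos r (le_of_lt hr))]
      exact hu r (le_of_lt hr)
    have hbi : IntegrableOn (fun r => (v r : ℂ)) (Ioi 1) := by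
      refine Integrable.mono' ((i0'.const_mul (2 * (n : ℝ) + 1)).add i1')
        (hB.aestronglyMeasurable.mono_measure (Measure.restrict_mono
          (Ioi_subset_Ioi zero_le_one) le_rfl))
        ((ae_restrict_iff' measurableSet_Ioi).2 (Eventually.of_forall fun r hr => ?_))
      rw [Complex.norm_real, Real.norm_eq_abs]
      exact hv r (le_of_lt hr)
    have hpos : ∀ (j : ℕ) (w : ℝ → ℂ), ∀ r ∈ Ioi (0 : ℝ), 0 ≤ hq lam r ^ (n - 1) *
        (hq lam r ^ (2 * j) * ‖w r‖ ^ 2) := fun j w r hr => by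
      have := hq_pos hl hr
      positivity
    have j0 : ∫ r in Ioi (1 : ℝ), hq lam r ^ (n - 1) * (hq lam r ^ (2 * 1) * ‖g r‖ ^ 2) ≤ S0 := by
      rw [e0]
      exact setIntegral_mono_set i0 ((ae_restrict_iff' measurableSet_Ioi).2
        (Eventually.of_forall (hpos 1 g)))
        (LE.le.eventuallyLE (Ioi_subset_Ioi zero_le_one))
    have j1 : ∫ r in Ioi (1 : ℝ), hq lam r ^ (n - 1) * (hq lam r ^ (2 * 2) * ‖g1 r‖ ^ 2) ≤ S1 := by
      rw [e1]
      exact setIntegral_mono_set i1 ((ae_restrict_iff' measurableSet_Ioi).2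
        (Eventually.of_forall (hpos 2 g1)))
        (LE.le.eventuallyLE (Ioi_subset_Ioi zero_le_one))
    intro r hr
    have h9 := hB.norm_le_of_one_le hBi hbi hr
    simp only [Complex.norm_real, Real.norm_eq_abs] at h9
    rw [abs_of_nonneg (hupos r hr)] at h9
    have h10 : ∫ r in Ioi (1 : ℝ), |u r| ≤ S0 := by
      refine le_trans (setIntegral_mono_on ?_ i0' measurableSet_Ioi fun r hr => ?_) j0
      · simpa [IntegrableOn] using hBi.norm
      · rw [abs_of_nonneg (hupos r (le_of_lt hr))]
        exact hu r (le_of_lt hr)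
    have h11 : ∫ r in Ioi (1 : ℝ), |v r| ≤ (2 * n + 1) * S0 + S1 := by
      refine le_trans (setIntegral_mono_on ?_ ((i0'.const_mul (2 * (n : ℝ) + 1)).add i1')
        measurableSet_Ioi fun r hr => hv r (le_of_lt hr)) ?_
      · simpa [IntegrableOn] using hbi.norm
      · simp only [Pi.add_apply]
        rw [integral_add (i0'.const_mul _) i1', integral_const_mul]
        gcongr
    have hnn : (0 : ℝ) ≤ n := Nat.cast_nonneg n
    nlinarith [mul_nonneg hnn hS0, mul_nonneg hnn hS1]
  -- the integrated inequality
  have hgc : ContinuousOn g (Ioi 0) := IsPrim.continuousOn h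
  have hFc : ContinuousOn (fun r => hq lam r ^ (n - 1) * ‖g r‖ ^ 2) (Ioi 0) :=
    (continuous_hq.pow _).continuousOn.mul (hgc.norm.pow 2)
  have hn1 : (2 : ℝ) ≤ n := by exact_mod_cast hn
  obtain ⟨k1, k2⟩ := integrableOn_Ioi_of_integral_Ioc_le
    (F := fun r => hq lam r ^ (n - 1) * ‖g r‖ ^ 2) (I := (2 * n + 3) * (S0 + S1))
    (fun a b ha hab => (hFc.mono fun x hx => ha.trans_le hx.1).integrableOn_Icc.mono_set
      Ioc_subset_Icc_self)
    (fun r hr => by have := hq_pos hl hr; positivity) (fun a b ha ha1 hb1 => by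
      have hb : 0 < b := by linarith
      have hab' : a ≤ b := by linarith
      obtain ⟨m1, m2⟩ := hB.re ha hb
      have hpt : ∀ r ∈ Ioc a b, hq lam r ^ (n - 1) * ‖g r‖ ^ 2 ≤
          v r + hq lam r ^ (n - 1) * (hq lam r ^ (2 * 2) * ‖g1 r‖ ^ 2) := by
        intro r hr
        have hr0 : 0 < r := ha.trans hr.1
        have hqp : 0 < hq lam r ^ (n - 1) := pow_pos (hq_pos hl hr0) _
        have h3 : ‖g r‖ ^ 2 ≤ (n * hc lam r * ‖g r‖ ^ 2 +
            2 * hq lam r ^ 2 * (g1 r * (starRingEnd ℂ) (g r)).re) +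
            hq lam r ^ 4 * ‖g1 r‖ ^ 2 := by
          have h4 := hab r
          have h5 := neg_abs_le (g1 r * (starRingEnd ℂ) (g r)).re
          have h6 : 2 * ‖g r‖ ^ 2 ≤ n * hc lam r * ‖g r‖ ^ 2 := by
            have := one_le_hc (lam := lam) r
            gcongr
            nlinarith
          have h7 : 2 * hq lam r ^ 2 * (-|(g1 r * (starRingEnd ℂ) (g r)).re|) ≤
              2 * hq lam r ^ 2 * (g1 r * (starRingEnd ℂ) (g r)).re := by gcongr
          nlinarith [sq_nonneg (hq lam r ^ 2 * ‖g1 r‖ - ‖g r‖)]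
        calc _ ≤ hq lam r ^ (n - 1) * ((n * hc lam r * ‖g r‖ ^ 2 +
            2 * hq lam r ^ 2 * (g1 r * (starRingEnd ℂ) (g r)).re) +
            hq lam r ^ 4 * ‖g1 r‖ ^ 2) := by gcongr
          _ = _ := by simp only [v]; ring
      have hvi : IntegrableOn v (Ioc a b) :=
        (intervalIntegrable_iff_integrableOn_Ioc_of_le hab').1 m1
      have hsub : Ioc a b ⊆ Ioi 0 := fun x hx => ha.trans hx.1
      have j1 : ∫ r in Ioc a b, hq lam r ^ (n - 1) * (hq lam r ^ (2 * 2) * ‖g1 r‖ ^ 2) ≤ S1 := by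
        rw [e1]
        refine setIntegral_mono_set i1 ((ae_restrict_iff' measurableSet_Ioi).2
          (Eventually.of_forall fun r hr => ?_)) (LE.le.eventuallyLE hsub)
        have := hq_pos hl hr
        simp only [Pi.zero_apply]
        positivity
      have h12 := setIntegral_mono_on ((hFc.mono fun x hx =>
        ha.trans_le hx.1).integrableOn_Icc.mono_set Ioc_subset_Icc_self)
        (hvi.add (i1.mono_set hsub)) measurableSet_Ioc hpt
      simp only [Pi.add_apply] at h12
      rw [integral_add hvi (i1.mono_set hsub), ← intervalIntegral.integral_of_le hab' (f := v), m2] at h12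
      have h13 := hbound b hb1
      have h14 : 0 ≤ u a := by
        have := hq_pos hl ha
        positivity
      refine h12.trans ?_
      linarith)
  refine ⟨(memLp_radial_iff hl).2 ⟨hgc.aestronglyMeasurable measurableSet_Ioi, k1⟩, ?_⟩
  rw [radialSq_eq hl]
  exact k2

end Integral

/-! ### Control of second derivatives by the Laplacian, and Green's formula. -/

section Regularity

variable {n : ℕ} {lam : ℝ}

lemma hq_pow_eq (hn : 1 ≤ n) (r : ℝ) : hq lam r ^ n = hq lam r ^ (n - 1) * hq lam r := by
  rw [← pow_succ, Nat.sub_add_cancel hn]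

lemma hq_cast_pow_eq (hn : 1 ≤ n) (r : ℝ) :
    (hq lam r : ℂ) ^ n = (hq lam r : ℂ) ^ (n - 1) * (hq lam r : ℂ) := by
  rw [← pow_succ, Nat.sub_add_cancel hn]

lemma integral_hq_pow_le (hn : 1 ≤ n) (hl : 0 < lam) {a : ℝ} (ha : 0 ≤ a) :
    ∫ t in (0 : ℝ)..a, hq lam t ^ (n - 1) ≤ hq lam a ^ n := by
  have h1 : ∫ t in (0 : ℝ)..a, (n * hq lam t ^ (n - 1) * hc lam t) = hq lam a ^ n - hq lam 0 ^ n :=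
    intervalIntegral.integral_eq_sub_of_hasDerivAt (fun t _ => (hasDerivAt_hq hl t).pow n)
      (by
        have h1 := continuous_hq (lam := lam)
        have h2 := continuous_hc (lam := lam)
        exact Continuous.intervalIntegrable (by fun_prop) _ _)
  rw [hq_zero, zero_pow (by omega), sub_zero] at h1
  rw [← h1]
  refine intervalIntegral.integral_mono_on ha ((continuous_hq.pow _).intervalIntegrable _ _)
    (by
        have h1 := continuous_hq (lam := lam)
        have h2 := continuous_hc (lam := lam)
        exact Continuous.intervalIntegrable (by fun_prop) _ _) fun t ht => ?_
  have h2 := one_le_hc (lam := lam) t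
  have h3 : (1 : ℝ) ≤ n := by exact_mod_cast hn
  have h4 : 0 ≤ hq lam t ^ (n - 1) := pow_nonneg (ht.1.trans (le_hq hl ht.1)) _
  nlinarith [mul_nonneg h4 (sub_nonneg.2 h2), mul_nonneg (mul_nonneg h4 (sub_nonneg.2 h2))
    (sub_nonneg.2 h3), mul_nonneg h4 (sub_nonneg.2 h3)]

/-- A radial vector field with `L²` divergence vanishes at the origin at the natural rate. -/
lemma norm_sq_le_of_div (hn : 1 ≤ n) (hl : 0 < lam) {g h : ℝ → ℂ}
    (hp : IsPrim (fun r => (hq lam r : ℂ) ^ n * g r) (fun r => (hq lam r : ℂ) ^ (n - 1) * h r))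
    (h0 : Tendsto (fun r => (hq lam r : ℂ) ^ n * g r) (𝓝[>] 0) (𝓝 0))
    (hh : MemLp h 2 (radialMeasure n lam)) {a : ℝ} (ha : 0 < a) :
    hq lam a ^ n * ‖g a‖ ^ 2 ≤ (radialSq n lam h + 1) ^ 2 := by
  obtain ⟨hQ, hQ0⟩ := isPrim_primitive_weight hl hh
  set R := radialSq n lam h
  have hR : 0 ≤ R := radialSq_nonneg h
  have hga : (hq lam a : ℂ) ^ n * g a = ∫ t in (0 : ℝ)..a, (hq lam t : ℂ) ^ (n - 1) * h t := by
    have h1 := hp.tendsto_zero (hh.integrableOn_weight hl 1)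
    have h2 := tendsto_nhds_unique h0 h1
    have h3 := hp.integral_eq one_pos ha
    have hi : ∀ x, 0 ≤ x → IntervalIntegrable (fun t => (hq lam t : ℂ) ^ (n - 1) * h t)
        volume 0 x := fun x hx =>
      (intervalIntegrable_iff_integrableOn_Ioc_of_le hx).2 (hh.integrableOn_weight hl x)
    rw [← intervalIntegral.integral_add_adjacent_intervals (hi 1 zero_le_one)
      ((hi 1 zero_le_one).symm.trans (hi a ha.le)), h3]
    linear_combination -h2
  have hqa := hq_pos hl ha
  -- Weight for the inequality |h| ≤ s|h|² + 1/s, chosen so that both integrals contribute multiples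
  -- of s.
  set s := Real.sqrt (hq lam a ^ n)
  have hs : 0 < s := Real.sqrt_pos.2 (pow_pos hqa n)
  have hs2 : s ^ 2 = hq lam a ^ n := Real.sq_sqrt (pow_nonneg hqa.le n)
  have h2i := ((memLp_radial_iff hl).1 hh).2
  have hsub : Ioc 0 a ⊆ Ioi (0 : ℝ) := Ioc_subset_Ioi_self
  have hw : IntegrableOn (fun t => hq lam t ^ (n - 1)) (Ioc 0 a) :=
    ((continuous_hq.pow _).integrableOn_Icc).mono_set Ioc_subset_Icc_self
  have h1 : ‖(hq lam a : ℂ) ^ n * g a‖ ≤ s * R + s⁻¹ * hq lam a ^ n := by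
    rw [hga, intervalIntegral.integral_of_le ha.le]
    refine (norm_integral_le_integral_norm _).trans ?_
    have h3 : ∫ t in Ioc 0 a, ‖(hq lam t : ℂ) ^ (n - 1) * h t‖ ≤
        ∫ t in Ioc 0 a, (s * (hq lam t ^ (n - 1) * ‖h t‖ ^ 2) + s⁻¹ * hq lam t ^ (n - 1)) := by
      refine setIntegral_mono_on (hh.integrableOn_weight hl a).norm
        (((h2i.mono_set hsub).const_mul s).add (hw.const_mul s⁻¹)) measurableSet_Ioc
        fun t ht => ?_
      have h4 := hq_pos hl ht.1
      simp only [norm_mul, norm_pow, Complex.norm_real, Real.norm_eq_abs, abs_of_pos h4]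
      have h5 : ‖h t‖ ≤ s * ‖h t‖ ^ 2 + s⁻¹ := by
        have h6 : 0 ≤ s⁻¹ * (s * ‖h t‖ - 1) ^ 2 := by positivity
        have h7 : s⁻¹ * (s * ‖h t‖ - 1) ^ 2 = s * ‖h t‖ ^ 2 - 2 * ‖h t‖ + s⁻¹ := by
          field_simp
          ring
        have := norm_nonneg (h t)
        linarith
      have h6 : 0 ≤ hq lam t ^ (n - 1) := by positivity
      nlinarith [mul_le_mul_of_nonneg_left h5 h6]
    refine h3.trans ?_
    rw [integral_add ((h2i.mono_set hsub).const_mul s) (hw.const_mul s⁻¹), integral_const_mul,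
      integral_const_mul]
    refine add_le_add (mul_le_mul_of_nonneg_left ?_ hs.le)
      (mul_le_mul_of_nonneg_left ?_ (inv_nonneg.2 hs.le))
    · rw [show R = _ from radialSq_eq hl h]
      refine setIntegral_mono_set h2i ((ae_restrict_iff' measurableSet_Ioi).2
        (Eventually.of_forall fun t ht => ?_)) (LE.le.eventuallyLE hsub)
      have := hq_pos hl ht
      simp only [Pi.zero_apply]
      positivity
    · rw [← intervalIntegral.integral_of_le ha.le]
      exact integral_hq_pow_le hn hl ha.le
  have h4 : s * R + s⁻¹ * hq lam a ^ n = s * (R + 1) := by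
    rw [← hs2]
    field_simp
  rw [h4, norm_mul, norm_pow, Complex.norm_real, Real.norm_eq_abs, abs_of_pos hqa, ← hs2] at h1
  rw [← hs2]
  have h5 : s * ‖g a‖ ≤ R + 1 := by
    by_contra hcon
    push Not at hcon
    nlinarith [mul_lt_mul_of_pos_left hcon hs]
  calc s ^ 2 * ‖g a‖ ^ 2 = (s * ‖g a‖) ^ 2 := by ring
    _ ≤ _ := by gcongr

/-- The second derivative of a radial function is controlled by its Laplacian. -/
lemma isD_of_div (hn : 2 ≤ n) (hl : 0 < lam) (hl1 : lam ≤ 1) {g h : ℝ → ℂ}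
    (hp : IsPrim (fun r => (hq lam r : ℂ) ^ n * g r) (fun r => (hq lam r : ℂ) ^ (n - 1) * h r))
    (h0 : Tendsto (fun r => (hq lam r : ℂ) ^ n * g r) (𝓝[>] 0) (𝓝 0))
    (hg : MemLp (fun r => (hq lam r : ℂ) ^ 1 * g r) 2 (radialMeasure n lam))
    (hh : MemLp h 2 (radialMeasure n lam)) :
    IsD lam g (fun r => (h r - n * (hc lam r : ℂ) * g r) / (hq lam r : ℂ) ^ 2) ∧
      MemLp (fun r => (hq lam r : ℂ) ^ 2 *
        ((h r - n * (hc lam r : ℂ) * g r) / (hq lam r : ℂ) ^ 2)) 2 (radialMeasure n lam) := by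
  set g1 : ℝ → ℂ := fun r => (h r - n * (hc lam r : ℂ) * g r) / (hq lam r : ℂ) ^ 2
  have hg1 : ∀ r, 0 < r → h r = (hq lam r : ℂ) ^ 2 * g1 r + n * (hc lam r : ℂ) * g r := by
    intro r hr
    have := hq_cast_ne_zero hl hr
    simp only [g1]
    field_simp
    ring
  have hD : IsD lam g g1 := by
    have hinv : IsPrim (fun r => ((hq lam r : ℂ) ^ n)⁻¹)
        (fun r => -(n * (hq lam r : ℂ) ^ (n - 1) * (hc lam r : ℂ)) / ((hq lam r : ℂ) ^ n) ^ 2) := by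
      have := IsPrim.of_ofReal (u := fun r => (hq lam r ^ n)⁻¹)
        (fun r hr => ((hasDerivAt_hq hl r).pow n).inv (pow_ne_zero n (hq_ne_zero hl hr))) (by
          have h1 := continuous_hq (lam := lam)
          have h2 := continuous_hc (lam := lam)
          refine ContinuousOn.div (by fun_prop) (by fun_prop) fun r hr => ?_
          exact pow_ne_zero _ (pow_ne_zero _ (hq_ne_zero hl hr)))
      simpa using this
    refine (hinv.mul hp).congr (fun r hr => ?_) (Eventually.of_forall fun r hr => ?_)
    · have := hq_cast_ne_zero hl hr
      field_simp
    · have := hq_cast_ne_zero hl hr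
      rw [hg1 r hr, hq_cast_pow_eq (show 1 ≤ n by omega) r]
      field_simp
      ring
  refine ⟨hD, ?_⟩
  set R := radialSq n lam h
  have hR : 0 ≤ R := radialSq_nonneg h
  set S0 := radialSq n lam (fun r => (hq lam r : ℂ) ^ 1 * g r)
  have e0 : S0 = _ := radialSq_hq_mul hl 1 g
  have i0 := integrableOn_hq_mul hl 1 hg
  have ih := ((memLp_radial_iff hl).1 hh).2
  have hg1m : AEStronglyMeasurable (fun r => (hq lam r : ℂ) ^ 2 * g1 r)
      (volume.restrict (Ioi 0)) := by
    have h1 : AEStronglyMeasurable (fun r => (hq lam r : ℂ) * g1 r)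
        (volume.restrict (Ioi 0)) := IsPrim.aestronglyMeasurable hD
    refine ((Complex.continuous_ofReal.comp (continuous_hq (lam := lam))).aestronglyMeasurable.mul h1).congr
      (Eventually.of_forall fun r => ?_)
    simp only [Pi.mul_apply, Function.comp]
    ring
  -- In the expansion of |h|² with h = hq² g1 + n hc g, all terms other than |hq² g1|² make up,
  -- after weighting, the derivative v of u, up to n lam² hq²|g|². After integration over (a, b) the
  -- term u(b) has the good sign, and u(a) is bounded for a ≤ 1 by `norm_sq_le_of_div`.
  set u : ℝ → ℝ := fun r => n * hc lam r * hq lam r ^ n * ‖g r‖ ^ 2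
  set v : ℝ → ℝ := fun r => n * (lam ^ 2 * hq lam r * hq lam r ^ n * ‖g r‖ ^ 2 +
    n * hc lam r ^ 2 * hq lam r ^ (n - 1) * ‖g r‖ ^ 2 +
    2 * hc lam r * hq lam r ^ n * hq lam r * (g1 r * (starRingEnd ℂ) (g r)).re)
  have hB : IsPrim (fun r => (u r : ℂ)) (fun r => (v r : ℂ)) := by
    refine ((((IsPrim.hc hl).mul (IsPrim.hq_pow hl n)).mul hD.normSq).const_mul n).congr
      (fun r _ => by simp only [u]; push_cast; ring) (Eventually.of_forall fun r _ => ?_)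
    simp only [v]
    push_cast
    ring
  have hid : ∀ r, 0 < r → hq lam r ^ (n - 1) * ‖(hq lam r : ℂ) ^ 2 * g1 r‖ ^ 2 =
      hq lam r ^ (n - 1) * ‖h r‖ ^ 2 +
        n * lam ^ 2 * (hq lam r ^ (n - 1) * (hq lam r ^ (2 * 1) * ‖g r‖ ^ 2)) - v r := by
    intro r hr
    have h1 := hg1 r hr
    have h2 : ‖h r‖ ^ 2 = ‖(hq lam r : ℂ) ^ 2 * g1 r‖ ^ 2 +
        2 * (n * hc lam r * hq lam r ^ 2 * (g1 r * (starRingEnd ℂ) (g r)).re) +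
        n ^ 2 * hc lam r ^ 2 * ‖g r‖ ^ 2 := by
      rw [h1, ← Complex.normSq_eq_norm_sq, ← Complex.normSq_eq_norm_sq,
        ← Complex.normSq_eq_norm_sq, Complex.normSq_add, Complex.normSq_mul (_ * _) (g r)]
      have h3 : ((hq lam r : ℂ) ^ 2 * g1 r * (starRingEnd ℂ) (n * (hc lam r : ℂ) * g r)) =
          ((n * hc lam r * hq lam r ^ 2 : ℝ) : ℂ) * (g1 r * (starRingEnd ℂ) (g r)) := by
        simp only [map_mul, Complex.conj_ofReal, map_natCast]
        push_cast
        ring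
      rw [h3, Complex.re_ofReal_mul]
      have h4 : Complex.normSq (n * (hc lam r : ℂ)) = n ^ 2 * hc lam r ^ 2 := by
        rw [Complex.normSq_mul, Complex.normSq_ofReal, Complex.normSq_natCast]
        ring
      rw [h4]
      ring
    rw [h2]
    simp only [v, hq_pow_eq (show 1 ≤ n by omega) r]
    ring
  obtain ⟨k1, -⟩ := integrableOn_Ioi_of_integral_Ioc_le
    (F := fun r => hq lam r ^ (n - 1) * ‖(hq lam r : ℂ) ^ 2 * g1 r‖ ^ 2)
    (I := R + n * lam ^ 2 * S0 + n * 2 * (R + 1) ^ 2)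
    (fun a b ha hab => by
      obtain ⟨m1, -⟩ := hB.re ha (ha.trans_le hab)
      have hsub : Ioc a b ⊆ Ioi 0 := fun x hx => ha.trans hx.1
      refine IntegrableOn.congr_fun (((ih.mono_set hsub).add
        ((i0.mono_set hsub).const_mul (n * lam ^ 2))).sub
        ((intervalIntegrable_iff_integrableOn_Ioc_of_le hab).1 m1)) (fun r hr => ?_)
        measurableSet_Ioc
      exact (hid r (hsub hr)).symm)
    (fun r hr => by have := hq_pos hl hr; positivity)
    (fun a b ha ha1 hb1 => by
      have hb : 0 < b := by linarith
      have hab : a ≤ b := by linarith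
      obtain ⟨m1, m2⟩ := hB.re ha hb
      have hsub : Ioc a b ⊆ Ioi 0 := fun x hx => ha.trans hx.1
      have hvi : IntegrableOn v (Ioc a b) :=
        (intervalIntegrable_iff_integrableOn_Ioc_of_le hab).1 m1
      rw [setIntegral_congr_fun measurableSet_Ioc fun r hr => hid r (hsub hr)]
      have hi1 := (ih.mono_set hsub)
      have hi2 := ((i0.mono_set hsub).const_mul (n * lam ^ 2))
      have hi3 : Integrable (fun r => hq lam r ^ (n - 1) * ‖h r‖ ^ 2 +
          n * lam ^ 2 * (hq lam r ^ (n - 1) * (hq lam r ^ (2 * 1) * ‖g r‖ ^ 2)))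
          (volume.restrict (Ioc a b)) := hi1.add hi2
      rw [integral_sub hi3 hvi, integral_add hi1 hi2, integral_const_mul,
        ← intervalIntegral.integral_of_le hab (f := v), m2]
      have j1 : ∫ r in Ioc a b, hq lam r ^ (n - 1) * ‖h r‖ ^ 2 ≤ R := by
        rw [show R = _ from radialSq_eq hl h]
        refine setIntegral_mono_set ih ((ae_restrict_iff' measurableSet_Ioi).2
          (Eventually.of_forall fun t ht => ?_)) (LE.le.eventuallyLE hsub)
        have := hq_pos hl ht
        simp only [Pi.zero_apply]
        positivity
      have j2 : ∫ r in Ioc a b, hq lam r ^ (n - 1) * (hq lam r ^ (2 * 1) * ‖g r‖ ^ 2) ≤ S0 := by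
        rw [e0]
        refine setIntegral_mono_set i0 ((ae_restrict_iff' measurableSet_Ioi).2
          (Eventually.of_forall fun t ht => ?_)) (LE.le.eventuallyLE hsub)
        have := hq_pos hl ht
        simp only [Pi.zero_apply]
        positivity
      have j3 : 0 ≤ u b := by
        have := hq_pos hl hb
        have := hc_pos (lam := lam) b
        positivity
      have j4 : u a ≤ n * 2 * ((R + 1) ^ 2 * 2) / 2 := by
        have h3 := norm_sq_le_of_div (by omega) hl hp h0 hh ha
        have h4 : hc lam a ≤ 1 + hq lam a := hc_le hl hl1 ha
        have h5 : hc lam a ≤ 2 := by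
          have h6 : Real.cosh (lam * a) ≤ Real.cosh 1 := by
            rw [Real.cosh_le_cosh, abs_of_pos (mul_pos hl ha), abs_one]
            exact mul_le_one₀ hl1 ha.le ha1
          have h7 : Real.cosh 1 ≤ 2 := by
            rw [Real.cosh_eq]
            have := Real.exp_one_lt_d9
            have h4 : Real.exp (-1) ≤ 1 := by
              rw [Real.exp_le_one_iff]; norm_num
            linarith
          exact h6.trans h7
        have h6 : u a = n * hc lam a * (hq lam a ^ n * ‖g a‖ ^ 2) := by
          simp only [u]
          ring
        have h7 : (0 : ℝ) ≤ n := Nat.cast_nonneg n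
        have h8 := hc_pos (lam := lam) a
        have h9 := hq_pos hl ha
        rw [h6]
        calc n * hc lam a * (hq lam a ^ n * ‖g a‖ ^ 2) ≤ n * 2 * (R + 1) ^ 2 := by gcongr
          _ = _ := by ring
      have j5 : n * lam ^ 2 * ∫ r in Ioc a b,
          hq lam r ^ (n - 1) * (hq lam r ^ (2 * 1) * ‖g r‖ ^ 2) ≤ n * lam ^ 2 * S0 := by gcongr
      linarith)
  exact (memLp_radial_iff hl).2 ⟨hg1m, k1⟩

/-- Green's formula. -/
lemma integral_green (hn : 2 ≤ n) (hl : 0 < lam) (hl1 : lam ≤ 1) {f f1 h k : ℝ → ℂ}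
    (hD : IsD lam f f1) (hf : MemLp f 2 (radialMeasure n lam))
    (hf1 : MemLp (fun r => (hq lam r : ℂ) ^ 1 * f1 r) 2 (radialMeasure n lam))
    (hp : IsPrim (fun r => (hq lam r : ℂ) ^ n * h r) (fun r => (hq lam r : ℂ) ^ (n - 1) * k r))
    (hh : MemLp h 2 (radialMeasure n lam))
    (hh1 : MemLp (fun r => (hq lam r : ℂ) ^ 1 * h r) 2 (radialMeasure n lam))
    (hk : MemLp k 2 (radialMeasure n lam)) :
    ∫ r, (starRingEnd ℂ) (f r) * k r ∂(radialMeasure n lam) =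
      -∫ r, (starRingEnd ℂ) ((hq lam r : ℂ) ^ 1 * f1 r) * ((hq lam r : ℂ) ^ 1 * h r)
        ∂(radialMeasure n lam) := by
  have hfs : MemLp (fun r => (starRingEnd ℂ) (f r)) 2 (radialMeasure n lam) := hf.star
  have hf1s : MemLp (fun r => (starRingEnd ℂ) ((hq lam r : ℂ) ^ 1 * f1 r)) 2
    (radialMeasure n lam) := hf1.star
  have i1 := hfs.integrableOn_mul hl hk
  have i2 := hf1s.integrableOn_mul hl hh1
  have hprim : IsPrim (fun r => (starRingEnd ℂ) (f r) * ((hq lam r : ℂ) ^ n * h r))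
      (fun r => (hq lam r : ℂ) ^ (n - 1) * ((starRingEnd ℂ) (f r) * k r) +
        (hq lam r : ℂ) ^ (n - 1) *
          ((starRingEnd ℂ) ((hq lam r : ℂ) ^ 1 * f1 r) * ((hq lam r : ℂ) ^ 1 * h r))) := by
    refine ((IsPrim.star hD).mul hp).congr (fun _ _ => rfl) (Eventually.of_forall fun r _ => ?_)
    simp only [map_mul, pow_one]
    rw [hq_cast_pow_eq (show 1 ≤ n by omega) r]
    ring
  have key := hprim.integral_Ioi_eq_zero hl hl1 (i1.add i2) ?_ ?_
  · rw [integral_add i1 i2] at key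
    rw [integral_radial hl, integral_radial hl]
    simp only [Complex.real_smul, Complex.ofReal_pow]
    exact eq_neg_of_add_eq_zero_left key
  · refine ((hfs.integrableOn_mul hl hh).mono_set Ioc_subset_Ioi_self).norm.congr
      ((ae_restrict_iff' measurableSet_Ioc).2 (Eventually.of_forall fun r hr => ?_))
    have := hq_pos hl hr.1
    simp only [hq_cast_pow_eq (show 1 ≤ n by omega) r, norm_mul, norm_pow, Complex.norm_real,
      Real.norm_eq_abs, abs_of_pos this]
    field_simp
  · refine ((hfs.integrableOn_mul hl hh1).mono_set (Ioi_subset_Ioi zero_le_one)).congr_fun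
      (fun r _ => ?_) measurableSet_Ioi
    simp only [pow_one]
    rw [hq_cast_pow_eq (show 1 ≤ n by omega) r]
    ring

/-- A function with a weak gradient in `L²` is `o(r ^ (-n))` at the origin. -/
lemma IsD.tendsto_pow_mul (hn : 2 ≤ n) (hl : 0 < lam) (hl1 : lam ≤ 1) {f f1 : ℝ → ℂ}
    (hD : IsD lam f f1) (hf : MemLp f 2 (radialMeasure n lam))
    (hf1 : MemLp (fun r => (hq lam r : ℂ) ^ 1 * f1 r) 2 (radialMeasure n lam)) :
    Tendsto (fun r => (hq lam r : ℂ) ^ n * f r) (𝓝[>] 0) (𝓝 0) := by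
  have hp := (IsPrim.hq_pow hl n).mul hD
  have hi : ∀ F : ℝ → ℂ, MemLp F 2 (radialMeasure n lam) → ∀ φ : ℝ → ℂ, Continuous φ →
      IntegrableOn (fun r => φ r * ((hq lam r : ℂ) ^ (n - 1) * F r)) (Ioc 0 1) := by
    intro F hF φ hφ
    obtain ⟨K, hK⟩ := isCompact_Icc.exists_bound_of_continuousOn hφ.continuousOn (s := Icc 0 1)
    exact (hF.integrableOn_weight hl 1).bdd_mul (c := K) hφ.aestronglyMeasurable
      ((ae_restrict_iff' measurableSet_Ioc).2 (Eventually.of_forall fun r hr =>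
        hK r (Ioc_subset_Icc_self hr)))
  have hqc := Complex.continuous_ofReal.comp (continuous_hq (lam := lam))
  have hcc := Complex.continuous_ofReal.comp (continuous_hc (lam := lam))
  refine hp.tendsto_zero_zero hl hl1 ?_ ?_
  · refine ((hi f hf _ (hcc.const_mul (n : ℂ))).add (hi _ hf1 _ hqc)).congr_fun (fun r hr => ?_)
      measurableSet_Ioc
    simp only [Function.comp, pow_one, Pi.add_apply]
    rw [hq_cast_pow_eq (show 1 ≤ n by omega) r]
    ring
  · refine (hf.integrableOn_weight hl 1).norm.congr
      ((ae_restrict_iff' measurableSet_Ioc).2 (Eventually.of_forall fun r hr => ?_))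
    have := hq_pos hl hr.1
    simp only [hq_cast_pow_eq (show 1 ≤ n by omega) r, norm_mul, norm_pow, Complex.norm_real,
      Real.norm_eq_abs, abs_of_pos this]
    field_simp

end Regularity

/-! ### Towers of derivatives and the Laplacian acting on them. -/

section Tower

variable {n M : ℕ} {lam : ℝ} {G H : ℕ → ℝ → ℂ}

/-- `G 0, …, G M` are the successive derivatives of `G 0` with respect to
`cosh (lam r) / lam ^ 2`, the `j`-th one being square integrable in dimension `n + 2 j`. -/
structure IsTower (n : ℕ) (lam : ℝ) (M : ℕ) (G : ℕ → ℝ → ℂ) : Prop where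
  isD : ∀ j < M, IsD lam (G j) (G (j + 1))
  memLp : ∀ j ≤ M, MemLp (G j) 2 (radialMeasure (n + 2 * j) lam)

def towerSq (n : ℕ) (lam : ℝ) (M : ℕ) (G : ℕ → ℝ → ℂ) : ℝ :=
  ∑ j ∈ Finset.range (M + 1), radialSq (n + 2 * j) lam (G j)

lemma towerSq_nonneg (G : ℕ → ℝ → ℂ) : 0 ≤ towerSq n lam M G :=
  Finset.sum_nonneg fun _ _ => radialSq_nonneg _

lemma radialSq_le_towerSq (G : ℕ → ℝ → ℂ) {j : ℕ} (hj : j ≤ M) :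
    radialSq (n + 2 * j) lam (G j) ≤ towerSq n lam M G :=
  Finset.single_le_sum (f := fun j => radialSq (n + 2 * j) lam (G j))
    (fun _ _ => radialSq_nonneg _) (Finset.mem_range.2 (by omega))

lemma IsD.add {f g f' g' : ℝ → ℂ} (hf : IsD lam f f') (hg : IsD lam g g') :
    IsD lam (fun r => f r + g r) (fun r => f' r + g' r) :=
  (IsPrim.add hf hg).congr (fun _ _ => rfl) (ae_of_all _ fun _ _ => by ring)

lemma IsD.const_mul {f f' : ℝ → ℂ} (a : ℂ) (hf : IsD lam f f') :
    IsD lam (fun r => a * f r) (fun r => a * f' r) :=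
  (IsPrim.const_mul a hf).congr (fun _ _ => rfl) (ae_of_all _ fun _ _ => by ring)

lemma IsD.star {f f' : ℝ → ℂ} (hf : IsD lam f f') :
    IsD lam (fun r => (starRingEnd ℂ) (f r)) (fun r => (starRingEnd ℂ) (f' r)) :=
  (IsPrim.star hf).congr (fun _ _ => rfl) (ae_of_all _ fun _ _ => by simp)

lemma IsD.mul {f g f' g' : ℝ → ℂ} (hf : IsD lam f f') (hg : IsD lam g g') :
    IsD lam (fun r => f r * g r) (fun r => f' r * g r + f r * g' r) :=
  (IsPrim.mul hf hg).congr (fun _ _ => rfl) (ae_of_all _ fun _ _ => by ring)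

lemma IsD.zero : IsD lam (fun _ => 0) (fun _ => 0) :=
  IsPrim.zero.congr (fun _ _ => rfl) (ae_of_all _ fun _ _ => by simp)

lemma IsD.sum {ι : Type*} (s : Finset ι) {F F' : ι → ℝ → ℂ} (h : ∀ i ∈ s, IsD lam (F i) (F' i)) :
    IsD lam (fun x => ∑ i ∈ s, F i x) (fun x => ∑ i ∈ s, F' i x) :=
  (IsPrim.sum s h).congr (fun _ _ => rfl) (ae_of_all _ fun _ _ => by simp [Finset.mul_sum])

lemma IsD.hq_sq (hl : 0 < lam) :
    IsD lam (fun r => (hq lam r : ℂ) ^ 2) (fun r => 2 * (hc lam r : ℂ)) :=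
  (IsPrim.hq_pow hl 2).congr (fun _ _ => rfl) (ae_of_all _ fun _ _ => by simp; ring)

lemma IsD.hc (hl : 0 < lam) :
    IsD lam (fun r => (hc lam r : ℂ)) (fun _ => (lam : ℂ) ^ 2) :=
  (IsPrim.hc hl).congr (fun _ _ => rfl) (ae_of_all _ fun _ _ => by ring)

lemma IsD.congr {f g f' g' : ℝ → ℂ} (h : IsD lam f f') (hf : ∀ x, 0 < x → f x = g x)
    (hg : ∀ᵐ x, 0 < x → f' x = g' x) : IsD lam g g' :=
  IsPrim.congr h hf (hg.mono fun x hx h0 => by rw [hx h0])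

lemma IsD.ae_unique (hl : 0 < lam) {f g f' g' : ℝ → ℂ} (hf : IsD lam f f') (hg : IsD lam g g')
    (h : ∀ᵐ t, 0 < t → f t = g t) : ∀ᵐ t, 0 < t → f' t = g' t := by
  have h1 := IsPrim.eq_of_ae hf hg h
  have h2 : IsPrim f (fun r => (hq lam r : ℂ) * g' r) :=
    IsPrim.congr hg (fun x hx => (h1 x hx).symm) (ae_of_all _ fun _ _ => rfl)
  filter_upwards [IsPrim.ae_unique hf h2] with t ht h0
  exact mul_left_cancel₀ (hq_cast_ne_zero hl h0) (ht h0)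

lemma IsTower.ae_unique (hl : 0 < lam) (hG : IsTower n lam M G) (hH : IsTower n lam M H)
    (h : ∀ᵐ t, 0 < t → G 0 t = H 0 t) {j : ℕ} (hj : j ≤ M) :
    ∀ᵐ t, 0 < t → G j t = H j t := by
  induction j with
  | zero => exact h
  | succ j ih => exact (hG.isD j hj).ae_unique hl (hH.isD j hj) (ih (by omega))

lemma IsTower.mono (hG : IsTower n lam M G) {M' : ℕ} (h : M' ≤ M) : IsTower n lam M' G :=
  ⟨fun j hj => hG.isD j (by omega), fun j hj => hG.memLp j (by omega)⟩

lemma IsTower.add (hG : IsTower n lam M G) (hH : IsTower n lam M H) :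
    IsTower n lam M (fun j r => G j r + H j r) :=
  ⟨fun j hj => (hG.isD j hj).add (hH.isD j hj), fun j hj => (hG.memLp j hj).add (hH.memLp j hj)⟩

lemma IsTower.const_mul (a : ℂ) (hG : IsTower n lam M G) :
    IsTower n lam M (fun j r => a * G j r) :=
  ⟨fun j hj => (hG.isD j hj).const_mul a, fun j hj => (hG.memLp j hj).const_mul a⟩

lemma IsTower.zero : IsTower n lam M (fun _ _ => 0) :=
  ⟨fun _ _ => IsD.zero, fun _ _ => MemLp.zero⟩

lemma IsTower.star (hG : IsTower n lam M G) :
    IsTower n lam M (fun j r => (starRingEnd ℂ) (G j r)) :=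
  ⟨fun j hj => (hG.isD j hj).star, fun j hj => (hG.memLp j hj).star⟩

/-- One derivative is traded for two dimensions; this drives the induction in
`exists_tower_of_resolvent`. -/
lemma IsTower.tail (hG : IsTower n lam (M + 1) G) : IsTower (n + 2) lam M (fun j => G (j + 1)) :=
  ⟨fun j hj => hG.isD (j + 1) (by omega), fun j hj => by
    have h := hG.memLp (j + 1) (by omega)
    rwa [show n + 2 * (j + 1) = n + 2 + 2 * j by ring] at h⟩

lemma IsTower.memLp_pow (hn : 1 ≤ n) (hl : 0 < lam) (hG : IsTower n lam M G) {j : ℕ}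
    (hj : j ≤ M) : MemLp (fun r => (hq lam r : ℂ) ^ j * G j r) 2 (radialMeasure n lam) :=
  (memLp_shift_iff hn hl j).1 (hG.memLp j hj)

/-- The zeroth order coefficient in the `j`-th derivative of the Laplacian. -/
def lapCoef (n j : ℕ) : ℝ := j * (n + j - 1)

/-- The tower of the Laplacian. -/
def lapTower (n : ℕ) (lam : ℝ) (G : ℕ → ℝ → ℂ) (j : ℕ) (r : ℝ) : ℂ :=
  (hq lam r : ℂ) ^ 2 * G (j + 2) r + ((n + 2 * j : ℕ) : ℂ) * (hc lam r : ℂ) * G (j + 1) r +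
    (lapCoef n j * lam ^ 2 : ℝ) * G j r

/-- Since D(hq²) = 2 hc and D(hc) = lam², the first coefficient n + 2j grows by 2 and `lapCoef n (j
+ 1)` is `lapCoef n j` plus n + 2j. -/
lemma isD_lapTower (hl : 0 < lam) {j : ℕ} (h0 : IsD lam (G j) (G (j + 1)))
    (h1 : IsD lam (G (j + 1)) (G (j + 2))) (h2 : IsD lam (G (j + 2)) (G (j + 3))) :
    IsD lam (lapTower n lam G j) (lapTower n lam G (j + 1)) := by
  have := (((IsD.hq_sq hl).mul h2).add (((IsD.hc hl).mul h1).const_mul ((n + 2 * j : ℕ) : ℂ))).add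
    (h0.const_mul ((lapCoef n j * lam ^ 2 : ℝ) : ℂ))
  refine this.congr (fun r _ => ?_) (ae_of_all _ fun r _ => ?_)
  · simp only [lapTower]; ring
  · simp only [lapTower, lapCoef]; push_cast; ring

/-- A tower places the entry j + 1 only in the heavier weight of dimension n + 2j + 2. The term hc G
(j + 1) of the Laplacian needs the weight of dimension n + 2j, which costs one further derivative.
-/
lemma IsTower.hardy (hn : 2 ≤ n) (hl : 0 < lam) (hl1 : lam ≤ 1) (hG : IsTower n lam M G) {j : ℕ}
    (hj : j + 2 ≤ M) : MemLp (G (j + 1)) 2 (radialMeasure (n + 2 * j) lam) ∧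
      radialSq (n + 2 * j) lam (G (j + 1)) ≤ (2 * (n + 2 * j : ℕ) + 3) *
        (radialSq (n + 2 * (j + 1)) lam (G (j + 1)) +
          radialSq (n + 2 * (j + 2)) lam (G (j + 2))) := by
  have e1 : n + 2 * (j + 1) = n + 2 * j + 2 * 1 := by ring
  have e2 : n + 2 * (j + 2) = n + 2 * j + 2 * 2 := by ring
  have h1 := hG.memLp (j + 1) (by omega)
  have h2 := hG.memLp (j + 2) (by omega)
  rw [e1, memLp_shift_iff (by omega) hl] at h1
  rw [e2, memLp_shift_iff (by omega) hl] at h2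
  rw [e1, e2, radialSq_shift (n := n + 2 * j) (by omega) hl 1,
    radialSq_shift (n := n + 2 * j) (by omega) hl 2]
  exact (hG.isD (j + 1) (by omega)).hardy (by omega) hl hl1 h1 h2

/-- By `hc_le`, the factor hc is controlled by the weights 1 and hq together. -/
lemma memLp_hc_mul (hl : 0 < lam) (hl1 : lam ≤ 1) {g : ℝ → ℂ}
    (h0 : MemLp g 2 (radialMeasure n lam))
    (h1 : MemLp (fun r => (hq lam r : ℂ) ^ 1 * g r) 2 (radialMeasure n lam)) :
    MemLp (fun r => (hc lam r : ℂ) * g r) 2 (radialMeasure n lam) ∧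
      radialSq n lam (fun r => (hc lam r : ℂ) * g r) ≤
        2 * radialSq n lam g + 2 * radialSq n lam (fun r => (hq lam r : ℂ) ^ 1 * g r) := by
  have hs := h0.norm.add h1.norm
  have hb : ∀ᵐ r ∂(radialMeasure n lam), ‖(hc lam r : ℂ) * g r‖ ≤
      ‖g r‖ + ‖(hq lam r : ℂ) ^ 1 * g r‖ := ae_radial_of_forall hl fun r hr => by
    rw [norm_mul, norm_mul, norm_pow, Complex.norm_real, Complex.norm_real, Real.norm_eq_abs,
      Real.norm_eq_abs, abs_of_pos (hc_pos r), abs_of_pos (hq_pos hl hr), pow_one]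
    nlinarith [hc_le hl hl1 hr, norm_nonneg (g r)]
  have hm : MemLp (fun r => (hc lam r : ℂ) * g r) 2 (radialMeasure n lam) := by
    refine MemLp.mono hs (((Complex.continuous_ofReal.comp
      (continuous_hc (lam := lam))).aestronglyMeasurable).mul h0.1) ?_
    filter_upwards [hb] with r hr
    exact hr.trans (le_abs_self _)
  refine ⟨hm, ?_⟩
  have hA : MemLp (fun r => ((‖g r‖ : ℝ) : ℂ)) 2 (radialMeasure n lam) := h0.norm.ofReal
  have hB : MemLp (fun r => ((‖(hq lam r : ℂ) ^ 1 * g r‖ : ℝ) : ℂ)) 2 (radialMeasure n lam) :=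
    h1.norm.ofReal
  refine ((radialSq_mono (hA.add hB) ?_).trans (radialSq_add_le hA hB)).trans (le_of_eq ?_)
  · filter_upwards [hb] with r hr
    refine hr.trans (le_of_eq ?_)
    simp only [Pi.add_apply]
    rw [← Complex.ofReal_add, Complex.norm_real, Real.norm_eq_abs, abs_of_nonneg (by positivity)]
  · simp [radialSq]

lemma IsTower.hc_mul (hn : 2 ≤ n) (hl : 0 < lam) (hl1 : lam ≤ 1) (hG : IsTower n lam M G) {j : ℕ}
    (hj : j + 2 ≤ M) :
    MemLp (fun r => (hc lam r : ℂ) * G (j + 1) r) 2 (radialMeasure (n + 2 * j) lam) ∧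
      radialSq (n + 2 * j) lam (fun r => (hc lam r : ℂ) * G (j + 1) r) ≤
        (4 * (n + 2 * j : ℕ) + 8) * (radialSq (n + 2 * (j + 1)) lam (G (j + 1)) +
          radialSq (n + 2 * (j + 2)) lam (G (j + 2))) := by
  obtain ⟨h1, h2⟩ := hG.hardy hn hl hl1 hj
  have e1 : n + 2 * (j + 1) = n + 2 * j + 2 * 1 := by ring
  have h3 := hG.memLp (j + 1) (by omega)
  rw [e1, memLp_shift_iff (by omega) hl] at h3
  obtain ⟨h4, h5⟩ := memLp_hc_mul hl hl1 h1 h3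
  refine ⟨h4, h5.trans ?_⟩
  rw [← radialSq_shift (by omega) hl, ← e1]
  nlinarith [h2, radialSq_nonneg (n := n + 2 * (j + 1)) (lam := lam) (G (j + 1)),
    radialSq_nonneg (n := n + 2 * (j + 2)) (lam := lam) (G (j + 2))]

lemma IsTower.memLp_hq_sq (hn : 2 ≤ n) (hl : 0 < lam) (hG : IsTower n lam M G) {j : ℕ}
    (hj : j + 2 ≤ M) :
    MemLp (fun r => (hq lam r : ℂ) ^ 2 * G (j + 2) r) 2 (radialMeasure (n + 2 * j) lam) := by
  have h3 := hG.memLp (j + 2) (by omega)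
  rwa [show n + 2 * (j + 2) = n + 2 * j + 2 * 2 by ring, memLp_shift_iff (by omega) hl] at h3

lemma IsTower.lapTower (hn : 2 ≤ n) (hl : 0 < lam) (hl1 : lam ≤ 1)
    (hG : IsTower n lam (M + 2) G) : IsTower n lam M (lapTower n lam G) := by
  refine ⟨fun j hj => isD_lapTower hl (hG.isD j (by omega)) (hG.isD _ (by omega))
    (hG.isD _ (by omega)), fun j hj => ?_⟩
  have := ((hG.memLp_hq_sq hn hl (j := j) (by omega)).add
    ((hG.hc_mul hn hl hl1 (j := j) (by omega)).1.const_mul ((n + 2 * j : ℕ) : ℂ))).add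
    ((hG.memLp j (by omega)).const_mul ((lapCoef n j * lam ^ 2 : ℝ) : ℂ))
  refine this.ae_eq (ae_of_all _ fun r => ?_)
  simp only [_root_.lapTower, Pi.add_apply]; ring

lemma lapCoef_nonneg (n j : ℕ) (hn : 1 ≤ n) : 0 ≤ lapCoef n j := by
  have : (1 : ℝ) ≤ n := by exact_mod_cast hn
  have h2 : (0 : ℝ) ≤ j := by positivity
  unfold lapCoef
  nlinarith

/-- At each level the three terms of the Laplacian are bounded by the entry j + 2, by Hardy's
inequality, and by lam ≤ 1. Only the independence of the constant from lam matters. -/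
lemma IsTower.towerSq_lapTower_le (hn : 2 ≤ n) (hl : 0 < lam) (hl1 : lam ≤ 1)
    (hG : IsTower n lam (M + 2) G) : towerSq n lam M (_root_.lapTower n lam G) ≤
      (M + 1) * (4 + 64 * (n + 2 * M) ^ 4) * towerSq n lam (M + 2) G := by
  have key : ∀ j ∈ Finset.range (M + 1), radialSq (n + 2 * j) lam (_root_.lapTower n lam G j) ≤
      (4 + 64 * (n + 2 * M) ^ 4) * towerSq n lam (M + 2) G := by
    intro j hj
    have hj : j ≤ M := by simpa [Nat.lt_succ_iff] using hj
    have hA := hG.memLp_hq_sq hn hl (j := j) (by omega)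
    obtain ⟨hB, hB'⟩ := hG.hc_mul hn hl hl1 (j := j) (by omega)
    have hC := hG.memLp j (by omega)
    have e2 : n + 2 * (j + 2) = n + 2 * j + 2 * 2 := by ring
    have hS := radialSq_le_towerSq (n := n) (lam := lam) G (show j + 2 ≤ M + 2 by omega)
    have hS1 := radialSq_le_towerSq (n := n) (lam := lam) G (show j + 1 ≤ M + 2 by omega)
    have hS0 := radialSq_le_towerSq (n := n) (lam := lam) G (show j ≤ M + 2 by omega)
    have hS' := hS
    rw [e2, radialSq_shift (by omega) hl] at hS'
    have h1 := radialSq_add_le (hA.add (hB.const_mul ((n + 2 * j : ℕ) : ℂ)))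
      (hC.const_mul ((lapCoef n j * lam ^ 2 : ℝ) : ℂ))
    have h2 := radialSq_add_le hA (hB.const_mul ((n + 2 * j : ℕ) : ℂ))
    rw [radialSq_const_mul] at h1 h2
    have e : radialSq (n + 2 * j) lam (_root_.lapTower n lam G j) = radialSq (n + 2 * j) lam
        (fun r => ((fun r => (hq lam r : ℂ) ^ 2 * G (j + 2) r) +
          fun r => ((n + 2 * j : ℕ) : ℂ) * ((hc lam r : ℂ) * G (j + 1) r)) r +
          ((lapCoef n j * lam ^ 2 : ℝ) : ℂ) * G j r) := by
      congr 1; funext r; simp only [_root_.lapTower, Pi.add_apply]; ring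
    rw [e]
    have hT := towerSq_nonneg (n := n) (lam := lam) (M := M + 2) G
    set T := towerSq n lam (M + 2) G
    have hN : ((n + 2 * j : ℕ) : ℝ) ≤ n + 2 * M := by push_cast; gcongr
    have hN2 : (2 : ℝ) ≤ ((n + 2 * j : ℕ) : ℝ) := by exact_mod_cast (by omega : 2 ≤ n + 2 * j)
    set N := ((n + 2 * j : ℕ) : ℝ) with hNdef
    have hX : (2 : ℝ) ≤ n + 2 * M := hN2.trans hN
    set X : ℝ := n + 2 * M
    have hnorm : ‖((n + 2 * j : ℕ) : ℂ)‖ = N := by rw [Complex.norm_natCast]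
    have hcoef0 := lapCoef_nonneg n j (by omega)
    have hcoef : lapCoef n j ≤ X ^ 2 := by
      have ha : (j : ℝ) ≤ N := by simp only [hNdef]; push_cast; nlinarith [Nat.cast_nonneg (α := ℝ) n, Nat.cast_nonneg (α := ℝ) j]
      have hb : (n + j - 1 : ℝ) ≤ N := by simp only [hNdef]; push_cast; nlinarith [Nat.cast_nonneg (α := ℝ) j]
      have hb0 : (0 : ℝ) ≤ n + j - 1 := by
        have : (2 : ℝ) ≤ n := by exact_mod_cast hn
        have : (0 : ℝ) ≤ j := by positivity
        linarith
      unfold lapCoef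
      calc (j : ℝ) * (n + j - 1) ≤ X * X := by
            apply mul_le_mul (ha.trans hN) (hb.trans hN) hb0 (by linarith)
        _ = X ^ 2 := by ring
    have hcl : ‖((lapCoef n j * lam ^ 2 : ℝ) : ℂ)‖ ≤ X ^ 2 := by
      rw [Complex.norm_real, Real.norm_eq_abs, abs_of_nonneg (by positivity)]
      have : lam ^ 2 ≤ 1 := pow_le_one₀ hl.le hl1
      nlinarith
    have hcl2 : ‖((lapCoef n j * lam ^ 2 : ℝ) : ℂ)‖ ^ 2 ≤ X ^ 4 := by
      calc _ ≤ (X ^ 2) ^ 2 := by gcongr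
        _ = X ^ 4 := by ring
    rw [hnorm] at h2
    have hB2 : radialSq (n + 2 * j) lam (fun r => (hc lam r : ℂ) * G (j + 1) r) ≤
        (4 * X + 8) * (2 * T) := by
      have hs := add_nonneg (radialSq_nonneg (n := n + 2 * (j + 1)) (lam := lam) (G (j + 1)))
        (radialSq_nonneg (n := n + 2 * (j + 2)) (lam := lam) (G (j + 2)))
      exact hB'.trans (mul_le_mul (by linarith) (by linarith) hs (by linarith))
    have hN2B : N ^ 2 * radialSq (n + 2 * j) lam (fun r => (hc lam r : ℂ) * G (j + 1) r) ≤
        X ^ 2 * ((4 * X + 8) * (2 * T)) := by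
      gcongr
      exact radialSq_nonneg _
    have hlast : ‖((lapCoef n j * lam ^ 2 : ℝ) : ℂ)‖ ^ 2 * radialSq (n + 2 * j) lam (G j) ≤
        X ^ 4 * T := by
      gcongr
      exact radialSq_nonneg _
    have hpoly : X ^ 2 * ((4 * X + 8) * 2) ≤ 15 * X ^ 4 := by
      have h3 : 0 ≤ X ^ 2 * ((X - 2) * (15 * X + 22) + 28) := by
        have : 0 ≤ (X - 2) * (15 * X + 22) := mul_nonneg (by linarith) (by linarith)
        positivity
      nlinarith [h3]
    have hpT : X ^ 2 * ((4 * X + 8) * (2 * T)) ≤ 15 * X ^ 4 * T := by nlinarith [hpoly, hT]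
    have hX4 : 0 ≤ X ^ 4 * T := by positivity
    have h3 : radialSq (n + 2 * j) lam ((fun r => (hq lam r : ℂ) ^ 2 * G (j + 2) r) +
          fun r => ((n + 2 * j : ℕ) : ℂ) * ((hc lam r : ℂ) * G (j + 1) r)) ≤
          2 * T + 30 * (X ^ 4 * T) := by
      refine (le_of_eq rfl).trans (h2.trans ?_)
      linarith
    refine h1.trans ((add_le_add (mul_le_mul_of_nonneg_left h3 two_pos.le)
      (mul_le_mul_of_nonneg_left hlast two_pos.le)).trans ?_)
    clear h1 h2 h3 e hA hB hC
    linarith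
  refine (Finset.sum_le_sum key).trans (le_of_eq ?_)
  simp; ring

end Tower

/-! ### Pointwise bounds on towers, far from the origin and near it. -/

section Sobolev

variable {n M : ℕ} {lam : ℝ} {G H : ℕ → ℝ → ℂ}

lemma radialSq_level (hn : 1 ≤ n) (hl : 0 < lam) (G : ℕ → ℝ → ℂ) (i : ℕ) :
    radialSq (n + 2 * i) lam (G i) =
      ∫ r in Ioi (0 : ℝ), hq lam r ^ (n - 1) * (hq lam r ^ (2 * i) * ‖G i r‖ ^ 2) := by
  rw [radialSq_shift hn hl, radialSq_hq_mul hl]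

lemma IsTower.integrableOn_level (hn : 1 ≤ n) (hl : 0 < lam) (hG : IsTower n lam M G) {i : ℕ}
    (hi : i ≤ M) :
    IntegrableOn (fun r => hq lam r ^ (n - 1) * (hq lam r ^ (2 * i) * ‖G i r‖ ^ 2)) (Ioi 0) :=
  integrableOn_hq_mul hl i (hG.memLp_pow hn hl hi)

/-- For r ≥ 1 the density hq^(n-1) is at least 1, so hq^(2i)|G i|² and its derivative are dominated
by the L² densities of the levels i and i + 1; then `IsPrim.norm_le_of_one_le` applies. -/
lemma IsTower.norm_sq_le_of_one_le (hn : 1 ≤ n) (hl : 0 < lam) (hl1 : lam ≤ 1)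
    (hG : IsTower n lam M G) {i : ℕ} (hi : i + 1 ≤ M) {r : ℝ} (hr : 1 ≤ r) :
    (hq lam r ^ i * ‖G i r‖) ^ 2 ≤ (4 * i + 3) * towerSq n lam M G := by
  set w : ℕ → ℝ → ℝ := fun i r => hq lam r ^ (n - 1) * (hq lam r ^ (2 * i) * ‖G i r‖ ^ 2) with hw
  have hw0 : ∀ i r, 0 < r → 0 ≤ w i r := fun i r h => by
    have := hq_pos hl h
    simp only [hw]; positivity
  have hq1 : ∀ r, 1 ≤ r → 1 ≤ hq lam r := fun r h => h.trans (le_hq hl (by linarith))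
  have hB := (IsPrim.hq_pow hl (2 * i)).mul (hG.isD i hi).normSq
  have hwI := hG.integrableOn_level hn hl (show i ≤ M by omega)
  have hwI1 := hG.integrableOn_level hn hl hi
  have hsub : Ioi (1 : ℝ) ⊆ Ioi 0 := Ioi_subset_Ioi zero_le_one
  have hwle : ∀ r, 1 ≤ r → hq lam r ^ (2 * i) * ‖G i r‖ ^ 2 ≤ w i r := fun r h => by
    have h1 := hq1 r h
    exact le_mul_of_one_le_left (by positivity) (one_le_pow₀ h1)
  have hwle1 : ∀ r, 1 ≤ r → hq lam r ^ (2 * (i + 1)) * ‖G (i + 1) r‖ ^ 2 ≤ w (i + 1) r := by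
    intro r h
    have h1 := hq1 r h
    exact le_mul_of_one_le_left (by positivity) (one_le_pow₀ h1)
  have hBn : ∀ r, 1 ≤ r → ‖(hq lam r : ℂ) ^ (2 * i) * ((‖G i r‖ ^ 2 : ℝ) : ℂ)‖ ≤ w i r := by
    intro r h
    have h1 := hq1 r h
    rw [norm_mul, norm_pow, Complex.norm_real, Complex.norm_real, Real.norm_eq_abs,
      Real.norm_eq_abs, abs_of_pos (by linarith), abs_of_nonneg (by positivity)]
    exact hwle r h
  have hbn : ∀ r, 1 ≤ r → ‖((2 * i : ℕ) : ℂ) * (hq lam r : ℂ) ^ (2 * i - 1) * (hc lam r : ℂ) *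
        ((‖G i r‖ ^ 2 : ℝ) : ℂ) + (hq lam r : ℂ) ^ (2 * i) *
        ((2 * hq lam r * (G (i + 1) r * (starRingEnd ℂ) (G i r)).re : ℝ) : ℂ)‖ ≤
        (4 * i + 1) * w i r + w (i + 1) r := by
    intro r h
    have h1 := hq1 r h
    have hc2 : hc lam r ≤ 2 * hq lam r := by linarith [hc_le hl hl1 (show 0 < r by linarith)]
    refine (norm_add_le _ _).trans ?_
    rw [norm_mul, norm_mul, norm_mul, norm_mul, norm_pow, norm_pow, Complex.norm_real,
      Complex.norm_real, Complex.norm_real, Complex.norm_real, Complex.norm_natCast,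
      Real.norm_eq_abs, Real.norm_eq_abs, Real.norm_eq_abs, Real.norm_eq_abs,
      abs_of_pos (show 0 < hq lam r by linarith), abs_of_pos (hc_pos r),
      abs_of_nonneg (show 0 ≤ ‖G i r‖ ^ 2 by positivity), abs_mul,
      abs_of_pos (show 0 < 2 * hq lam r by linarith)]
    have ha : ((2 * i : ℕ) : ℝ) * hq lam r ^ (2 * i - 1) * hc lam r * ‖G i r‖ ^ 2 ≤
        4 * i * (hq lam r ^ (2 * i) * ‖G i r‖ ^ 2) := by
      rcases Nat.eq_zero_or_pos i with h0 | h0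
      · simp [h0]
      · have e : hq lam r ^ (2 * i) = hq lam r ^ (2 * i - 1) * hq lam r := by
          rw [← pow_succ]; congr 1; omega
        rw [e]
        have : ((2 * i : ℕ) : ℝ) * hq lam r ^ (2 * i - 1) * hc lam r * ‖G i r‖ ^ 2 ≤
          ((2 * i : ℕ) : ℝ) * hq lam r ^ (2 * i - 1) * (2 * hq lam r) * ‖G i r‖ ^ 2 := by gcongr
        refine this.trans (le_of_eq ?_)
        push_cast; ring
    have hb := abs_re_mul_conj_le (G i r) (G (i + 1) r)
    have hb2 : hq lam r ^ (2 * i) * (2 * hq lam r *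
        |(G (i + 1) r * (starRingEnd ℂ) (G i r)).re|) ≤
        hq lam r ^ (2 * i) * ‖G i r‖ ^ 2 + hq lam r ^ (2 * (i + 1)) * ‖G (i + 1) r‖ ^ 2 := by
      have e : hq lam r ^ (2 * (i + 1)) = hq lam r ^ (2 * i) * hq lam r ^ 2 := by ring
      rw [e, mul_assoc (hq lam r ^ (2 * i)) (hq lam r ^ 2), ← mul_add]
      refine mul_le_mul_of_nonneg_left ?_ (by positivity)
      have : 2 * hq lam r * |(G (i + 1) r * (starRingEnd ℂ) (G i r)).re| ≤
          2 * hq lam r * (‖G (i + 1) r‖ * ‖G i r‖) := by gcongr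
      nlinarith [sq_nonneg (‖G i r‖ - hq lam r * ‖G (i + 1) r‖)]
    have hi0 : (0 : ℝ) ≤ i := by positivity
    nlinarith [hwle r h, hwle1 r h]
  have hmono : ∀ {f : ℝ → ℂ} {g : ℝ → ℝ}, AEStronglyMeasurable f (volume.restrict (Ioi 0)) →
      IntegrableOn g (Ioi 0) → (∀ r, 0 < r → 0 ≤ g r) → (∀ r, 1 ≤ r → ‖f r‖ ≤ g r) →
      IntegrableOn f (Ioi 1) ∧ ∫ s in Ioi (1 : ℝ), ‖f s‖ ≤ ∫ s in Ioi (0 : ℝ), g s := by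
    intro f g hf hg hg0 hfg
    have hi : IntegrableOn f (Ioi 1) := (hg.mono_set hsub).mono'
      (hf.mono_measure (Measure.restrict_mono hsub le_rfl))
      ((ae_restrict_iff' measurableSet_Ioi).2 (ae_of_all _ fun r hr => hfg r (le_of_lt hr)))
    refine ⟨hi, ?_⟩
    refine (setIntegral_mono_on hi.norm (hg.mono_set hsub) measurableSet_Ioi
      fun r hr => hfg r (le_of_lt hr)).trans ?_
    exact setIntegral_mono_set hg ((ae_restrict_iff' measurableSet_Ioi).2
      (ae_of_all _ fun r hr => hg0 r hr)) (ae_of_all _ fun _ hx => hsub hx)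
  obtain ⟨i1, i2⟩ := hmono (hB.continuousOn.aestronglyMeasurable measurableSet_Ioi) hwI (hw0 i) hBn
  obtain ⟨i3, i4⟩ := hmono hB.aestronglyMeasurable
    ((hwI.const_mul (4 * i + 1 : ℝ)).add hwI1) (fun r h => by
      have := hw0 i r h
      have := hw0 (i + 1) r h
      simp only [Pi.add_apply]; positivity) hbn
  have hfin := hB.norm_le_of_one_le i1 i3 hr
  have h1 := hq1 r hr
  rw [norm_mul, norm_pow, Complex.norm_real, Complex.norm_real, Real.norm_eq_abs,
    Real.norm_eq_abs, abs_of_pos (show 0 < hq lam r by linarith),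
    abs_of_nonneg (by positivity)] at hfin
  have e4 : ∫ s in Ioi (0 : ℝ), ((fun r => (4 * i + 1 : ℝ) * w i r) + w (i + 1)) s =
      (4 * i + 1) * (∫ s in Ioi (0 : ℝ), w i s) + ∫ s in Ioi (0 : ℝ), w (i + 1) s := by
    rw [← integral_const_mul]
    exact integral_add (hwI.const_mul (4 * i + 1 : ℝ)) hwI1
  have hi4 := i4.trans (le_of_eq e4)
  rw [← radialSq_level hn hl, ← radialSq_level hn hl] at hi4
  rw [← radialSq_level hn hl] at i2
  have h5 := radialSq_le_towerSq (n := n) (lam := lam) G (show i ≤ M by omega)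
  have h6 := radialSq_le_towerSq (n := n) (lam := lam) G hi
  have e7 : (hq lam r ^ i * ‖G i r‖) ^ 2 = hq lam r ^ (2 * i) * ‖G i r‖ ^ 2 := by ring
  rw [e7]
  have hi0 : (0 : ℝ) ≤ i := by positivity
  nlinarith [mul_le_mul_of_nonneg_left h5 hi0]

lemma IsD.norm_le_integral (hl : 0 < lam) {f g : ℝ → ℂ} (h : IsD lam f g) {φ : ℝ → ℝ} {r : ℝ}
    (hr : 0 < r) (hr1 : r ≤ 1) (hφ : IntervalIntegrable φ volume r 1)
    (hb : ∀ t ∈ Ioc r 1, hq lam t * ‖g t‖ ≤ φ t) : ‖f r‖ ≤ ‖f 1‖ + ∫ t in r..1, φ t := by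
  have e := IsPrim.integral_eq h hr zero_lt_one
  have h2 : ‖∫ t in r..1, (hq lam t : ℂ) * g t‖ ≤ ∫ t in r..1, φ t := by
    refine intervalIntegral.norm_integral_le_of_norm_le hr1 ?_ hφ
    refine ae_of_all _ fun t ht => ?_
    rw [norm_mul, Complex.norm_real, Real.norm_eq_abs, abs_of_pos (hq_pos hl (hr.trans ht.1))]
    exact hb t ht
  have e3 : f r = f 1 - ∫ t in r..1, (hq lam t : ℂ) * g t := by rw [e]; ring
  rw [e3]
  exact (norm_sub_le _ _).trans (by linarith)

lemma integral_inv_pow_le {r : ℝ} (hr : 0 < r) (hr1 : r ≤ 1) {k : ℕ} (hk : 1 ≤ k) :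
    IntervalIntegrable (fun t : ℝ => (1 / t) ^ (k + 1)) volume r 1 ∧
      ∫ t in r..1, (1 / t) ^ (k + 1) ≤ (1 / r) ^ k := by
  have h0 : (0 : ℝ) ∉ uIcc r 1 := by
    rw [uIcc_of_le hr1]; exact fun h => absurd h.1 (not_le.2 hr)
  have e : (fun t : ℝ => (1 / t) ^ (k + 1)) = fun t : ℝ => t ^ (-((k : ℤ) + 1)) := by
    funext t
    rw [zpow_neg, one_div, inv_pow]; norm_cast
  constructor
  · rw [e]
    exact intervalIntegral.intervalIntegrable_zpow (Or.inr h0)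
  · rw [e, integral_zpow (Or.inr ⟨by omega, h0⟩)]
    have e2 : (-((k : ℤ) + 1) + 1) = -(k : ℤ) := by ring
    have e3 : ((-((k : ℤ) + 1) : ℤ) : ℝ) + 1 = -(k : ℝ) := by push_cast; ring
    rw [e2, e3, one_zpow, zpow_neg, zpow_natCast, one_div, inv_pow]
    have hk' : (1 : ℝ) ≤ k := by exact_mod_cast hk
    rw [div_neg, ← neg_div, div_le_iff₀ (by linarith)]
    have : (0 : ℝ) ≤ (r ^ k)⁻¹ := by positivity
    nlinarith

lemma IsTower.norm_one_le (hn : 1 ≤ n) (hl : 0 < lam) (hl1 : lam ≤ 1)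
    (hG : IsTower n lam M G) {i : ℕ} (hi : i + 1 ≤ M) {N : ℝ} (hN : 0 < N)
    (hGN : towerSq n lam M G ≤ N ^ 2) : ∀ r, 1 ≤ r →
      hq lam r ^ i * ‖G i r‖ ≤ (4 * M + 3) * N := by
  intro r hr
  have h := hG.norm_sq_le_of_one_le hn hl hl1 hi hr
  have hiM : (i : ℝ) ≤ M := by exact_mod_cast (by omega : i ≤ M)
  have hi0 : (0 : ℝ) ≤ i := by positivity
  have hT := towerSq_nonneg (n := n) (lam := lam) (M := M) G
  refine le_of_sq_le_sq ?_ (by positivity)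
  have h1 : (4 * (i : ℝ) + 3) * towerSq n lam M G ≤ (4 * M + 3) * N ^ 2 := by gcongr
  have h2 : (4 * (M : ℝ) + 3) * N ^ 2 ≤ ((4 * M + 3) * N) ^ 2 := by
    rw [mul_pow]
    refine mul_le_mul_of_nonneg_right ?_ (by positivity)
    nlinarith
  linarith

/-- Downward induction on the order of the derivative. The entry M − 1 gets a crude power of 1/r
from the L² bound on the entry M; each further integration of hq G, with hq ≤ 2r, removes two
powers, as long as the exponent stays at least 1. -/
lemma IsTower.exists_norm_le_small (n M : ℕ) (hn : 1 ≤ n) (l : ℕ) (hM : l + 1 ≤ M) :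
    ∃ C : ℝ, 0 ≤ C ∧ ∀ (lam : ℝ) (G : ℕ → ℝ → ℂ) (N : ℝ), 0 < lam → lam ≤ 1 →
      IsTower n lam M G → 0 < N → towerSq n lam M G ≤ N ^ 2 → ∀ r, 0 < r → r ≤ 1 →
      ‖G (M - 1 - l) r‖ ≤ C * N * (1 / r) ^ (max 1 (n + M - 2 * l)) := by
  have hone : ∀ i, i + 1 ≤ M → ∀ (lam : ℝ) (G : ℕ → ℝ → ℂ) (N : ℝ), 0 < lam → lam ≤ 1 →
      IsTower n lam M G → 0 < N → towerSq n lam M G ≤ N ^ 2 → ∀ x : ℝ, 1 ≤ x → ∀ k : ℕ,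
      ‖G i 1‖ ≤ (4 * M + 3) * N * x ^ k := by
    intro i hi lam G N hl hl1 hG hN hGN x hx k
    have h := hG.norm_one_le hn hl hl1 hi hN hGN 1 le_rfl
    have h1 : 1 ≤ hq lam 1 ^ i := one_le_pow₀ (le_hq hl zero_le_one)
    have h2 : ‖G i 1‖ ≤ hq lam 1 ^ i * ‖G i 1‖ := le_mul_of_one_le_left (norm_nonneg _) h1
    exact (h2.trans h).trans (le_mul_of_one_le_right (by positivity) (one_le_pow₀ hx))
  induction l with
  | zero =>
    refine ⟨4 * M + 4, by positivity, fun lam G N hl hl1 hG hN hGN r hr hr1 => ?_⟩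
    have hm : max 1 (n + M - 2 * 0) = n + M := by omega
    have hMe : M - 1 + 1 = M := by omega
    rw [hm, Nat.sub_zero]
    have hD := hG.isD (M - 1) (by omega)
    rw [hMe] at hD
    set P := n + M
    have hx : 1 ≤ 1 / r := by rw [le_div_iff₀ hr]; linarith
    set w : ℝ → ℝ := fun r => hq lam r ^ (n - 1) * (hq lam r ^ (2 * M) * ‖G M r‖ ^ 2) with hw
    have hwI : IntegrableOn w (Ioi 0) := hG.integrableOn_level hn hl le_rfl
    have hw0 : ∀ t, 0 < t → 0 ≤ w t := fun t h => by
      have := hq_pos hl h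
      simp only [hw]; positivity
    have hsub : Ioc r 1 ⊆ Ioi 0 := fun t ht => hr.trans ht.1
    have hwii : IntervalIntegrable w volume r 1 := by
      rw [intervalIntegrable_iff_integrableOn_Ioc_of_le hr1]
      exact hwI.mono_set hsub
    have hwle : ∫ t in r..1, w t ≤ N ^ 2 := by
      rw [intervalIntegral.integral_of_le hr1]
      refine (setIntegral_mono_set hwI ((ae_restrict_iff' measurableSet_Ioi).2
        (ae_of_all _ hw0)) (ae_of_all _ fun _ hx => hsub hx)).trans ?_
      rw [hw, ← radialSq_level hn hl]
      exact (radialSq_le_towerSq G le_rfl).trans hGN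
    have hr1P : (1 / r) ^ P * r ^ P = 1 := by rw [← mul_pow, one_div_mul_cancel hr.ne', one_pow]
    -- Young's inequality in place of Cauchy-Schwarz, weighted so that both terms integrate to at
    -- most N (1/r)^P / 2.
    have hb : ∀ t ∈ Ioc r 1, hq lam t * ‖G M t‖ ≤
        (1 / r) ^ P / (2 * N) * w t + N * (1 / r) ^ P / 2 := by
      intro t ht
      have ht0 : 0 < t := hr.trans ht.1
      have hqt := hq_pos hl ht0
      have hrq : r ≤ hq lam t := ht.1.le.trans (le_hq hl ht0.le)
      have h1 : r ^ (2 * P) ≤ hq lam t ^ (n - 1 + 2 * M - 2) :=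
        (pow_le_pow_of_le_one hr.le hr1 (by omega)).trans (pow_le_pow_left₀ hr.le hrq _)
      have h2 : r ^ (2 * P) * (hq lam t * ‖G M t‖) ^ 2 ≤ w t := by
        have e : w t = hq lam t ^ (n - 1 + 2 * M - 2) * (hq lam t * ‖G M t‖) ^ 2 := by
          have e1 : hq lam t ^ (n - 1 + 2 * M) = hq lam t ^ (n - 1 + 2 * M - 2) * hq lam t ^ 2 := by
            rw [← pow_add]; congr 1; omega
          simp only [hw]
          rw [← mul_assoc, ← pow_add, e1]; ring
        rw [e]
        exact mul_le_mul_of_nonneg_right h1 (by positivity)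
      set a := hq lam t * ‖G M t‖
      set X := (1 / r) ^ P
      have hX : 0 < X := by positivity
      have hXr : X * r ^ P = 1 := hr1P
      have h3 : a ^ 2 ≤ X ^ 2 * w t := by
        calc a ^ 2 = X ^ 2 * (r ^ (2 * P) * a ^ 2) := by
              rw [pow_mul', ← mul_assoc, ← mul_pow, hXr]; ring
          _ ≤ _ := by gcongr
      have h4 : X / (2 * N) * w t = X ^ 2 * w t / (2 * N * X) := by field_simp
      have h5 : a ≤ a ^ 2 / (2 * N * X) + N * X / 2 := by
        rw [← sub_nonneg]
        have : a ^ 2 / (2 * N * X) + N * X / 2 - a = (a - N * X) ^ 2 / (2 * N * X) := by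
          field_simp; ring
        rw [this]; positivity
      rw [h4]
      refine h5.trans ?_
      gcongr
    have hle := hD.norm_le_integral hl hr hr1
      ((hwii.const_mul ((1 / r) ^ P / (2 * N))).add
        (intervalIntegrable_const (c := N * (1 / r) ^ P / 2))) hb
    rw [intervalIntegral.integral_add (hwii.const_mul _) intervalIntegrable_const,
      intervalIntegral.integral_const_mul, intervalIntegral.integral_const, smul_eq_mul] at hle
    have h1 := hone (M - 1) (by omega) lam G N hl hl1 hG hN hGN (1 / r) hx P
    have h2 : (1 / r) ^ P / (2 * N) * ∫ t in r..1, w t ≤ (1 / r) ^ P / (2 * N) * N ^ 2 := by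
      gcongr
    have h3 : (1 / r) ^ P / (2 * N) * N ^ 2 = N * (1 / r) ^ P / 2 := by field_simp
    have h4 : (1 - r) * (N * (1 / r) ^ P / 2) ≤ 1 * (N * (1 / r) ^ P / 2) := by
      gcongr; linarith
    refine hle.trans ?_
    nlinarith
  | succ l ih =>
    obtain ⟨C, hC, ih⟩ := ih (by omega)
    refine ⟨4 * M + 3 + 2 * C, by positivity, fun lam G N hl hl1 hG hN hGN r hr hr1 => ?_⟩
    have hD := hG.isD (M - 1 - (l + 1)) (by omega)
    have e1 : M - 1 - (l + 1) + 1 = M - 1 - l := by omega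
    rw [e1] at hD
    set p := max 1 (n + M - 2 * l)
    -- Keeping the exponent at least 1 avoids a logarithm in the integral of (1/t)^(k+1).
    set k := max 1 (n + M - 2 * (l + 1))
    have hk : 1 ≤ k := le_max_left _ _
    have hpk : p ≤ k + 2 := by omega
    obtain ⟨i1, i2⟩ := integral_inv_pow_le hr hr1 hk
    have hb : ∀ t ∈ Ioc r 1, hq lam t * ‖G (M - 1 - l) t‖ ≤ 2 * C * N * (1 / t) ^ (k + 1) := by
      intro t ht
      have ht0 : 0 < t := hr.trans ht.1
      have h1 := ih lam G N hl hl1 hG hN hGN t ht0 ht.2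
      have hx : 1 ≤ 1 / t := by rw [le_div_iff₀ ht0]; linarith [ht.2]
      have h2 : (1 / t) ^ p ≤ (1 / t) ^ (k + 2) := pow_le_pow_right₀ hx hpk
      calc hq lam t * ‖G (M - 1 - l) t‖ ≤ (2 * t) * (C * N * (1 / t) ^ (k + 2)) := by
            refine mul_le_mul (hq_le_two_mul hl hl1 ht0.le ht.2) (h1.trans ?_) (norm_nonneg _)
              (by positivity)
            gcongr
        _ = 2 * C * N * (1 / t) ^ (k + 1) := by
            rw [pow_succ (1 / t) (k + 1)]; field_simp
    have hle := hD.norm_le_integral hl hr hr1 (i1.const_mul (2 * C * N)) hb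
    rw [intervalIntegral.integral_const_mul] at hle
    have hx : 1 ≤ 1 / r := by rw [le_div_iff₀ hr]; linarith
    have h1 := hone (M - 1 - (l + 1)) (by omega) lam G N hl hl1 hG hN hGN (1 / r) hx k
    have h2 : 2 * C * N * ∫ t in r..1, (1 / t) ^ (k + 1) ≤ 2 * C * N * (1 / r) ^ k := by gcongr
    refine hle.trans ?_
    nlinarith

end Sobolev

/-! ### The Sobolev embedding and the algebra property. -/

section Product

variable {n M : ℕ} {lam : ℝ} {G H : ℕ → ℝ → ℂ}

/-- For i ≥ 1 the hypotheses give n + 2 + 2i − M ≤ i, so the singularity left by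
`IsTower.exists_norm_le_small` is at most r^(-i) and is absorbed by hq^i. For i = 0 the remaining
power 1/r is not absorbed; one integrates the bound for i = 1 instead. -/
lemma IsTower.exists_norm_le_aux (n M : ℕ) (hn : 2 ≤ n) (hM : 2 * n + 4 ≤ M) (i : ℕ)
    (hi : 2 * i ≤ M) : ∃ C : ℝ, 0 ≤ C ∧ ∀ (lam : ℝ) (G : ℕ → ℝ → ℂ) (N : ℝ), 0 < lam → lam ≤ 1 →
      IsTower n lam M G → 0 < N → towerSq n lam M G ≤ N ^ 2 → ∀ r, 0 < r →
      hq lam r ^ i * ‖G i r‖ ≤ C * N := by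
  have hpos : ∀ i, 2 * i ≤ M → 1 ≤ i → ∃ C : ℝ, 0 ≤ C ∧ ∀ (lam : ℝ) (G : ℕ → ℝ → ℂ) (N : ℝ),
      0 < lam → lam ≤ 1 → IsTower n lam M G → 0 < N → towerSq n lam M G ≤ N ^ 2 → ∀ r, 0 < r →
      hq lam r ^ i * ‖G i r‖ ≤ C * N := by
    intro i hi hi1
    obtain ⟨C, hC, h⟩ := IsTower.exists_norm_le_small n M (by omega) (M - 1 - i) (by omega)
    refine ⟨4 * M + 3 + 2 ^ i * C, by positivity, fun lam G N hl hl1 hG hN hGN r hr => ?_⟩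
    rcases le_total 1 r with hr1 | hr1
    · refine (hG.norm_one_le (by omega) hl hl1 (by omega) hN hGN r hr1).trans ?_
      have : 0 ≤ 2 ^ i * C * N := by positivity
      nlinarith
    · have h1 := h lam G N hl hl1 hG hN hGN r hr hr1
      rw [show M - 1 - (M - 1 - i) = i by omega] at h1
      set p := max 1 (n + M - 2 * (M - 1 - i))
      have hp : p ≤ i := by omega
      have hx : 1 ≤ 1 / r := by rw [le_div_iff₀ hr]; linarith
      have h2 : (1 / r) ^ p ≤ (1 / r) ^ i := pow_le_pow_right₀ hx hp
      have h3 : hq lam r ^ i ≤ (2 * r) ^ i :=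
        pow_le_pow_left₀ (hq_pos hl hr).le (hq_le_two_mul hl hl1 hr.le hr1) i
      calc hq lam r ^ i * ‖G i r‖ ≤ (2 * r) ^ i * (C * N * (1 / r) ^ i) := by
            refine mul_le_mul h3 (h1.trans ?_) (norm_nonneg _) (by positivity)
            gcongr
        _ = 2 ^ i * C * N := by
            have : r ^ i * (1 / r) ^ i = 1 := by rw [← mul_pow, mul_one_div_cancel hr.ne', one_pow]
            rw [mul_pow]
            linear_combination 2 ^ i * C * N * this
        _ ≤ _ := by
            have : 0 ≤ (4 * (M : ℝ) + 3) * N := by positivity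
            nlinarith
  rcases Nat.eq_zero_or_pos i with h0 | h0
  · subst h0
    obtain ⟨C, hC, h⟩ := hpos 1 (by omega) le_rfl
    refine ⟨4 * M + 3 + C, by positivity, fun lam G N hl hl1 hG hN hGN r hr => ?_⟩
    have hone := hG.norm_one_le (by omega) hl hl1 (show 0 + 1 ≤ M by omega) hN hGN
    simp only [pow_zero, one_mul] at hone ⊢
    rcases le_total 1 r with hr1 | hr1
    · refine (hone r hr1).trans ?_
      have : 0 ≤ C * N := by positivity
      nlinarith
    · have hle := (hG.isD 0 (by omega)).norm_le_integral hl hr hr1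
        (intervalIntegrable_const (c := C * N)) (fun t ht => by
          have := h lam G N hl hl1 hG hN hGN t (hr.trans ht.1)
          simpa using this)
      rw [intervalIntegral.integral_const, smul_eq_mul] at hle
      have h1 := hone 1 le_rfl
      have h2 : (1 - r) * (C * N) ≤ 1 * (C * N) := by gcongr; linarith
      refine hle.trans ?_
      nlinarith
  · exact hpos i hi h0

/-- Sobolev embedding, for the lower half of the derivatives of a tower. -/
lemma IsTower.exists_norm_le (n M : ℕ) (hn : 2 ≤ n) (hM : 2 * n + 4 ≤ M) :
    ∃ C : ℝ, 0 < C ∧ ∀ (lam : ℝ) (G : ℕ → ℝ → ℂ) (N : ℝ), 0 < lam → lam ≤ 1 →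
      IsTower n lam M G → 0 ≤ N → towerSq n lam M G ≤ N ^ 2 → ∀ i, 2 * i ≤ M → ∀ r, 0 < r →
      hq lam r ^ i * ‖G i r‖ ≤ C * N := by
  choose! C hC h using IsTower.exists_norm_le_aux n M hn hM
  refine ⟨1 + ∑ i ∈ Finset.range (M + 1), |C i|, by positivity,
    fun lam G N hl hl1 hG hN hGN i hi r hr => ?_⟩
  have h0 : C i ≤ 1 + ∑ i ∈ Finset.range (M + 1), |C i| := by
    have := Finset.single_le_sum (f := fun i => |C i|) (fun _ _ => abs_nonneg _)
      (Finset.mem_range.2 (by omega : i < M + 1))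
    linarith [le_abs_self (C i)]
  -- The auxiliary bound is for N > 0; enlarging N slightly includes N = 0.
  refine le_of_forall_pos_le_add fun δ hδ => ?_
  set K := 1 + ∑ i ∈ Finset.range (M + 1), |C i|
  have hK : 0 < K := by positivity
  have hN' : 0 < N + δ / K := by positivity
  have h1 := h i hi lam G (N + δ / K) hl hl1 hG hN'
    (hGN.trans (pow_le_pow_left₀ hN (by linarith [show 0 < δ / K by positivity]) 2)) r hr
  refine h1.trans ?_
  calc C i * (N + δ / K) ≤ K * (N + δ / K) := by gcongr
    _ = K * N + δ := by field_simp

/-- The tower of a product, given by the Leibniz rule. -/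
def mulTower (G H : ℕ → ℝ → ℂ) (j : ℕ) (r : ℝ) : ℂ :=
  ∑ ij ∈ Finset.HasAntidiagonal.antidiagonal j,
    (j.choose ij.1 : ℂ) * (G ij.1 r * H ij.2 r)

/-- D is a derivation, and Pascal's rule recombines the binomial coefficients. -/
lemma isD_mulTower {j : ℕ} (hG : ∀ i ≤ j, IsD lam (G i) (G (i + 1)))
    (hH : ∀ i ≤ j, IsD lam (H i) (H (i + 1))) :
    IsD lam (mulTower G H j) (mulTower G H (j + 1)) := by
  have h := IsD.sum (lam := lam) (Finset.HasAntidiagonal.antidiagonal j)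
    (F := fun ij r => (j.choose ij.1 : ℂ) * (G ij.1 r * H ij.2 r))
    (F' := fun ij r => (j.choose ij.1 : ℂ) * (G (ij.1 + 1) r * H ij.2 r + G ij.1 r * H (ij.2 + 1) r))
    (fun ij hij => by
      have := Finset.HasAntidiagonal.mem_antidiagonal.1 hij
      exact ((hG ij.1 (by omega)).mul (hH ij.2 (by omega))).const_mul _)
  refine h.congr (fun r _ => rfl) (ae_of_all _ fun r _ => ?_)
  have e := Finset.sum_antidiagonal_choose_succ_mul (R := ℂ) (fun a b => G a r * H b r) j
  simp only [mulTower]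
  rw [e, ← Finset.sum_add_distrib]
  refine Finset.sum_congr rfl fun ij hij => ?_
  rw [Nat.choose_symm_of_eq_add (Finset.HasAntidiagonal.mem_antidiagonal.1 hij).symm]
  ring

lemma radialSq_sum_le {ι : Type*} (s : Finset ι) {f : ι → ℝ → ℂ}
    (hf : ∀ i ∈ s, MemLp (f i) 2 (radialMeasure n lam)) :
    radialSq n lam (fun r => ∑ i ∈ s, f i r) ≤ s.card * ∑ i ∈ s, radialSq n lam (f i) := by
  unfold radialSq
  rw [← integral_finsetSum s fun i hi => (hf i hi).integrable_norm_pow two_ne_zero,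
    ← integral_const_mul]
  refine integral_mono ((memLp_finsetSum s hf).integrable_norm_pow two_ne_zero)
    ((integrable_finsetSum s fun i hi => (hf i hi).integrable_norm_pow two_ne_zero).const_mul _)
    fun r => ?_
  calc ‖∑ i ∈ s, f i r‖ ^ 2 ≤ (∑ i ∈ s, ‖f i r‖) ^ 2 := by
        gcongr; exact norm_sum_le _ _
    _ ≤ _ := sq_sum_le_card_mul_sum_sq

lemma memLp_mul_of_norm_le (hl : 0 < lam) {f g : ℝ → ℂ} {A : ℝ}
    (hfm : AEStronglyMeasurable f (radialMeasure n lam)) (hf : ∀ r, 0 < r → ‖f r‖ ≤ A)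
    (hg : MemLp g 2 (radialMeasure n lam)) :
    MemLp (fun r => f r * g r) 2 (radialMeasure n lam) ∧
      radialSq n lam (fun r => f r * g r) ≤ A ^ 2 * radialSq n lam g := by
  have hA : 0 ≤ A := (norm_nonneg _).trans (hf 1 one_pos)
  have hb : ∀ᵐ r ∂(radialMeasure n lam), ‖f r * g r‖ ≤ ‖(A : ℂ) * g r‖ :=
    ae_radial_of_forall hl fun r hr => by
      rw [norm_mul, norm_mul, Complex.norm_real, Real.norm_eq_abs, abs_of_nonneg hA]
      gcongr
      exact hf r hr
  refine ⟨(hg.const_mul (A : ℂ)).mono (hfm.mul hg.1) hb, ?_⟩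
  refine (radialSq_mono (hg.const_mul (A : ℂ)) hb).trans (le_of_eq ?_)
  rw [radialSq_const_mul, Complex.norm_real, Real.norm_eq_abs, abs_of_nonneg hA]

/-- The tower norm is an algebra norm up to a constant. -/
lemma IsTower.exists_mulTower (n M : ℕ) (hn : 2 ≤ n) (hM : 2 * n + 4 ≤ M) :
    ∃ C : ℝ, 0 < C ∧ ∀ (lam : ℝ) (G H : ℕ → ℝ → ℂ) (A B : ℝ), 0 < lam → lam ≤ 1 →
      IsTower n lam M G → IsTower n lam M H → 0 ≤ A → 0 ≤ B → towerSq n lam M G ≤ A ^ 2 →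
      towerSq n lam M H ≤ B ^ 2 → IsTower n lam M (mulTower G H) ∧
        towerSq n lam M (mulTower G H) ≤ (C * (A * B)) ^ 2 := by
  obtain ⟨C, hC, hS⟩ := IsTower.exists_norm_le n M hn hM
  refine ⟨(M + 1) ^ 2 * 2 ^ M * C, by positivity,
    fun lam G H A B hl hl1 hG hH hA hB hGA hHB => ?_⟩
  have hterm : ∀ j ≤ M, ∀ ij ∈ Finset.HasAntidiagonal.antidiagonal j,
      MemLp (fun r => (hq lam r : ℂ) ^ j * ((j.choose ij.1 : ℂ) * (G ij.1 r * H ij.2 r))) 2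
        (radialMeasure n lam) ∧ radialSq n lam
        (fun r => (hq lam r : ℂ) ^ j * ((j.choose ij.1 : ℂ) * (G ij.1 r * H ij.2 r))) ≤
        (2 ^ M * C * (A * B)) ^ 2 := by
    intro j hj ij hij
    have hsum := Finset.HasAntidiagonal.mem_antidiagonal.1 hij
    obtain ⟨a, b⟩ := ij
    simp only at hsum ⊢
    have hGm := hG.memLp_pow (by omega) hl (show a ≤ M by omega)
    have hHm := hH.memLp_pow (by omega) hl (show b ≤ M by omega)
    have hGs := (radialSq_le_towerSq (n := n) (lam := lam) G (show a ≤ M by omega)).trans hGA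
    have hHs := (radialSq_le_towerSq (n := n) (lam := lam) H (show b ≤ M by omega)).trans hHB
    rw [radialSq_shift (by omega) hl] at hGs hHs
    have hnorm : ∀ (K : ℕ → ℝ → ℂ) (c : ℕ) (r : ℝ), 0 < r →
        ‖(hq lam r : ℂ) ^ c * K c r‖ = hq lam r ^ c * ‖K c r‖ := by
      intro K c r hr
      rw [norm_mul, norm_pow, Complex.norm_real, Real.norm_eq_abs, abs_of_pos (hq_pos hl hr)]
    have key : MemLp (fun r => ((hq lam r : ℂ) ^ a * G a r) * ((hq lam r : ℂ) ^ b * H b r)) 2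
        (radialMeasure n lam) ∧ radialSq n lam
        (fun r => ((hq lam r : ℂ) ^ a * G a r) * ((hq lam r : ℂ) ^ b * H b r)) ≤
        (C * (A * B)) ^ 2 := by
      -- Since a + b = j ≤ M, one of the two indices is at most M/2; that factor is bounded by the
      -- Sobolev embedding, and the other stays in L².
      rcases le_total (2 * a) M with h | h
      · obtain ⟨h1, h2⟩ := memLp_mul_of_norm_le hl hGm.1 (A := C * A) (fun r hr => by
          rw [hnorm G a r hr]; exact hS lam G A hl hl1 hG hA hGA a h r hr) hHm
        refine ⟨h1, h2.trans ?_⟩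
        calc (C * A) ^ 2 * _ ≤ (C * A) ^ 2 * B ^ 2 := by gcongr
          _ = _ := by ring
      · obtain ⟨h1, h2⟩ := memLp_mul_of_norm_le hl hHm.1 (A := C * B) (fun r hr => by
          rw [hnorm H b r hr]; exact hS lam H B hl hl1 hH hB hHB b (by omega) r hr) hGm
        have e : (fun r => ((hq lam r : ℂ) ^ a * G a r) * ((hq lam r : ℂ) ^ b * H b r)) =
          fun r => ((hq lam r : ℂ) ^ b * H b r) * ((hq lam r : ℂ) ^ a * G a r) := by
          funext r; ring
        rw [e]
        refine ⟨h1, h2.trans ?_⟩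
        calc (C * B) ^ 2 * _ ≤ (C * B) ^ 2 * A ^ 2 := by gcongr
          _ = _ := by ring
    have e : (fun r => (hq lam r : ℂ) ^ j * ((j.choose a : ℂ) * (G a r * H b r))) =
        fun r => (j.choose a : ℂ) *
          (((hq lam r : ℂ) ^ a * G a r) * ((hq lam r : ℂ) ^ b * H b r)) := by
      funext r; rw [← hsum, pow_add]; ring
    rw [e]
    refine ⟨key.1.const_mul _, ?_⟩
    rw [radialSq_const_mul, Complex.norm_natCast]
    have hch : (j.choose a : ℝ) ≤ 2 ^ M := by
      have h1 : j.choose a ≤ 2 ^ j := Nat.choose_le_two_pow j a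
      have h2 : 2 ^ j ≤ 2 ^ M := Nat.pow_le_pow_right two_pos hj
      exact_mod_cast h1.trans h2
    calc (j.choose a : ℝ) ^ 2 * _ ≤ (2 ^ M) ^ 2 * (C * (A * B)) ^ 2 := by
          gcongr
          · exact radialSq_nonneg _
          · exact key.2
      _ = _ := by ring
  have hsumeq : ∀ j, (fun r => (hq lam r : ℂ) ^ j * mulTower G H j r) = fun r =>
      ∑ ij ∈ Finset.HasAntidiagonal.antidiagonal j,
        (hq lam r : ℂ) ^ j * ((j.choose ij.1 : ℂ) * (G ij.1 r * H ij.2 r)) := by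
    intro j; funext r; rw [mulTower, Finset.mul_sum]
  refine ⟨⟨fun j hj => isD_mulTower (fun i hi => hG.isD i (by omega))
    (fun i hi => hH.isD i (by omega)), fun j hj => ?_⟩, ?_⟩
  · rw [memLp_shift_iff (by omega) hl, hsumeq]
    exact memLp_finsetSum _ fun ij hij => (hterm j hj ij hij).1
  · have hj : ∀ j ∈ Finset.range (M + 1), radialSq (n + 2 * j) lam (mulTower G H j) ≤
        (M + 1) * ((M + 1) * (2 ^ M * C * (A * B)) ^ 2) := by
      intro j hj
      have hj : j ≤ M := by simpa [Nat.lt_succ_iff] using hj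
      rw [radialSq_shift (by omega) hl, hsumeq]
      refine (radialSq_sum_le _ fun ij hij => (hterm j hj ij hij).1).trans ?_
      have hcard : ((Finset.HasAntidiagonal.antidiagonal j).card : ℝ) ≤ M + 1 := by
        rw [Finset.Nat.card_antidiagonal]; exact_mod_cast (by omega : j + 1 ≤ M + 1)
      have h2 := Finset.sum_le_card_nsmul (Finset.HasAntidiagonal.antidiagonal j) _ _
        fun ij hij => (hterm j hj ij hij).2
      rw [nsmul_eq_mul] at h2
      have h3 : ((Finset.HasAntidiagonal.antidiagonal j).card : ℝ) * (2 ^ M * C * (A * B)) ^ 2 ≤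
        (M + 1) * (2 ^ M * C * (A * B)) ^ 2 := by gcongr
      exact mul_le_mul hcard (h2.trans h3)
        (Finset.sum_nonneg fun _ _ => radialSq_nonneg _) (by positivity)
    have h := Finset.sum_le_card_nsmul _ _ _ hj
    rw [nsmul_eq_mul, Finset.card_range] at h
    refine h.trans ?_
    push_cast
    have hM1 : (1 : ℝ) ≤ (M : ℝ) + 1 := by linarith [Nat.cast_nonneg (α := ℝ) M]
    have h4 : ((M : ℝ) + 1) ^ 3 ≤ (M + 1) ^ 4 := pow_le_pow_right₀ hM1 (by norm_num)
    calc ((M : ℝ) + 1) * ((M + 1) * ((M + 1) * (2 ^ M * C * (A * B)) ^ 2))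
        = (M + 1) ^ 3 * (2 ^ M * C * (A * B)) ^ 2 := by ring
      _ ≤ (M + 1) ^ 4 * (2 ^ M * C * (A * B)) ^ 2 := by gcongr
      _ = _ := by ring

end Product

/-! ### Elliptic regularity for the resolvent equation. -/

section Resolvent

variable {lam : ℝ}

lemma lapCoef_zero (n : ℕ) : lapCoef n 0 = 0 := by simp [lapCoef]

/-- Elliptic regularity: a weak solution of `(α - Δ) u = f` has two more derivatives than `f`. -/
lemma exists_tower_of_resolvent (hl : 0 < lam) (hl1 : lam ≤ 1) (M : ℕ) :
    ∀ (n : ℕ) (α : ℝ) (f : ℕ → ℝ → ℂ) (u₀ u₁ : ℝ → ℂ), 2 ≤ n → IsTower n lam M f →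
      IsD lam u₀ u₁ → MemLp u₀ 2 (radialMeasure n lam) →
      MemLp (fun r => (hq lam r : ℂ) ^ 1 * u₁ r) 2 (radialMeasure n lam) →
      IsPrim (fun r => (hq lam r : ℂ) ^ n * u₁ r)
        (fun r => (hq lam r : ℂ) ^ (n - 1) * (α * u₀ r - f 0 r)) →
      Tendsto (fun r => (hq lam r : ℂ) ^ n * u₁ r) (𝓝[>] 0) (𝓝 0) →
      ∃ G, IsTower n lam (M + 2) G ∧ G 0 = u₀ ∧ G 1 = u₁ ∧
        ∀ r, 0 < r → α * u₀ r - lapTower n lam G 0 r = f 0 r := by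
  induction M with
  | zero =>
    intro n α f u₀ u₁ hn hf hD h0 h1 hp hz
    have hrhs : MemLp (fun r => (α : ℂ) * u₀ r - f 0 r) 2 (radialMeasure n lam) :=
      (h0.const_mul _).sub (hf.memLp 0 le_rfl)
    obtain ⟨hD2, h2⟩ := isD_of_div hn hl hl1 hp hz h1 hrhs
    set u₂ : ℝ → ℂ := fun r =>
      ((α : ℂ) * u₀ r - f 0 r - n * (hc lam r : ℂ) * u₁ r) / (hq lam r : ℂ) ^ 2 with hu₂
    let G : ℕ → ℝ → ℂ := fun j => match j with | 0 => u₀ | 1 => u₁ | _ => u₂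
    refine ⟨G, ⟨fun j hj => ?_, fun j hj => ?_⟩, rfl, rfl, fun r hr => ?_⟩
    · interval_cases j
      · exact hD
      · exact hD2
    · interval_cases j
      · exact h0
      · exact (memLp_shift_iff (by omega) hl 1).2 h1
      · exact (memLp_shift_iff (by omega) hl 2).2 h2
    · have := hq_cast_ne_zero hl hr
      simp only [lapTower, lapCoef_zero, G, hu₂]
      push_cast
      field_simp
      ring
  | succ M ih =>
    intro n α f u₀ u₁ hn hf hD h0 h1 hp hz
    have hf0 := hf.memLp 0 (by omega)
    have hrhs : MemLp (fun r => (α : ℂ) * u₀ r - f 0 r) 2 (radialMeasure n lam) :=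
      (h0.const_mul _).sub hf0
    obtain ⟨hD2, h2⟩ := isD_of_div hn hl hl1 hp hz h1 hrhs
    -- The equation, written as hq² u₂ + n hc u₁ = α u₀ − f 0, leaves no other choice for the second
    -- derivative.
    set u₂ : ℝ → ℂ := fun r =>
      ((α : ℂ) * u₀ r - f 0 r - n * (hc lam r : ℂ) * u₁ r) / (hq lam r : ℂ) ^ 2 with hu₂
    have hfd := hf.isD 0 (by omega)
    have hq2 : ∀ r, 0 < r → (hq lam r : ℂ) ^ (n + 2) * u₂ r =
        ((hq lam r : ℂ) ^ n * (α * u₀ r - f 0 r)) -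
          (n * ((hc lam r : ℂ) * ((hq lam r : ℂ) ^ n * u₁ r))) := by
      intro r hr
      have := hq_cast_ne_zero hl hr
      simp only [hu₂]
      field_simp
      ring
    -- Applying D to (α − Δ)u = f in dimension n gives the same equation for u₁ in dimension n + 2,
    -- with α − n lam² in place of α. For this reason the induction runs over all n and α.
    have hp2 : IsPrim (fun r => (hq lam r : ℂ) ^ (n + 2) * u₂ r) (fun r => (hq lam r : ℂ) ^
        (n + 2 - 1) * (((α - n * lam ^ 2 : ℝ) : ℂ) * u₁ r - (fun j => f (j + 1)) 0 r)) := by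
      have hA := (IsPrim.hq_pow hl n).mul ((IsPrim.const_mul (α : ℂ) hD).sub hfd)
      have hB := ((IsPrim.hc hl).mul hp).const_mul (n : ℂ)
      refine (hA.sub hB).congr (fun r hr => (hq2 r hr).symm) (ae_of_all _ fun r hr => ?_)
      have e1 : (hq lam r : ℂ) ^ (n + 2 - 1) = (hq lam r : ℂ) ^ n * (hq lam r : ℂ) := by
        rw [← pow_succ]; congr 1
      rw [e1]
      push_cast
      ring
    -- The new flux is a combination of hq^n u₀, hq^n f 0 and the old flux, each of which vanishes
    -- at the origin.
    have hz2 : Tendsto (fun r => (hq lam r : ℂ) ^ (n + 2) * u₂ r) (𝓝[>] 0) (𝓝 0) := by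
      have hu := hD.tendsto_pow_mul hn hl hl1 h0 h1
      have hff := hfd.tendsto_pow_mul hn hl hl1 hf0 (hf.memLp_pow (by omega) hl (by omega))
      have hcc : Tendsto (fun r => (hc lam r : ℂ)) (𝓝[>] 0) (𝓝 (hc lam 0 : ℂ)) :=
        ((Complex.continuous_ofReal.comp continuous_hc).tendsto 0).mono_left nhdsWithin_le_nhds
      have h3 := ((hu.const_mul (α : ℂ)).sub hff).sub ((hcc.mul hz).const_mul (n : ℂ))
      simp only [mul_zero, sub_zero] at h3
      refine h3.congr' ?_
      filter_upwards [self_mem_nhdsWithin] with r hr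
      rw [hq2 r hr]
      ring
    have hu1 : MemLp u₁ 2 (radialMeasure (n + 2) lam) :=
      (memLp_shift_iff (by omega) hl 1).2 h1
    have hu2 : MemLp (fun r => (hq lam r : ℂ) ^ 1 * u₂ r) 2 (radialMeasure (n + 2) lam) := by
      have : MemLp u₂ 2 (radialMeasure (n + 2 + 2 * 1) lam) :=
        (memLp_shift_iff (by omega) hl 2).2 h2
      exact (memLp_shift_iff (by omega) hl 1).1 this
    obtain ⟨G', hG', hG0, hG1, -⟩ := ih (n + 2) (α - n * lam ^ 2) (fun j => f (j + 1)) u₁ u₂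
      (by omega) hf.tail hD2 hu1 hu2 hp2 hz2
    let G : ℕ → ℝ → ℂ := fun j => match j with | 0 => u₀ | j + 1 => G' j
    refine ⟨G, ⟨fun j hj => ?_, fun j hj => ?_⟩, rfl, hG0, fun r hr => ?_⟩
    · rcases j with _ | j
      · show IsD lam u₀ (G' 0)
        rw [hG0]; exact hD
      · exact hG'.isD j (by omega)
    · rcases j with _ | j
      · exact h0
      · have := hG'.memLp j (by omega)
        rwa [show n + 2 + 2 * j = n + 2 * (j + 1) by ring] at this
    · have := hq_cast_ne_zero hl hr
      simp only [lapTower, lapCoef_zero, G, hG0, hG1, hu₂]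
      push_cast
      field_simp
      ring

end Resolvent

/-! ### The Hilbert space of towers. -/

section TowerSpace

variable {n M : ℕ} {lam : ℝ} {G H : ℕ → ℝ → ℂ}

/-- The ℓ² sum provides an inner product whose square norm is `towerSq`. -/
abbrev TowerAmbient (n : ℕ) (lam : ℝ) (M : ℕ) : Type :=
  PiLp 2 (fun j : Fin (M + 1) => Lp ℂ 2 (radialMeasure (n + 2 * (j : ℕ)) lam))

/-- `F` consists of the classes of the functions of the tower `G`. -/
structure Represents (F : TowerAmbient n lam M) (G : ℕ → ℝ → ℂ) : Prop where
  isTower : IsTower n lam M G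
  ae_eq : ∀ j : Fin (M + 1), F j =ᵐ[radialMeasure (n + 2 * (j : ℕ)) lam] G j

lemma Represents.add {E F : TowerAmbient n lam M} (hE : Represents E G) (hF : Represents F H) :
    Represents (E + F) (fun j r => G j r + H j r) :=
  ⟨hE.isTower.add hF.isTower, fun j => by
    have h : (E + F) j = E j + F j := rfl
    rw [h]
    filter_upwards [Lp.coeFn_add (E j) (F j), hE.ae_eq j, hF.ae_eq j] with r h1 h2 h3
    rw [h1, Pi.add_apply, h2, h3]⟩

lemma Represents.smul {E : TowerAmbient n lam M} (a : ℂ) (hE : Represents E G) :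
    Represents (a • E) (fun j r => a * G j r) :=
  ⟨hE.isTower.const_mul a, fun j => by
    have h : (a • E) j = a • E j := rfl
    rw [h]
    filter_upwards [Lp.coeFn_smul a (E j), hE.ae_eq j] with r h1 h2
    rw [h1, Pi.smul_apply, h2, smul_eq_mul]⟩

lemma Represents.zero : Represents (0 : TowerAmbient n lam M) (fun _ _ => 0) :=
  ⟨IsTower.zero, fun _ => Lp.coeFn_zero _ _ _⟩

/-- The Sobolev space of radial functions all of whose first `M` derivatives are square
integrable. -/
def towerSpace (n : ℕ) (lam : ℝ) (M : ℕ) : Submodule ℂ (TowerAmbient n lam M) where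
  carrier := {F | ∃ G, Represents F G}
  add_mem' := fun ⟨_, hG⟩ ⟨_, hH⟩ => ⟨_, hG.add hH⟩
  zero_mem' := ⟨_, Represents.zero⟩
  smul_mem' := fun a _ ⟨_, hG⟩ => ⟨_, hG.smul a⟩

lemma tsupport_mul_subset_left' {η φ : ℝ → ℝ} (h : tsupport η ⊆ Ioi 0) :
    tsupport (fun r => η r * φ r) ⊆ Ioi 0 :=
  (tsupport_mul_subset_left (f := η) (g := φ)).trans h

/-- Dividing a test function by the density turns its unweighted pairing with F into an inner
product of L², hence into a continuous functional. -/
lemma memLp_test (hl : 0 < lam) {η : ℝ → ℝ} (hη : ContDiff ℝ ∞ η) (hsp : HasCompactSupport η)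
    (hs : tsupport η ⊆ Ioi 0) :
    MemLp (fun r => ((η r / hq lam r ^ (n - 1) : ℝ) : ℂ)) 2 (radialMeasure n lam) := by
  obtain ⟨a, b, ha, hab, hsub⟩ := exists_tsupport_subset_Icc hsp hs
  have hcont : ContinuousOn (fun r => η r / hq lam r ^ (n - 1)) (Ioi 0) :=
    hη.continuous.continuousOn.div (continuous_hq.pow _).continuousOn
      fun r hr => pow_ne_zero _ (hq_ne_zero hl hr)
  rw [memLp_radial_iff hl]
  refine ⟨(Complex.continuous_ofReal.comp_continuousOn hcont).aestronglyMeasurable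
    measurableSet_Ioi, ?_⟩
  have hI : IntegrableOn (fun r => hq lam r ^ (n - 1) *
      ‖((η r / hq lam r ^ (n - 1) : ℝ) : ℂ)‖ ^ 2) (Icc a b) := by
    refine ContinuousOn.integrableOn_Icc ?_
    refine ((continuous_hq.pow _).continuousOn).mul (ContinuousOn.pow ?_ 2)
    exact (Complex.continuous_ofReal.comp_continuousOn
      (hcont.mono fun r hr => ha.trans_le hr.1)).norm
  refine (hI.integrable_of_forall_notMem_eq_zero ?_).integrableOn
  intro r hr
  rw [eq_zero_of_tsupport_subset hsub hr]
  simp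

lemma inner_test (hl : 0 < lam) {η : ℝ → ℝ} (h : MemLp (fun r =>
    ((η r / hq lam r ^ (n - 1) : ℝ) : ℂ)) 2 (radialMeasure n lam))
    (F : Lp ℂ 2 (radialMeasure n lam)) :
    inner ℂ (h.toLp _) F = ∫ r in Ioi (0 : ℝ), (η r : ℂ) * F r := by
  rw [MeasureTheory.L2.inner_def, ← integral_congr_ae (f := fun r =>
    ((η r / hq lam r ^ (n - 1) : ℝ) : ℂ) * F r), integral_radial hl]
  · refine setIntegral_congr_fun measurableSet_Ioi fun r hr => ?_
    have := hq_cast_ne_zero hl hr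
    simp only [Complex.real_smul]
    push_cast
    field_simp
  · filter_upwards [h.coeFn_toLp] with r hr
    rw [hr, RCLike.inner_apply, Complex.conj_ofReal, mul_comm]

/-- Membership becomes a family of linear equations continuous in F, so closedness is immediate. The
lemma of du Bois-Reymond rebuilds actual primitives from the weak equations. -/
lemma mem_towerSpace_iff (hl : 0 < lam) (F : TowerAmbient n lam M) :
    F ∈ towerSpace n lam M ↔ ∀ (j : ℕ) (hj : j < M) (η : ℝ → ℝ),
      ContDiff ℝ ∞ η → HasCompactSupport η → tsupport η ⊆ Ioi 0 →
      ∫ r in Ioi (0 : ℝ), ((deriv η r : ℝ) : ℂ) * F ⟨j, by omega⟩ r =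
        -∫ r in Ioi (0 : ℝ), ((η r * hq lam r : ℝ) : ℂ) * F ⟨j + 1, by omega⟩ r := by
  constructor
  · rintro ⟨G, hG, hae⟩ j hj η hη hsp hs
    obtain ⟨a, b, ha, hab, hsub⟩ := exists_tsupport_subset_Icc hsp hs
    have h := IsPrim.integral_test (hG.isD j hj) hη ha hab hsub
    have h0 := (ae_radial_iff hl).1 (hae ⟨j, by omega⟩)
    have h1 := (ae_radial_iff hl).1 (hae ⟨j + 1, by omega⟩)
    rw [integral_congr_ae (g := fun r => ((deriv η r : ℝ) : ℂ) * G j r)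
      (h0.mono fun r hr => by simp only [hr]), h]
    congr 1
    refine integral_congr_ae (h1.mono fun r hr => ?_)
    simp only [hr]
    push_cast
    ring
  · intro h
    have hint : ∀ (j : Fin (M + 1)) (x y : ℝ), 0 < x → 0 < y →
        IntervalIntegrable (F j) volume x y := fun j x y hx hy =>
      (Lp.memLp (F j)).intervalIntegrable_of_pos hl hx hy
    have hex : ∀ j : ℕ, ∀ hj : j < M, ∃ P : ℝ → ℂ,
        (∀ᵐ x, 0 < x → F ⟨j, by omega⟩ x = P x) ∧
        IsPrim P (fun r => (hq lam r : ℂ) * F ⟨j + 1, by omega⟩ r) := by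
      intro j hj
      refine exists_isPrim_of_weak (hint _) (fun x y hx hy => ?_) fun η hη hsp hs => ?_
      · exact (hint _ x y hx hy).continuousOn_mul
          (Complex.continuous_ofReal.comp continuous_hq).continuousOn
      · rw [h j hj η hη hsp hs]
        congr 1
        refine integral_congr_ae (ae_of_all _ fun r => ?_)
        push_cast; ring
    choose P hP1 hP2 using hex
    -- The top entry is the derivative of the entry below but need not have a derivative itself, so
    -- any representative of its class will do.
    let G : ℕ → ℝ → ℂ := fun j =>
      if hj : j < M then P j hj else if hj' : j < M + 1 then F ⟨j, hj'⟩ else 0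
    have hGF : ∀ (j : ℕ) (hj : j < M + 1), ∀ᵐ x, 0 < x → F ⟨j, hj⟩ x = G j x := by
      intro j hj
      by_cases hjM : j < M
      · simp only [G, hjM, dite_true]; exact hP1 j hjM
      · simp only [G, hjM, hj, dite_true, dite_false]; exact ae_of_all _ fun _ _ => trivial
    have hae : ∀ j : Fin (M + 1), F j =ᵐ[radialMeasure (n + 2 * (j : ℕ)) lam] G j := fun j =>
      (ae_radial_iff' hl).2 (hGF j j.2)
    refine ⟨G, ⟨fun j hj => ?_, fun j hj => ?_⟩, hae⟩
    · have hGj : G j = P j hj := by simp only [G, hj, dite_true]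
      rw [hGj]
      refine (hP2 j hj).congr (fun _ _ => rfl) ?_
      filter_upwards [hGF (j + 1) (by omega)] with r hr h0
      rw [hr h0]
    · exact (Lp.memLp (F ⟨j, by omega⟩)).ae_eq (hae ⟨j, by omega⟩)

lemma isClosed_towerSpace (hl : 0 < lam) :
    IsClosed (towerSpace n lam M : Set (TowerAmbient n lam M)) := by
  have e : (towerSpace n lam M : Set (TowerAmbient n lam M)) =
      {F | ∀ (j : ℕ) (hj : j < M) (η : ℝ → ℝ),
      ContDiff ℝ ∞ η → HasCompactSupport η → tsupport η ⊆ Ioi 0 →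
      ∫ r in Ioi (0 : ℝ), ((deriv η r : ℝ) : ℂ) * F ⟨j, by omega⟩ r =
        -∫ r in Ioi (0 : ℝ), ((η r * hq lam r : ℝ) : ℂ) * F ⟨j + 1, by omega⟩ r} := by
    ext F; exact mem_towerSpace_iff hl F
  rw [e]
  simp only [ofPred_forall]
  refine isClosed_iInter fun j => isClosed_iInter fun hj => isClosed_iInter fun η =>
    isClosed_iInter fun hη => isClosed_iInter fun hsp => isClosed_iInter fun hs => ?_
  have hd : ContDiff ℝ ∞ (deriv η) := by
    have := contDiff_infty_iff_deriv.1 hη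
    exact this.2
  have h1 := memLp_test (n := n + 2 * j) hl hd hsp.deriv
    ((tsupport_deriv_subset (f := η) (𝕜 := ℝ)).trans hs)
  have h2 := memLp_test (n := n + 2 * (j + 1)) hl (hη.mul (contDiff_hq (lam := lam)))
    (hsp.mul_right) (tsupport_mul_subset_left' hs)
  have e2 : ∀ F : TowerAmbient n lam M,
      (∫ r in Ioi (0 : ℝ), ((deriv η r : ℝ) : ℂ) * F ⟨j, by omega⟩ r =
        -∫ r in Ioi (0 : ℝ), ((η r * hq lam r : ℝ) : ℂ) * F ⟨j + 1, by omega⟩ r) ↔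
      inner ℂ (h1.toLp _) (F ⟨j, by omega⟩) = -inner ℂ (h2.toLp _) (F ⟨j + 1, by omega⟩) := by
    intro F
    rw [inner_test hl h1 (F ⟨j, by omega⟩), inner_test hl h2 (F ⟨j + 1, by omega⟩)]
  simp only [e2]
  refine isClosed_eq ?_ ?_
  · exact continuous_const.inner (PiLp.continuous_apply 2 _ _)
  · exact (continuous_const.inner (PiLp.continuous_apply 2 _ _)).neg

end TowerSpace

/-! ### The Laplacian and the inclusions as bounded operators. -/

section TowerOperators

variable {n M : ℕ} {lam : ℝ} {G H : ℕ → ℝ → ℂ}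

instance [Fact (0 < lam)] : CompleteSpace (towerSpace n lam M) :=
  (isClosed_towerSpace Fact.out).completeSpace_coe

lemma Represents.eq_of_ae (hl : 0 < lam) {E F : TowerAmbient n lam M} (hE : Represents E G)
    (hF : Represents F H) (h : ∀ᵐ r, 0 < r → G 0 r = H 0 r) : E = F := by
  refine PiLp.ext fun j => Lp.ext ?_
  have h1 := (ae_radial_iff' (n := n + 2 * (j : ℕ)) hl).2
    (hE.isTower.ae_unique hl hF.isTower h (by omega : (j : ℕ) ≤ M))
  filter_upwards [h1, hE.ae_eq j, hF.ae_eq j] with r h1 h2 h3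
  rw [h2, h1, h3]

lemma Represents.unique {E F : TowerAmbient n lam M} (hE : Represents E G)
    (hF : Represents F G) : E = F :=
  PiLp.ext fun j => Lp.ext ((hE.ae_eq j).trans (hF.ae_eq j).symm)

lemma Represents.ae_unique (hl : 0 < lam) {E : TowerAmbient n lam M} (hG : Represents E G)
    (hH : Represents E H) {j : ℕ} (hj : j ≤ M) : ∀ᵐ r, 0 < r → G j r = H j r := by
  have h1 := hG.ae_eq ⟨j, by omega⟩
  have h2 := hH.ae_eq ⟨j, by omega⟩
  exact (ae_radial_iff' hl).1 (h1.symm.trans h2)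

lemma Represents.norm_sq {E : TowerAmbient n lam M} (hE : Represents E G) :
    ‖E‖ ^ 2 = towerSq n lam M G := by
  rw [PiLp.norm_sq_eq_of_L2, towerSq, Finset.sum_range]
  refine Finset.sum_congr rfl fun j _ => ?_
  rw [radialSq_congr (hE.ae_eq j).symm, ← norm_toLp_sq (Lp.memLp (E j)), Lp.toLp_coeFn]

lemma Represents.inner_eq {E F : TowerAmbient n lam M} (hE : Represents E G)
    (hF : Represents F H) : inner ℂ E F = ∑ j ∈ Finset.range (M + 1),
      ∫ r, (starRingEnd ℂ) (G j r) * H j r ∂(radialMeasure (n + 2 * j) lam) := by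
  rw [PiLp.inner_apply, Finset.sum_range]
  refine Finset.sum_congr rfl fun j _ => ?_
  rw [MeasureTheory.L2.inner_def]
  refine integral_congr_ae ?_
  filter_upwards [hE.ae_eq j, hF.ae_eq j] with r h1 h2
  rw [h1, h2, RCLike.inner_apply, mul_comm]

def towerMk (G : ℕ → ℝ → ℂ) (hG : IsTower n lam M G) : towerSpace n lam M :=
  ⟨WithLp.toLp 2 fun j => (hG.memLp j (by omega)).toLp (G j),
    G, hG, fun j => (hG.memLp j (by omega)).coeFn_toLp⟩

lemma represents_towerMk (hG : IsTower n lam M G) :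
    Represents (towerMk G hG : TowerAmbient n lam M) G :=
  ⟨hG, fun j => (hG.memLp j (by omega)).coeFn_toLp⟩

/-- The choice is immaterial: by `Represents.ae_unique` two representatives agree almost everywhere
at each level up to M. -/
def towerRep (u : towerSpace n lam M) : ℕ → ℝ → ℂ := u.2.choose

lemma represents_towerRep (u : towerSpace n lam M) :
    Represents (u : TowerAmbient n lam M) (towerRep u) := u.2.choose_spec

lemma norm_sq_eq_towerSq (u : towerSpace n lam M) : ‖u‖ ^ 2 = towerSq n lam M (towerRep u) :=
  (represents_towerRep u).norm_sq

lemma Represents.congr (hl : 0 < lam) {E : TowerAmbient n lam M} (hE : Represents E G)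
    (hH : IsTower n lam M H) (h : ∀ᵐ r, 0 < r → G 0 r = H 0 r) : Represents E H := by
  have h1 := represents_towerMk hH
  rwa [← hE.eq_of_ae hl h1 h] at h1

lemma Represents.sub {E F : TowerAmbient n lam M} (hE : Represents E G) (hF : Represents F H) :
    Represents (E - F) (fun j r => G j r - H j r) := by
  have h := hE.add (hF.smul (-1))
  rw [neg_one_smul, ← sub_eq_add_neg] at h
  simpa only [neg_one_mul, ← sub_eq_add_neg] using h

lemma lapTower_congr {j : ℕ} (h : ∀ i ≤ j + 2, ∀ᵐ r, 0 < r → G i r = H i r) :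
    ∀ᵐ r, 0 < r → lapTower n lam G j r = lapTower n lam H j r := by
  filter_upwards [h j (by omega), h (j + 1) (by omega), h (j + 2) le_rfl] with r h0 h1 h2 hr
  rw [lapTower, lapTower, h0 hr, h1 hr, h2 hr]


def lapConst (n M : ℕ) : ℝ := (M + 1) * (4 + 64 * (n + 2 * M) ^ 4)

lemma lapConst_nonneg (n M : ℕ) : 0 ≤ lapConst n M := by unfold lapConst; positivity

/-- The Laplacian, as a linear operator which loses two derivatives. -/
def lapLM (hn : 2 ≤ n) (hl : 0 < lam) (hl1 : lam ≤ 1) (M : ℕ) :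
    towerSpace n lam (M + 2) →ₗ[ℂ] towerSpace n lam M where
  toFun u := towerMk _ ((represents_towerRep u).isTower.lapTower hn hl hl1)
  map_add' u v := by
    have h := represents_towerMk ((represents_towerRep (u + v)).isTower.lapTower hn hl hl1)
    have hu := represents_towerMk ((represents_towerRep u).isTower.lapTower hn hl hl1)
    have hv := represents_towerMk ((represents_towerRep v).isTower.lapTower hn hl hl1)
    refine Subtype.ext (h.eq_of_ae hl (hu.add hv) ?_)
    have e : (fun r => lapTower n lam (towerRep u) 0 r + lapTower n lam (towerRep v) 0 r) =
        lapTower n lam (fun j r => towerRep u j r + towerRep v j r) 0 := by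
      funext r; simp only [lapTower]; ring
    have h2 := lapTower_congr (n := n) (lam := lam) (j := 0) fun i hi =>
      (represents_towerRep (u + v)).ae_unique hl
        ((represents_towerRep u).add (represents_towerRep v)) (by omega : i ≤ M + 2)
    rw [← e] at h2
    exact h2
  map_smul' a u := by
    have h := represents_towerMk ((represents_towerRep (a • u)).isTower.lapTower hn hl hl1)
    have hu := represents_towerMk ((represents_towerRep u).isTower.lapTower hn hl hl1)
    refine Subtype.ext (h.eq_of_ae hl (hu.smul a) ?_)
    have e : (fun r => a * lapTower n lam (towerRep u) 0 r) =
        lapTower n lam (fun j r => a * towerRep u j r) 0 := by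
      funext r; simp only [lapTower]; ring
    have h2 := lapTower_congr (n := n) (lam := lam) (j := 0) fun i hi =>
      (represents_towerRep (a • u)).ae_unique hl ((represents_towerRep u).smul a)
        (by omega : i ≤ M + 2)
    rw [← e] at h2
    exact h2

lemma norm_towerMk_sq (hG : IsTower n lam M G) : ‖towerMk G hG‖ ^ 2 = towerSq n lam M G :=
  (represents_towerMk hG).norm_sq

def lapCLM (hn : 2 ≤ n) (hl : 0 < lam) (hl1 : lam ≤ 1) (M : ℕ) :
    towerSpace n lam (M + 2) →L[ℂ] towerSpace n lam M :=
  (lapLM hn hl hl1 M).mkContinuous √(lapConst n M) fun u => by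
    have h := (represents_towerRep u).isTower.towerSq_lapTower_le hn hl hl1
    rw [← norm_towerMk_sq ((represents_towerRep u).isTower.lapTower hn hl hl1),
      ← norm_sq_eq_towerSq] at h
    refine le_of_sq_le_sq ?_ (by positivity)
    rw [mul_pow, Real.sq_sqrt (lapConst_nonneg n M)]
    exact h

lemma norm_lapCLM_le (hn : 2 ≤ n) (hl : 0 < lam) (hl1 : lam ≤ 1)
    (u : towerSpace n lam (M + 2)) : ‖lapCLM hn hl hl1 M u‖ ≤ √(lapConst n M) * ‖u‖ :=
  (LinearMap.mkContinuous_norm_le _ (Real.sqrt_nonneg _) _).trans' le_rfl |> fun h =>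
    ((lapCLM hn hl hl1 M).le_opNorm u).trans (by gcongr; exact h)

lemma Represents.lap (hn : 2 ≤ n) (hl : 0 < lam) (hl1 : lam ≤ 1) {u : towerSpace n lam (M + 2)}
    (hu : Represents (u : TowerAmbient n lam (M + 2)) G) :
    Represents (lapCLM hn hl hl1 M u : TowerAmbient n lam M) (lapTower n lam G) :=
  (represents_towerMk ((represents_towerRep u).isTower.lapTower hn hl hl1)).congr hl
    (hu.isTower.lapTower hn hl hl1)
    (lapTower_congr fun i hi => (represents_towerRep u).ae_unique hl hu (by omega))

/-- The inclusion of a Sobolev space into one with fewer derivatives. -/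
def resCLM (n : ℕ) (lam : ℝ) {M M' : ℕ} (h : M' ≤ M) :
    towerSpace n lam M →L[ℂ] towerSpace n lam M' :=
  LinearMap.mkContinuous
    { toFun := fun u => ⟨WithLp.toLp 2 fun j => (u : TowerAmbient n lam M) ⟨j, by omega⟩,
        towerRep u, (represents_towerRep u).isTower.mono h,
          fun j => (represents_towerRep u).ae_eq ⟨j, by omega⟩⟩
      map_add' := fun _ _ => rfl
      map_smul' := fun _ _ => rfl } 1 fun u => by
    have h1 := norm_sq_eq_towerSq u
    have h2 : Represents (WithLp.toLp 2 fun j => (u : TowerAmbient n lam M) ⟨j, by omega⟩ :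
        TowerAmbient n lam M') (towerRep u) := ⟨(represents_towerRep u).isTower.mono h,
          fun j => (represents_towerRep u).ae_eq ⟨j, by omega⟩⟩
    rw [one_mul]
    refine le_of_sq_le_sq ?_ (norm_nonneg _)
    rw [h1]
    refine h2.norm_sq.le.trans ?_
    exact Finset.sum_le_sum_of_subset_of_nonneg (Finset.range_mono (by omega))
      fun _ _ _ => radialSq_nonneg _

lemma Represents.res {M' : ℕ} (h : M' ≤ M) {u : towerSpace n lam M}
    (hu : Represents (u : TowerAmbient n lam M) G) :
    Represents (resCLM n lam h u : TowerAmbient n lam M') G :=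
  ⟨hu.isTower.mono h, fun j => hu.ae_eq ⟨j, by omega⟩⟩

lemma norm_resCLM_le {M' : ℕ} (h : M' ≤ M) (u : towerSpace n lam M) :
    ‖resCLM n lam h u‖ ≤ ‖u‖ := by
  have := (resCLM n lam h).le_opNorm u
  have h1 : ‖resCLM n lam h‖ ≤ 1 := LinearMap.mkContinuous_norm_le _ zero_le_one _
  nlinarith [norm_nonneg u]

lemma resCLM_injective (hl : 0 < lam) {M' : ℕ} (h : M' ≤ M) :
    Function.Injective (resCLM n lam h) := by
  intro u v huv
  have hu := represents_towerRep u
  have hv := represents_towerRep v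
  have h1 := hu.res h
  rw [huv] at h1
  exact Subtype.ext (hu.eq_of_ae hl hv (h1.ae_unique hl (hv.res h) (by omega)))

/-- The pairing of `u` with the Laplacian of `v` is symmetric, level by level. -/
lemma IsTower.integral_lapTower (hn : 2 ≤ n) (hl : 0 < lam) (hl1 : lam ≤ 1)
    (hG : IsTower n lam (M + 2) G) (hH : IsTower n lam (M + 2) H) {j : ℕ} (hj : j ≤ M) :
    ∫ r, (starRingEnd ℂ) (G j r) * _root_.lapTower n lam H j r ∂(radialMeasure (n + 2 * j) lam) =
      -∫ r, (starRingEnd ℂ) ((hq lam r : ℂ) ^ 1 * G (j + 1) r) * ((hq lam r : ℂ) ^ 1 * H (j + 1) r)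
        ∂(radialMeasure (n + 2 * j) lam) + (lapCoef n j * lam ^ 2 : ℝ) *
      ∫ r, (starRingEnd ℂ) (G j r) * H j r ∂(radialMeasure (n + 2 * j) lam) := by
  set N := n + 2 * j with hN
  have e1 : n + 2 * (j + 1) = N + 2 * 1 := by omega
  have hG0 := hG.memLp j (by omega)
  have hH0 := hH.memLp j (by omega)
  have hG1 := hG.memLp (j + 1) (by omega)
  have hH1 := hH.memLp (j + 1) (by omega)
  rw [e1, memLp_shift_iff (by omega) hl] at hG1 hH1
  have hk : MemLp (fun r => (hq lam r : ℂ) ^ 2 * H (j + 2) r +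
      (N : ℂ) * ((hc lam r : ℂ) * H (j + 1) r)) 2 (radialMeasure N lam) :=
    (hH.memLp_hq_sq hn hl (j := j) (by omega)).add
      ((hH.hc_mul hn hl hl1 (j := j) (by omega)).1.const_mul _)
  have hp : IsPrim (fun r => (hq lam r : ℂ) ^ N * H (j + 1) r) (fun r => (hq lam r : ℂ) ^ (N - 1) *
      ((hq lam r : ℂ) ^ 2 * H (j + 2) r + (N : ℂ) * ((hc lam r : ℂ) * H (j + 1) r))) := by
    refine ((IsPrim.hq_pow hl N).mul (hH.isD (j + 1) (by omega))).congr (fun _ _ => rfl)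
      (ae_of_all _ fun r _ => ?_)
    rw [hq_cast_pow_eq (by omega : 1 ≤ N)]
    ring
  have hgreen := integral_green (by omega) hl hl1 (hG.isD j (by omega)) hG0 hG1 hp
    (hH.hardy hn hl hl1 (j := j) (by omega)).1 hH1 hk
  rw [← hgreen, ← integral_const_mul, ← integral_add]
  · refine integral_congr_ae (ae_of_all _ fun r => ?_)
    simp only [_root_.lapTower, ← hN]
    ring
  · exact hG0.star.integrable_mul hk
  · exact (hG0.star.integrable_mul hH0).const_mul _

end TowerOperators

/-! ### Invertibility of 1 − Δ and self-adjointness of its inverse. -/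

section ResolventOperator

variable {n M : ℕ} {lam : ℝ} {G H : ℕ → ℝ → ℂ}

lemma integral_conj_mul_self (f : ℝ → ℂ) :
    ∫ r, (starRingEnd ℂ) (f r) * f r ∂(radialMeasure n lam) = (radialSq n lam f : ℂ) := by
  rw [radialSq, ← integral_complex_ofReal]
  refine integral_congr_ae (ae_of_all _ fun r => ?_)
  simp only
  rw [mul_comm, Complex.mul_conj, Complex.normSq_eq_norm_sq]

lemma conj_integral_conj_mul (f g : ℝ → ℂ) :
    (starRingEnd ℂ) (∫ r, (starRingEnd ℂ) (f r) * g r ∂(radialMeasure n lam)) =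
      ∫ r, (starRingEnd ℂ) (g r) * f r ∂(radialMeasure n lam) := by
  rw [← integral_conj]
  refine integral_congr_ae (ae_of_all _ fun r => ?_)
  simp [mul_comm]

/-- At each level `IsTower.integral_lapTower` expresses the pairing through two Hermitian forms with
real coefficients. The Laplacian is thus symmetric for the tower inner product itself, not only in
L², which makes the group an isometry of every tower space. -/
lemma inner_res_lap (hn : 2 ≤ n) (hl : 0 < lam) (hl1 : lam ≤ 1) (u v : towerSpace n lam (M + 2)) :
    inner ℂ (resCLM n lam (Nat.le_add_right M 2) u) (lapCLM hn hl hl1 M v) =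
      inner ℂ (lapCLM hn hl hl1 M u) (resCLM n lam (Nat.le_add_right M 2) v) := by
  have hu := represents_towerRep u
  have hv := represents_towerRep v
  have e1 : ∀ {u v : towerSpace n lam (M + 2)} {G H : ℕ → ℝ → ℂ},
      Represents (u : TowerAmbient n lam (M + 2)) G →
      Represents (v : TowerAmbient n lam (M + 2)) H →
      inner ℂ (resCLM n lam (Nat.le_add_right M 2) u) (lapCLM hn hl hl1 M v) =
      ∑ j ∈ Finset.range (M + 1),
        (-∫ r, (starRingEnd ℂ) ((hq lam r : ℂ) ^ 1 * G (j + 1) r) *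
          ((hq lam r : ℂ) ^ 1 * H (j + 1) r) ∂(radialMeasure (n + 2 * j) lam) +
        (lapCoef n j * lam ^ 2 : ℝ) *
        ∫ r, (starRingEnd ℂ) (G j r) * H j r ∂(radialMeasure (n + 2 * j) lam)) := by
    intro u v G H hu hv
    rw [Submodule.coe_inner, (hu.res (Nat.le_add_right M 2)).inner_eq (hv.lap hn hl hl1)]
    refine Finset.sum_congr rfl fun j hj => ?_
    exact hu.isTower.integral_lapTower hn hl hl1 hv.isTower
      (by simpa [Nat.lt_succ_iff] using hj)
  rw [e1 hu hv, ← inner_conj_symm (lapCLM hn hl hl1 M u), e1 hv hu, map_sum]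
  refine Finset.sum_congr rfl fun j _ => ?_
  rw [map_add, map_neg, map_mul, Complex.conj_ofReal, conj_integral_conj_mul,
    conj_integral_conj_mul]

/-- `1 - Δ`. -/
def oneSubLap (hn : 2 ≤ n) (hl : 0 < lam) (hl1 : lam ≤ 1) (M : ℕ) :
    towerSpace n lam (M + 2) →L[ℂ] towerSpace n lam M :=
  resCLM n lam (Nat.le_add_right M 2) - lapCLM hn hl hl1 M

lemma Represents.oneSubLap (hn : 2 ≤ n) (hl : 0 < lam) (hl1 : lam ≤ 1)
    {u : towerSpace n lam (M + 2)} (hu : Represents (u : TowerAmbient n lam (M + 2)) G) :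
    Represents (oneSubLap hn hl hl1 M u : TowerAmbient n lam M)
      (fun j r => G j r - lapTower n lam G j r) :=
  (hu.res (Nat.le_add_right M 2)).sub (hu.lap hn hl hl1)

/-- Pairing Δu = u with u at level 0 gives ‖u‖² = −‖∇u‖². -/
lemma oneSubLap_injective (hn : 2 ≤ n) (hl : 0 < lam) (hl1 : lam ≤ 1) :
    Function.Injective (oneSubLap (n := n) hn hl hl1 M) := by
  rw [injective_iff_map_eq_zero]
  intro u hu
  have hG := represents_towerRep u
  have h1 := hG.oneSubLap hn hl hl1
  rw [hu] at h1
  have h2 := h1.ae_unique hl (Represents.zero (n := n) (M := M)) (Nat.zero_le _)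
  have h3 := hG.isTower.integral_lapTower hn hl hl1 hG.isTower (Nat.zero_le M)
  rw [integral_conj_mul_self, lapCoef_zero] at h3
  have h4 : ∫ r, (starRingEnd ℂ) (towerRep u 0 r) * lapTower n lam (towerRep u) 0 r
      ∂(radialMeasure (n + 2 * 0) lam) = (radialSq (n + 2 * 0) lam (towerRep u 0) : ℂ) := by
    rw [← integral_conj_mul_self]
    refine integral_congr_ae ((ae_radial_iff' hl).2 ?_)
    filter_upwards [h2] with r hr h0
    rw [sub_eq_zero.1 (hr h0)]
  rw [h4] at h3
  simp only [zero_mul, Complex.ofReal_zero, add_zero] at h3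
  rw [← Complex.ofReal_neg, Complex.ofReal_inj] at h3
  have h5 : radialSq (n + 2 * 0) lam (towerRep u 0) = 0 := by
    have h6 := radialSq_nonneg (n := n + 2 * 0) (lam := lam)
      (fun r => (hq lam r : ℂ) ^ 1 * towerRep u (0 + 1) r)
    exact le_antisymm (by linarith) (radialSq_nonneg _)
  have h6 : towerRep u 0 =ᵐ[radialMeasure (n + 2 * 0) lam] 0 := by
    have hm := hG.isTower.memLp 0 (by omega)
    have h7 := eLpNorm_sq_eq hm
    rw [h5, ENNReal.ofReal_zero] at h7
    exact (eLpNorm_eq_zero_iff hm.1 two_ne_zero).1 (pow_eq_zero_iff two_ne_zero |>.1 h7)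
  exact Subtype.ext (hG.eq_of_ae hl Represents.zero ((ae_radial_iff' hl).1 h6))

lemma memLp_of_hasCompactSupport (hl : 0 < lam) {φ : ℝ → ℝ} (hφ : Continuous φ)
    (hsp : HasCompactSupport φ) : MemLp (fun r => (φ r : ℂ)) 2 (radialMeasure n lam) := by
  rw [memLp_radial_iff hl]
  refine ⟨(Complex.continuous_ofReal.comp hφ).aestronglyMeasurable, ?_⟩
  have e : (fun r => hq lam r ^ (n - 1) * ‖(φ r : ℂ)‖ ^ 2) =
      fun r => φ r * (hq lam r ^ (n - 1) * φ r) := by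
    funext r
    rw [Complex.norm_real, Real.norm_eq_abs, sq_abs]; ring
  rw [e]
  exact (Continuous.integrable_of_hasCompactSupport
    (hφ.mul ((continuous_hq.pow _).mul hφ)) hsp.mul_right).integrableOn

/-- The tower of order one of a smooth function. -/
def testTower (lam : ℝ) (φ : ℝ → ℝ) : ℕ → ℝ → ℂ
  | 0 => fun r => (φ r : ℂ)
  | _ => fun r => ((deriv φ r / hq lam r : ℝ) : ℂ)

lemma isTower_testTower (hn : 1 ≤ n) (hl : 0 < lam) {φ : ℝ → ℝ} (hφ : ContDiff ℝ ∞ φ)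
    (hsp : HasCompactSupport φ) : IsTower n lam 1 (testTower lam φ) := by
  have hd : ContDiff ℝ ∞ (deriv φ) := (contDiff_infty_iff_deriv.1 hφ).2
  refine ⟨fun j hj => ?_, fun j hj => ?_⟩
  · interval_cases j
    refine (IsPrim.ofReal_of_contDiff hφ).congr (fun _ _ => rfl) (ae_of_all _ fun r hr => ?_)
    have := hq_cast_ne_zero hl hr
    simp only [testTower]
    push_cast
    field_simp
  · interval_cases j
    · exact memLp_of_hasCompactSupport hl hφ.continuous hsp
    · refine (memLp_shift_iff hn hl 1).2
        ((memLp_of_hasCompactSupport hl hd.continuous hsp.deriv).ae_eq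
          (ae_radial_of_forall hl fun r hr => ?_))
      have := hq_cast_ne_zero hl hr
      simp only [testTower]
      push_cast
      field_simp

lemma integral_radial_shift (hn : 1 ≤ n) (hl : 0 < lam) (j : ℕ) (f : ℝ → ℂ) :
    ∫ r, f r ∂(radialMeasure (n + 2 * j) lam) =
      ∫ r, (hq lam r : ℂ) ^ (2 * j) * f r ∂(radialMeasure n lam) := by
  rw [integral_radial hl, integral_radial hl]
  refine integral_congr_ae (ae_of_all _ fun r => ?_)
  simp only [Complex.real_smul]
  rw [show n + 2 * j - 1 = n - 1 + 2 * j by omega]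
  push_cast
  ring

/-- The tower norm with M = 1 is the H¹ norm, because entry 1 in dimension n + 2 has the L² norm of
hq G 1 in dimension n, that is, of the gradient. The Riesz theorem there represents the pairing with
f, and the even test functions belong to the space. -/
lemma exists_weak_resolvent [Fact (0 < lam)] (hn : 2 ≤ n) (hl : 0 < lam)
    {f : ℝ → ℂ} (hf : MemLp f 2 (radialMeasure n lam)) :
    ∃ G, IsTower n lam 1 G ∧
      IsWeakRadialDiv n lam (fun r => (hq lam r : ℂ) ^ 1 * G 1 r) (fun r => G 0 r - f r) := by
  let f0 : Lp ℂ 2 (radialMeasure (n + 2 * ((0 : Fin 2) : ℕ)) lam) := MemLp.toLp f hf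
  have hf0 : f0 =ᵐ[radialMeasure n lam] f := MemLp.coeFn_toLp hf
  let φ : towerSpace n lam 1 →L[ℂ] ℂ := (innerSL ℂ f0).comp
    ((PiLp.proj 2 (fun j : Fin 2 => Lp ℂ 2 (radialMeasure (n + 2 * (j : ℕ)) lam)) 0).comp
      (towerSpace n lam 1).subtypeL)
  let u : towerSpace n lam 1 := (InnerProductSpace.toDual ℂ (towerSpace n lam 1)).symm φ
  have hu : ∀ v : towerSpace n lam 1, inner ℂ v u = inner ℂ ((v : TowerAmbient n lam 1) 0) f0 := by
    intro v
    have h1 : inner ℂ u v = φ v := InnerProductSpace.toDual_symm_apply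
    rw [← inner_conj_symm v u, h1, ← inner_conj_symm _ f0]
    rfl
  have hG := represents_towerRep u
  have h1 := hG.isTower.memLp_pow (by omega) hl le_rfl
  have h0 := hG.isTower.memLp 0 (by omega)
  refine ⟨towerRep u, hG.isTower, fun η hη hsp heven => ?_⟩
  have hT := isTower_testTower (n := n) (by omega) hl hη hsp
  have hd : ContDiff ℝ ∞ (deriv η) := (contDiff_infty_iff_deriv.1 hη).2
  have hv := hu (towerMk _ hT)
  have hR := represents_towerMk hT
  rw [Submodule.coe_inner, hR.inner_eq hG, Finset.sum_range_succ, Finset.sum_range_one,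
    integral_radial_shift (by omega) hl 1] at hv
  have e0 : inner ℂ ((towerMk _ hT : TowerAmbient n lam 1) 0) f0 =
      ∫ r, (η r : ℂ) * f r ∂(radialMeasure n lam) := by
    rw [MeasureTheory.L2.inner_def]
    refine integral_congr_ae ?_
    have h2 := hR.ae_eq 0
    filter_upwards [h2, hf0] with r h3 h4
    rw [h3, h4, RCLike.inner_apply]
    simp [testTower, mul_comm]
  rw [e0] at hv
  have e1 : ∫ r, (hq lam r : ℂ) ^ (2 * 1) * ((starRingEnd ℂ) (testTower lam η 1 r) *
      towerRep u 1 r) ∂(radialMeasure n lam) =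
      ∫ r, ((deriv η r : ℝ) : ℂ) * ((hq lam r : ℂ) ^ 1 * towerRep u 1 r)
        ∂(radialMeasure n lam) := by
    refine integral_congr_ae (ae_radial_of_forall hl fun r hr => ?_)
    have := hq_cast_ne_zero hl hr
    simp only [testTower, Complex.conj_ofReal]
    push_cast
    field_simp
  have hηm := memLp_of_hasCompactSupport (n := n) hl hη.continuous hsp
  have e2 : ∫ r, (η r : ℂ) * (towerRep u 0 r - f r) ∂(radialMeasure n lam) =
      (∫ r, (η r : ℂ) * towerRep u 0 r ∂(radialMeasure n lam)) -
        ∫ r, (η r : ℂ) * f r ∂(radialMeasure n lam) := by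
    refine Eq.trans (integral_congr_ae (ae_of_all _ fun r => ?_))
      (integral_sub (hηm.integrable_mul h0) (hηm.integrable_mul hf))
    simp only
    ring
  rw [e1] at hv
  rw [e2, ← hv]
  simp only [testTower, Complex.conj_ofReal, mul_zero, add_zero]
  ring

/-- A weak solution in H¹ is upgraded by `exists_tower_of_resolvent`. -/
lemma oneSubLap_surjective (hn : 2 ≤ n) (hl : 0 < lam) (hl1 : lam ≤ 1) :
    Function.Surjective (oneSubLap (n := n) hn hl hl1 M) := by
  have : Fact (0 < lam) := ⟨hl⟩
  intro f
  have hf := represents_towerRep f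
  have hf0 := hf.isTower.memLp 0 (by omega)
  obtain ⟨U, hU, hw⟩ := exists_weak_resolvent hn hl hf0
  have hU0 := hU.memLp 0 (by omega)
  have hU1 := hU.memLp_pow (by omega) hl le_rfl
  have hrhs : MemLp (fun r => U 0 r - towerRep f 0 r) 2 (radialMeasure n lam) := hU0.sub hf0
  have hae := IsWeakRadialDiv.ae_eq hl hU1 hrhs hw
  obtain ⟨hP, hPz⟩ := isPrim_primitive_weight hl hrhs
  set P : ℝ → ℂ := fun x => ∫ t in (0 : ℝ)..x, (hq lam t : ℂ) ^ (n - 1) *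
    (U 0 t - towerRep f 0 t) with hPdef
  -- The entry 1 of the weak solution is replaced by the representative whose flux is exactly the
  -- primitive starting from 0, as elliptic regularity requires.
  let u₁ : ℝ → ℂ := fun r => P r / (hq lam r : ℂ) ^ n
  have hu1 : ∀ r, 0 < r → (hq lam r : ℂ) ^ n * u₁ r = P r := fun r hr => by
    have := hq_cast_ne_zero hl hr
    simp only [u₁]; field_simp
  have hU1u : ∀ᵐ r, 0 < r → U 1 r = u₁ r := by
    filter_upwards [hae] with r hr h0
    have := hq_cast_ne_zero hl h0
    have h3 := hr h0
    rw [← mul_assoc, ← pow_add, show n - 1 + 1 = n by omega] at h3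
    simp only [u₁, hPdef, ← h3]
    field_simp
  obtain ⟨G, hG, hG0, -, hGe⟩ := exists_tower_of_resolvent hl hl1 M n 1 (towerRep f) (U 0) u₁ hn
    hf.isTower ((hU.isD 0 one_pos).congr (fun _ _ => rfl) hU1u) hU0
    (hU1.ae_eq ((ae_radial_iff' hl).2 (hU1u.mono fun r hr h0 => by rw [hr h0])))
    (hP.congr (fun r hr => (hu1 r hr).symm) (ae_of_all _ fun r _ => by simp))
    (hPz.congr' (by filter_upwards [self_mem_nhdsWithin] with r hr using (hu1 r hr).symm))
  refine ⟨towerMk G hG, Subtype.ext (((represents_towerMk hG).oneSubLap hn hl hl1).eq_of_ae hl hf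
    (ae_of_all _ fun r hr => ?_))⟩
  rw [← hGe r hr, hG0]
  simp

def resolventEquiv [Fact (0 < lam)] (hn : 2 ≤ n) (hl : 0 < lam) (hl1 : lam ≤ 1) (M : ℕ) :
    towerSpace n lam (M + 2) ≃L[ℂ] towerSpace n lam M :=
  ContinuousLinearEquiv.ofBijective (oneSubLap hn hl hl1 M)
    (LinearMap.ker_eq_bot.2 (oneSubLap_injective hn hl hl1))
    (LinearMap.range_eq_top.2 (oneSubLap_surjective hn hl hl1))

/-- `(1 - Δ)⁻¹`. -/
def resolventCLM [Fact (0 < lam)] (hn : 2 ≤ n) (hl : 0 < lam) (hl1 : lam ≤ 1) (M : ℕ) :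
    towerSpace n lam M →L[ℂ] towerSpace n lam M :=
  (resCLM n lam (Nat.le_add_right M 2)).comp
    ((resolventEquiv hn hl hl1 M).symm : towerSpace n lam M →L[ℂ] towerSpace n lam (M + 2))

lemma oneSubLap_resolventEquiv_symm [Fact (0 < lam)] (hn : 2 ≤ n) (hl : 0 < lam) (hl1 : lam ≤ 1)
    (f : towerSpace n lam M) :
    oneSubLap hn hl hl1 M ((resolventEquiv hn hl hl1 M).symm f) = f :=
  (resolventEquiv hn hl hl1 M).apply_symm_apply f

lemma resolventCLM_injective [Fact (0 < lam)] (hn : 2 ≤ n) (hl : 0 < lam) (hl1 : lam ≤ 1) :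
    Function.Injective (resolventCLM (n := n) hn hl hl1 M) :=
  (resCLM_injective hl (Nat.le_add_right M 2)).comp (resolventEquiv hn hl hl1 M).symm.injective

/-- Every vector has the form (1 − Δ)u, and for such vectors the symmetry is `inner_res_lap`. -/
lemma isSelfAdjoint_resolventCLM [Fact (0 < lam)] (hn : 2 ≤ n) (hl : 0 < lam) (hl1 : lam ≤ 1) :
    IsSelfAdjoint (resolventCLM (n := n) hn hl hl1 M) := by
  rw [ContinuousLinearMap.isSelfAdjoint_iff_isSymmetric]
  intro f g
  obtain ⟨u, rfl⟩ := (resolventEquiv hn hl hl1 M).surjective f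
  obtain ⟨v, rfl⟩ := (resolventEquiv hn hl hl1 M).surjective g
  have e : ∀ w, resolventCLM (n := n) hn hl hl1 M (resolventEquiv hn hl hl1 M w) =
      resCLM n lam (Nat.le_add_right M 2) w := fun w => by
    simp [resolventCLM]
  have e2 : ∀ w, resolventEquiv hn hl hl1 M w =
      resCLM n lam (Nat.le_add_right M 2) w - lapCLM hn hl hl1 M w := fun w => rfl
  simp only [ContinuousLinearMap.coe_coe, e]
  rw [e2, e2, inner_sub_left, inner_sub_right, inner_res_lap]

end ResolventOperator

/-! ### The unitary group generated from a bounded resolvent. -/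

section UnitaryGroup

/-- For real `x`, the function `x exp(i t (1 - 1 / x))`. -/
def phase (t x : ℝ) : ℂ := x * Complex.exp (Complex.I * (t * (1 - 1 / x) : ℝ))

lemma norm_exp_I_mul (y : ℝ) : ‖Complex.exp (Complex.I * (y : ℂ))‖ = 1 := by
  rw [mul_comm]; exact Complex.norm_exp_ofReal_mul_I y

lemma norm_phase (t x : ℝ) : ‖phase t x‖ = |x| := by
  rw [phase, norm_mul, norm_exp_I_mul, mul_one, Complex.norm_real, Real.norm_eq_abs]

/-- The factor x damps the oscillation at x = 0, so the continuous functional calculus applies even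
though 0 may lie in the spectrum of J. -/
lemma continuous_phase (t : ℝ) : Continuous (phase t) := by
  rw [continuous_iff_continuousAt]
  intro x
  by_cases hx : x = 0
  · subst hx
    have h0 : phase t 0 = 0 := by simp [phase]
    rw [ContinuousAt, h0]
    refine squeeze_zero_norm (fun y => (norm_phase t y).le) ?_
    exact (continuous_abs.tendsto' 0 0 abs_zero)
  · unfold phase
    refine Complex.continuous_ofReal.continuousAt.mul ?_
    refine Complex.continuous_exp.continuousAt.comp (continuousAt_const.mul ?_)
    refine Complex.continuous_ofReal.continuousAt.comp (continuousAt_const.mul ?_)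
    exact continuousAt_const.sub (continuousAt_const.div continuousAt_id hx)

lemma phase_mul_phase (s t x : ℝ) : phase s x * phase t x = x * phase (s + t) x := by
  have : Complex.exp (Complex.I * ((s + t) * (1 - 1 / x) : ℝ)) =
      Complex.exp (Complex.I * (s * (1 - 1 / x) : ℝ)) *
        Complex.exp (Complex.I * (t * (1 - 1 / x) : ℝ)) := by
    rw [← Complex.exp_add]; congr 1; push_cast; ring
  simp only [phase]
  rw [this]; ring

lemma star_phase (t x : ℝ) : (starRingEnd ℂ) (phase t x) = phase (-t) x := by
  simp only [phase, map_mul, Complex.conj_ofReal, ← Complex.exp_conj, Complex.conj_I]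
  congr 2
  push_cast; ring

/-- Second order Taylor estimate for the phase, uniform in `x`. -/
lemma norm_phase_taylor (t h x : ℝ) :
    ‖phase (t + h) x * x - phase t x * x - h * (Complex.I * ((x - 1 : ℝ) * phase t x))‖ ≤
      2 * (x - 1) ^ 2 * h ^ 2 := by
  by_cases hx : x = 0
  · subst hx
    simp [phase]
    positivity
  set y : ℝ := h * (1 - 1 / x) with hy
  have hxy : x * y = h * (x - 1) := by rw [hy]; field_simp
  have hphase : phase (t + h) x = phase t x * Complex.exp (Complex.I * (y : ℂ)) := by
    simp only [phase]
    rw [mul_assoc, ← Complex.exp_add]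
    congr 2
    push_cast [hy]; ring
  have hxy' : (x : ℂ) * y = h * ((x - 1 : ℝ) : ℂ) := by exact_mod_cast hxy
  have e : phase (t + h) x * x - phase t x * x - h * (Complex.I * ((x - 1 : ℝ) * phase t x)) =
      phase t x * x * (Complex.exp (Complex.I * y) - 1 - Complex.I * y) := by
    rw [hphase]
    linear_combination (-Complex.I * phase t x) * (-hxy')
  have hexp : ‖Complex.exp (Complex.I * y) - 1 - Complex.I * y‖ ≤ 2 * y ^ 2 := by
    -- Taylor's formula for small y; for |y| ≥ 1 the trivial bound 2|y| is already at most 2y².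
    rcases le_total |y| 1 with h1 | h1
    · have hn : ‖Complex.I * (y : ℂ)‖ = |y| := by simp
      have h2 := Complex.norm_exp_sub_one_sub_id_le (x := Complex.I * y) (by rw [hn]; exact h1)
      rw [hn, sq_abs] at h2
      nlinarith [sq_nonneg y]
    · have h2 := Real.norm_exp_I_mul_ofReal_sub_one_le (x := y)
      rw [Real.norm_eq_abs] at h2
      have h3 : ‖Complex.I * (y : ℂ)‖ = |y| := by simp
      refine (norm_sub_le _ _).trans ?_
      rw [h3, ← sq_abs y]
      nlinarith
  rw [e, norm_mul, norm_mul, norm_phase, Complex.norm_real, Real.norm_eq_abs]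
  calc |x| * |x| * _ ≤ |x| * |x| * (2 * y ^ 2) := by gcongr
    _ = 2 * (x * y) ^ 2 := by rw [abs_mul_abs_self]; ring
    _ = _ := by rw [hxy]; ring

variable {X : Type*} [NormedAddCommGroup X] [InnerProductSpace ℂ X] [CompleteSpace X]

lemma cfc_re_mul (J : X →L[ℂ] X) {f g : ℝ → ℂ} (hf : Continuous f)
    (hg : Continuous g) : cfc (fun z : ℂ => f z.re * g z.re) J =
      cfc (fun z : ℂ => f z.re) J * cfc (fun z : ℂ => g z.re) J :=
  cfc_mul _ _ J (hf.comp Complex.continuous_re).continuousOn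
    (hg.comp Complex.continuous_re).continuousOn

lemma cfc_ofReal_re {J : X →L[ℂ] X} (hJ : IsSelfAdjoint J) :
    cfc (fun z : ℂ => (z.re : ℂ)) J = J := by
  have h : (spectrum ℂ J).EqOn (fun z : ℂ => (z.re : ℂ)) (fun z => z) := fun z hz =>
    (hJ.mem_spectrum_eq_re hz).symm
  rw [cfc_congr h, cfc_id' ℂ J hJ.isStarNormal]

/-- The operator `J exp(i t (1 - J⁻¹))`. -/
def phaseOp (J : X →L[ℂ] X) (t : ℝ) : X →L[ℂ] X := cfc (fun z : ℂ => phase t z.re) J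

lemma phaseOp_zero {J : X →L[ℂ] X} (hJ : IsSelfAdjoint J) : phaseOp J 0 = J := by
  rw [phaseOp]
  simp only [phase, zero_mul, Complex.ofReal_zero, mul_zero, Complex.exp_zero, mul_one]
  exact cfc_ofReal_re hJ

lemma phaseOp_mul {J : X →L[ℂ] X} (hJ : IsSelfAdjoint J) (s t : ℝ) :
    phaseOp J s * phaseOp J t = J * phaseOp J (s + t) := by
  rw [phaseOp, phaseOp, ← cfc_re_mul J (continuous_phase s) (continuous_phase t)]
  simp only [phase_mul_phase]
  rw [cfc_re_mul J Complex.continuous_ofReal (continuous_phase _), cfc_ofReal_re hJ]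
  rfl

lemma phaseOp_commute {J : X →L[ℂ] X} (hJ : IsSelfAdjoint J) (t : ℝ) :
    J * phaseOp J t = phaseOp J t * J := by
  have := phaseOp_mul hJ t 0
  rw [phaseOp_zero hJ, add_zero] at this
  exact this.symm

lemma star_phaseOp (J : X →L[ℂ] X) (t : ℝ) : star (phaseOp J t) = phaseOp J (-t) := by
  rw [phaseOp, ← cfc_star]
  congr 1
  funext z
  exact star_phase t z.re

/-- The adjoint of `phaseOp J t` is `phaseOp J (-t)`, and the product of the two is J². Hence J x ↦
`phaseOp J t x` is well defined and isometric. -/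
lemma norm_phaseOp_apply {J : X →L[ℂ] X} (hJ : IsSelfAdjoint J) (t : ℝ) (x : X) :
    ‖phaseOp J t x‖ = ‖J x‖ := by
  have h1 : (phaseOp J t).adjoint * phaseOp J t = J * J := by
    rw [← ContinuousLinearMap.star_eq_adjoint, star_phaseOp, phaseOp_mul hJ, neg_add_cancel,
      phaseOp_zero hJ]
  have h2 : inner ℂ (phaseOp J t x) (phaseOp J t x) = inner ℂ (J x) (J x) := by
    rw [← ContinuousLinearMap.adjoint_inner_right]
    have e : (phaseOp J t).adjoint (phaseOp J t x) = J (J x) := DFunLike.congr_fun h1 x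
    rw [e, ← ContinuousLinearMap.adjoint_inner_left, ← ContinuousLinearMap.star_eq_adjoint, hJ.star_eq]
  rw [inner_self_eq_norm_sq_to_K, inner_self_eq_norm_sq_to_K] at h2
  have h3 : ‖phaseOp J t x‖ ^ 2 = ‖J x‖ ^ 2 := by exact_mod_cast h2
  exact (pow_left_inj₀ (norm_nonneg _) (norm_nonneg _) two_ne_zero).1 h3

lemma cfc_re_sub (J : X →L[ℂ] X) {f g : ℝ → ℂ} (hf : Continuous f)
    (hg : Continuous g) : cfc (fun z : ℂ => f z.re - g z.re) J =
      cfc (fun z : ℂ => f z.re) J - cfc (fun z : ℂ => g z.re) J :=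
  cfc_sub (fun z : ℂ => f z.re) (fun z : ℂ => g z.re) J
    (hf.comp Complex.continuous_re).continuousOn (hg.comp Complex.continuous_re).continuousOn

lemma cfc_re_const_mul (J : X →L[ℂ] X) (c : ℂ) {f : ℝ → ℂ} (hf : Continuous f) :
    cfc (fun z : ℂ => c * f z.re) J = c • cfc (fun z : ℂ => f z.re) J :=
  cfc_const_mul c (fun z : ℂ => f z.re) J (hf.comp Complex.continuous_re).continuousOn

/-- The additional factor J removes the pole of 1 − 1/x, so the remainder in `norm_phase_taylor` is
O(h²) uniformly on the spectrum and the derivative exists in operator norm. -/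
lemma hasDerivAt_phaseOp_mul {J : X →L[ℂ] X} (hJ : IsSelfAdjoint J) (t : ℝ) :
    HasDerivAt (fun t => phaseOp J t * J) (Complex.I • ((J - 1) * phaseOp J t)) t := by
  have e1 : ∀ s, phaseOp J s * J = cfc (fun z : ℂ => phase s z.re * z.re) J := fun s => by
    rw [cfc_re_mul J (continuous_phase s) Complex.continuous_ofReal, cfc_ofReal_re hJ]; rfl
  have e2 : (J - 1) * phaseOp J t =
      cfc (fun z : ℂ => ((z.re - 1 : ℝ) : ℂ) * phase t z.re) J := by
    have h1 : (fun z : ℂ => ((z.re - 1 : ℝ) : ℂ)) = fun z => (z.re : ℂ) - 1 := by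
      funext z; push_cast; rfl
    rw [cfc_re_mul J (f := fun x => ((x - 1 : ℝ) : ℂ)) (by fun_prop) (continuous_phase t), h1,
      cfc_re_sub J (f := fun x => (x : ℂ)) (g := fun _ => 1) Complex.continuous_ofReal
        continuous_const, cfc_ofReal_re hJ, cfc_const_one ℂ J hJ.isStarNormal]
    rfl
  have hcp : ∀ s, Continuous fun x : ℝ => phase s x * (x : ℂ) := fun s =>
    (continuous_phase s).mul Complex.continuous_ofReal
  have hcd : Continuous fun x : ℝ => Complex.I * (((x - 1 : ℝ) : ℂ) * phase t x) :=
    continuous_const.mul (Continuous.mul (by fun_prop) (continuous_phase t))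
  have hbd : ∀ z ∈ spectrum ℂ J, ‖z‖ ≤ ‖J‖ := fun z hz =>
    (spectrum.norm_le_norm_mul_of_mem hz).trans
      (mul_le_of_le_one_right (norm_nonneg _) ContinuousLinearMap.norm_id_le)
  rw [hasDerivAt_iff_isLittleO_nhds_zero]
  have hO : (fun h : ℝ => phaseOp J (t + h) * J - phaseOp J t * J -
      h • (Complex.I • ((J - 1) * phaseOp J t))) =O[𝓝 0] fun h : ℝ => h ^ 2 := by
    refine Asymptotics.IsBigO.of_bound (2 * (‖J‖ + 1) ^ 2) (Eventually.of_forall fun h => ?_)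
    have e3 : phaseOp J (t + h) * J - phaseOp J t * J -
        h • (Complex.I • ((J - 1) * phaseOp J t)) = cfc (fun z : ℂ => (phase (t + h) z.re * z.re -
          phase t z.re * z.re) - h * (Complex.I * (((z.re - 1 : ℝ) : ℂ) * phase t z.re))) J := by
      rw [cfc_re_sub J (f := fun x => phase (t + h) x * x - phase t x * x)
        (g := fun x => h * (Complex.I * (((x - 1 : ℝ) : ℂ) * phase t x)))
        ((hcp _).sub (hcp _)) (continuous_const.mul hcd),
        cfc_re_sub J (f := fun x => phase (t + h) x * x) (g := fun x => phase t x * x)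
        (hcp _) (hcp _), ← e1, ← e1, cfc_re_const_mul J (h : ℂ) hcd,
        cfc_re_const_mul J Complex.I (f := fun x => ((x - 1 : ℝ) : ℂ) * phase t x)
          (Continuous.mul (by fun_prop) (continuous_phase t)), ← e2]
      rfl
    rw [e3]
    refine norm_cfc_le (by positivity) fun z hz => ?_
    have hre : |z.re| ≤ ‖J‖ := (Complex.abs_re_le_norm z).trans (hbd z hz)
    refine (norm_phase_taylor t h z.re).trans ?_
    rw [norm_pow, Real.norm_eq_abs, sq_abs]
    refine mul_le_mul_of_nonneg_right ?_ (sq_nonneg h)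
    refine mul_le_mul_of_nonneg_left (sq_le_sq' ?_ ?_) two_pos.le
    · linarith [(abs_le.1 hre).1]
    · linarith [(abs_le.1 hre).2]
  refine hO.trans_isLittleO ?_
  simpa using Asymptotics.isLittleO_pow_id (𝕜 := ℝ) one_lt_two

section Group

variable {J : X →L[ℂ] X}

/-- The orthogonal complement of the range is the kernel of the adjoint, here of J itself. -/
lemma denseRange_of_isSelfAdjoint (hJ : IsSelfAdjoint J) (hi : Function.Injective J) :
    DenseRange J := by
  have h1 : (LinearMap.range J.toLinearMap)ᗮ = ⊥ := by
    have := ContinuousLinearMap.orthogonal_range J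
    rw [this, ← ContinuousLinearMap.star_eq_adjoint, hJ.star_eq]
    exact LinearMap.ker_eq_bot.2 hi
  have h2 := (Submodule.topologicalClosure_eq_top_iff (K := LinearMap.range J.toLinearMap)).2 h1
  have h3 := Submodule.dense_iff_topologicalClosure_eq_top.2 h2
  exact h3

/-- The unitary group `exp(i t (1 - J⁻¹))`. -/
def unitaryGroup (J : X →L[ℂ] X) (t : ℝ) : X →L[ℂ] X :=
  LinearMap.extendOfNorm (phaseOp J t).toLinearMap J.toLinearMap

variable (hJ : IsSelfAdjoint J) (hi : Function.Injective J)
include hJ hi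

lemma unitaryGroup_apply (t : ℝ) (x : X) : unitaryGroup J t (J x) = phaseOp J t x :=
  LinearMap.extendOfNorm_eq (f := (phaseOp J t).toLinearMap) (e := J.toLinearMap)
    (denseRange_of_isSelfAdjoint hJ hi)
    ⟨1, fun x => by rw [one_mul]; exact (norm_phaseOp_apply hJ t x).le⟩ x

lemma clm_ext_of_dense {A B : X →L[ℂ] X} (h : ∀ x, A (J x) = B (J x)) : A = B := by
  refine ContinuousLinearMap.ext fun x => ?_
  exact congrFun ((denseRange_of_isSelfAdjoint hJ hi).equalizer A.continuous B.continuous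
    (funext h)) x

lemma norm_unitaryGroup_apply (t : ℝ) (x : X) : ‖unitaryGroup J t x‖ = ‖x‖ := by
  have h : (fun x => ‖unitaryGroup J t x‖) = fun x => ‖x‖ :=
    (denseRange_of_isSelfAdjoint hJ hi).equalizer (by fun_prop) continuous_norm (funext fun x => by
      simp only [Function.comp_apply]
      rw [unitaryGroup_apply hJ hi, norm_phaseOp_apply hJ])
  exact congrFun h x

lemma unitaryGroup_mul_self (t : ℝ) : unitaryGroup J t * J = phaseOp J t :=
  ContinuousLinearMap.ext fun x => unitaryGroup_apply hJ hi t x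

lemma unitaryGroup_commute (t : ℝ) : J * unitaryGroup J t = unitaryGroup J t * J := by
  refine clm_ext_of_dense hJ hi fun x => ?_
  show J (unitaryGroup J t (J x)) = unitaryGroup J t (J (J x))
  rw [unitaryGroup_apply hJ hi, unitaryGroup_apply hJ hi]
  exact DFunLike.congr_fun (phaseOp_commute hJ t) x

lemma unitaryGroup_zero : unitaryGroup J 0 = 1 := by
  refine clm_ext_of_dense hJ hi fun x => ?_
  rw [unitaryGroup_apply hJ hi, phaseOp_zero hJ]; rfl

lemma unitaryGroup_mul (s t : ℝ) :
    unitaryGroup J s * unitaryGroup J t = unitaryGroup J (s + t) := by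
  refine clm_ext_of_dense hJ hi fun x => ?_
  -- The multiplication rule for `phaseOp` carries a surplus factor J, so both sides are compared
  -- after applying J.
  refine hi ?_
  show J (unitaryGroup J s (unitaryGroup J t (J x))) = J (unitaryGroup J (s + t) (J x))
  rw [unitaryGroup_apply hJ hi, unitaryGroup_apply hJ hi]
  have h1 : J (unitaryGroup J s (phaseOp J t x)) = unitaryGroup J s (J (phaseOp J t x)) :=
    DFunLike.congr_fun (unitaryGroup_commute hJ hi s) _
  rw [h1, unitaryGroup_apply hJ hi]
  exact DFunLike.congr_fun (phaseOp_mul hJ s t) x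

/-- The group alone is only strongly continuous; composed with J² it is differentiable in norm,
which is all that the Duhamel argument uses. -/
lemma hasDerivAt_unitaryGroup_mul (t : ℝ) :
    HasDerivAt (fun t => unitaryGroup J t * (J * J))
      (Complex.I • ((J - 1) * (J * unitaryGroup J t))) t := by
  have h := hasDerivAt_phaseOp_mul hJ t
  simp only [← unitaryGroup_mul_self hJ hi, mul_assoc] at h
  rwa [← unitaryGroup_commute hJ hi] at h

/-- Continuity holds on the dense range of J² and passes to every x because the operators are
isometries. -/
lemma continuous_unitaryGroup_apply (x : X) : Continuous fun t => unitaryGroup J t x := by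
  have hd := denseRange_of_isSelfAdjoint hJ hi
  have hd2 : DenseRange (J * J : X →L[ℂ] X) := hd.comp hd J.continuous
  rw [Metric.continuous_iff]
  intro t ε hε
  obtain ⟨y, hy⟩ := Metric.denseRange_iff.1 hd2 x (ε / 3) (by positivity)
  have hc : Continuous fun t => unitaryGroup J t ((J * J : X →L[ℂ] X) y) := by
    rw [continuous_iff_continuousAt]
    intro s
    exact ((hasDerivAt_unitaryGroup_mul hJ hi s).continuousAt.clm_apply continuousAt_const)
  obtain ⟨δ, hδ, h⟩ := Metric.continuous_iff.1 hc t (ε / 3) (by positivity)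
  refine ⟨δ, hδ, fun s hs => ?_⟩
  have h1 : ∀ r, dist (unitaryGroup J r x) (unitaryGroup J r ((J * J : X →L[ℂ] X) y)) < ε / 3 := by
    intro r
    rw [dist_eq_norm, ← map_sub, norm_unitaryGroup_apply hJ hi, ← dist_eq_norm]
    exact hy
  calc dist (unitaryGroup J s x) (unitaryGroup J t x)
      ≤ _ + _ + _ := dist_triangle4 _ (unitaryGroup J s ((J * J : X →L[ℂ] X) y))
        (unitaryGroup J t ((J * J : X →L[ℂ] X) y)) _
    _ < ε / 3 + ε / 3 + ε / 3 := by
        have := h1 t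
        rw [dist_comm] at this
        exact add_lt_add (add_lt_add (h1 s) (h s hs)) this
    _ = ε := by ring

lemma continuousOn_unitaryGroup_comp {s : Set ℝ} {a : ℝ → ℝ} {v : ℝ → X} (ha : Continuous a)
    (hv : ContinuousOn v s) : ContinuousOn (fun t => unitaryGroup J (a t) (v t)) s := by
  intro t ht
  rw [ContinuousWithinAt, tendsto_iff_norm_sub_tendsto_zero]
  have h1 : Tendsto (fun r => ‖v r - v t‖) (𝓝[s] t) (𝓝 0) :=
    tendsto_iff_norm_sub_tendsto_zero.1 (hv t ht)
  have h2 : Tendsto (fun r => ‖unitaryGroup J (a r) (v t) - unitaryGroup J (a t) (v t)‖)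
      (𝓝[s] t) (𝓝 0) :=
    (tendsto_iff_norm_sub_tendsto_zero.1
      (((continuous_unitaryGroup_apply hJ hi (v t)).comp ha).tendsto t)).mono_left nhdsWithin_le_nhds
  refine squeeze_zero (fun _ => norm_nonneg _) (fun r => ?_) (by simpa using h1.add h2)
  calc ‖unitaryGroup J (a r) (v r) - unitaryGroup J (a t) (v t)‖
      = ‖unitaryGroup J (a r) (v r - v t) +
          (unitaryGroup J (a r) (v t) - unitaryGroup J (a t) (v t))‖ := by
        rw [map_sub]; congr 1; abel
    _ ≤ _ := by
        refine (norm_add_le _ _).trans ?_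
        rw [norm_unitaryGroup_apply hJ hi]

end Group

end UnitaryGroup

/-! ### Semilinear evolution equations with a small source. -/

section Duhamel

variable {X : Type*} [NormedAddCommGroup X]

lemma continuousOn_comp_of_lipschitz {T K : ℝ} {F : ℝ → X → X}
    (hFc : ∀ x, ‖x‖ ≤ 1 → ContinuousOn (fun t => F t x) (Icc 0 T))
    (hFL : ∀ t ∈ Icc 0 T, ∀ x y, ‖x‖ ≤ 1 → ‖y‖ ≤ 1 → ‖F t x - F t y‖ ≤ K * ‖x - y‖)
    {y : ℝ → X} (hy : ContinuousOn y (Icc 0 T)) (hy1 : ∀ t ∈ Icc 0 T, ‖y t‖ ≤ 1) :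
    ContinuousOn (fun t => F t (y t)) (Icc 0 T) := by
  intro t ht
  rw [ContinuousWithinAt, tendsto_iff_norm_sub_tendsto_zero]
  have h1 : Tendsto (fun r => K * ‖y r - y t‖) (𝓝[Icc 0 T] t) (𝓝 (K * 0)) :=
    (tendsto_iff_norm_sub_tendsto_zero.1 (hy t ht)).const_mul K
  have h2 : Tendsto (fun r => ‖F r (y t) - F t (y t)‖) (𝓝[Icc 0 T] t) (𝓝 0) :=
    tendsto_iff_norm_sub_tendsto_zero.1 (hFc (y t) (hy1 t ht) t ht)
  have h3 := h1.add h2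
  rw [mul_zero, add_zero] at h3
  refine squeeze_zero' (Eventually.of_forall fun _ => norm_nonneg _) ?_ h3
  filter_upwards [self_mem_nhdsWithin] with r hr
  calc ‖F r (y r) - F t (y t)‖ = ‖(F r (y r) - F r (y t)) + (F r (y t) - F t (y t))‖ := by
        congr 1; abel
    _ ≤ _ := (norm_add_le _ _).trans (by gcongr; exact hFL r hr _ _ (hy1 r hr) (hy1 t ht))

variable [InnerProductSpace ℂ X]

/-- The radial retraction onto the unit ball. -/
def ballRetraction (x : X) : X := (((max 1 ‖x‖)⁻¹ : ℝ) : ℂ) • x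

lemma norm_ballRetraction_le (x : X) : ‖ballRetraction x‖ ≤ 1 ∧ ‖ballRetraction x‖ ≤ ‖x‖ := by
  have h1 : (1 : ℝ) ≤ max 1 ‖x‖ := le_max_left _ _
  have h2 : ‖x‖ ≤ max 1 ‖x‖ := le_max_right _ _
  have e : ‖ballRetraction x‖ = (max 1 ‖x‖)⁻¹ * ‖x‖ := by
    rw [ballRetraction, norm_smul, Complex.norm_real, Real.norm_eq_abs, abs_of_pos (by positivity)]
  rw [e]
  constructor
  · rw [inv_mul_le_iff₀ (by linarith)]; linarith
  · exact mul_le_of_le_one_left (norm_nonneg _) (inv_le_one_of_one_le₀ h1)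

lemma ballRetraction_of_le {x : X} (h : ‖x‖ ≤ 1) : ballRetraction x = x := by
  simp [ballRetraction, max_eq_left h]

lemma norm_ballRetraction_sub_le (x y : X) :
    ‖ballRetraction x - ballRetraction y‖ ≤ 2 * ‖x - y‖ := by
  set a := max 1 ‖x‖ with ha
  set b := max 1 ‖y‖ with hb
  have ha1 : (1 : ℝ) ≤ a := le_max_left _ _
  have hb1 : (1 : ℝ) ≤ b := le_max_left _ _
  have hyb : ‖y‖ ≤ b := le_max_right _ _
  have hab : |a - b| ≤ ‖x - y‖ :=
    (abs_max_sub_max_le_max 1 ‖x‖ 1 ‖y‖).trans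
      (by rw [sub_self, abs_zero]; exact max_le (norm_nonneg _) (abs_norm_sub_norm_le x y))
  have e : ballRetraction x - ballRetraction y =
      ((a⁻¹ : ℝ) : ℂ) • (x - y) + ((a⁻¹ - b⁻¹ : ℝ) : ℂ) • y := by
    simp only [ballRetraction, ← ha, ← hb, Complex.ofReal_sub, sub_smul, smul_sub]
    abel
  rw [e]
  refine (norm_add_le _ _).trans ?_
  rw [norm_smul, norm_smul, Complex.norm_real, Complex.norm_real, Real.norm_eq_abs,
    Real.norm_eq_abs, abs_of_pos (by positivity : 0 < a⁻¹)]
  have h1 : a⁻¹ * ‖x - y‖ ≤ ‖x - y‖ :=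
    mul_le_of_le_one_left (norm_nonneg _) (inv_le_one_of_one_le₀ ha1)
  have h2 : |a⁻¹ - b⁻¹| * ‖y‖ ≤ ‖x - y‖ := by
    have : a⁻¹ - b⁻¹ = (b - a) * (a⁻¹ * b⁻¹) := by field_simp
    rw [this, abs_mul, abs_of_pos (by positivity : 0 < a⁻¹ * b⁻¹), abs_sub_comm]
    calc |a - b| * (a⁻¹ * b⁻¹) * ‖y‖ ≤ |a - b| * (1 * b⁻¹) * b := by
          gcongr; exact inv_le_one_of_one_le₀ ha1
      _ = |a - b| := by field_simp
      _ ≤ _ := hab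
  linarith

/-- By e^x − 1 ≤ x e^x; this form has no division by K and includes K = 0. -/
lemma gronwallBound_zero_le {K β t : ℝ} (hK : 0 ≤ K) (hβ : 0 ≤ β) :
    gronwallBound 0 K β t ≤ β * t * Real.exp (K * t) := by
  rcases eq_or_lt_of_le hK with rfl | hK
  · rw [gronwallBound_K0]; simp
  · rw [gronwallBound_of_K_ne_0 hK.ne']
    have h1 : Real.exp (K * t) - 1 ≤ K * t * Real.exp (K * t) := by
      have h2 := Real.add_one_le_exp (-(K * t))
      have h3 : Real.exp (-(K * t)) * Real.exp (K * t) = 1 := by rw [← Real.exp_add]; simp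
      nlinarith [Real.exp_pos (K * t)]
    calc 0 * Real.exp (K * t) + β / K * (Real.exp (K * t) - 1)
        ≤ β / K * (K * t * Real.exp (K * t)) := by rw [zero_mul, zero_add]; gcongr
      _ = _ := by field_simp

variable [CompleteSpace X]

/-- Global solution of an ordinary differential equation with small source. -/
lemma exists_ode_solution {T K β : ℝ} (hT : 0 ≤ T) (hK : 0 ≤ K) (hβ : 0 ≤ β) {F : ℝ → X → X}
    (hFc : ∀ x, ‖x‖ ≤ 1 → ContinuousOn (fun t => F t x) (Icc 0 T))
    (hFL : ∀ t ∈ Icc 0 T, ∀ x y, ‖x‖ ≤ 1 → ‖y‖ ≤ 1 → ‖F t x - F t y‖ ≤ K * ‖x - y‖)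
    (hF0 : ∀ t ∈ Icc 0 T, ‖F t 0‖ ≤ β) (hsmall : β * T * Real.exp (K * T) ≤ 1) :
    ∃ v : ℝ → X, v 0 = 0 ∧ (∀ t ∈ Icc 0 T, ‖v t‖ ≤ β * t * Real.exp (K * t)) ∧
      ∀ t ∈ Icc 0 T, HasDerivWithinAt v (F t (v t)) (Icc 0 T) t := by
  have hbd : ∀ t ∈ Icc 0 T, ∀ x, ‖F t (ballRetraction x)‖ ≤ K * ‖ballRetraction x‖ + β := by
    intro t ht x
    have h := hFL t ht (ballRetraction x) 0 (norm_ballRetraction_le x).1 (by simp)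
    rw [sub_zero] at h
    calc ‖F t (ballRetraction x)‖ ≤ ‖F t (ballRetraction x) - F t 0‖ + ‖F t 0‖ := by
          simpa using norm_add_le (F t (ballRetraction x) - F t 0) (F t 0)
      _ ≤ _ := add_le_add h (hF0 t ht)
  let L : NNReal := ⟨K + β, by positivity⟩
  let a : NNReal := ⟨(K + β) * T, by positivity⟩
  -- F is controlled only on the unit ball. Composed with the retraction it is globally bounded and
  -- 2K-Lipschitz, so the solution lives on all of [0, T]. The smallness hypothesis then keeps the
  -- solution in the ball, where the retraction is the identity.
  have hPL : IsPicardLindelof (fun t x => F t (ballRetraction x)) (tmin := 0) (tmax := T)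
      ⟨0, le_rfl, hT⟩ (0 : X) a 0 L ⟨2 * K, by positivity⟩ := by
    refine ⟨fun t ht => ?_, fun x _ => ?_, fun t ht x _ => ?_, ?_⟩
    · refine LipschitzOnWith.of_dist_le_mul fun x _ y _ => ?_
      rw [dist_eq_norm, dist_eq_norm]
      refine (hFL t ht _ _ (norm_ballRetraction_le x).1 (norm_ballRetraction_le y).1).trans ?_
      calc K * ‖ballRetraction x - ballRetraction y‖ ≤ K * (2 * ‖x - y‖) := by
            gcongr; exact norm_ballRetraction_sub_le x y
        _ = 2 * K * ‖x - y‖ := by ring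
    · exact hFc _ (norm_ballRetraction_le x).1
    · refine (hbd t ht x).trans ?_
      show K * ‖ballRetraction x‖ + β ≤ K + β
      nlinarith [(norm_ballRetraction_le x).1]
    · simp only [sub_zero, sub_self, max_eq_left hT, NNReal.coe_zero]
      exact le_rfl
  obtain ⟨v, hv0, hv⟩ := hPL.exists_eq_forall_mem_Icc_hasDerivWithinAt₀
  have hv0 : v 0 = 0 := hv0
  have hle : ∀ t ∈ Icc 0 T, ‖v t‖ ≤ β * t * Real.exp (K * t) := by
    intro t ht
    have h := norm_le_gronwallBound_of_norm_deriv_right_le (f := v) (δ := 0) (K := K) (ε := β)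
      (f' := fun t => F t (ballRetraction (v t)))
      (a := 0) (b := T) (fun s hs => (hv s hs).continuousWithinAt)
      (fun s hs => (hv s (Ico_subset_Icc_self hs)).mono_of_mem_nhdsWithin (Icc_mem_nhdsGE_of_mem hs))
      (by rw [hv0, norm_zero]) (fun s hs => (hbd s (Ico_subset_Icc_self hs) (v s)).trans (by
        gcongr; exact (norm_ballRetraction_le _).2)) t ht
    rw [sub_zero] at h
    exact h.trans (gronwallBound_zero_le hK hβ)
  refine ⟨v, hv0, hle, fun t ht => ?_⟩
  have h1 : ‖v t‖ ≤ 1 := by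
    refine (hle t ht).trans (le_trans ?_ hsmall)
    have ht2 := ht.2
    have ht1 := ht.1
    gcongr
  have := hv t ht
  rwa [ballRetraction_of_le h1] at this

variable {J : X →L[ℂ] X}

/-- Solution of `w' = i b (1 - J⁻¹) w + F(t, w)`, `w(0) = 0`, for a small source `F(t, 0)`. -/
lemma exists_mild_solution (hJ : IsSelfAdjoint J) (hi : Function.Injective J) (b : ℝ)
    {T K β : ℝ} (hT : 0 ≤ T) (hK : 0 ≤ K) (hβ : 0 ≤ β) {F : ℝ → X → X}
    (hFc : ∀ x, ‖x‖ ≤ 1 → ContinuousOn (fun t => F t x) (Icc 0 T))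
    (hFL : ∀ t ∈ Icc 0 T, ∀ x y, ‖x‖ ≤ 1 → ‖y‖ ≤ 1 → ‖F t x - F t y‖ ≤ K * ‖x - y‖)
    (hF0 : ∀ t ∈ Icc 0 T, ‖F t 0‖ ≤ β) (hsmall : β * T * Real.exp (K * T) ≤ 1) :
    ∃ w : ℝ → X, w 0 = 0 ∧ ContinuousOn w (Icc 0 T) ∧
      (∀ t ∈ Icc 0 T, ‖w t‖ ≤ β * t * Real.exp (K * t)) ∧
      ∀ t ∈ Icc 0 T, HasDerivWithinAt (fun t => J (J (w t)))
        (((b : ℂ) * Complex.I) • (J (J (w t)) - J (w t)) + J (J (F t (w t)))) (Icc 0 T) t := by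
  have hisom := norm_unitaryGroup_apply hJ hi
  -- For v(t) = U(−bt)w(t) the unbounded term disappears; isometry preserves the Lipschitz constant,
  -- the source bound and the unit ball.
  obtain ⟨v, hv0, hvle, hv⟩ := exists_ode_solution (X := X) hT hK hβ
    (F := fun t x => unitaryGroup J (-(b * t)) (F t (unitaryGroup J (b * t) x)))
    (fun x hx => continuousOn_unitaryGroup_comp hJ hi (by fun_prop)
      (continuousOn_comp_of_lipschitz hFc hFL
        (continuousOn_unitaryGroup_comp hJ hi (by fun_prop) continuousOn_const)
        fun t _ => by rw [hisom]; exact hx))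
    (fun t ht x y hx hy => by
      rw [← map_sub, hisom]
      refine (hFL t ht _ _ (by rwa [hisom]) (by rwa [hisom])).trans ?_
      rw [← map_sub, hisom])
    (fun t ht => by rw [hisom, map_zero]; exact hF0 t ht) hsmall
  refine ⟨fun t => unitaryGroup J (b * t) (v t), by simp [hv0],
    continuousOn_unitaryGroup_comp hJ hi (by fun_prop) fun t ht => (hv t ht).continuousWithinAt,
    fun t ht => by rw [hisom]; exact hvle t ht, fun t ht => ?_⟩
  have hcomm : ∀ s x, J (unitaryGroup J s x) = unitaryGroup J s (J x) := fun s x =>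
    DFunLike.congr_fun (unitaryGroup_commute hJ hi s) x
  have h1 := (hasDerivAt_unitaryGroup_mul hJ hi (b * t)).scomp t
    ((hasDerivAt_id t).const_mul b)
  -- Product rule for U(bt)J² applied to v(t), where U(bt)J² is differentiable in norm. This is why
  -- the conclusion differentiates J²w and not w.
  have h2 := ((((ContinuousLinearMap.restrictScalarsL ℂ X X ℝ ℝ).hasFDerivAt.comp_hasDerivAt t
    h1).hasDerivWithinAt (s := Icc 0 T))).clm_apply (hv t ht)
  have e : (fun t => J (J (unitaryGroup J (b * t) (v t)))) =
      fun s => unitaryGroup J (b * s) (J (J (v s))) := by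
    funext s
    rw [hcomm, hcomm]
  rw [e]
  refine h2.congr_deriv ?_
  have e2 : unitaryGroup J (b * t) (J (J (unitaryGroup J (-(b * t))
      (F t (unitaryGroup J (b * t) (v t)))))) = J (J (F t (unitaryGroup J (b * t) (v t)))) := by
    rw [hcomm, hcomm]
    have := DFunLike.congr_fun (unitaryGroup_mul hJ hi (b * t) (-(b * t)))
      (J (J (F t (unitaryGroup J (b * t) (v t)))))
    rw [add_neg_cancel, unitaryGroup_zero hJ hi] at this
    exact this
  refine congrArg₂ (· + ·) ?_ e2
  show (b * 1) • Complex.I • (J (J (unitaryGroup J (b * t) (v t))) -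
    J (unitaryGroup J (b * t) (v t))) = _
  rw [mul_one, mul_smul]
  rfl

end Duhamel

/-! ### The power nonlinearity on the tower space. -/

section Nonlinearity

variable {n M : ℕ} {lam : ℝ} {G H : ℕ → ℝ → ℂ}

-- The value 0 is never taken when 2n + 4 ≤ M and 0 < lam ≤ 1, by `Represents.mul`.
open Classical in
def towerMul (u v : towerSpace n lam M) : towerSpace n lam M :=
  if h : IsTower n lam M (mulTower (towerRep u) (towerRep v)) then towerMk _ h else 0

def towerStar (u : towerSpace n lam M) : towerSpace n lam M :=
  towerMk _ (represents_towerRep u).isTower.star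

/-- `|u| ^ (2 σ) u`. -/
def towerPower : ℕ → towerSpace n lam M → towerSpace n lam M
  | 0, u => u
  | σ + 1, u => towerMul (towerPower σ u) (towerMul u (towerStar u))

lemma mulTower_zero (G H : ℕ → ℝ → ℂ) (r : ℝ) : mulTower G H 0 r = G 0 r * H 0 r := by
  simp [mulTower]

lemma Represents.star (hl : 0 < lam) {u : towerSpace n lam M}
    (hu : Represents (u : TowerAmbient n lam M) G) :
    Represents (towerStar u : TowerAmbient n lam M) (fun j r => (starRingEnd ℂ) (G j r)) := by
  refine (represents_towerMk (represents_towerRep u).isTower.star).congr hl hu.isTower.star ?_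
  filter_upwards [(represents_towerRep u).ae_unique hl hu (Nat.zero_le _)] with r h h0
  rw [h h0]

lemma norm_towerStar (u : towerSpace n lam M) : ‖towerStar u‖ = ‖u‖ := by
  have h : ‖towerStar u‖ ^ 2 = ‖u‖ ^ 2 := by
    rw [towerStar, norm_towerMk_sq, norm_sq_eq_towerSq]
    simp [towerSq, radialSq]
  exact (pow_left_inj₀ (norm_nonneg _) (norm_nonneg _) two_ne_zero).1 h

lemma towerStar_sub (hl : 0 < lam) (u v : towerSpace n lam M) :
    towerStar u - towerStar v = towerStar (u - v) := by
  have hu := represents_towerRep u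
  have hv := represents_towerRep v
  have huv : Represents ((u - v : towerSpace n lam M) : TowerAmbient n lam M) _ := hu.sub hv
  refine Subtype.ext (((hu.star hl).sub (hv.star hl)).eq_of_ae hl (huv.star hl)
    (ae_of_all _ fun r _ => ?_))
  simp only [map_sub]

variable (hn : 2 ≤ n) (hM : 2 * n + 4 ≤ M) (hl : 0 < lam) (hl1 : lam ≤ 1)
include hn hM hl hl1

lemma Represents.mul {u v : towerSpace n lam M} (hu : Represents (u : TowerAmbient n lam M) G)
    (hv : Represents (v : TowerAmbient n lam M) H) :
    Represents (towerMul u v : TowerAmbient n lam M) (mulTower G H) := by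
  obtain ⟨C, -, hC⟩ := IsTower.exists_mulTower n M hn hM
  have hR : ∀ {G H : ℕ → ℝ → ℂ}, IsTower n lam M G → IsTower n lam M H →
      IsTower n lam M (mulTower G H) := fun {G H} hG hH =>
    (hC lam G H _ _ hl hl1 hG hH (Real.sqrt_nonneg _) (Real.sqrt_nonneg _)
      (Real.sq_sqrt (towerSq_nonneg _)).ge (Real.sq_sqrt (towerSq_nonneg _)).ge).1
  have h := hR (represents_towerRep u).isTower (represents_towerRep v).isTower
  rw [towerMul, dif_pos h]
  refine (represents_towerMk h).congr hl (hR hu.isTower hv.isTower) ?_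
  filter_upwards [(represents_towerRep u).ae_unique hl hu (Nat.zero_le _),
    (represents_towerRep v).ae_unique hl hv (Nat.zero_le _)] with r h1 h2 h0
  rw [mulTower_zero, mulTower_zero, h1 h0, h2 h0]

lemma towerMul_sub_left (u u' v : towerSpace n lam M) :
    towerMul (u - u') v = towerMul u v - towerMul u' v := by
  have hu := represents_towerRep u
  have hu' := represents_towerRep u'
  have hv := represents_towerRep v
  have hd : Represents ((u - u' : towerSpace n lam M) : TowerAmbient n lam M) _ := hu.sub hu'
  refine Subtype.ext ((hd.mul hn hM hl hl1 hv).eq_of_ae hl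
    ((hu.mul hn hM hl hl1 hv).sub (hu'.mul hn hM hl hl1 hv)) (ae_of_all _ fun r _ => ?_))
  simp only [mulTower_zero]; ring

lemma towerMul_sub_right (u v v' : towerSpace n lam M) :
    towerMul u (v - v') = towerMul u v - towerMul u v' := by
  have hu := represents_towerRep u
  have hv := represents_towerRep v
  have hv' := represents_towerRep v'
  have hd : Represents ((v - v' : towerSpace n lam M) : TowerAmbient n lam M) _ := hv.sub hv'
  refine Subtype.ext ((hu.mul hn hM hl hl1 hd).eq_of_ae hl
    ((hu.mul hn hM hl hl1 hv).sub (hu.mul hn hM hl hl1 hv')) (ae_of_all _ fun r _ => ?_))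
  simp only [mulTower_zero]; ring

lemma Represents.power (σ : ℕ) {u : towerSpace n lam M}
    (hu : Represents (u : TowerAmbient n lam M) G) :
    ∃ K, Represents (towerPower σ u : TowerAmbient n lam M) K ∧
      ∀ r, K 0 r = (‖G 0 r‖ : ℂ) ^ (2 * σ) * G 0 r := by
  induction σ with
  | zero => exact ⟨G, hu, fun r => by simp⟩
  | succ σ ih =>
    obtain ⟨K, hK, hK0⟩ := ih
    refine ⟨_, hK.mul hn hM hl hl1 (hu.mul hn hM hl hl1 (hu.star hl)), fun r => ?_⟩
    rw [mulTower_zero, mulTower_zero, hK0, Complex.mul_conj, Complex.normSq_eq_norm_sq]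
    push_cast; ring

omit hl hl1 in
lemma exists_norm_towerMul_le : ∃ C : ℝ, 0 < C ∧ ∀ lam : ℝ, 0 < lam → lam ≤ 1 →
    ∀ u v : towerSpace n lam M, ‖towerMul u v‖ ≤ C * (‖u‖ * ‖v‖) := by
  obtain ⟨C, hC0, hC⟩ := IsTower.exists_mulTower n M hn hM
  refine ⟨C, hC0, fun lam hl hl1 u v => ?_⟩
  have hu := represents_towerRep u
  have hv := represents_towerRep v
  have h := (hC lam _ _ ‖u‖ ‖v‖ hl hl1 hu.isTower hv.isTower (norm_nonneg _) (norm_nonneg _)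
    (norm_sq_eq_towerSq u).ge (norm_sq_eq_towerSq v).ge).2
  rw [← (hu.mul hn hM hl hl1 hv).norm_sq] at h
  exact le_of_sq_le_sq h (by positivity)

/-- The exponent 2σ being even, the nonlinearity is a monomial of degree 2σ + 1 in u and its
conjugate. The algebra property and a telescoping sum give both bounds, the factor 2σ + 1 counting
the factors replaced one at a time. -/
lemma norm_towerPower_le {C : ℝ} (hC0 : 0 < C)
    (hC : ∀ u v : towerSpace n lam M, ‖towerMul u v‖ ≤ C * (‖u‖ * ‖v‖)) {R : ℝ} (σ : ℕ)
    {u v : towerSpace n lam M} (hu : ‖u‖ ≤ R) (hv : ‖v‖ ≤ R) :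
    ‖towerPower σ u‖ ≤ C ^ (2 * σ) * R ^ (2 * σ + 1) ∧
      ‖towerPower σ u - towerPower σ v‖ ≤ (2 * σ + 1) * C ^ (2 * σ) * R ^ (2 * σ) * ‖u - v‖ := by
  have hR : 0 ≤ R := (norm_nonneg _).trans hu
  have hA : ∀ {x : towerSpace n lam M}, ‖x‖ ≤ R → ‖towerMul x (towerStar x)‖ ≤ C * R ^ 2 := by
    intro x hx
    refine (hC _ _).trans ?_
    rw [norm_towerStar, sq]
    gcongr
  have hAd : ‖towerMul u (towerStar u) - towerMul v (towerStar v)‖ ≤ 2 * C * R * ‖u - v‖ := by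
    have e : towerMul u (towerStar u) - towerMul v (towerStar v) =
        towerMul (u - v) (towerStar u) + towerMul v (towerStar (u - v)) := by
      rw [towerMul_sub_left hn hM hl hl1, ← towerStar_sub hl, towerMul_sub_right hn hM hl hl1]
      abel
    rw [e]
    refine (norm_add_le _ _).trans ((add_le_add (hC _ _) (hC _ _)).trans ?_)
    rw [norm_towerStar, norm_towerStar]
    have h1 : C * (‖u - v‖ * ‖u‖) ≤ C * (‖u - v‖ * R) := by gcongr
    have h2 : C * (‖v‖ * ‖u - v‖) ≤ C * (R * ‖u - v‖) := by gcongr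
    linarith
  have hb : ∀ σ, ∀ {x : towerSpace n lam M}, ‖x‖ ≤ R →
      ‖towerPower σ x‖ ≤ C ^ (2 * σ) * R ^ (2 * σ + 1) := by
    intro σ x hx
    induction σ with
    | zero => simpa [towerPower] using hx
    | succ σ ih =>
      calc ‖towerPower (σ + 1) x‖ ≤ C * (‖towerPower σ x‖ * ‖towerMul x (towerStar x)‖) := hC _ _
        _ ≤ C * ((C ^ (2 * σ) * R ^ (2 * σ + 1)) * (C * R ^ 2)) := by
          gcongr; exact hA hx
        _ = _ := by ring
  refine ⟨hb σ hu, ?_⟩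
  induction σ with
  | zero => simp [towerPower]
  | succ σ ih =>
    have e : towerPower (σ + 1) u - towerPower (σ + 1) v =
        towerMul (towerPower σ u - towerPower σ v) (towerMul u (towerStar u)) +
        towerMul (towerPower σ v) (towerMul u (towerStar u) - towerMul v (towerStar v)) := by
      rw [towerMul_sub_left hn hM hl hl1, towerMul_sub_right hn hM hl hl1, towerPower, towerPower]
      abel
    rw [e]
    refine (norm_add_le _ _).trans ((add_le_add (hC _ _) (hC _ _)).trans ?_)
    calc C * (‖towerPower σ u - towerPower σ v‖ * ‖towerMul u (towerStar u)‖) +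
        C * (‖towerPower σ v‖ * ‖towerMul u (towerStar u) - towerMul v (towerStar v)‖)
        ≤ C * (((2 * σ + 1) * C ^ (2 * σ) * R ^ (2 * σ) * ‖u - v‖) * (C * R ^ 2)) +
          C * ((C ^ (2 * σ) * R ^ (2 * σ + 1)) * (2 * C * R * ‖u - v‖)) := by
          gcongr
          · exact hA hu
          · exact hb σ hv
      _ = _ := by push_cast; ring

end Nonlinearity

/-! ### The correction to an approximate solution. -/

section Approximation

variable {n M : ℕ} {lam : ℝ} {G H : ℕ → ℝ → ℂ}

/-- 1 − Δ undoes J at any lower regularity, since both act on the same representative tower. -/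
lemma oneSubLap_res_resolventCLM [Fact (0 < lam)] (hn : 2 ≤ n) (hl : 0 < lam) (hl1 : lam ≤ 1)
    {M' : ℕ} (h : M' + 2 ≤ M) (x : towerSpace n lam M) :
    oneSubLap hn hl hl1 M' (resCLM n lam h (resolventCLM hn hl hl1 M x)) =
      resCLM n lam (by omega : M' ≤ M) x := by
  set y := (resolventEquiv hn hl hl1 M).symm x with hy
  have hY := represents_towerRep y
  have hx := hY.oneSubLap hn hl hl1
  rw [hy, oneSubLap_resolventEquiv_symm] at hx
  have hJ : Represents (resolventCLM hn hl hl1 M x : TowerAmbient n lam M) (towerRep y) :=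
    hY.res (Nat.le_add_right M 2)
  exact Subtype.ext (((hJ.res h).oneSubLap hn hl hl1).unique (hx.res (by omega)))

/-- The class of a function in `L²`. -/
def levelZero (n : ℕ) (lam : ℝ) (M : ℕ) :
    towerSpace n lam M →L[ℂ] Lp ℂ 2 (radialMeasure n lam) :=
  (PiLp.proj 2 (fun j : Fin (M + 1) => Lp ℂ 2 (radialMeasure (n + 2 * (j : ℕ)) lam))
    ⟨0, Nat.succ_pos M⟩).comp (towerSpace n lam M).subtypeL

lemma Represents.levelZero {u : towerSpace n lam M}
    (hu : Represents (u : TowerAmbient n lam M) G) :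
    levelZero n lam M u =ᵐ[radialMeasure n lam] G 0 := hu.ae_eq ⟨0, Nat.succ_pos M⟩

set_option maxHeartbeats 1000000 in
/-- The correction to an approximate solution `φ` of the equation
`i w' + b Δ w = κ |w| ^ (2 σ) w` whose nonlinear part is exact. -/
lemma exists_correction (hn : 2 ≤ n) (hM : 2 * n + 4 ≤ M) (hl : 0 < lam) (hl1 : lam ≤ 1)
    {C : ℝ} (hC0 : 0 < C) (hC : ∀ u v : towerSpace n lam M, ‖towerMul u v‖ ≤ C * (‖u‖ * ‖v‖))
    (σ : ℕ) {κ : ℝ} (hκ : |κ| = 1) {b T A : ℝ} (hb : 0 ≤ b) (hT : 0 ≤ T) (hA : 0 ≤ A)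
    {φ : ℝ → towerSpace n lam (M + 2)} (hφ : ContinuousOn φ (Icc 0 T))
    (hφA : ∀ t ∈ Icc 0 T, ‖φ t‖ ≤ A) {K β : ℝ}
    (hKdef : K = (2 * σ + 1) * C ^ (2 * σ) * (A + 1) ^ (2 * σ))
    (hβdef : β = b * (√(lapConst n M) * A)) (hsmall : β * T * Real.exp (K * T) ≤ 1) :
    ∃ w : ℝ → towerSpace n lam M, w 0 = 0 ∧ ContinuousOn w (Icc 0 T) ∧
      (∀ t ∈ Icc 0 T, ‖w t‖ ≤ β * t * Real.exp (K * t)) ∧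
      ∀ t ∈ Icc 0 T, HasDerivWithinAt (fun t => resCLM n lam (Nat.zero_le M) (w t))
        (((b : ℂ) * Complex.I) • lapCLM hn hl hl1 0 (resCLM n lam (by omega : 2 ≤ M) (w t)) +
          resCLM n lam (Nat.zero_le M) ((-Complex.I * κ) •
            (towerPower σ (resCLM n lam (Nat.le_add_right M 2) (φ t) + w t) -
              towerPower σ (resCLM n lam (Nat.le_add_right M 2) (φ t))) +
            (Complex.I * b) • lapCLM hn hl hl1 M (φ t))) (Icc 0 T) t := by
  have : Fact (0 < lam) := ⟨hl⟩
  set J := resolventCLM (n := n) hn hl hl1 M with hJ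
  set R := resCLM n lam (Nat.le_add_right M 2) with hR
  -- At x = 0 only the residual ibΔφ remains, and its norm is at most β. The curve φ is taken two
  -- derivatives smoother so that this residual lies in the space where w is sought.
  set F : ℝ → towerSpace n lam M → towerSpace n lam M := fun t x => (-Complex.I * κ) •
    (towerPower σ (R (φ t) + x) - towerPower σ (R (φ t))) +
      (Complex.I * b) • lapCLM hn hl hl1 M (φ t) with hF
  have hRA : ∀ t ∈ Icc 0 T, ‖R (φ t)‖ ≤ A := fun t ht => (norm_resCLM_le _ _).trans (hφA t ht)
  have hball : ∀ t ∈ Icc 0 T, ∀ x : towerSpace n lam M, ‖x‖ ≤ 1 → ‖R (φ t) + x‖ ≤ A + 1 :=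
    fun t ht x hx => (norm_add_le _ _).trans (add_le_add (hRA t ht) hx)
  have hcont : ∀ {y : ℝ → towerSpace n lam M}, ContinuousOn y (Icc 0 T) →
      (∀ t ∈ Icc 0 T, ‖y t‖ ≤ A + 1) → ContinuousOn (fun t => towerPower σ (y t)) (Icc 0 T) := by
    intro y hy hyb t ht
    rw [ContinuousWithinAt, tendsto_iff_norm_sub_tendsto_zero]
    have h1 := (tendsto_iff_norm_sub_tendsto_zero.1 (hy t ht)).const_mul
      ((2 * σ + 1) * C ^ (2 * σ) * (A + 1) ^ (2 * σ))
    rw [mul_zero] at h1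
    refine squeeze_zero' (Eventually.of_forall fun _ => norm_nonneg _) ?_ h1
    filter_upwards [self_mem_nhdsWithin] with r hr
    exact (norm_towerPower_le hn hM hl hl1 hC0 hC σ (hyb r hr) (hyb t ht)).2
  have hnormI : ‖-Complex.I * (κ : ℂ)‖ = 1 := by
    rw [norm_mul, norm_neg, Complex.norm_I, Complex.norm_real, Real.norm_eq_abs, hκ, one_mul]
  have hRc : ContinuousOn (fun t => R (φ t)) (Icc 0 T) := R.continuous.comp_continuousOn hφ
  have hLc : ContinuousOn (fun t => lapCLM hn hl hl1 M (φ t)) (Icc 0 T) :=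
    (lapCLM hn hl hl1 M).continuous.comp_continuousOn hφ
  have hN0 : ContinuousOn (fun t => towerPower σ (R (φ t))) (Icc 0 T) :=
    hcont hRc fun t ht => (hRA t ht).trans (by linarith)
  have hFc : ∀ x, ‖x‖ ≤ 1 → ContinuousOn (fun t => F t x) (Icc 0 T) := by
    intro x hx
    have hN1 : ContinuousOn (fun t => towerPower σ (R (φ t) + x)) (Icc 0 T) :=
      hcont (hRc.add continuousOn_const) fun t ht => hball t ht x hx
    have h1 := hN1.sub hN0
    have h2 := h1.const_smul (-Complex.I * κ)
    have h3 := hLc.const_smul (Complex.I * b)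
    exact h2.add h3
  have hFL : ∀ t ∈ Icc 0 T, ∀ x y, ‖x‖ ≤ 1 → ‖y‖ ≤ 1 → ‖F t x - F t y‖ ≤ K * ‖x - y‖ := by
    intro t ht x y hx hy
    have e : F t x - F t y = (-Complex.I * κ) •
        (towerPower σ (R (φ t) + x) - towerPower σ (R (φ t) + y)) := by
      simp only [hF]
      rw [add_sub_add_right_eq_sub, ← smul_sub, sub_sub_sub_cancel_right]
    have h := (norm_towerPower_le hn hM hl hl1 hC0 hC σ (hball t ht x hx) (hball t ht y hy)).2
    rw [add_sub_add_left_eq_sub, ← hKdef] at h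
    rw [e, norm_smul, hnormI, one_mul]
    exact h
  have hF0 : ∀ t ∈ Icc 0 T, ‖F t 0‖ ≤ β := by
    intro t ht
    simp only [hF, add_zero, sub_self, smul_zero, zero_add]
    rw [norm_smul, norm_mul, Complex.norm_I, Complex.norm_real, Real.norm_eq_abs,
      abs_of_nonneg hb, one_mul, hβdef]
    refine mul_le_mul_of_nonneg_left ((norm_lapCLM_le hn hl hl1 _).trans ?_) hb
    exact mul_le_mul_of_nonneg_left (hφA t ht) (Real.sqrt_nonneg _)
  obtain ⟨w, hw0, hwc, hwle, hw⟩ := exists_mild_solution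
    (isSelfAdjoint_resolventCLM (n := n) (M := M) hn hl hl1)
    (resolventCLM_injective (n := n) (M := M) hn hl hl1) b hT
    (K := K) (β := β) (by rw [hKdef]; positivity) (by rw [hβdef]; positivity) (F := F)
    hFc hFL hF0 hsmall
  refine ⟨w, hw0, hwc, hwle, fun t ht => ?_⟩
  have hA2 : ∀ x : towerSpace n lam M, oneSubLap hn hl hl1 0 (oneSubLap hn hl hl1 2
      (resCLM n lam (by omega : 2 + 2 ≤ M) (J (J x)))) = resCLM n lam (Nat.zero_le M) x := by
    intro x
    rw [hJ, oneSubLap_res_resolventCLM hn hl hl1 (by omega : 2 + 2 ≤ M)]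
    exact oneSubLap_res_resolventCLM hn hl hl1 (by omega : 0 + 2 ≤ M) x
  have hA1 : ∀ x : towerSpace n lam M, oneSubLap hn hl hl1 0 (oneSubLap hn hl hl1 2
      (resCLM n lam (by omega : 2 + 2 ≤ M) (J x))) = resCLM n lam (Nat.zero_le M) x -
        lapCLM hn hl hl1 0 (resCLM n lam (by omega : 2 ≤ M) x) := by
    intro x
    rw [hJ, oneSubLap_res_resolventCLM hn hl hl1 (by omega : 2 + 2 ≤ M)]
    rfl
  -- Applying (1 − Δ)², with values in L², to the equation for J²w recovers the equation for w: the
  -- terms J²w and Jw become w and (1 − Δ)w, whose difference is Δw.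
  let B : towerSpace n lam M →L[ℂ] towerSpace n lam 0 := (oneSubLap hn hl hl1 0).comp
    ((oneSubLap hn hl hl1 2).comp (resCLM n lam (by omega : 2 + 2 ≤ M)))
  have h1 := ((B.restrictScalars ℝ).hasFDerivAt).comp_hasDerivWithinAt t (hw t ht)
  have e1 : (⇑(B.restrictScalars ℝ) ∘ fun t => J (J (w t))) =
      fun t => resCLM n lam (Nat.zero_le M) (w t) := funext fun s => hA2 (w s)
  rw [hJ] at e1
  rw [e1] at h1
  refine h1.congr_deriv ?_
  show B _ = _
  rw [map_add, map_smul, map_sub]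
  refine congrArg₂ (· + ·) (congrArg _ ?_) (hA2 _)
  show oneSubLap hn hl hl1 0 (oneSubLap hn hl hl1 2 (resCLM n lam (by omega : 2 + 2 ≤ M)
    (J (J (w t))))) - oneSubLap hn hl hl1 0 (oneSubLap hn hl hl1 2
      (resCLM n lam (by omega : 2 + 2 ≤ M) (J (w t)))) = _
  rw [hA2, hA1, sub_sub_cancel]

end Approximation

/-! ### Derivatives of the phase solution and their growth in time. -/

section Tame

/-- Families of functions of `(lam, τ, r)` generated by the approximate solution
`a(r) exp(-i κ τ ρ(r))` under the operations which occur in its derivatives. -/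
inductive Tame (κ : ℝ) (ρ : ℝ → ℝ) : (ℝ → ℝ → ℝ → ℂ) → Prop
  | base (f : ℝ → ℂ) (hf : ContDiff ℝ ∞ f) (hs : tsupport f ⊆ Icc 1 2) :
      Tame κ ρ (fun _ τ r => f r * Complex.exp (-Complex.I * κ * τ * ρ r))
  | add {p p' : ℝ → ℝ → ℝ → ℂ} : Tame κ ρ p → Tame κ ρ p' →
      Tame κ ρ (fun lam τ r => p lam τ r + p' lam τ r)
  | const_mul {p : ℝ → ℝ → ℝ → ℂ} (a : ℂ) : Tame κ ρ p → Tame κ ρ (fun lam τ r => a * p lam τ r)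
  | time {p : ℝ → ℝ → ℝ → ℂ} : Tame κ ρ p → Tame κ ρ (fun lam τ r => τ * p lam τ r)
  | lam {p : ℝ → ℝ → ℝ → ℂ} : Tame κ ρ p → Tame κ ρ (fun lam τ r => lam * p lam τ r)
  | hq {p : ℝ → ℝ → ℝ → ℂ} : Tame κ ρ p → Tame κ ρ (fun lam τ r => hq lam r * p lam τ r)
  | hc {p : ℝ → ℝ → ℝ → ℂ} : Tame κ ρ p → Tame κ ρ (fun lam τ r => hc lam r * p lam τ r)
  | inv {p : ℝ → ℝ → ℝ → ℂ} : Tame κ ρ p → Tame κ ρ (fun lam τ r => (hq lam r : ℂ)⁻¹ * p lam τ r)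

namespace Tame

variable {κ : ℝ} {ρ : ℝ → ℝ} {p : ℝ → ℝ → ℝ → ℂ}

lemma eq_zero (h : Tame κ ρ p) (lam τ : ℝ) {r : ℝ} (hr : r ∉ Icc (1 : ℝ) 2) :
    p lam τ r = 0 := by
  induction h with
  | base f hf hs =>
    have : f r = 0 := image_eq_zero_of_notMem_tsupport fun h => hr (hs h)
    simp [this]
  | add _ _ h1 h2 => simp [h1, h2]
  | const_mul a _ h => simp [h]
  | time _ h => simp [h]
  | lam _ h => simp [h]
  | hq _ h => simp [h]
  | hc _ h => simp [h]
  | inv _ h => simp [h]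

/-- The constructors are what differentiation produces: the phase brings down a factor τ, hc' = lam²
hq brings in lam, and the derivative of 1/hq is −hc/hq². -/
lemma exists_deriv (hρ : ContDiff ℝ ∞ ρ) (h : Tame κ ρ p) : ∃ p', Tame κ ρ p' ∧
    ∀ lam : ℝ, 0 < lam → ∀ τ r : ℝ, 0 < r →
      HasDerivAt (fun r => p lam τ r) (p' lam τ r) r := by
  induction h with
  | base f hf hs =>
    have hf' : ContDiff ℝ ∞ (deriv f) := (contDiff_infty_iff_deriv.1 hf).2
    have hρ' : ContDiff ℝ ∞ (deriv ρ) := (contDiff_infty_iff_deriv.1 hρ).2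
    have hg : ContDiff ℝ ∞ (fun r => f r * ((deriv ρ r : ℝ) : ℂ)) :=
      hf.mul (Complex.ofRealCLM.contDiff.comp hρ')
    refine ⟨_, (Tame.base (deriv f) hf' ((tsupport_deriv_subset).trans hs)).add
      ((Tame.base _ hg ((tsupport_mul_subset_left (f := f)).trans hs)).time.const_mul
        (-Complex.I * κ)), fun lam _ τ r _ => ?_⟩
    have h1 := (contDiff_infty_iff_deriv.1 hf).1.differentiableAt (x := r) |>.hasDerivAt
    have h2 := ((contDiff_infty_iff_deriv.1 hρ).1.differentiableAt (x := r)
      |>.hasDerivAt).ofReal_comp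
    refine (h1.mul ((h2.const_mul (-Complex.I * κ * τ)).cexp)).congr_deriv ?_
    ring
  | add _ _ h1 h2 =>
    obtain ⟨p1, t1, d1⟩ := h1
    obtain ⟨p2, t2, d2⟩ := h2
    exact ⟨_, t1.add t2, fun lam hl τ r hr => (d1 lam hl τ r hr).add (d2 lam hl τ r hr)⟩
  | const_mul a _ h =>
    obtain ⟨p1, t1, d1⟩ := h
    exact ⟨_, t1.const_mul a, fun lam hl τ r hr => (d1 lam hl τ r hr).const_mul a⟩
  | time _ h =>
    obtain ⟨p1, t1, d1⟩ := h
    exact ⟨_, t1.time, fun lam hl τ r hr => (d1 lam hl τ r hr).const_mul _⟩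
  | lam _ h =>
    obtain ⟨p1, t1, d1⟩ := h
    exact ⟨_, t1.lam, fun lam hl τ r hr => (d1 lam hl τ r hr).const_mul _⟩
  | hq t0 h =>
    obtain ⟨p1, t1, d1⟩ := h
    exact ⟨_, t0.hc.add t1.hq, fun lam hl τ r hr =>
      ((hasDerivAt_hq hl r).ofReal_comp).mul (d1 lam hl τ r hr)⟩
  | hc t0 h =>
    obtain ⟨p1, t1, d1⟩ := h
    refine ⟨_, (t0.hq.lam.lam).add t1.hc, fun lam hl τ r hr => ?_⟩
    refine (((hasDerivAt_hc hl r).ofReal_comp).mul (d1 lam hl τ r hr)).congr_deriv ?_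
    push_cast; ring
  | inv t0 h =>
    obtain ⟨p1, t1, d1⟩ := h
    refine ⟨_, (t0.hc.inv.inv.const_mul (-1)).add t1.inv, fun lam hl τ r hr => ?_⟩
    have := hq_cast_ne_zero hl hr
    refine ((((hasDerivAt_hq hl r).ofReal_comp).inv this).mul (d1 lam hl τ r hr)).congr_deriv ?_
    simp only [Pi.inv_apply]
    field_simp

lemma exists_deriv_time (hρ : ContDiff ℝ ∞ ρ) (h : Tame κ ρ p) : ∃ p', Tame κ ρ p' ∧
    ∀ lam τ r : ℝ, HasDerivAt (fun τ => p lam τ r) (p' lam τ r) τ := by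
  induction h with
  | base f hf hs =>
    have hg : ContDiff ℝ ∞ (fun r => f r * (ρ r : ℂ)) :=
      hf.mul (Complex.ofRealCLM.contDiff.comp hρ)
    refine ⟨_, (Tame.base _ hg ((tsupport_mul_subset_left (f := f)).trans hs)).const_mul
      (-Complex.I * κ), fun lam τ r => ?_⟩
    have h1 : HasDerivAt (fun τ : ℝ => (τ : ℂ)) 1 τ := Complex.ofRealCLM.hasDerivAt
    refine ((((h1.const_mul (-Complex.I * κ)).mul_const (ρ r : ℂ)).cexp).const_mul
      (f r)).congr_deriv ?_
    ring
  | add _ _ h1 h2 =>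
    obtain ⟨p1, t1, d1⟩ := h1
    obtain ⟨p2, t2, d2⟩ := h2
    exact ⟨_, t1.add t2, fun lam τ r => (d1 lam τ r).add (d2 lam τ r)⟩
  | const_mul a _ h =>
    obtain ⟨p1, t1, d1⟩ := h
    exact ⟨_, t1.const_mul a, fun lam τ r => (d1 lam τ r).const_mul a⟩
  | time t0 h =>
    obtain ⟨p1, t1, d1⟩ := h
    refine ⟨_, t0.add t1.time, fun lam τ r => ?_⟩
    have h1 : HasDerivAt (fun τ : ℝ => (τ : ℂ)) 1 τ := Complex.ofRealCLM.hasDerivAt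
    refine (h1.mul (d1 lam τ r)).congr_deriv ?_
    ring
  | lam _ h =>
    obtain ⟨p1, t1, d1⟩ := h
    exact ⟨_, t1.lam, fun lam τ r => (d1 lam τ r).const_mul _⟩
  | hq _ h =>
    obtain ⟨p1, t1, d1⟩ := h
    exact ⟨_, t1.hq, fun lam τ r => (d1 lam τ r).const_mul _⟩
  | hc _ h =>
    obtain ⟨p1, t1, d1⟩ := h
    exact ⟨_, t1.hc, fun lam τ r => (d1 lam τ r).const_mul _⟩
  | inv _ h =>
    obtain ⟨p1, t1, d1⟩ := h
    exact ⟨_, t1.inv, fun lam τ r => (d1 lam τ r).const_mul _⟩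

end Tame

lemma hc_le_cosh_two {lam r : ℝ} (hl : 0 < lam) (hl1 : lam ≤ 1) (hr : r ∈ Icc (0 : ℝ) 2) :
    hc lam r ≤ Real.cosh 2 := by
  unfold hc
  rw [Real.cosh_le_cosh, abs_of_nonneg (mul_nonneg hl.le hr.1), abs_two]
  nlinarith [hr.1, hr.2]

lemma hq_le_cosh_two {lam r : ℝ} (hl : 0 < lam) (hl1 : lam ≤ 1) (hr : r ∈ Icc (0 : ℝ) 2) :
    hq lam r ≤ 2 * Real.cosh 2 := by
  have h2 := Convex.image_sub_le_mul_sub_of_deriv_le (convex_Icc (0 : ℝ) 2)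
    (f := hq lam) continuous_hq.continuousOn
    (fun x _ => (hasDerivAt_hq hl x).differentiableAt.differentiableWithinAt) (C := Real.cosh 2)
    (fun x hx => by
      rw [(hasDerivAt_hq hl x).deriv]
      exact hc_le_cosh_two hl hl1 (interior_subset hx)) 0 (by simp) r hr hr.1
  rw [hq_zero, sub_zero, sub_zero] at h2
  nlinarith [hr.2, Real.cosh_pos 2]

lemma memLp_of_support {n : ℕ} {lam : ℝ} (hl : 0 < lam) (hl1 : lam ≤ 1) {f : ℝ → ℂ} {A : ℝ}
    (hf : AEStronglyMeasurable f (volume.restrict (Ioi 0))) (hA : ∀ r, 0 < r → ‖f r‖ ≤ A)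
    (h0 : ∀ r, r ∉ Icc (1 : ℝ) 2 → f r = 0) : MemLp f 2 (radialMeasure n lam) ∧
      radialSq n lam f ≤ (2 * Real.cosh 2) ^ n * A ^ 2 := by
  have hA0 : 0 ≤ A := (norm_nonneg _).trans (hA 1 one_pos)
  have hQ : 1 ≤ 2 * Real.cosh 2 := by linarith [Real.one_le_cosh 2]
  set W := (2 * Real.cosh 2) ^ n * A ^ 2
  have hb : ∀ r, 0 < r → ‖hq lam r ^ (n - 1) * ‖f r‖ ^ 2‖ ≤ (Icc (1 : ℝ) 2).indicator
      (fun _ => W) r := by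
    intro r hr
    by_cases h : r ∈ Icc (1 : ℝ) 2
    · rw [indicator_of_mem h, Real.norm_eq_abs,
        abs_of_nonneg (mul_nonneg (pow_nonneg (hq_pos hl hr).le _) (sq_nonneg _))]
      have h1 := hq_le_cosh_two hl hl1 (⟨hr.le, h.2⟩ : r ∈ Icc (0 : ℝ) 2)
      have h2 : hq lam r ^ (n - 1) ≤ (2 * Real.cosh 2) ^ n :=
        (pow_le_pow_left₀ (hq_pos hl hr).le h1 _).trans (pow_le_pow_right₀ hQ (Nat.sub_le _ _))
      exact mul_le_mul h2 (pow_le_pow_left₀ (norm_nonneg _) (hA r hr) 2) (sq_nonneg _)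
        (by positivity)
    · rw [indicator_of_notMem h, h0 r h]; simp
  have hW : IntegrableOn ((Icc (1 : ℝ) 2).indicator (fun _ => W)) (Ioi 0) :=
    ((integrableOn_const (by simp)).integrable_indicator measurableSet_Icc).integrableOn
  have hI : IntegrableOn (fun r => hq lam r ^ (n - 1) * ‖f r‖ ^ 2) (Ioi 0) :=
    hW.mono' ((continuous_hq.pow _).aestronglyMeasurable.mul (hf.norm.pow 2))
      ((ae_restrict_iff' measurableSet_Ioi).2 (ae_of_all _ hb))
  refine ⟨(memLp_radial_iff hl).2 ⟨hf, hI⟩, ?_⟩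
  rw [radialSq_eq hl]
  refine (setIntegral_mono_on hI hW measurableSet_Ioi fun r hr =>
    (le_abs_self _).trans (hb r hr)).trans (le_of_eq ?_)
  have hsub : Icc (1 : ℝ) 2 ⊆ Ioi 0 := fun r hr => zero_lt_one.trans_le hr.1
  rw [setIntegral_indicator measurableSet_Icc, inter_eq_right.2 hsub, setIntegral_const]
  norm_num [Measure.real]

namespace Tame

variable {κ : ℝ} {ρ : ℝ → ℝ} {p : ℝ → ℝ → ℝ → ℂ}

/-- The support stays in [1, 2], where lam, hq, hc and 1/hq are bounded uniformly for lam ≤ 1, and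
the phase has modulus 1. Growth in time comes from the explicit factors τ alone. -/
lemma exists_bound (h : Tame κ ρ p) : ∃ (C : ℝ) (N : ℕ), 0 ≤ C ∧ ∀ lam : ℝ, 0 < lam → lam ≤ 1 →
    ∀ τ : ℝ, 0 ≤ τ → ∀ r : ℝ, 0 < r → ‖p lam τ r‖ ≤ C * (1 + τ) ^ N := by
  have hmul : ∀ {p : ℝ → ℝ → ℝ → ℂ} {m : ℝ → ℝ → ℝ} {A : ℝ}, Tame κ ρ p → 0 ≤ A →
      (∀ lam : ℝ, 0 < lam → lam ≤ 1 → ∀ r ∈ Icc (1 : ℝ) 2, |m lam r| ≤ A) →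
      (∃ (C : ℝ) (N : ℕ), 0 ≤ C ∧ ∀ lam : ℝ, 0 < lam → lam ≤ 1 →
        ∀ τ : ℝ, 0 ≤ τ → ∀ r : ℝ, 0 < r → ‖p lam τ r‖ ≤ C * (1 + τ) ^ N) →
      ∃ (C : ℝ) (N : ℕ), 0 ≤ C ∧ ∀ lam : ℝ, 0 < lam → lam ≤ 1 →
        ∀ τ : ℝ, 0 ≤ τ → ∀ r : ℝ, 0 < r → ‖(m lam r : ℂ) * p lam τ r‖ ≤ C * (1 + τ) ^ N := by
    rintro p m A hp hA hm ⟨C, N, hC, h⟩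
    refine ⟨A * C, N, by positivity, fun lam hl hl1 τ hτ r hr => ?_⟩
    by_cases hr2 : r ∈ Icc (1 : ℝ) 2
    · rw [norm_mul, Complex.norm_real, Real.norm_eq_abs, mul_assoc]
      exact mul_le_mul (hm lam hl hl1 r hr2) (h lam hl hl1 τ hτ r hr) (norm_nonneg _) hA
    · rw [hp.eq_zero lam τ hr2]; simp; positivity
  induction h with
  | base f hf hs =>
    obtain ⟨C, hC⟩ := (HasCompactSupport.of_support_subset_isCompact isCompact_Icc
      ((subset_tsupport f).trans hs)).exists_bound_of_continuous hf.continuous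
    refine ⟨C, 0, (norm_nonneg _).trans (hC 0), fun lam _ _ τ _ r _ => ?_⟩
    have e : Complex.exp (-Complex.I * κ * τ * ρ r) =
        Complex.exp (Complex.I * ((-(κ * τ * ρ r) : ℝ) : ℂ)) := by
      congr 1; push_cast; ring
    rw [pow_zero, mul_one, norm_mul, e, norm_exp_I_mul, mul_one]
    exact hC r
  | add _ _ h1 h2 =>
    obtain ⟨C1, N1, hC1, b1⟩ := h1
    obtain ⟨C2, N2, hC2, b2⟩ := h2
    refine ⟨C1 + C2, N1 + N2, by positivity, fun lam hl hl1 τ hτ r hr => ?_⟩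
    have hτ1 : 1 ≤ 1 + τ := by linarith
    have e1 : (1 + τ) ^ N1 ≤ (1 + τ) ^ (N1 + N2) := pow_le_pow_right₀ hτ1 (by omega)
    have e2 : (1 + τ) ^ N2 ≤ (1 + τ) ^ (N1 + N2) := pow_le_pow_right₀ hτ1 (by omega)
    refine (norm_add_le _ _).trans ((add_le_add (b1 lam hl hl1 τ hτ r hr)
      (b2 lam hl hl1 τ hτ r hr)).trans ?_)
    rw [add_mul]
    gcongr
  | const_mul a _ h =>
    obtain ⟨C, N, hC, b⟩ := h
    refine ⟨‖a‖ * C, N, by positivity, fun lam hl hl1 τ hτ r hr => ?_⟩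
    rw [norm_mul, mul_assoc]
    exact mul_le_mul_of_nonneg_left (b lam hl hl1 τ hτ r hr) (norm_nonneg _)
  | time _ h =>
    obtain ⟨C, N, hC, b⟩ := h
    refine ⟨C, N + 1, hC, fun lam hl hl1 τ hτ r hr => ?_⟩
    rw [norm_mul, Complex.norm_real, Real.norm_eq_abs, abs_of_nonneg hτ]
    calc τ * _ ≤ (1 + τ) * (C * (1 + τ) ^ N) :=
          mul_le_mul (by linarith) (b lam hl hl1 τ hτ r hr) (norm_nonneg _) (by linarith)
      _ = _ := by ring
  | lam t h =>
    exact hmul (m := fun lam _ => lam) (A := 1) t zero_le_one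
      (fun lam hl hl1 r _ => by rw [abs_of_pos hl]; exact hl1) h
  | hq t h =>
    exact hmul (m := fun lam r => _root_.hq lam r) (A := 2 * Real.cosh 2) t (by positivity)
      (fun lam hl hl1 r hr => by
        have hr0 : 0 < r := zero_lt_one.trans_le hr.1
        rw [abs_of_pos (hq_pos hl hr0)]
        exact hq_le_cosh_two hl hl1 ⟨hr0.le, hr.2⟩) h
  | hc t h =>
    exact hmul (m := fun lam r => _root_.hc lam r) (A := Real.cosh 2) t (by positivity)
      (fun lam hl hl1 r hr => by
        rw [abs_of_pos (hc_pos r)]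
        exact hc_le_cosh_two hl hl1 ⟨(zero_lt_one.trans_le hr.1).le, hr.2⟩) h
  | inv t h =>
    have := hmul (m := fun lam r => (_root_.hq lam r)⁻¹) (A := 1) t zero_le_one
      (fun lam hl hl1 r hr => by
        have hr0 : 0 < r := zero_lt_one.trans_le hr.1
        rw [abs_inv, abs_of_pos (hq_pos hl hr0)]
        exact inv_le_one_of_one_le₀ (hr.1.trans (le_hq hl hr0.le))) h
    simpa using this

lemma exists_bound_lt {q : ℕ → ℝ → ℝ → ℝ → ℂ} (h : ∀ j, Tame κ ρ (q j)) (m : ℕ) :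
    ∃ (C : ℝ) (N : ℕ), 0 ≤ C ∧ ∀ j < m, ∀ lam : ℝ, 0 < lam → lam ≤ 1 →
    ∀ τ : ℝ, 0 ≤ τ → ∀ r : ℝ, 0 < r → ‖q j lam τ r‖ ≤ C * (1 + τ) ^ N := by
  induction m with
  | zero => exact ⟨0, 0, le_rfl, fun j hj => absurd hj (Nat.not_lt_zero _)⟩
  | succ m ih =>
    obtain ⟨C1, N1, hC1, b1⟩ := ih
    obtain ⟨C2, N2, hC2, b2⟩ := (h m).exists_bound
    refine ⟨C1 + C2, N1 + N2, by positivity, fun j hj lam hl hl1 τ hτ r hr => ?_⟩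
    have hτ1 : 1 ≤ 1 + τ := by linarith
    have e1 : (1 + τ) ^ N1 ≤ (1 + τ) ^ (N1 + N2) := pow_le_pow_right₀ hτ1 (by omega)
    have e2 : (1 + τ) ^ N2 ≤ (1 + τ) ^ (N1 + N2) := pow_le_pow_right₀ hτ1 (by omega)
    rcases Nat.lt_succ_iff_lt_or_eq.1 hj with hj | rfl
    · exact (b1 j hj lam hl hl1 τ hτ r hr).trans (by gcongr; linarith)
    · exact (b2 lam hl hl1 τ hτ r hr).trans (by gcongr; linarith)

lemma continuousOn (hρ : ContDiff ℝ ∞ ρ) (h : Tame κ ρ p) {lam : ℝ} (hl : 0 < lam) (τ : ℝ) :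
    ContinuousOn (p lam τ) (Ioi 0) := by
  obtain ⟨p', -, h'⟩ := h.exists_deriv hρ
  exact fun r hr => (h' lam hl τ r hr).continuousAt.continuousWithinAt

lemma exists_isD (hρ : ContDiff ℝ ∞ ρ) (h : Tame κ ρ p) : ∃ p', Tame κ ρ p' ∧
    ∀ lam : ℝ, 0 < lam → ∀ τ : ℝ, IsD lam (p lam τ) (p' lam τ) := by
  obtain ⟨p', t, h'⟩ := h.exists_deriv hρ
  refine ⟨_, t.inv, fun lam hl τ => ?_⟩
  refine (IsPrim.of_hasDerivAt (fun r hr => h' lam hl τ r hr) (t.continuousOn hρ hl τ)).congr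
    (fun _ _ => rfl) (ae_of_all _ fun r hr => ?_)
  have := hq_cast_ne_zero hl hr
  field_simp

lemma exists_derivatives (hρ : ContDiff ℝ ∞ ρ) (h : Tame κ ρ p) :
    ∃ G : ℕ → ℝ → ℝ → ℝ → ℂ, G 0 = p ∧ (∀ j, Tame κ ρ (G j)) ∧
      ∀ j, ∀ lam : ℝ, 0 < lam → ∀ τ : ℝ, IsD lam (G j lam τ) (G (j + 1) lam τ) := by
  choose! D hD1 hD2 using fun (p : ℝ → ℝ → ℝ → ℂ) (h : Tame κ ρ p) => h.exists_isD hρ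
  have ht : ∀ j, Tame κ ρ (D^[j] p) := fun j => by
    induction j with
    | zero => exact h
    | succ j ih => rw [Function.iterate_succ_apply']; exact hD1 _ ih
  refine ⟨fun j => D^[j] p, rfl, ht, fun j lam hl τ => ?_⟩
  simp only [Function.iterate_succ_apply']
  exact hD2 _ (ht j) lam hl τ

/-- A tame family is a Lipschitz curve of Sobolev functions, of polynomial growth in time. -/
lemma exists_tower (hρ : ContDiff ℝ ∞ ρ) (h : Tame κ ρ p) (n M : ℕ) :
    ∃ (G : ℕ → ℝ → ℝ → ℝ → ℂ) (B : ℝ) (N : ℕ), G 0 = p ∧ 0 < B ∧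
      ∀ lam : ℝ, 0 < lam → lam ≤ 1 → ∀ τ : ℝ, 0 ≤ τ → IsTower n lam M (fun j => G j lam τ) ∧
        towerSq n lam M (fun j => G j lam τ) ≤ (B * (1 + τ) ^ N) ^ 2 ∧
        ∀ τ' : ℝ, 0 ≤ τ' → τ' ≤ τ → towerSq n lam M (fun j r => G j lam τ r - G j lam τ' r) ≤
          (B * (1 + τ) ^ N * |τ - τ'|) ^ 2 := by
  obtain ⟨G, hG0, hGt, hGD⟩ := h.exists_derivatives hρ
  choose G' hG't hG'd using fun j => (hGt j).exists_deriv_time hρ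
  obtain ⟨C1, N1, hC1, b1⟩ := exists_bound_lt hGt (M + 1)
  obtain ⟨C2, N2, hC2, b2⟩ := exists_bound_lt hG't (M + 1)
  have hQ : 1 ≤ 2 * Real.cosh 2 := by linarith [Real.one_le_cosh 2]
  set Q := 2 * Real.cosh 2
  have hW : 1 ≤ (M + 1) * Q ^ (n + 2 * M) := by
    have := one_le_pow₀ hQ (n := n + 2 * M)
    nlinarith [Nat.cast_nonneg (α := ℝ) M]
  set W := (M + 1) * Q ^ (n + 2 * M)
  have hsum : ∀ {lam : ℝ} {F : ℕ → ℝ → ℂ} {A : ℝ},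
      (∀ j ≤ M, radialSq (n + 2 * j) lam (F j) ≤ Q ^ (n + 2 * j) * A ^ 2) →
      towerSq n lam M F ≤ (W * A) ^ 2 := by
    intro lam F A hF
    have h1 : ∀ j ∈ Finset.range (M + 1), radialSq (n + 2 * j) lam (F j) ≤
        Q ^ (n + 2 * M) * A ^ 2 := fun j hj => by
      have hj : j ≤ M := by simpa [Nat.lt_succ_iff] using hj
      refine (hF j hj).trans (mul_le_mul_of_nonneg_right ?_ (sq_nonneg _))
      exact pow_le_pow_right₀ hQ (by omega)
    refine (Finset.sum_le_card_nsmul _ _ _ h1).trans ?_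
    rw [Finset.card_range, nsmul_eq_mul]
    have h2 : ((M + 1 : ℕ) : ℝ) * (Q ^ (n + 2 * M) * A ^ 2) = W * A ^ 2 := by
      simp only [W]; push_cast; ring
    rw [h2, mul_pow]
    refine mul_le_mul_of_nonneg_right ?_ (sq_nonneg _)
    nlinarith
  refine ⟨G, W * (C1 + C2 + 1), N1 + N2, hG0, by positivity, fun lam hl hl1 τ hτ => ?_⟩
  have hτ1 : 1 ≤ 1 + τ := by linarith
  have e1 : (1 + τ) ^ N1 ≤ (1 + τ) ^ (N1 + N2) := pow_le_pow_right₀ hτ1 (by omega)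
  have e2 : (1 + τ) ^ N2 ≤ (1 + τ) ^ (N1 + N2) := pow_le_pow_right₀ hτ1 (by omega)
  have hmeas : ∀ j τ, AEStronglyMeasurable (G j lam τ) (volume.restrict (Ioi 0)) := fun j τ =>
    ((hGt j).continuousOn hρ hl τ).aestronglyMeasurable measurableSet_Ioi
  have hmem : ∀ j ≤ M, _ := fun j hj => memLp_of_support (n := n + 2 * j) hl hl1 (hmeas j τ)
    (A := (C1 + C2 + 1) * (1 + τ) ^ (N1 + N2)) (fun r hr =>
      (b1 j (by omega) lam hl hl1 τ hτ r hr).trans (by gcongr; linarith))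
    (fun r hr => (hGt j).eq_zero lam τ hr)
  refine ⟨⟨fun j _ => hGD j lam hl τ, fun j hj => (hmem j hj).1⟩, ?_, fun τ' hτ' hle => ?_⟩
  · refine (hsum fun j hj => (hmem j hj).2).trans (le_of_eq (by ring))
  · refine (hsum (A := (C1 + C2 + 1) * (1 + τ) ^ (N1 + N2) * |τ - τ'|) fun j hj =>
      (memLp_of_support hl hl1 ((hmeas j τ).sub (hmeas j τ')) (fun r hr => ?_) fun r hr => ?_).2).trans
      (le_of_eq (by ring))
    · have hd := Convex.norm_image_sub_le_of_norm_hasDerivWithin_le (s := Icc 0 τ)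
        (f := fun τ => G j lam τ r) (f' := fun τ => G' j lam τ r) (C := C2 * (1 + τ) ^ N2)
        (fun s _ => (hG'd j lam s r).hasDerivWithinAt) (fun s hs =>
          (b2 j (by omega) lam hl hl1 s hs.1 r hr).trans (by
            have := hs.1
            have := hs.2
            gcongr))
        (convex_Icc 0 τ) ⟨hτ', hle⟩ ⟨hτ, le_rfl⟩
      refine hd.trans ?_
      rw [Real.norm_eq_abs]
      gcongr
      linarith
    · rw [Pi.sub_apply, (hGt j).eq_zero lam τ hr, (hGt j).eq_zero lam τ' hr, sub_zero]

/-- A tame family is a differentiable curve in `L²`. -/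
lemma hasDerivWithinAt (hρ : ContDiff ℝ ∞ ρ) (h : Tame κ ρ p) {p' : ℝ → ℝ → ℝ → ℂ}
    (ht : Tame κ ρ p') (hd : ∀ lam τ r : ℝ, HasDerivAt (fun τ => p lam τ r) (p' lam τ r) τ)
    {n : ℕ} {lam T : ℝ} (hl : 0 < lam) (hl1 : lam ≤ 1)
    {U : ℝ → Lp ℂ 2 (radialMeasure n lam)} {V : Lp ℂ 2 (radialMeasure n lam)}
    (hU : ∀ τ ∈ Icc 0 T, U τ =ᵐ[radialMeasure n lam] p lam τ) {τ : ℝ} (hτ : τ ∈ Icc 0 T)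
    (hV : V =ᵐ[radialMeasure n lam] p' lam τ) : HasDerivWithinAt U V (Icc 0 T) τ := by
  obtain ⟨p'', ht', hd'⟩ := ht.exists_deriv_time hρ
  obtain ⟨C, N, hC, hb⟩ := ht'.exists_bound
  have hmeas : ∀ {q : ℝ → ℝ → ℝ → ℂ}, Tame κ ρ q → ∀ τ,
      AEStronglyMeasurable (q lam τ) (volume.restrict (Ioi 0)) := fun hq τ =>
    (hq.continuousOn hρ hl τ).aestronglyMeasurable measurableSet_Ioi
  set K := C * (1 + T) ^ N
  have hT : 0 ≤ T := hτ.1.trans hτ.2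
  have hK : 0 ≤ K := by positivity
  have hb' : ∀ s ∈ Icc 0 T, ∀ r, 0 < r → ‖p'' lam s r‖ ≤ K := fun s hs r hr =>
    (hb lam hl hl1 s hs.1 r hr).trans (mul_le_mul_of_nonneg_left
      (pow_le_pow_left₀ (by linarith [hs.1]) (by linarith [hs.2]) N) hC)
  have hlip : ∀ s ∈ Icc 0 T, ∀ s' ∈ Icc 0 T, ∀ r, 0 < r →
      ‖p' lam s r - p' lam s' r‖ ≤ K * |s - s'| := fun s hs s' hs' r hr =>
    Convex.norm_image_sub_le_of_norm_hasDerivWithin_le (s := Icc 0 T)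
      (f := fun τ => p' lam τ r) (f' := fun τ => p'' lam τ r)
      (fun x _ => (hd' lam x r).hasDerivWithinAt) (fun x hx => hb' x hx r hr)
      (convex_Icc 0 T) hs' hs
  -- Two time derivatives give a quadratic remainder uniform in r; the common compact support turns
  -- it into an L² bound.
  have htaylor : ∀ s ∈ Icc 0 T, ∀ r, 0 < r →
      ‖p lam s r - p lam τ r - ((s - τ : ℝ) : ℂ) * p' lam τ r‖ ≤ K * |s - τ| * |s - τ| := by
    intro s hs r hr
    have hsub : uIcc τ s ⊆ Icc 0 T := uIcc_subset_Icc hτ hs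
    have := Convex.norm_image_sub_le_of_norm_hasDerivWithin_le (s := uIcc τ s)
      (f := fun x => p lam x r - ((x - τ : ℝ) : ℂ) * p' lam τ r)
      (f' := fun x => p' lam x r - p' lam τ r) (C := K * |s - τ|)
      (fun x _ => by
        have h1 : HasDerivAt (fun x : ℝ => ((x - τ : ℝ) : ℂ)) 1 x := by
          simpa using ((hasDerivAt_id x).sub_const τ).ofReal_comp
        exact (((hd lam x r).sub (h1.mul_const (p' lam τ r))).congr_deriv
          (by rw [one_mul])).hasDerivWithinAt)
      (fun x hx => (hlip x (hsub hx) τ hτ r hr).trans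
        (mul_le_mul_of_nonneg_left (abs_sub_left_of_mem_uIcc hx) hK))
      (convex_uIcc τ s) left_mem_uIcc right_mem_uIcc
    have e : p lam s r - p lam τ r - ((s - τ : ℝ) : ℂ) * p' lam τ r =
        p lam s r - ((s - τ : ℝ) : ℂ) * p' lam τ r -
          (p lam τ r - ((τ - τ : ℝ) : ℂ) * p' lam τ r) := by
      rw [sub_self, Complex.ofReal_zero, zero_mul]; ring
    rw [e]
    exact this
  set Q := (2 * Real.cosh 2) ^ n
  have hQ : 1 ≤ Q := one_le_pow₀ (by linarith [Real.one_le_cosh 2])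
  have hnorm : ∀ s ∈ Icc 0 T, ‖U s - U τ - (s - τ) • V‖ ≤ Q * K * |s - τ| ^ 2 := by
    intro s hs
    obtain ⟨m1, m2⟩ := memLp_of_support (n := n) hl hl1
      (f := fun r => p lam s r - p lam τ r - ((s - τ : ℝ) : ℂ) * p' lam τ r)
      (((hmeas h s).sub (hmeas h τ)).sub ((hmeas ht τ).const_mul _)) (htaylor s hs)
      (fun r hr => by simp [h.eq_zero lam _ hr, ht.eq_zero lam _ hr])
    have e : U s - U τ - (s - τ) • V = m1.toLp _ := by
      refine Lp.ext ?_
      filter_upwards [Lp.coeFn_sub (U s - U τ) ((s - τ) • V), Lp.coeFn_sub (U s) (U τ),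
        Lp.coeFn_smul (s - τ) V, m1.coeFn_toLp, hU s hs, hU τ hτ, hV] with r h1 h2 h3 h4 h5 h6 h7
      rw [h1, Pi.sub_apply, h2, Pi.sub_apply, h3, Pi.smul_apply, h4, h5, h6, h7,
        Complex.real_smul]
    rw [e]
    refine le_of_sq_le_sq ?_ (by positivity)
    rw [norm_toLp_sq]
    refine m2.trans ?_
    have e2 : (Q * K * |s - τ| ^ 2) ^ 2 = Q * (Q * (K * |s - τ| * |s - τ|) ^ 2) := by ring
    rw [e2]
    exact le_mul_of_one_le_left (by positivity) hQ
  rw [hasDerivWithinAt_iff_isLittleO]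
  have hO : (fun s => U s - U τ - (s - τ) • V) =O[𝓝[Icc 0 T] τ] fun s => (s - τ) ^ 2 := by
    refine Asymptotics.IsBigO.of_bound (Q * K) ?_
    filter_upwards [self_mem_nhdsWithin] with s hs
    rw [norm_pow, Real.norm_eq_abs]
    exact hnorm s hs
  refine hO.trans_isLittleO ?_
  have h2 : (fun x : ℝ => x ^ 2) =o[𝓝 0] fun x => x := by
    simpa using Asymptotics.isLittleO_pow_id (𝕜 := ℝ) one_lt_two
  have h3 : Tendsto (fun s => s - τ) (𝓝[Icc 0 T] τ) (𝓝 0) := by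
    have : Tendsto (fun s => s - τ) (𝓝 τ) (𝓝 (τ - τ)) := tendsto_id.sub_const τ
    rw [sub_self] at this
    exact this.mono_left nhdsWithin_le_nhds
  exact h2.comp_tendsto h3

end Tame

end Tame

/-! ### The rescaled solution as phase solution plus correction. -/

section Semiclassical

variable {σ n M : ℕ} {κ : ℝ} {a₀ : ℝ → ℂ}

/-- The solution of `i φ' = κ |φ| ^ (2 σ) φ`, `φ(0) = a₀`; it does not depend on the curvature. -/
def phaseSolution (σ : ℕ) (κ : ℝ) (a₀ : ℝ → ℂ) (_lam τ r : ℝ) : ℂ :=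
  a₀ r * Complex.exp (-Complex.I * κ * τ * ((‖a₀ r‖ ^ (2 * σ) : ℝ) : ℂ))

lemma contDiff_norm_pow (ha₀ : ContDiff ℝ ∞ a₀) (σ : ℕ) :
    ContDiff ℝ ∞ (fun r => ‖a₀ r‖ ^ (2 * σ)) := by
  simpa only [pow_mul] using (ha₀.norm_sq ℝ).pow σ

lemma tame_phaseSolution (ha₀ : ContDiff ℝ ∞ a₀) (hsupp : tsupport a₀ ⊆ Icc 1 2) :
    Tame κ (fun r => ‖a₀ r‖ ^ (2 * σ)) (phaseSolution σ κ a₀) :=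
  Tame.base a₀ ha₀ hsupp

lemma norm_phaseSolution (lam τ r : ℝ) : ‖phaseSolution σ κ a₀ lam τ r‖ = ‖a₀ r‖ := by
  have e : Complex.exp (-Complex.I * κ * τ * ((‖a₀ r‖ ^ (2 * σ) : ℝ) : ℂ)) =
      Complex.exp (Complex.I * ((-(κ * τ * ‖a₀ r‖ ^ (2 * σ)) : ℝ) : ℂ)) := by
    congr 1; push_cast; ring
  rw [phaseSolution, norm_mul, e, norm_exp_I_mul, mul_one]

lemma hasDerivAt_phaseSolution (lam τ r : ℝ) :
    HasDerivAt (fun τ => phaseSolution σ κ a₀ lam τ r)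
      (-Complex.I * κ * ((‖phaseSolution σ κ a₀ lam τ r‖ : ℂ) ^ (2 * σ) *
        phaseSolution σ κ a₀ lam τ r)) τ := by
  have h1 : HasDerivAt (fun τ : ℝ => (τ : ℂ)) 1 τ := Complex.ofRealCLM.hasDerivAt
  refine ((((h1.const_mul (-Complex.I * κ)).mul_const
    ((‖a₀ r‖ ^ (2 * σ) : ℝ) : ℂ)).cexp).const_mul (a₀ r)).congr_deriv ?_
  rw [norm_phaseSolution, phaseSolution]
  push_cast
  ring

lemma phaseSolution_zero (lam r : ℝ) : phaseSolution σ κ a₀ lam 0 r = a₀ r := by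
  simp [phaseSolution]

/-- The phase solution as a continuous curve of Sobolev functions. -/
lemma exists_phase_tower (ha₀ : ContDiff ℝ ∞ a₀) (hsupp : tsupport a₀ ⊆ Icc 1 2) (n M : ℕ) :
    ∃ (B : ℝ) (N : ℕ), 0 < B ∧ ∀ lam : ℝ, 0 < lam → lam ≤ 1 →
      ∃ (φ : ℝ → towerSpace n lam M) (G : ℝ → ℕ → ℝ → ℂ), ∀ T : ℝ, 0 ≤ T →
        ContinuousOn φ (Icc 0 T) ∧ ∀ τ ∈ Icc 0 T, ‖φ τ‖ ≤ B * (1 + T) ^ N ∧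
          Represents (φ τ : TowerAmbient n lam M) (G τ) ∧
            G τ 0 = phaseSolution σ κ a₀ lam τ := by
  obtain ⟨G, B, N, hG0, hB, hG⟩ := (tame_phaseSolution (σ := σ) (κ := κ) ha₀ hsupp).exists_tower
    (contDiff_norm_pow ha₀ σ) n M
  refine ⟨B, N, hB, fun lam hl hl1 => ?_⟩
  -- Clamping the time at 0 gives one curve on the real line, chosen before T.
  have hmax : ∀ τ : ℝ, (0 : ℝ) ≤ max τ 0 := fun τ => le_max_right _ _
  refine ⟨fun τ => towerMk _ (hG lam hl hl1 (max τ 0) (hmax τ)).1,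
    fun τ j => G j lam (max τ 0), fun T hT => ⟨?_, fun τ hτ => ⟨?_, represents_towerMk _, ?_⟩⟩⟩
  · have hle : ∀ x y : ℝ, x ∈ Icc 0 T → y ∈ Icc 0 T → y ≤ x →
        dist (towerMk _ (hG lam hl hl1 (max x 0) (hmax x)).1)
          (towerMk _ (hG lam hl hl1 (max y 0) (hmax y)).1) ≤ B * (1 + T) ^ N * dist x y := by
      intro x y hx hy hyx
      have h1 := (represents_towerMk (hG lam hl hl1 (max x 0) (hmax x)).1).sub
        (represents_towerMk (hG lam hl hl1 (max y 0) (hmax y)).1)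
      have h2 := (hG lam hl hl1 (max x 0) (hmax x)).2.2 (max y 0) (hmax y)
        (max_le_max_right 0 hyx)
      rw [← h1.norm_sq] at h2
      have h3 := le_of_sq_le_sq h2 (by positivity)
      have hpow := pow_le_pow_left₀ (by linarith [hx.1] : 0 ≤ 1 + x)
        (by linarith [hx.2] : 1 + x ≤ 1 + T) N
      have h4 : B * (1 + max x 0) ^ N * |max x 0 - max y 0| ≤ B * (1 + T) ^ N * dist x y := by
        rw [Real.dist_eq, max_eq_left hx.1, max_eq_left hy.1]
        gcongr
      rw [dist_eq_norm]
      exact h3.trans h4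
    refine (LipschitzOnWith.of_dist_le_mul (K := ⟨B * (1 + T) ^ N, by positivity⟩)
      fun x hx y hy => ?_).continuousOn
    rcases le_total y x with h | h
    · exact hle x y hx hy h
    · rw [dist_comm, dist_comm x y]
      exact hle y x hy hx h
  · have h1 := (hG lam hl hl1 (max τ 0) (hmax τ)).2.1
    rw [← norm_towerMk_sq (hG lam hl hl1 (max τ 0) (hmax τ)).1] at h1
    refine (le_of_sq_le_sq h1 (by positivity)).trans ?_
    rw [max_eq_left hτ.1]
    have := hτ.1
    have := hτ.2
    gcongr
  · simp only [max_eq_left hτ.1, hG0]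

/-- The semiclassical solution as a small perturbation of the phase solution. -/
lemma exists_semiclassical_tower (hn : 2 ≤ n) (hM : 2 * n + 4 ≤ M) (σ : ℕ) (hκ : |κ| = 1)
    (ha₀ : ContDiff ℝ ∞ a₀) (hsupp : tsupport a₀ ⊆ Icc 1 2) :
    ∃ (C B : ℝ) (N : ℕ), 0 < C ∧ 0 < B ∧ ∀ lam : ℝ, 0 < lam → lam ≤ 1 →
      ∀ b T A K β : ℝ, 0 ≤ b → 0 ≤ T → A = B * (1 + T) ^ N →
      K = (2 * σ + 1) * C ^ (2 * σ) * (A + 1) ^ (2 * σ) → β = b * (√(lapConst n M) * A) →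
      β * T * Real.exp (K * T) ≤ 1 →
      ∃ Ψ : ℝ → towerSpace n lam M, ContinuousOn Ψ (Icc 0 T) ∧
        levelZero n lam M (Ψ 0) =ᵐ[radialMeasure n lam] a₀ ∧
        (∀ τ ∈ Icc 0 T, ∃ w : towerSpace n lam M, ‖w‖ ≤ β * τ * Real.exp (K * τ) ∧
          levelZero n lam M (Ψ τ) =ᵐ[radialMeasure n lam]
            fun r => phaseSolution σ κ a₀ lam τ r + levelZero n lam M w r) ∧
        ∀ τ ∈ Icc 0 T, ∀ G, Represents (Ψ τ : TowerAmbient n lam M) G →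
          ∃ V : Lp ℂ 2 (radialMeasure n lam),
            HasDerivWithinAt (fun τ => levelZero n lam M (Ψ τ)) V (Icc 0 T) τ ∧
            V =ᵐ[radialMeasure n lam] fun r => Complex.I * b * lapTower n lam G 0 r -
              Complex.I * κ * ((‖G 0 r‖ : ℂ) ^ (2 * σ) * G 0 r) := by
  obtain ⟨C, hC, hmul⟩ := exists_norm_towerMul_le hn hM
  obtain ⟨B, N, hB, hφ⟩ := exists_phase_tower (σ := σ) (κ := κ) ha₀ hsupp n (M + 2)
  refine ⟨C, B, N, hC, hB, fun lam hl hl1 b T A K β hb hT hA hK hβ hsmall => ?_⟩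
  obtain ⟨φ, P, hφP⟩ := hφ lam hl hl1
  obtain ⟨hφc, hφ⟩ := hφP T hT
  rw [← hA] at hφ
  obtain ⟨w, hw0, hwc, hwle, hw⟩ := exists_correction hn hM hl hl1 hC (hmul lam hl hl1) σ hκ hb hT
    (hA ▸ by positivity) hφc (fun t ht => (hφ t ht).1) hK hβ hsmall
  set R := resCLM n lam (Nat.le_add_right M 2) with hR
  have hRφ : ∀ τ ∈ Icc 0 T, Represents (R (φ τ) : TowerAmbient n lam M) (P τ) := fun τ hτ =>
    (hφ τ hτ).2.1.res _
  have hzero : ∀ τ ∈ Icc 0 T, levelZero n lam M (R (φ τ)) =ᵐ[radialMeasure n lam]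
      phaseSolution σ κ a₀ lam τ := fun τ hτ => by
    rw [← (hφ τ hτ).2.2]
    exact (hRφ τ hτ).levelZero
  have h0T : (0 : ℝ) ∈ Icc 0 T := ⟨le_rfl, hT⟩
  refine ⟨fun τ => R (φ τ) + w τ, (R.continuous.comp_continuousOn hφc).add hwc, ?_,
    fun τ hτ => ⟨w τ, hwle τ hτ, ?_⟩, fun τ hτ G hG => ?_⟩
  · simp only [hw0, add_zero]
    exact (hzero 0 h0T).trans (ae_of_all _ fun r => phaseSolution_zero lam r)
  · simp only [map_add]
    filter_upwards [Lp.coeFn_add (levelZero n lam M (R (φ τ))) (levelZero n lam M (w τ)),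
      hzero τ hτ] with r h1 h2
    rw [h1, Pi.add_apply, h2]
  · obtain ⟨p', hp', hd⟩ := (tame_phaseSolution (σ := σ) (κ := κ) ha₀ hsupp).exists_deriv_time
      (contDiff_norm_pow ha₀ σ)
    have hp'e : ∀ τ r, p' lam τ r = -Complex.I * κ * ((‖phaseSolution σ κ a₀ lam τ r‖ : ℂ) ^
        (2 * σ) * phaseSolution σ κ a₀ lam τ r) := fun τ r =>
      (hd lam τ r).unique (hasDerivAt_phaseSolution lam τ r)
    obtain ⟨Q, hQ, hQ0⟩ := (hRφ τ hτ).power hn hM hl hl1 σ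
    obtain ⟨Q', hQ', hQ0'⟩ := hG.power hn hM hl hl1 σ
    have hV1 : levelZero n lam M ((-Complex.I * κ) • towerPower σ (R (φ τ)))
        =ᵐ[radialMeasure n lam] p' lam τ := by
      have h1 : Represents (((-Complex.I * κ) • towerPower σ (R (φ τ)) : towerSpace n lam M) :
          TowerAmbient n lam M) _ := hQ.smul (-Complex.I * κ)
      refine h1.levelZero.trans (ae_of_all _ fun r => ?_)
      simp only
      rw [hQ0, (hφ τ hτ).2.2, hp'e]
    -- The first derivative supplies the nonlinear term at φ, the second the nonlinear difference
    -- and both Laplacians. In the sum the term at φ cancels.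
    have d1 := (tame_phaseSolution (σ := σ) (κ := κ) ha₀ hsupp).hasDerivWithinAt
      (contDiff_norm_pow ha₀ σ) hp' hd hl hl1 hzero hτ hV1
    have d2 := (((levelZero n lam 0).restrictScalars ℝ).hasFDerivAt).comp_hasDerivWithinAt τ
      (hw τ hτ)
    refine ⟨_, ((d1.add d2).congr_of_mem (fun s _ => ?_) hτ), ?_⟩
    · simp only [map_add]; rfl
    · have hwr := represents_towerRep (w τ)
      have hsum : ∀ i ≤ 2, ∀ᵐ r, 0 < r → G i r = P τ i r + towerRep (w τ) i r := fun i hi =>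
        hG.ae_unique hl ((hRφ τ hτ).add hwr) (by omega)
      have hNL : Represents (((-Complex.I * κ) • (towerPower σ (R (φ τ) + w τ) -
          towerPower σ (R (φ τ))) + (Complex.I * b) • lapCLM hn hl hl1 M (φ τ) :
            towerSpace n lam M) : TowerAmbient n lam M) _ :=
        ((hQ'.sub hQ).smul (-Complex.I * κ)).add
          (((hφ τ hτ).2.1.lap hn hl hl1).smul (Complex.I * b))
      have hW := hNL.res (Nat.zero_le M)
      have hLw : Represents (lapCLM hn hl hl1 0 (resCLM n lam (by omega : 2 ≤ M) (w τ)) :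
          TowerAmbient n lam 0) _ := (hwr.res (by omega : 2 ≤ M)).lap hn hl hl1
      have hD : Represents (((((b : ℂ) * Complex.I) • lapCLM hn hl hl1 0
          (resCLM n lam (by omega : 2 ≤ M) (w τ)) + resCLM n lam (Nat.zero_le M)
            ((-Complex.I * κ) • (towerPower σ (R (φ τ) + w τ) - towerPower σ (R (φ τ))) +
              (Complex.I * b) • lapCLM hn hl hl1 M (φ τ))) : towerSpace n lam 0) :
          TowerAmbient n lam 0) _ := (hLw.smul ((b : ℂ) * Complex.I)).add hW
      have hlap := (ae_radial_iff' (n := n) hl).2 (lapTower_congr (n := n) (lam := lam) (j := 0)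
        (H := fun i r => P τ i r + towerRep (w τ) i r) hsum)
      refine (Lp.coeFn_add _ _).trans ?_
      filter_upwards [hD.levelZero, hV1, hlap] with r h1 h2 h3
      rw [Pi.add_apply, h2, h3, hp'e]
      refine (congrArg _ h1).trans ?_
      rw [hQ0, hQ0', (hφ τ hτ).2.2]
      simp only [lapTower]
      ring

end Semiclassical

/-! ### Comparison of the Sobolev norms with the tower norm. -/

section SobolevNorms

variable {n m M : ℕ} {lam : ℝ} {G : ℕ → ℝ → ℂ}

lemma IsTower.lapTower_iterate (hn : 2 ≤ n) (hl : 0 < lam) (hl1 : lam ≤ 1) {i : ℕ}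
    (hG : IsTower n lam (M + 2 * i) G) : IsTower n lam M ((_root_.lapTower n lam)^[i] G) := by
  induction i generalizing M with
  | zero => exact hG
  | succ i ih =>
    rw [Function.iterate_succ_apply']
    refine IsTower.lapTower hn hl hl1 (ih ?_)
    rwa [show M + 2 + 2 * i = M + 2 * (i + 1) by ring]

lemma exists_towerSq_iterate_le (n M i : ℕ) (hn : 2 ≤ n) : ∃ C : ℝ, 0 < C ∧ ∀ lam : ℝ, 0 < lam →
    lam ≤ 1 → ∀ G, IsTower n lam (M + 2 * i) G →
      towerSq n lam M ((lapTower n lam)^[i] G) ≤ C * towerSq n lam (M + 2 * i) G := by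
  induction i generalizing M with
  | zero => exact ⟨1, one_pos, fun lam _ _ G _ => by simp⟩
  | succ i ih =>
    obtain ⟨C, hC, h⟩ := ih (M + 2)
    have e : M + 2 + 2 * i = M + 2 * (i + 1) := by ring
    rw [e] at h
    refine ⟨(lapConst n M + 1) * C, mul_pos (by linarith [lapConst_nonneg n M]) hC,
      fun lam hl hl1 G hG => ?_⟩
    have hG' : IsTower n lam (M + 2) ((lapTower n lam)^[i] G) :=
      IsTower.lapTower_iterate hn hl hl1 (e ▸ hG)
    rw [Function.iterate_succ_apply', mul_assoc]
    refine (hG'.towerSq_lapTower_le hn hl hl1).trans ?_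
    refine (mul_le_mul_of_nonneg_left (h lam hl hl1 G hG) (lapConst_nonneg n M)).trans ?_
    exact mul_le_mul_of_nonneg_right (by linarith) (mul_nonneg hC.le (towerSq_nonneg _))

open Classical in
/-- The derivatives `f, ∇f, Δf, ∇Δf, …` in terms of the radial derivatives of `f`. -/
def towerChain (n : ℕ) (lam : ℝ) (G : ℕ → ℝ → ℂ) (j : ℕ) (r : ℝ) : ℂ :=
  if Even j then (lapTower n lam)^[j / 2] G 0 r
  else (hq lam r : ℂ) * (lapTower n lam)^[j / 2] G 1 r

lemma towerChain_even (i : ℕ) : towerChain n lam G (2 * i) = (lapTower n lam)^[i] G 0 := by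
  funext r
  rw [towerChain, if_pos (even_two_mul i), Nat.mul_div_cancel_left i two_pos]

lemma towerChain_odd (i : ℕ) : towerChain n lam G (2 * i + 1) =
    fun r => (hq lam r : ℂ) * (lapTower n lam)^[i] G 1 r := by
  funext r
  rw [towerChain, if_neg (Nat.not_even_two_mul_add_one i), show (2 * i + 1) / 2 = i by omega]

lemma IsTower.memLp_hq_one (hn : 2 ≤ n) (hl : 0 < lam) (hG : IsTower n lam M G) (hM : 1 ≤ M) :
    MemLp (fun r => (hq lam r : ℂ) * G 1 r) 2 (radialMeasure n lam) := by
  simpa using hG.memLp_pow (by omega) hl hM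

lemma IsTower.isPrim_div (hl : 0 < lam) (hn : 2 ≤ n) (hG : IsTower n lam M G) (hM : 2 ≤ M) :
    IsPrim (fun r => (hq lam r : ℂ) ^ n * G 1 r)
      (fun r => (hq lam r : ℂ) ^ (n - 1) * _root_.lapTower n lam G 0 r) := by
  refine ((IsPrim.hq_pow hl n).mul (hG.isD 1 (by omega))).congr (fun _ _ => rfl)
    (ae_of_all _ fun r _ => ?_)
  rw [hq_cast_pow_eq (by omega : 1 ≤ n), _root_.lapTower, lapCoef_zero]
  push_cast
  ring

/-- Iterated Laplacians of a tower are towers, and each consecutive pair in the chain is linked by a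
primitive. The divergence steps require G 1 itself in L², which is Hardy's inequality. -/
lemma IsTower.isSobolevChain (hn : 2 ≤ n) (hl : 0 < lam) (hl1 : lam ≤ 1)
    (hG : IsTower n lam M G) (hm : m ≤ M) {f : ℝ → ℂ} (hf : G 0 =ᵐ[radialMeasure n lam] f) :
    IsSobolevChain n lam m f (towerChain n lam G) := by
  have hit : ∀ {i : ℕ}, 2 * i ≤ m →
      IsTower n lam (m - 2 * i) ((_root_.lapTower n lam)^[i] G) := fun {i} hi =>
    IsTower.lapTower_iterate hn hl hl1 (hG.mono (by omega))
  refine ⟨?_, fun j hj => ?_, fun j hj he => ?_, fun j hj ho => ?_⟩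
  · exact (by simpa using towerChain_even (n := n) (lam := lam) (G := G) 0 ▸ hf)
  · rcases Nat.even_or_odd' j with ⟨i, rfl | rfl⟩
    · rw [towerChain_even]
      exact (hit hj).memLp 0 (Nat.zero_le _)
    · rw [towerChain_odd]
      exact (hit (i := i) (by omega)).memLp_hq_one hn hl (by omega)
  · obtain ⟨i, rfl⟩ := he.exists_two_nsmul
    rw [smul_eq_mul] at hj ⊢
    rw [towerChain_even, towerChain_odd]
    have h := hit (i := i) (by omega)
    exact isWeakRadialGrad_of_isPrim hn hl hl1 (h.isD 0 (by omega)) (h.memLp 0 (Nat.zero_le _))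
      (h.memLp_hq_one hn hl (by omega))
  · obtain ⟨i, rfl⟩ := ho
    rw [show 2 * i + 1 + 1 = 2 * (i + 1) by ring, towerChain_even, towerChain_odd,
      Function.iterate_succ_apply']
    have h := hit (i := i) (by omega)
    exact isWeakRadialDiv_of_isPrim hn hl hl1 (h.isPrim_div hl hn (by omega))
      (h.hardy hn hl hl1 (j := 0) (by omega)).1 (h.memLp_hq_one hn hl (by omega))
      (by simpa [Function.iterate_succ_apply'] using
        (hit (i := i + 1) (by omega)).memLp 0 (Nat.zero_le _))

/-- The infimum defining the norm is bounded by the value on the chain built from the tower. -/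
lemma exists_sobolevNormSq_le (n m M : ℕ) (hn : 2 ≤ n) (hm : m ≤ M) : ∃ C : ℝ, 0 < C ∧
    ∀ lam : ℝ, 0 < lam → lam ≤ 1 → ∀ G f, IsTower n lam M G → G 0 =ᵐ[radialMeasure n lam] f →
      sobolevNormSq n lam m f ≤ ENNReal.ofReal (C * towerSq n lam M G) := by
  choose! C hC0 hC using fun i => exists_towerSq_iterate_le n (m - 2 * i) i hn
  refine ⟨∑ j ∈ Finset.range (m + 1), C (j / 2),
    Finset.sum_pos (fun j _ => hC0 _) ⟨0, by simp⟩, fun lam hl hl1 G f hG hf => ?_⟩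
  have hch := hG.isSobolevChain hn hl hl1 hm hf
  refine (iInf₂_le _ hch).trans ?_
  rw [Finset.sum_mul, ENNReal.ofReal_sum_of_nonneg fun j _ =>
    mul_nonneg (hC0 _).le (towerSq_nonneg _)]
  refine Finset.sum_le_sum fun j hj => ?_
  have hj : j ≤ m := by simpa [Nat.lt_succ_iff] using hj
  rw [eLpNorm_sq_eq (hch.memLp j hj)]
  refine ENNReal.ofReal_le_ofReal ?_
  have hmono : ∀ i, 2 * i ≤ m → towerSq n lam (m - 2 * i) ((lapTower n lam)^[i] G) ≤
      C i * towerSq n lam M G := fun i hi => by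
    have e : m - 2 * i + 2 * i = m := by omega
    refine (hC i lam hl hl1 G (hG.mono (by omega))).trans
      (mul_le_mul_of_nonneg_left ?_ (hC0 i).le)
    exact Finset.sum_le_sum_of_subset_of_nonneg (Finset.range_mono (by omega))
      fun _ _ _ => radialSq_nonneg _
  rcases Nat.even_or_odd' j with ⟨i, rfl | rfl⟩
  · rw [towerChain_even, Nat.mul_div_cancel_left i two_pos]
    exact (radialSq_le_towerSq _ (Nat.zero_le _)).trans (hmono i hj)
  · rw [towerChain_odd, show (2 * i + 1) / 2 = i by omega]
    refine le_trans ?_ (hmono i (by omega))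
    have := radialSq_le_towerSq (n := n) (lam := lam) (M := m - 2 * i) (j := 1)
      (G := (lapTower n lam)^[i] G) (by omega)
    rw [radialSq_shift (by omega) hl] at this
    simpa using this

lemma sobolevNormSq_zero (n : ℕ) (hn : 2 ≤ n) (hl : 0 < lam) (hl1 : lam ≤ 1) (m : ℕ) :
    sobolevNormSq n lam m (fun _ => 0) = 0 := by
  obtain ⟨C, -, h⟩ := exists_sobolevNormSq_le n m m hn le_rfl
  have := h lam hl hl1 (fun _ _ => 0) (fun _ => 0) IsTower.zero (ae_eq_refl _)
  simpa [towerSq, radialSq] using this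

/-- The integrand is at most τ^(1−2θ) near 0, integrable as θ < 1, and at most τ^(−2θ−1) at
infinity, integrable as θ > 0. -/
lemma lintegral_rpow_min_lt_top {θ : ℝ} (h0 : 0 < θ) (h1 : θ < 1) :
    ∫⁻ τ in Ioi (0 : ℝ), ENNReal.ofReal (τ ^ (-2 * θ - 1)) * ENNReal.ofReal (min 1 (τ ^ 2)) < ⊤ := by
  have hI : IntegrableOn (fun τ : ℝ => τ ^ (-2 * θ - 1) * min 1 (τ ^ 2)) (Ioi 0) := by
    have hm : AEStronglyMeasurable (fun τ : ℝ => τ ^ (-2 * θ - 1) * min 1 (τ ^ 2)) volume := by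
      have : Measurable (fun τ : ℝ => τ ^ (-2 * θ - 1) * min 1 (τ ^ 2)) := by fun_prop
      exact this.aestronglyMeasurable
    rw [← Ioc_union_Ioi_eq_Ioi zero_le_one]
    refine IntegrableOn.union ?_ ?_
    · have h2 : IntegrableOn (fun τ : ℝ => τ ^ (1 - 2 * θ)) (Ioc 0 1) :=
        (intervalIntegral.intervalIntegrable_rpow' (by linarith)).1
      refine h2.mono' hm.restrict ((ae_restrict_iff' measurableSet_Ioc).2 (ae_of_all _ fun τ hτ => ?_))
      have hτ0 := hτ.1
      rw [Real.norm_eq_abs, abs_of_nonneg (by positivity)]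
      refine (mul_le_mul_of_nonneg_left (min_le_right _ _) (by positivity)).trans (le_of_eq ?_)
      rw [← Real.rpow_natCast τ 2, ← Real.rpow_add hτ0]
      congr 1; push_cast; ring
    · have h2 : IntegrableOn (fun τ : ℝ => τ ^ (-2 * θ - 1)) (Ioi 1) :=
        integrableOn_Ioi_rpow_of_lt (by linarith) one_pos
      refine h2.mono' hm.restrict ((ae_restrict_iff' measurableSet_Ioi).2 (ae_of_all _ fun τ hτ => ?_))
      have hτ0 : 0 < τ := one_pos.trans hτ
      rw [Real.norm_eq_abs, abs_of_nonneg (by positivity)]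
      exact mul_le_of_le_one_right (by positivity) (min_le_left _ _)
  have h2 := hI.lintegral_lt_top
  refine (setLIntegral_congr_fun measurableSet_Ioi fun τ hτ => ?_).trans_lt h2
  exact (ENNReal.ofReal_mul (Real.rpow_nonneg (le_of_lt hτ) _)).symm

/-- The fractional Sobolev norms are controlled by the integer ones. -/
lemma exists_sobolevNorm_le (n M : ℕ) (hn : 2 ≤ n) {k : ℝ} (hk : ⌊k⌋₊ + 1 ≤ M) :
    ∃ C : ℝ, 0 < C ∧ ∀ lam : ℝ, 0 < lam → lam ≤ 1 → ∀ (w : towerSpace n lam M) (f : ℝ → ℂ),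
      levelZero n lam M w =ᵐ[radialMeasure n lam] f →
        sobolevNorm n lam k f ≤ ENNReal.ofReal (C * ‖w‖) := by
  obtain ⟨C1, hC1, h1⟩ := exists_sobolevNormSq_le n ⌊k⌋₊ M hn (by omega)
  obtain ⟨C2, hC2, h2⟩ := exists_sobolevNormSq_le n (⌊k⌋₊ + 1) M hn hk
  set θ := Int.fract k with hθ
  have hsq : ∀ D x : ℝ, 0 ≤ D → 0 ≤ x →
      ENNReal.ofReal (D * x ^ 2) ^ (1 / 2 : ℝ) ≤ ENNReal.ofReal ((D + 1) * x) := by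
    intro D x hD hx
    rw [ENNReal.ofReal_rpow_of_nonneg (by positivity) (by norm_num), ← Real.sqrt_eq_rpow]
    refine ENNReal.ofReal_le_ofReal (Real.sqrt_le_iff.2 ⟨by positivity, ?_⟩)
    rw [mul_pow]
    exact mul_le_mul_of_nonneg_right (by nlinarith) (sq_nonneg _)
  by_cases hk0 : θ = 0
  · refine ⟨C1 + 1, by linarith, fun lam hl hl1 w f hf => ?_⟩
    rw [sobolevNorm, if_pos hk0]
    have hw := represents_towerRep w
    refine le_trans (ENNReal.rpow_le_rpow (h1 lam hl hl1 _ f hw.isTower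
      (hw.levelZero.symm.trans hf)) (by norm_num)) ?_
    rw [← norm_sq_eq_towerSq]
    exact hsq C1 _ hC1.le (norm_nonneg _)
  · have hθ0 : 0 < θ := lt_of_le_of_ne (Int.fract_nonneg k) (Ne.symm hk0)
    set I := ∫⁻ τ in Ioi (0 : ℝ), ENNReal.ofReal (τ ^ (-2 * θ - 1)) *
      ENNReal.ofReal (min 1 (τ ^ 2)) with hI
    have hIlt : I < ⊤ := lintegral_rpow_min_lt_top hθ0 (Int.fract_lt_one k)
    set s := 2 * Real.sin (Real.pi * θ) / Real.pi with hs
    have hCC : 0 < C1 + C2 := by positivity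
    refine ⟨|s| * I.toReal * (C1 + C2) + 1, by positivity, fun lam hl hl1 w f hf => ?_⟩
    rw [sobolevNorm, if_neg hk0]
    have hw := represents_towerRep w
    have hf' : towerRep w 0 =ᵐ[radialMeasure n lam] f := hw.levelZero.symm.trans hf
    have b1 := h1 lam hl hl1 _ f hw.isTower hf'
    have b2 := h2 lam hl hl1 _ f hw.isTower hf'
    rw [← norm_sq_eq_towerSq] at b1 b2
    -- Only the two trivial decompositions are tried, h = 0 for large τ and h = f for small τ.
    have hKf : ∀ τ : ℝ, kFunctionalSq n lam ⌊k⌋₊ f τ ≤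
        ENNReal.ofReal (min 1 (τ ^ 2)) * ENNReal.ofReal ((C1 + C2) * ‖w‖ ^ 2) := by
      intro τ
      have c1 : kFunctionalSq n lam ⌊k⌋₊ f τ ≤ ENNReal.ofReal (C1 * ‖w‖ ^ 2) := by
        refine (iInf_le _ (fun _ => 0)).trans ?_
        simpa [sobolevNormSq_zero n hn hl hl1] using b1
      have c2 : kFunctionalSq n lam ⌊k⌋₊ f τ ≤
          ENNReal.ofReal (τ ^ 2) * ENNReal.ofReal (C2 * ‖w‖ ^ 2) := by
        refine (iInf_le _ f).trans ?_
        simp only [sub_self, sobolevNormSq_zero n hn hl hl1, zero_add]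
        gcongr
      rcases le_total 1 (τ ^ 2) with h | h
      · rw [min_eq_left h, ENNReal.ofReal_one, one_mul]
        refine c1.trans (ENNReal.ofReal_le_ofReal ?_)
        gcongr; linarith
      · rw [min_eq_right h]
        refine c2.trans ?_
        gcongr; linarith
    refine le_trans (ENNReal.rpow_le_rpow ?_ (by norm_num))
      (hsq (|s| * I.toReal * (C1 + C2)) ‖w‖ (by positivity) (norm_nonneg _))
    have hIle : ∫⁻ τ in Ioi (0 : ℝ), ENNReal.ofReal (τ ^ (-2 * θ - 1)) *
        kFunctionalSq n lam ⌊k⌋₊ f τ ≤ I * ENNReal.ofReal ((C1 + C2) * ‖w‖ ^ 2) := by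
      rw [hI, ← lintegral_mul_const _ (by fun_prop)]
      refine lintegral_mono fun τ => ?_
      rw [mul_assoc]
      gcongr
      exact hKf τ
    refine (mul_le_mul' (ENNReal.ofReal_le_ofReal (le_abs_self s)) hIle).trans (le_of_eq ?_)
    have e : I = ENNReal.ofReal I.toReal := (ENNReal.ofReal_toReal hIlt.ne).symm
    rw [e, ENNReal.toReal_ofReal ENNReal.toReal_nonneg, ← ENNReal.ofReal_mul ENNReal.toReal_nonneg,
      ← ENNReal.ofReal_mul (abs_nonneg _)]
    congr 1; ring

end SobolevNorms

/-! ### Scaling to curvature −1. -/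

section Scaling

variable {n M : ℕ} {lam : ℝ} {G : ℕ → ℝ → ℂ}

lemma quasiMeasurePreserving_mul_left {c : ℝ} (hc : c ≠ 0) :
    Measure.QuasiMeasurePreserving (fun r : ℝ => c * r) volume volume := by
  refine ⟨measurable_const_mul c, Measure.AbsolutelyContinuous.mk fun s hs h0 => ?_⟩
  rw [Measure.map_apply (measurable_const_mul c) hs, Real.volume_preimage_mul_left hc, h0, mul_zero]

lemma ae_scale {c : ℝ} (hc : 0 < c) {p : ℝ → Prop} (h : ∀ᵐ r, 0 < r → p r) :
    ∀ᵐ r, 0 < r → p (c * r) :=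
  ((quasiMeasurePreserving_mul_left hc.ne').ae h).mono fun _ hr h0 => hr (mul_pos hc h0)

lemma ae_radial_scale {mu : ℝ} (hl : 0 < lam) (hm : 0 < mu) {c : ℝ} (hc : 0 < c) {p : ℝ → Prop}
    (h : ∀ᵐ r ∂(radialMeasure n lam), p r) : ∀ᵐ r ∂(radialMeasure n mu), p (c * r) :=
  (ae_radial_iff' hm).2 (ae_scale hc ((ae_radial_iff' hl).1 h))

lemma aestronglyMeasurable_scale {c : ℝ} (hc : 0 < c) {f : ℝ → ℂ}
    (h : AEStronglyMeasurable f (volume.restrict (Ioi 0))) :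
    AEStronglyMeasurable (fun r => f (c * r)) (volume.restrict (Ioi 0)) := by
  have h1 := ((aestronglyMeasurable_indicator_iff measurableSet_Ioi).2 h).comp_quasiMeasurePreserving
    (quasiMeasurePreserving_mul_left hc.ne')
  refine h1.restrict.congr ((ae_restrict_iff' measurableSet_Ioi).2 (ae_of_all _ fun r hr => ?_))
  have : c * r ∈ Ioi (0 : ℝ) := mul_pos hc hr
  rw [Function.comp_apply, indicator_of_mem this]

lemma hq_one_eq (hl : 0 < lam) (r : ℝ) : hq 1 r = lam * hq lam (lam⁻¹ * r) := by
  rw [hq, hq, mul_inv_cancel_left₀ hl.ne']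
  field_simp

lemma hc_one_eq (hl : 0 < lam) (r : ℝ) : hc 1 r = hc lam (lam⁻¹ * r) := by
  rw [hc, hc, mul_inv_cancel_left₀ hl.ne', one_mul]

lemma memLp_scale (hn : 1 ≤ n) (hl : 0 < lam) {f : ℝ → ℂ} (hf : MemLp f 2 (radialMeasure n lam)) :
    MemLp (fun r => f (lam⁻¹ * r)) 2 (radialMeasure n 1) ∧
      radialSq n 1 (fun r => f (lam⁻¹ * r)) = lam ^ n * radialSq n lam f := by
  have hc : 0 < lam⁻¹ := inv_pos.2 hl
  have e : ∀ r, hq 1 r ^ (n - 1) * ‖f (lam⁻¹ * r)‖ ^ 2 =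
      lam ^ (n - 1) * (hq lam (lam⁻¹ * r) ^ (n - 1) * ‖f (lam⁻¹ * r)‖ ^ 2) := fun r => by
    rw [hq_one_eq hl, mul_pow, mul_assoc]
  obtain ⟨h1, h2⟩ := (memLp_radial_iff hl).1 hf
  refine ⟨(memLp_radial_iff one_pos).2 ⟨aestronglyMeasurable_scale hc h1, ?_⟩, ?_⟩
  · simp only [e]
    have := (integrableOn_Ioi_comp_mul_left_iff
      (fun r => hq lam r ^ (n - 1) * ‖f r‖ ^ 2) 0 hc).2 (by rwa [mul_zero])
    exact this.const_mul _
  · rw [radialSq_eq one_pos, radialSq_eq hl]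
    simp only [e]
    rw [integral_const_mul, integral_comp_mul_left_Ioi (fun r => hq lam r ^ (n - 1) * ‖f r‖ ^ 2) 0 hc,
      mul_zero, inv_inv, smul_eq_mul, ← mul_assoc, ← pow_succ, Nat.sub_add_cancel hn]

lemma IsPrim.comp_mul_left {f g : ℝ → ℂ} (h : IsPrim f g) {c : ℝ} (hc : 0 < c) :
    IsPrim (fun r => f (c * r)) (fun r => (c : ℂ) * g (c * r)) := by
  intro x y hx hy
  obtain ⟨h1, h2⟩ := h (c * x) (c * y) (mul_pos hc hx) (mul_pos hc hy)
  have h3 := h1.comp_mul_left (c := c)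
  rw [mul_div_cancel_left₀ _ hc.ne', mul_div_cancel_left₀ _ hc.ne'] at h3
  refine ⟨h3.const_mul _, ?_⟩
  rw [intervalIntegral.integral_const_mul, intervalIntegral.integral_comp_mul_left g hc.ne', h2,
    Complex.real_smul, ← mul_assoc, ← Complex.ofReal_mul, mul_inv_cancel₀ hc.ne',
    Complex.ofReal_one, one_mul]

/-- Scaling from the space of curvature `-lam ^ 2` to the space of curvature `-1`. -/
def scaleTower (lam : ℝ) (G : ℕ → ℝ → ℂ) (j : ℕ) (r : ℝ) : ℂ :=
  (lam⁻¹ : ℂ) ^ (2 * j) * G j (lam⁻¹ * r)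

/-- Each application of D contributes lam⁻², one factor from the chain rule and one from
`hq_one_eq`. -/
lemma IsTower.scale (hn : 1 ≤ n) (hl : 0 < lam) (hG : IsTower n lam M G) :
    IsTower n 1 M (scaleTower lam G) := by
  have hc : 0 < lam⁻¹ := inv_pos.2 hl
  have hl' : (lam : ℂ) ≠ 0 := Complex.ofReal_ne_zero.2 hl.ne'
  refine ⟨fun j hj => ?_, fun j hj =>
    (memLp_scale (by omega) hl (hG.memLp j hj)).1.const_mul _⟩
  refine (((hG.isD j hj).comp_mul_left hc).const_mul ((lam⁻¹ : ℂ) ^ (2 * j))).congr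
    (fun r _ => rfl) (ae_of_all _ fun r _ => ?_)
  rw [scaleTower, hq_one_eq hl]
  push_cast
  rw [show 2 * (j + 1) = 2 * j + 2 by ring, pow_add]
  field_simp

/-- Far from sharp in lam, but it serves only to carry continuity in time to the scaled solution at
fixed lam. -/
lemma towerSq_scale_le (hn : 1 ≤ n) (hl : 0 < lam) (hl1 : lam ≤ 1) (hG : IsTower n lam M G) :
    towerSq n 1 M (scaleTower lam G) ≤ (lam⁻¹) ^ (4 * M) * towerSq n lam M G := by
  have hc1 : 1 ≤ lam⁻¹ := (one_le_inv₀ hl).2 hl1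
  rw [towerSq, towerSq, Finset.mul_sum]
  refine Finset.sum_le_sum fun j hj => ?_
  have hj : j ≤ M := by simpa [Nat.lt_succ_iff] using hj
  have e := radialSq_const_mul (n := n + 2 * j) (lam := 1) ((lam⁻¹ : ℂ) ^ (2 * j))
    (fun r => G j (lam⁻¹ * r))
  have e2 : ‖(lam⁻¹ : ℂ) ^ (2 * j)‖ ^ 2 = lam⁻¹ ^ (4 * j) := by
    rw [norm_pow, norm_inv, Complex.norm_real, Real.norm_eq_abs, abs_of_pos hl, ← pow_mul]
    congr 1; ring
  rw [(memLp_scale (by omega) hl (hG.memLp j hj)).2, e2] at e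
  refine e.le.trans ?_
  rw [← mul_assoc]
  refine mul_le_mul_of_nonneg_right ?_ (radialSq_nonneg _)
  calc lam⁻¹ ^ (4 * j) * lam ^ (n + 2 * j) ≤ lam⁻¹ ^ (4 * M) * 1 :=
        mul_le_mul (pow_le_pow_right₀ hc1 (by omega)) (pow_le_one₀ hl.le hl1) (by positivity)
          (by positivity)
    _ = _ := mul_one _

lemma lapTower_scale (hl : 0 < lam) (r : ℝ) :
    lapTower n 1 (scaleTower lam G) 0 r = (lam⁻¹ : ℂ) ^ 2 * lapTower n lam G 0 (lam⁻¹ * r) := by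
  have hl' : (lam : ℂ) ≠ 0 := Complex.ofReal_ne_zero.2 hl.ne'
  simp only [lapTower, scaleTower, lapCoef_zero]
  rw [hq_one_eq hl, hc_one_eq hl]
  push_cast
  field_simp

/-- Scaling as a linear operator on `L²`. -/
def scaleCLM (n : ℕ) (hn : 1 ≤ n) (hl : 0 < lam) :
    Lp ℂ 2 (radialMeasure n lam) →L[ℂ] Lp ℂ 2 (radialMeasure n 1) :=
  LinearMap.mkContinuous
    { toFun := fun f => (memLp_scale hn hl (Lp.memLp f)).1.toLp _
      map_add' := fun f g => by
        refine Lp.ext ?_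
        filter_upwards [(memLp_scale hn hl (Lp.memLp (f + g))).1.coeFn_toLp,
          (memLp_scale hn hl (Lp.memLp f)).1.coeFn_toLp,
          (memLp_scale hn hl (Lp.memLp g)).1.coeFn_toLp,
          Lp.coeFn_add ((memLp_scale hn hl (Lp.memLp f)).1.toLp _)
            ((memLp_scale hn hl (Lp.memLp g)).1.toLp _),
          ae_radial_scale hl one_pos (inv_pos.2 hl) (Lp.coeFn_add f g)] with r h1 h2 h3 h4 h5
        rw [h1, h4, Pi.add_apply, h2, h3, h5, Pi.add_apply]
      map_smul' := fun a f => by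
        refine Lp.ext ?_
        filter_upwards [(memLp_scale hn hl (Lp.memLp (a • f))).1.coeFn_toLp,
          (memLp_scale hn hl (Lp.memLp f)).1.coeFn_toLp,
          Lp.coeFn_smul a ((memLp_scale hn hl (Lp.memLp f)).1.toLp _),
          ae_radial_scale hl one_pos (inv_pos.2 hl) (Lp.coeFn_smul a f)] with r h1 h2 h3 h4
        rw [h1, RingHom.id_apply, h3, Pi.smul_apply, h2, h4, Pi.smul_apply] }
    √(lam ^ n) fun f => by
      refine le_of_sq_le_sq ?_ (by positivity)
      show ‖(memLp_scale hn hl (Lp.memLp f)).1.toLp _‖ ^ 2 ≤ _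
      rw [norm_toLp_sq, (memLp_scale hn hl (Lp.memLp f)).2, mul_pow, Real.sq_sqrt (by positivity),
        ← norm_toLp_sq (Lp.memLp f), Lp.toLp_coeFn]

lemma coeFn_scaleCLM (hn : 1 ≤ n) (hl : 0 < lam) (f : Lp ℂ 2 (radialMeasure n lam)) :
    scaleCLM n hn hl f =ᵐ[radialMeasure n 1] fun r => f (lam⁻¹ * r) :=
  (memLp_scale hn hl (Lp.memLp f)).1.coeFn_toLp

/-- The scaled solution of the equation on the space of curvature `-1`. -/
lemma isRadialNLSSolution_scale (hn : 2 ≤ n) (hM : 2 * n + 4 ≤ M) (hl : 0 < lam) (hl1 : lam ≤ 1)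
    {σ : ℕ} {κ a b μ T : ℝ} (ha : 0 ≤ a) (hμ : 0 < μ) (hb : b = μ * (lam⁻¹) ^ 2)
    (haμ : μ * a ^ (2 * σ) = 1)
    {a₀ : ℝ → ℂ} {Ψ : ℝ → towerSpace n lam M} (hΨ : ContinuousOn Ψ (Icc 0 T))
    (h0 : levelZero n lam M (Ψ 0) =ᵐ[radialMeasure n lam] a₀)
    (hd : ∀ τ ∈ Icc 0 T, ∀ G, Represents (Ψ τ : TowerAmbient n lam M) G →
      ∃ V : Lp ℂ 2 (radialMeasure n lam),
        HasDerivWithinAt (fun τ => levelZero n lam M (Ψ τ)) V (Icc 0 T) τ ∧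
        V =ᵐ[radialMeasure n lam] fun r => Complex.I * b * lapTower n lam G 0 r -
          Complex.I * κ * ((‖G 0 r‖ : ℂ) ^ (2 * σ) * G 0 r)) :
    IsRadialNLSSolution n σ κ (fun r => (a : ℂ) * a₀ (lam⁻¹ * r)) (μ * T) (fun t =>
      (a : ℂ) • scaleCLM n (by omega) hl (levelZero n lam M (Ψ (μ⁻¹ * t)))) := by
  have hn1 : 1 ≤ n := by omega
  set L : Lp ℂ 2 (radialMeasure n lam) →L[ℂ] Lp ℂ 2 (radialMeasure n 1) :=
    (a : ℂ) • scaleCLM n hn1 hl with hL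
  have hLae : ∀ f : Lp ℂ 2 (radialMeasure n lam), L f =ᵐ[radialMeasure n 1]
      fun r => (a : ℂ) * f (lam⁻¹ * r) := fun f => by
    filter_upwards [Lp.coeFn_smul (a : ℂ) (scaleCLM n hn1 hl f), coeFn_scaleCLM hn1 hl f]
      with r h1 h2
    rw [hL, smul_apply, h1, Pi.smul_apply, h2, smul_eq_mul]
  have htr : ∀ {p : ℝ → Prop}, (∀ᵐ r ∂(radialMeasure n lam), p r) →
      ∀ᵐ r ∂(radialMeasure n 1), p (lam⁻¹ * r) := fun h =>
    ae_radial_scale hl one_pos (inv_pos.2 hl) h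
  have hLG : ∀ {w : towerSpace n lam M} {G : ℕ → ℝ → ℂ},
      Represents (w : TowerAmbient n lam M) G →
      (fun r => (a : ℂ) * scaleTower lam G 0 r) =ᵐ[radialMeasure n 1] L (levelZero n lam M w) := by
    intro w G hG
    filter_upwards [hLae (levelZero n lam M w), htr hG.levelZero] with r h1 h2
    rw [h1, h2]
    simp [scaleTower]
  have hmaps : MapsTo (fun t => μ⁻¹ * t) (Icc 0 (μ * T)) (Icc 0 T) := fun t ht => by
    refine ⟨mul_nonneg (inv_pos.2 hμ).le ht.1, ?_⟩
    rw [inv_mul_le_iff₀ hμ]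
    exact ht.2
  refine ⟨?_, ?_, fun t ht => ?_, fun t ht => ?_⟩
  · show L (levelZero n lam M (Ψ (μ⁻¹ * 0))) =ᵐ[radialMeasure n 1] _
    rw [mul_zero]
    filter_upwards [hLae (levelZero n lam M (Ψ 0)), htr h0] with r h1 h2
    rw [h1, h2]
  -- Boundedness in space and time comes from the Sobolev embedding at level 0 and the compactness
  -- of the time interval.
  · obtain ⟨A, hA⟩ := isCompact_Icc.exists_bound_of_continuousOn hΨ
    obtain ⟨C, hC, hS⟩ := IsTower.exists_norm_le n M hn hM
    refine ⟨a * (C * A), fun t ht => ?_⟩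
    have hr := represents_towerRep (Ψ (μ⁻¹ * t))
    have hA' := hA _ (hmaps ht)
    have hb0 := hS lam _ A hl hl1 hr.isTower ((norm_nonneg _).trans hA') (by
      rw [← norm_sq_eq_towerSq]
      exact pow_le_pow_left₀ (norm_nonneg _) hA' 2) 0 (Nat.zero_le _)
    have hb1 := (ae_radial_iff' (n := n) (lam := 1) one_pos).2 (ae_of_all _ fun r (hr : 0 < r) =>
      hb0 (lam⁻¹ * r) (mul_pos (inv_pos.2 hl) hr))
    filter_upwards [hLG hr, hb1] with r h1 h2
    refine (congrArg norm h1).symm.le.trans ?_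
    rw [norm_mul, Complex.norm_real, Real.norm_eq_abs, abs_of_nonneg ha]
    refine mul_le_mul_of_nonneg_left (le_trans (le_of_eq ?_) h2) ha
    simp [scaleTower]
  · obtain ⟨C, hC, hS⟩ := exists_sobolevNormSq_le n 2 M hn (by omega)
    have hτ : Tendsto (fun t' => Ψ (μ⁻¹ * t')) (𝓝[Icc 0 (μ * T)] t) (𝓝 (Ψ (μ⁻¹ * t))) :=
      (hΨ.comp (continuous_const_mul μ⁻¹).continuousOn hmaps) t ht
    have hlim : Tendsto (fun t' => ENNReal.ofReal (C * (a ^ 2 * ((lam⁻¹) ^ (4 * M) *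
        ‖Ψ (μ⁻¹ * t') - Ψ (μ⁻¹ * t)‖ ^ 2)))) (𝓝[Icc 0 (μ * T)] t) (𝓝 0) := by
      have h1 := ENNReal.tendsto_ofReal ((((((tendsto_iff_norm_sub_tendsto_zero.1 hτ).pow 2).const_mul
        ((lam⁻¹) ^ (4 * M))).const_mul (a ^ 2)).const_mul C))
      simpa using h1
    refine tendsto_of_tendsto_of_tendsto_of_le_of_le tendsto_const_nhds hlim
      (fun _ => zero_le) fun t' => ?_
    set w := Ψ (μ⁻¹ * t') - Ψ (μ⁻¹ * t) with hw
    have hr := represents_towerRep w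
    have hs := hr.isTower.scale hn1 hl
    have e : (fun r => (a : ℂ) * scaleTower lam (towerRep w) 0 r) =ᵐ[radialMeasure n 1]
        fun r => L (levelZero n lam M (Ψ (μ⁻¹ * t'))) r - L (levelZero n lam M (Ψ (μ⁻¹ * t))) r := by
      refine (hLG hr).trans ?_
      rw [hw, map_sub, map_sub]
      exact Lp.coeFn_sub _ _
    refine (hS 1 one_pos le_rfl _ _ (hs.const_mul (a : ℂ)) e).trans (ENNReal.ofReal_le_ofReal ?_)
    refine mul_le_mul_of_nonneg_left ?_ hC.le
    have e2 : towerSq n 1 M (fun j r => (a : ℂ) * scaleTower lam (towerRep w) j r) =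
        a ^ 2 * towerSq n 1 M (scaleTower lam (towerRep w)) := by
      simp only [towerSq, radialSq_const_mul, Finset.mul_sum, Complex.norm_real, Real.norm_eq_abs,
        sq_abs]
    rw [e2, norm_sq_eq_towerSq]
    exact mul_le_mul_of_nonneg_left (towerSq_scale_le hn1 hl hl1 hr.isTower) (sq_nonneg _)
  · have hr := represents_towerRep (Ψ (μ⁻¹ * t))
    obtain ⟨V, hV, hVae⟩ := hd _ (hmaps ht) _ hr
    have d1 : HasDerivWithinAt (fun t : ℝ => μ⁻¹ * t) μ⁻¹ (Icc 0 (μ * T)) t := by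
      simpa using ((hasDerivAt_id t).const_mul μ⁻¹).hasDerivWithinAt
    have d2 := hV.scomp t d1 hmaps
    have d3 := ((L.restrictScalars ℝ).hasFDerivAt).comp_hasDerivWithinAt t d2
    refine ⟨_, towerChain n 1 (fun j r => (a : ℂ) * scaleTower lam (towerRep (Ψ (μ⁻¹ * t))) j r),
      d3, ((hr.isTower.scale hn1 hl).const_mul (a : ℂ)).isSobolevChain hn one_pos le_rfl
        (by omega) (hLG hr), ?_⟩
    have hchain : ∀ r, towerChain n 1 (fun j r => (a : ℂ) *
        scaleTower lam (towerRep (Ψ (μ⁻¹ * t))) j r) 2 r = (a : ℂ) * ((lam⁻¹ : ℂ) ^ 2 *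
          lapTower n lam (towerRep (Ψ (μ⁻¹ * t))) 0 (lam⁻¹ * r)) := fun r => by
      refine (congrFun (towerChain_even 1) r).trans ?_
      rw [Function.iterate_one, ← lapTower_scale hl]
      simp only [lapTower]
      ring
    have hsm : (μ⁻¹ • V : Lp ℂ 2 (radialMeasure n lam)) =ᵐ[radialMeasure n lam]
        fun r => (μ⁻¹ : ℂ) * V r := by
      filter_upwards [Lp.coeFn_smul μ⁻¹ V] with r h
      rw [h, Pi.smul_apply, Complex.real_smul, Complex.ofReal_inv]
    filter_upwards [hLae (μ⁻¹ • V), htr hsm, htr hVae, hLG hr] with r h1 h2 h3 h4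
    rw [h2, h3] at h1
    refine (congrArg₂ (fun x y => Complex.I * x + y) h1 (hchain r)).trans ?_
    refine Eq.trans ?_ (congrArg (fun x : ℂ => (κ : ℂ) * (‖x‖ : ℂ) ^ (2 * σ) * x) h4)
    have hμ' : (μ : ℂ) ≠ 0 := Complex.ofReal_ne_zero.2 hμ.ne'
    have hl' : (lam : ℂ) ≠ 0 := Complex.ofReal_ne_zero.2 hl.ne'
    -- The relation μ a^(2σ) = 1 matches the nonlinear terms, as b = μ lam⁻² matches the Laplacians.
    have hpow : (a : ℂ) ^ (2 * σ) = (μ : ℂ)⁻¹ :=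
      eq_inv_of_mul_eq_one_right (by exact_mod_cast haμ)
    simp only [scaleTower, mul_zero, pow_zero, one_mul]
    rw [norm_mul, Complex.norm_real, Real.norm_eq_abs, abs_of_nonneg ha, Complex.ofReal_mul,
      mul_pow, hpow, hb]
    push_cast
    field_simp
    ring_nf
    rw [Complex.I_sq]
    ring

end Scaling

/-! ### Uniqueness of bounded strong solutions. -/

section Uniqueness

variable {n : ℕ} {lam : ℝ}

/-- The pointwise content of a Sobolev chain of order two. -/
lemma IsSobolevChain.exists_isPrim (hn : 2 ≤ n) (hl : 0 < lam) (hl1 : lam ≤ 1) {f : ℝ → ℂ}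
    {F : ℕ → ℝ → ℂ} (h : IsSobolevChain n lam 2 f F) : ∃ p g : ℝ → ℂ,
      f =ᵐ[radialMeasure n lam] p ∧ IsD lam p g ∧ MemLp p 2 (radialMeasure n lam) ∧
        MemLp g 2 (radialMeasure n lam) ∧
        MemLp (fun r => (hq lam r : ℂ) ^ 1 * g r) 2 (radialMeasure n lam) ∧
        IsPrim (fun r => (hq lam r : ℂ) ^ n * g r) (fun r => (hq lam r : ℂ) ^ (n - 1) * F 2 r) := by
  have m0 := h.memLp 0 (by norm_num)
  have m1 := h.memLp 1 (by norm_num)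
  have m2 := h.memLp 2 le_rfl
  obtain ⟨p, hp, hpF⟩ := (h.grad 0 (by norm_num) Even.zero).exists_isPrim hn hl m0 m1
  have hdiv := (h.div 1 (by norm_num) odd_one).ae_eq hl m1 m2
  obtain ⟨hP, hP0⟩ := isPrim_primitive_weight hl m2
  set P : ℝ → ℂ := fun x => ∫ t in (0 : ℝ)..x, (hq lam t : ℂ) ^ (n - 1) * F 2 t with hPdef
  -- The gradient is F 1 = hq g almost everywhere; defining g by the flux P makes hq^n g an exact
  -- primitive that vanishes at the origin, the input of `isD_of_div`.
  set g : ℝ → ℂ := fun r => P r / (hq lam r : ℂ) ^ n with hg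
  have hgP : ∀ r, 0 < r → P r = (hq lam r : ℂ) ^ n * g r := fun r hr => by
    rw [hg, mul_div_cancel₀ _ (pow_ne_zero _ (hq_cast_ne_zero hl hr))]
  have hgF : ∀ᵐ r, 0 < r → F 1 r = (hq lam r : ℂ) ^ 1 * g r := by
    filter_upwards [hdiv] with r h1 hr
    have h2 := (h1 hr).trans (hgP r hr)
    rw [hq_cast_pow_eq (by omega : 1 ≤ n), mul_assoc] at h2
    rw [pow_one]
    exact mul_left_cancel₀ (pow_ne_zero _ (hq_cast_ne_zero hl hr)) h2
  have hprim : IsPrim (fun r => (hq lam r : ℂ) ^ n * g r)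
      (fun r => (hq lam r : ℂ) ^ (n - 1) * F 2 r) := hP.congr hgP (ae_of_all _ fun _ _ => rfl)
  have mqg : MemLp (fun r => (hq lam r : ℂ) ^ 1 * g r) 2 (radialMeasure n lam) :=
    m1.ae_eq ((ae_radial_iff' hl).2 hgF)
  have h0 : Tendsto (fun r => (hq lam r : ℂ) ^ n * g r) (𝓝[>] 0) (𝓝 0) :=
    hP0.congr' (eventually_mem_nhdsWithin.mono fun r hr => hgP r hr)
  obtain ⟨hD, hD2⟩ := isD_of_div hn hl hl1 hprim h0 mqg m2
  refine ⟨p, g, h.zero.symm.trans hp, hpF.congr (fun _ _ => rfl) ?_, m0.ae_eq hp,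
    (hD.hardy hn hl hl1 mqg hD2).1, mqg, hprim⟩
  filter_upwards [hgF] with r h1 hr
  rw [h1 hr, pow_one]

/-- The Laplacian is symmetric, on the difference of two functions in `H²`. -/
lemma IsSobolevChain.im_integral_eq_zero (hn : 2 ≤ n) (hl : 0 < lam) (hl1 : lam ≤ 1)
    {f f' : ℝ → ℂ} {F F' : ℕ → ℝ → ℂ} (h : IsSobolevChain n lam 2 f F)
    (h' : IsSobolevChain n lam 2 f' F') :
    (∫ r, (starRingEnd ℂ) (f r - f' r) * (F 2 r - F' 2 r) ∂(radialMeasure n lam)).im = 0 := by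
  obtain ⟨p, g, hp, hpg, mp, mg, mqg, hg⟩ := h.exists_isPrim hn hl hl1
  obtain ⟨p', g', hp', hpg', mp', mg', mqg', hg'⟩ := h'.exists_isPrim hn hl hl1
  have mq : MemLp (fun r => (hq lam r : ℂ) ^ 1 * (g r - g' r)) 2 (radialMeasure n lam) := by
    simp only [mul_sub]
    exact mqg.sub mqg'
  have hgreen := integral_green hn hl hl1 (f := fun r => p r - p' r) (f1 := fun r => g r - g' r)
    (h := fun r => g r - g' r) (k := fun r => F 2 r - F' 2 r)
    ((hpg.sub hpg').congr (fun _ _ => rfl) (ae_of_all _ fun _ _ => by ring)) (mp.sub mp') mq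
    ((hg.sub hg').congr (fun _ _ => by ring) (ae_of_all _ fun _ _ => by ring)) (mg.sub mg') mq
    ((h.memLp 2 le_rfl).sub (h'.memLp 2 le_rfl))
  have e : ∫ r, (starRingEnd ℂ) (f r - f' r) * (F 2 r - F' 2 r) ∂(radialMeasure n lam) =
      ∫ r, (starRingEnd ℂ) (p r - p' r) * (F 2 r - F' 2 r) ∂(radialMeasure n lam) := by
    refine integral_congr_ae ?_
    filter_upwards [hp, hp'] with r h1 h2
    rw [h1, h2]
  rw [e, hgreen, integral_conj_mul_self, ← Complex.ofReal_neg, Complex.ofReal_im]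

lemma norm_power_sub_le (σ : ℕ) {A : ℝ} {z w : ℂ} (hz : ‖z‖ ≤ A) (hw : ‖w‖ ≤ A) :
    ‖(‖z‖ : ℂ) ^ (2 * σ) * z - (‖w‖ : ℂ) ^ (2 * σ) * w‖ ≤
      (A ^ (2 * σ) + (2 * σ : ℕ) * A ^ (2 * σ - 1) * A) * ‖z - w‖ := by
  have hA : 0 ≤ A := (norm_nonneg _).trans hz
  have e : (‖z‖ : ℂ) ^ (2 * σ) * z - (‖w‖ : ℂ) ^ (2 * σ) * w =
      ((‖z‖ ^ (2 * σ) : ℝ) : ℂ) * (z - w) +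
        ((‖z‖ ^ (2 * σ) - ‖w‖ ^ (2 * σ) : ℝ) : ℂ) * w := by
    push_cast; ring
  have h1 := abs_pow_sub_pow_le ‖z‖ ‖w‖ (2 * σ)
  rw [abs_norm, abs_norm] at h1
  have h2 : |‖z‖ ^ (2 * σ) - ‖w‖ ^ (2 * σ)| ≤ ‖z - w‖ * (2 * σ : ℕ) * A ^ (2 * σ - 1) :=
    h1.trans (mul_le_mul (mul_le_mul_of_nonneg_right (abs_norm_sub_norm_le z w) (Nat.cast_nonneg _))
      (pow_le_pow_left₀ (le_max_of_le_left (norm_nonneg _)) (max_le hz hw) _) (by positivity)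
        (by positivity))
  rw [e]
  refine (norm_add_le _ _).trans ?_
  rw [norm_mul, norm_mul, Complex.norm_real, Complex.norm_real, Real.norm_eq_abs, Real.norm_eq_abs,
    abs_of_nonneg (by positivity : 0 ≤ ‖z‖ ^ (2 * σ)), add_mul]
  refine add_le_add (mul_le_mul_of_nonneg_right (pow_le_pow_left₀ (norm_nonneg _) hz _)
    (norm_nonneg _)) ((mul_le_mul h2 hw (norm_nonneg _) (by positivity)).trans (le_of_eq (by ring)))

/-- Gronwall's inequality for the energy method. -/
lemma eq_zero_of_inner_deriv_le {E : Type*} [NormedAddCommGroup E] [InnerProductSpace ℝ E]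
    {d d' : ℝ → E} {L T : ℝ} (hd : ∀ t ∈ Icc 0 T, HasDerivWithinAt d (d' t) (Icc 0 T) t)
    (h0 : d 0 = 0) (hL : ∀ t ∈ Icc 0 T, inner ℝ (d t) (d' t) ≤ L * ‖d t‖ ^ 2) :
    ∀ t ∈ Icc 0 T, d t = 0 := by
  have hg : ∀ t ∈ Icc 0 T, HasDerivWithinAt (fun t => Real.exp (-(2 * L) * t) * ‖d t‖ ^ 2)
      (Real.exp (-(2 * L) * t) * (2 * (inner ℝ (d t) (d' t) - L * ‖d t‖ ^ 2))) (Icc 0 T) t := by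
    intro t ht
    have h1 : HasDerivAt (fun t : ℝ => Real.exp (-(2 * L) * t))
        (Real.exp (-(2 * L) * t) * (-(2 * L))) t := by
      simpa using ((hasDerivAt_id t).const_mul (-(2 * L))).exp
    refine (h1.hasDerivWithinAt.mul (hd t ht).norm_sq).congr_deriv ?_
    ring
  have hanti := antitoneOn_of_hasDerivWithinAt_nonpos (convex_Icc 0 T)
    (fun t ht => (hg t ht).continuousWithinAt)
    (fun t ht => (hg t (interior_subset ht)).mono interior_subset) fun t ht =>
      mul_nonpos_of_nonneg_of_nonpos (Real.exp_pos _).le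
        (by linarith [hL t (interior_subset ht)])
  intro t ht
  have h1 := hanti ⟨le_rfl, ht.1.trans ht.2⟩ ht ht.1
  have h3 : Real.exp (-(2 * L) * t) * ‖d t‖ ^ 2 ≤ 0 := h1.trans (by simp [h0])
  have h2 : ‖d t‖ ^ 2 ≤ 0 := by
    by_contra hcon
    push Not at hcon
    have := mul_pos (Real.exp_pos (-(2 * L) * t)) hcon
    linarith
  exact norm_eq_zero.1 (pow_eq_zero_iff two_ne_zero |>.1 (le_antisymm h2 (sq_nonneg _)))

/-- Bounded strong radial solutions are unique. -/
lemma IsRadialNLSSolution.eq (hn : 2 ≤ n) {σ : ℕ} {κ T : ℝ} (hκ : |κ| = 1) {u₀ : ℝ → ℂ}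
    {u v : ℝ → Lp ℂ 2 (radialMeasure n 1)} (hu : IsRadialNLSSolution n σ κ u₀ T u)
    (hv : IsRadialNLSSolution n σ κ u₀ T v) : ∀ t ∈ Icc 0 T, u t = v t := by
  obtain ⟨A1, hA1⟩ := hu.bounded
  obtain ⟨A2, hA2⟩ := hv.bounded
  set A := max A1 A2
  set L := A ^ (2 * σ) + (2 * σ : ℕ) * A ^ (2 * σ - 1) * A
  choose! Vu Fu hVu hFu hEu using hu.eqn
  choose! Vv Fv hVv hFv hEv using hv.eqn
  have key := eq_zero_of_inner_deriv_le (d := fun t => u t - v t) (d' := fun t => Vu t - Vv t)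
    (L := L) (T := T) (fun t ht => (hVu t ht).sub (hVv t ht))
    (sub_eq_zero.2 (Lp.ext (hu.init.trans hv.init.symm))) fun t ht => ?_
  · exact fun t ht => sub_eq_zero.1 (key t ht)
  have mW : MemLp (fun r => Complex.I * (Fu t 2 r - Fv t 2 r)) 2 (radialMeasure n 1) :=
    (((hFu t ht).memLp 2 le_rfl).sub ((hFv t ht).memLp 2 le_rfl)).const_mul _
  -- W is the Laplacian part of the time derivative of the difference. Its real inner product with
  -- the difference vanishes by Green's formula, and what is left is the nonlinear part, Lipschitz
  -- because both solutions are bounded.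
  set W := mW.toLp _ with hW
  have hWae := mW.coeFn_toLp
  have hdae := Lp.coeFn_sub (u t) (v t)
  have hzero : inner ℝ (u t - v t) W = 0 := by
    rw [MeasureTheory.L2.inner_def]
    have e : ∫ r, inner ℝ ((u t - v t) r) (W r) ∂(radialMeasure n 1) =
        ∫ r, RCLike.re (Complex.I * ((starRingEnd ℂ) (u t r - v t r) * (Fu t 2 r - Fv t 2 r)))
          ∂(radialMeasure n 1) := by
      refine integral_congr_ae ?_
      filter_upwards [hWae, hdae] with r h1 h2
      rw [h1, h2, Pi.sub_apply, Complex.inner]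
      simp only [RCLike.re_to_complex]
      congr 1; ring
    have hint : Integrable (fun r => (starRingEnd ℂ) (u t r - v t r) * (Fu t 2 r - Fv t 2 r))
        (radialMeasure n 1) :=
      MeasureTheory.MemLp.integrable_mul ((Lp.memLp (u t)).sub (Lp.memLp (v t))).star
        (((hFu t ht).memLp 2 le_rfl).sub ((hFv t ht).memLp 2 le_rfl))
    rw [e, integral_re (hint.const_mul _), integral_const_mul]
    have him := (hFu t ht).im_integral_eq_zero hn one_pos le_rfl (hFv t ht)
    rw [RCLike.re_to_complex, Complex.mul_re, Complex.I_re, Complex.I_im, him]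
    ring
  have hB : ‖Vu t - Vv t - W‖ ≤ L * ‖u t - v t‖ := by
    refine Lp.norm_le_mul_norm_of_ae_le_mul ?_
    filter_upwards [Lp.coeFn_sub (Vu t - Vv t) W, Lp.coeFn_sub (Vu t) (Vv t), hWae, hdae, hEu t ht,
      hEv t ht, hA1 t ht, hA2 t ht] with r h1 h2 h3 h4 h5 h6 h7 h8
    have e : Vu t r - Vv t r - Complex.I * (Fu t 2 r - Fv t 2 r) = -Complex.I * κ *
        ((‖u t r‖ : ℂ) ^ (2 * σ) * u t r - (‖v t r‖ : ℂ) ^ (2 * σ) * v t r) := by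
      have e1 : Vu t r - Vv t r - Complex.I * (Fu t 2 r - Fv t 2 r) = -Complex.I *
          ((Complex.I * Vu t r + Fu t 2 r) - (Complex.I * Vv t r + Fv t 2 r)) := by
        linear_combination (Vu t r - Vv t r) * Complex.I_sq
      rw [e1, h5, h6]; ring
    rw [h1, Pi.sub_apply, h2, Pi.sub_apply, h3, h4, Pi.sub_apply, e, norm_mul, norm_mul, norm_neg,
      Complex.norm_I, Complex.norm_real, Real.norm_eq_abs, hκ, one_mul, one_mul]
    exact norm_power_sub_le σ (h7.trans (le_max_left _ _)) (h8.trans (le_max_right _ _))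
  calc inner ℝ (u t - v t) (Vu t - Vv t)
      = inner ℝ (u t - v t) W + inner ℝ (u t - v t) (Vu t - Vv t - W) := by
        rw [← inner_add_right, add_sub_cancel]
    _ ≤ 0 + ‖u t - v t‖ * ‖Vu t - Vv t - W‖ := by
        rw [hzero]; gcongr; exact real_inner_le_norm _ _
    _ ≤ L * ‖u t - v t‖ ^ 2 := by nlinarith [norm_nonneg (u t - v t)]

end Uniqueness

/-! ### The choice of the time scale. -/

section Constants

/-- KT is at most a constant times (1 + T)^(2σN) T. With θ = 1/(2σN + 1) this grows no faster than
|ln ε|, and a small c₀ makes e^{KT} = O(ε^(-1/2)). The other half power of ε pays for the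
logarithmic factor A, so one of the two powers of ε in β survives. -/
lemma exists_time_constants {σ : ℕ} (hσ : 0 < σ) (N : ℕ) {C B P : ℝ} (hC : 0 < C) (hB : 0 < B)
    (hP : 0 ≤ P) : ∃ c₀ θ D : ℝ, 0 < c₀ ∧ 0 < θ ∧ 0 < D ∧ ∀ ε : ℝ, 0 < ε → ε ≤ 1 →
      ∀ T A K β : ℝ, T = c₀ * |Real.log ε| ^ θ → A = B * (1 + T) ^ N →
      K = (2 * σ + 1) * C ^ (2 * σ) * (A + 1) ^ (2 * σ) → β = ε ^ 2 * (P * A) →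
      β * T * Real.exp (K * T) ≤ 1 ∧ β * T * Real.exp (K * T) ≤ D * ε * T := by
  set a := 2 * σ * N with ha
  set K₀ := (2 * σ + 1) * C ^ (2 * σ) * (B + 1) ^ (2 * σ) with hK₀
  have hK₀pos : 0 < K₀ := by positivity
  set D := (P + 1) * B * 2 ^ N * (2 * Real.exp (1 / 2)) with hD
  have hDpos : 0 < D := by positivity
  set θ : ℝ := 1 / ((a : ℝ) + 1) with hθ
  have hθpos : 0 < θ := by positivity
  -- The three bounds give 1 + T ≤ 2y, KT ≤ (1 + l)/2 and DεT ≤ 1 respectively.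
  set c₀ := min 1 (min (1 / (2 * (K₀ * 2 ^ a))) (1 / D)) with hc₀
  have hc₀pos : 0 < c₀ := lt_min one_pos (lt_min (by positivity) (by positivity))
  have hc1 : c₀ ≤ 1 := min_le_left _ _
  have hcK : K₀ * 2 ^ a * c₀ ≤ 1 / 2 := by
    have : c₀ ≤ 1 / (2 * (K₀ * 2 ^ a)) := (min_le_right _ _).trans (min_le_left _ _)
    calc K₀ * 2 ^ a * c₀ ≤ K₀ * 2 ^ a * (1 / (2 * (K₀ * 2 ^ a))) := by gcongr
      _ = 1 / 2 := by field_simp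
  have hcD : D * c₀ ≤ 1 := by
    have : c₀ ≤ 1 / D := (min_le_right _ _).trans (min_le_right _ _)
    calc D * c₀ ≤ D * (1 / D) := by gcongr
      _ = 1 := by field_simp
  refine ⟨c₀, θ, D, hc₀pos, hθpos, hDpos, fun ε hε hε1 T A K β hT hA hK hβ => ?_⟩
  set l := |Real.log ε| with hl
  have hl0 : 0 ≤ l := abs_nonneg _
  have hεl : ε = Real.exp (-l) := by
    rw [hl, abs_of_nonpos (Real.log_nonpos hε.le hε1), neg_neg, Real.exp_log hε]
  -- Using 1 + |ln ε| keeps y ≥ 1 also for ε near 1, and y^(a+1) = 1 + l.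
  set y := (1 + l) ^ θ with hy
  have hy1 : 1 ≤ y := Real.one_le_rpow (by linarith) hθpos.le
  have hT0 : 0 ≤ T := by rw [hT]; positivity
  have hTy : T ≤ c₀ * y := by
    rw [hT]
    exact mul_le_mul_of_nonneg_left (Real.rpow_le_rpow hl0 (by linarith) hθpos.le) hc₀pos.le
  have hTy1 : 1 + T ≤ 2 * y := by nlinarith
  have hya : y ^ (a + 1) = 1 + l := by
    rw [hy, ← Real.rpow_mul_natCast (by linarith), hθ]
    push_cast
    rw [one_div, inv_mul_cancel₀ (by positivity), Real.rpow_one]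
  -- This is where σ ≥ 1 is needed: a = 2σN is then at least N.
  have hNa : N ≤ a + 1 := by nlinarith [Nat.zero_le N]
  have hA0 : 0 ≤ A := by rw [hA]; positivity
  have hAy : A ≤ B * 2 ^ N * (1 + l) := by
    rw [hA, mul_assoc, ← hya]
    refine mul_le_mul_of_nonneg_left ?_ hB.le
    calc (1 + T) ^ N ≤ (2 * y) ^ N := pow_le_pow_left₀ (by linarith) hTy1 N
      _ = 2 ^ N * y ^ N := mul_pow _ _ _
      _ ≤ 2 ^ N * y ^ (a + 1) :=
        mul_le_mul_of_nonneg_left (pow_le_pow_right₀ hy1 hNa) (by positivity)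
  have hKT : K * T ≤ (1 + l) / 2 := by
    have h1 : A + 1 ≤ (B + 1) * (1 + T) ^ N := by
      rw [hA]
      nlinarith [one_le_pow₀ (by linarith : 1 ≤ 1 + T) (n := N)]
    have h2 : K ≤ K₀ * (2 * y) ^ a := by
      rw [hK, hK₀, mul_assoc, mul_assoc, mul_assoc]
      refine mul_le_mul_of_nonneg_left (mul_le_mul_of_nonneg_left ?_ (by positivity)) (by positivity)
      calc (A + 1) ^ (2 * σ) ≤ ((B + 1) * (1 + T) ^ N) ^ (2 * σ) :=
            pow_le_pow_left₀ (by linarith) h1 _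
        _ = (B + 1) ^ (2 * σ) * (1 + T) ^ a := by
            rw [mul_pow, ← pow_mul, ha]; congr 2; ring
        _ ≤ (B + 1) ^ (2 * σ) * (2 * y) ^ a := mul_le_mul_of_nonneg_left
            (pow_le_pow_left₀ (by linarith) hTy1 _) (by positivity)
    calc K * T ≤ K₀ * (2 * y) ^ a * (c₀ * y) := mul_le_mul h2 hTy hT0 (by positivity)
      _ = K₀ * 2 ^ a * c₀ * y ^ (a + 1) := by rw [mul_pow]; ring
      _ ≤ 1 / 2 * (1 + l) := by
          rw [hya]; exact mul_le_mul_of_nonneg_right hcK (by linarith)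
      _ = (1 + l) / 2 := by ring
  -- Each of the two factors is of order e^{l/2}.
  have hexp : (1 + l) * Real.exp (K * T) ≤ 2 * Real.exp (1 / 2) * Real.exp l := by
    have h1 : 1 + l ≤ 2 * Real.exp (l / 2) := by linarith [Real.add_one_le_exp (l / 2)]
    have h2 : Real.exp (K * T) ≤ Real.exp (1 / 2) * Real.exp (l / 2) := by
      rw [← Real.exp_add]
      exact Real.exp_le_exp.2 (hKT.trans (le_of_eq (by ring)))
    have h3 : Real.exp l = Real.exp (l / 2) * Real.exp (l / 2) := by
      rw [← Real.exp_add]; congr 1; ring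
    calc (1 + l) * Real.exp (K * T)
        ≤ 2 * Real.exp (l / 2) * (Real.exp (1 / 2) * Real.exp (l / 2)) :=
          mul_le_mul h1 h2 (Real.exp_pos _).le (by positivity)
      _ = _ := by rw [h3]; ring
  have hεe : ε * Real.exp l = 1 := by rw [hεl, ← Real.exp_add, neg_add_cancel, Real.exp_zero]
  have hmain : ε * (P * A) * Real.exp (K * T) ≤ D := by
    have h1 : A * Real.exp (K * T) ≤ B * 2 ^ N * (2 * Real.exp (1 / 2) * Real.exp l) :=
      (mul_le_mul_of_nonneg_right hAy (Real.exp_pos _).le).trans (by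
        rw [mul_assoc]
        exact mul_le_mul_of_nonneg_left hexp (by positivity))
    calc ε * (P * A) * Real.exp (K * T) = ε * P * (A * Real.exp (K * T)) := by ring
      _ ≤ ε * P * (B * 2 ^ N * (2 * Real.exp (1 / 2) * Real.exp l)) :=
          mul_le_mul_of_nonneg_left h1 (by positivity)
      _ = P * B * 2 ^ N * (2 * Real.exp (1 / 2)) * (ε * Real.exp l) := by ring
      _ ≤ D := by
          rw [hεe, mul_one, hD]
          gcongr
          linarith
  have h2 : β * T * Real.exp (K * T) ≤ D * ε * T := by
    calc β * T * Real.exp (K * T) = ε * (P * A) * Real.exp (K * T) * (ε * T) := by rw [hβ]; ring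
      _ ≤ D * (ε * T) := mul_le_mul_of_nonneg_right hmain (by positivity)
      _ = _ := by ring
  refine ⟨h2.trans ?_, h2⟩
  have hyl : y ≤ 1 + l := by
    rw [← hya]
    exact le_self_pow₀ hy1 (Nat.succ_ne_zero a)
  have hel : ε * (1 + l) ≤ 1 := by
    rw [← hεe]
    exact mul_le_mul_of_nonneg_left (by linarith [Real.add_one_le_exp l]) hε.le
  calc D * ε * T ≤ D * ε * (c₀ * (1 + l)) := by
        refine mul_le_mul_of_nonneg_left (hTy.trans ?_) (by positivity)
        exact mul_le_mul_of_nonneg_left hyl hc₀pos.le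
    _ = D * c₀ * (ε * (1 + l)) := by ring
    _ ≤ 1 := mul_le_one₀ hcD (by positivity) hel

end Constants

end

/-! ### Assembly: existence by scaling, the estimate by uniqueness. -/

theorem propositionA1 (n : ℕ) (hn : 2 ≤ n) (σ : ℕ) (hσ : 0 < σ)
    (κ : ℝ) (hκ : κ = -1 ∨ κ = 1)
    (s : ℝ) (hs : s < (n : ℝ) / 2 - 1 / (σ : ℝ))
    (a₀ : ℝ → ℂ) (ha₀ : ContDiff ℝ ∞ a₀) (hsupp : tsupport a₀ ⊆ Icc 1 2)
    (k : ℝ) (hk : (n : ℝ) / 2 < k) :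
    ∃ c₀ c₁ θ C : ℝ, 0 < c₀ ∧ 0 < c₁ ∧ 0 < θ ∧ 0 < C ∧
      ∀ ε : ℝ, 0 < ε → ε ≤ 1 →
      ∀ lam : ℝ, 0 < lam → ε = lam ^ ((n : ℝ) * σ / 2 - 1 - s * σ) →
        (∃ u : ℝ → Lp ℂ 2 (radialMeasure n 1),
          IsRadialNLSSolution n σ κ (concentratedDatum n s lam a₀)
            (timeScale n σ s lam * (c₀ * ε * |Real.log ε| ^ θ)) u) ∧
        ∀ u : ℝ → Lp ℂ 2 (radialMeasure n 1),
          IsRadialNLSSolution n σ κ (concentratedDatum n s lam a₀)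
            (timeScale n σ s lam * (c₀ * ε * |Real.log ε| ^ θ)) u →
          ∀ t ∈ Icc 0 (c₀ * ε * |Real.log ε| ^ θ),
            sobolevNorm n lam k
                (fun r => rescaledSolution n σ s lam u t r - odeSolution σ κ ε a₀ t r) ≤
              ENNReal.ofReal (C * ε * |Real.log ε| ^ c₁) := by
  have hσ' : (0 : ℝ) < σ := Nat.cast_pos.2 hσ
  have hκ1 : |κ| = 1 := by rcases hκ with rfl | rfl <;> simp
  have hM : 2 * n + 4 ≤ 2 * n + ⌈k⌉₊ + 6 := by omega
  have hkM : ⌊k⌋₊ + 1 ≤ 2 * n + ⌈k⌉₊ + 6 := by have := Nat.floor_le_ceil k; omega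
  -- Large enough for the algebra property and for the H^k norm to be bounded by the tower norm.
  set M := 2 * n + ⌈k⌉₊ + 6 with hMdef
  obtain ⟨C, B, N, hC, hB, hsol⟩ := exists_semiclassical_tower hn hM σ hκ1 ha₀ hsupp
  obtain ⟨S, hS, hnorm⟩ := exists_sobolevNorm_le n M hn hkM
  obtain ⟨c₀, θ, D, hc₀, hθ, hD, hconst⟩ :=
    exists_time_constants hσ N hC hB (Real.sqrt_nonneg (lapConst n M))
  -- The error is S D ε T with T = c₀|ln ε|^θ, hence c₁ = θ.
  refine ⟨c₀, θ, θ, S * D * c₀, hc₀, hθ, hθ, by positivity, fun ε hε hε1 lam hl hεl => ?_⟩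
  -- The upper bound on s makes ε a positive power of lam, so ε ≤ 1 forces lam ≤ 1.
  have hexp : 0 < (n : ℝ) * σ / 2 - 1 - s * σ := by
    have h1 := mul_lt_mul_of_pos_right hs hσ'
    rw [sub_mul, one_div, inv_mul_cancel₀ hσ'.ne'] at h1
    linarith
  have hl1 : lam ≤ 1 := by
    by_contra hcon
    have := Real.one_lt_rpow (not_le.1 hcon) hexp
    linarith
  set T := c₀ * |Real.log ε| ^ θ with hT
  have hT0 : 0 ≤ T := by positivity
  obtain ⟨hsmall, hbound⟩ := hconst ε hε hε1 T _ _ _ hT rfl rfl rfl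
  obtain ⟨Ψ, hΨ, hΨ0, hΨw, hΨd⟩ := hsol lam hl hl1 (ε ^ 2) T _ _ _ (sq_nonneg ε) hT0 rfl rfl rfl hsmall
  set ts := timeScale n σ s lam with hts
  have hts0 : 0 < ts := Real.rpow_pos_of_pos hl _
  have htsε : ts = ε * lam ^ 2 := by
    rw [hts, timeScale, hεl, ← Real.rpow_natCast lam 2, ← Real.rpow_add hl]
    congr 1; push_cast; ring
  set a := lam ^ (-((n : ℝ) / 2) + s) with ha
  have ha0 : 0 < a := Real.rpow_pos_of_pos hl _
  -- The time of u is ts · t = ts · ε · τ, so μ = ts ε. Since ts = ε lam², the dispersion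
  -- coefficient in the time τ is μ lam⁻² = ε².
  have hμ : 0 < ts * ε := mul_pos hts0 hε
  have hb : ε ^ 2 = ts * ε * lam⁻¹ ^ 2 := by rw [htsε]; field_simp
  have haμ : ts * ε * a ^ (2 * σ) = 1 := by
    rw [hts, timeScale, hεl, ha, ← Real.rpow_mul_natCast hl.le, ← Real.rpow_add hl,
      ← Real.rpow_add hl]
    convert Real.rpow_zero lam using 2
    push_cast; ring
  have hv := isRadialNLSSolution_scale hn hM hl hl1 ha0.le hμ hb haμ hΨ hΨ0 hΨd
  have hdatum : (fun r => (a : ℂ) * a₀ (lam⁻¹ * r)) = concentratedDatum n s lam a₀ := by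
    funext r
    rw [concentratedDatum, inv_mul_eq_div]
  have htime : ts * ε * T = ts * (c₀ * ε * |Real.log ε| ^ θ) := by rw [hT]; ring
  rw [hdatum, htime] at hv
  refine ⟨⟨_, hv⟩, fun u hu t ht => ?_⟩
  have htu : ts * t ∈ Icc 0 (ts * (c₀ * ε * |Real.log ε| ^ θ)) :=
    ⟨mul_nonneg hts0.le ht.1, mul_le_mul_of_nonneg_left ht.2 hts0.le⟩
  -- An arbitrary solution is identified with the constructed one, for which the difference with the
  -- phase solution is the correction w.
  have huv := hu.eq hn hκ1 hv _ htu
  have hτe : (ts * ε)⁻¹ * (ts * t) = t / ε := by field_simp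
  rw [hτe] at huv
  have hτ : t / ε ∈ Icc 0 T :=
    ⟨div_nonneg ht.1 hε.le, (div_le_iff₀ hε).2 (ht.2.trans (le_of_eq (by rw [hT]; ring)))⟩
  obtain ⟨w, hw, hwe⟩ := hΨw _ hτ
  have haa : lam ^ ((n : ℝ) / 2 - s) * a = 1 := by
    rw [ha, ← Real.rpow_add hl]
    convert Real.rpow_zero lam using 2
    ring
  have hrescaled : levelZero n lam M w =ᵐ[radialMeasure n lam]
      fun r => rescaledSolution n σ s lam u t r - odeSolution σ κ ε a₀ t r := by
    have h1 := Lp.coeFn_smul (a : ℂ) (scaleCLM n (by omega) hl (levelZero n lam M (Ψ (t / ε))))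
    rw [← huv] at h1
    filter_upwards [hwe, ae_radial_scale one_pos hl hl h1, ae_radial_scale one_pos hl hl
      (coeFn_scaleCLM (by omega) hl (levelZero n lam M (Ψ (t / ε))))] with r h2 h3 h4
    have h5 : rescaledSolution n σ s lam u t r = levelZero n lam M (Ψ (t / ε)) r := by
      rw [rescaledSolution, h3, Pi.smul_apply, h4, inv_mul_cancel_left₀ hl.ne', smul_eq_mul,
        ← mul_assoc, ← Complex.ofReal_mul, haa, Complex.ofReal_one, one_mul]
    have h6 : odeSolution σ κ ε a₀ t r = phaseSolution σ κ a₀ lam (t / ε) r := by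
      rw [odeSolution, phaseSolution]
      push_cast
      rfl
    rw [h5, h6, h2, add_sub_cancel_left]
  refine (hnorm lam hl hl1 w _ hrescaled).trans (ENNReal.ofReal_le_ofReal ?_)
  have hw2 : ‖w‖ ≤ D * ε * T := by
    refine hw.trans (le_trans ?_ hbound)
    have h1 := hτ.1
    have h2 := hτ.2
    gcongr
  calc S * ‖w‖ ≤ S * (D * ε * T) := mul_le_mul_of_nonneg_left hw2 hS.le
    _ = S * D * c₀ * ε * |Real.log ε| ^ θ := by rw [hT]; ring
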